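/- Let $n\ge 1$ and let $(M,g,\mathbb Q)$ be a quaternionic contact (qc) manifold of dimension $4n+3$: a smooth manifold with a codimension-three distribution $H$, a metric $g$ on $H$ and a rank-three bundle $\mathbb Q\subset \mathrm{End}(H)$ such that locally $H=\bigcap_{s=1}^3\ker\eta_s$ for smooth one-forms $\eta_1,\eta_2,\eta_3$, and $\mathbb Q$ is spanned by $g$-Hermitian almost complex structures $I_1,I_2,I_3$ on $H$ with $I_1I_2=-I_2I_1=I_3$ and $2g(I_sX,Y)=d\eta_s(X,Y)$ for $X,Y\in H$. If $n=1$, one also requires that local Reeb vector fields exist, i.e. vector fields $\xi_s$ with $\eta_s(\xi_k)=\delta_{sk}$, $d\eta_s(\xi_s,X)=0$ and $d\eta_k(\xi_s,X)=-d\eta_s(\xi_k,X)$ for $X\in H$. Let $\nabla$ be the Biquard connection, with torsion $T$ and supplementary distribution $V$, $TM=H\oplus V$. It is characterized as follows: (i) $\nabla$ preserves $H$, $V$, $g$ and $\mathbb Q$, and $T(X,Y)=-[X,Y]_V$ for $X,Y\in H$; (ii) for $\xi\in V$, $T_\xi=T(\xi,\cdot)|_H$ is an endomorphism of $H$ orthogonal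 to $sp(n)\oplus sp(1)$; (iii) $\nabla\varphi=0$, where $\varphi:V\to\mathbb Q$ sends $\xi_s$ to $I_s$, and $\xi_s\in V$ are the vectors with $\eta_t(\xi_s)=\delta_{ts}$. Let $\{e_a\}_{a=1}^{4n}$ be an orthonormal basis of $H$; repeated indices $a,b$ are summed. Put $8n(n+2)S=g(R(e_b,e_a)e_a,e_b)$ with $R=[\nabla,\nabla]-\nabla_{[\,,\,]}$. Let $T^0_\xi$ and $b_\xi$ be the symmetric and skew-symmetric parts of $T_\xi$, let $T^0(X,Y)=\sum_s g(T^0_{\xi_s}I_sX,Y)$, and let $U(X,Y)=g(uX,Y)$, where $b_{\xi_s}=I_su$ for $s=1,2,3$. For a smooth function $f$ let $\nabla f$ be the horizontal gradient, $\nabla^2f(A,B)=(\nabla_A df)(B)$, $\nabla^3f(A,B,C)=(\nabla_A\nabla^2f)(B,C)$ and $\triangle f=-\nabla^2f(e_a,e_a)$. For $X,Y\in H$ define $$P_f(X)=\nabla^3f(X,e_b,e_b)+\sum_{t=1}^3\nabla^3f(I_tX,e_b,I_te_b)-4nS\,df(X)+4nT^0(X,\nabla f)-\tfrac{8n(n-2)}{n-1}U(X,\nabla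 f),$$ where the last term is omitted when $n=1$. Let $Cf=(\nabla_{e_a}P_f)(e_a)$, and let $B_0$ be the trace-free part of the $[3]$-component of the horizontal Hessian, $$4B_0(X,Y)=\nabla^2f(X,Y)+\sum_{s=1}^3\nabla^2f(I_sX,I_sY)+\tfrac1n\,\triangle f\,g(X,Y).$$ **Theorem.** For every smooth function $f$ on $M$ and every $X\in H$, $$4(\nabla_{e_a}B_0)(e_a,X)=\frac{n-1}{n}\,P_f(X).$$ If moreover $M$ is compact and $4n+3>7$, then the $C$-operator is non-negative: for every smooth $f$ the functions $f\cdot Cf$ and $P_f(\nabla f)$ are integrable and $$\int_M f\cdot Cf\;Vol_\eta=-\int_M P_f(\nabla f)\;Vol_\eta\ \ge\ 0,$$ where $Vol_\eta=\eta_1\wedge\eta_2\wedge\eta_3\wedge\omega_1^{2n}$, with $\omega_1(X,Y)=g(I_1X,Y)$ on $H$ and $\xi\lrcorner\omega_1=0$ for $\xi\in V$, is the canonical globally defined volume form. In that case, for every smooth $f$, $Cf$ vanishes identically on $M$ if and only if $B_0$ does, and then the form $P_f$ vanishes identically as well. -/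

import Mathlib

open Bundle Filter MeasureTheory Topology
open scoped Manifold ContDiff

noncomputable section

namespace QC

/-! ### Calculus with an affine connection

`M` is a smooth manifold of dimension `m` without boundary.  `FiberBundle.extend` extends a tangent
vector at a point to a vector field that is smooth near that point; the tensors below do not depend
on the extension. -/

section Calculus

/-- The tangent space of an `m`-dimensional smooth manifold. -/
abbrev T (m : ℕ) {M : Type*} [TopologicalSpace M] [ChartedSpace (EuclideanSpace ℝ (Fin m)) M]
    (p : M) : Type :=
  TangentSpace (𝓡 m) p

variable {m : ℕ} {M : Type*} [TopologicalSpace M] [ChartedSpace (EuclideanSpace ℝ (Fin m)) M]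
  [IsManifold (𝓡 m) ∞ M]

/-- A smooth extension of a tangent vector to a vector field. -/
abbrev ext {p : M} (v : T m p) (q : M) : T m q :=
  FiberBundle.extend (EuclideanSpace ℝ (Fin m)) v q

/-- The vector field `X` is smooth on the set `s`. -/
def SmoothOn (X : ∀ p : M, T m p) (s : Set M) : Prop :=
  ContMDiffOn (𝓡 m) (𝓡 m).tangent ∞
    (fun p => (TotalSpace.mk' (EuclideanSpace ℝ (Fin m)) p (X p) : TangentBundle (𝓡 m) M)) s

/-- The vector field `X` is differentiable at `p`. -/
def DiffAt (X : ∀ p : M, T m p) (p : M) : Prop :=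
  MDifferentiableAt (𝓡 m) (𝓡 m).tangent
    (fun p => (TotalSpace.mk' (EuclideanSpace ℝ (Fin m)) p (X p) : TangentBundle (𝓡 m) M)) p

/-- The directional derivative `v(f)`. -/
def dirDeriv (f : M → ℝ) (p : M) (v : T m p) : ℝ := mvfderiv (𝓡 m) f p v

/-- The exterior derivative of a one-form,
`dα(X, Y) = X(α(Y)) - Y(α(X)) - α([X, Y])`. -/
def extDer (α : ∀ p : M, T m p →L[ℝ] ℝ) (p : M) (v w : T m p) : ℝ :=
  dirDeriv (fun q => α q (ext w q)) p v - dirDeriv (fun q => α q (ext v q)) p w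
    - α p (VectorField.mlieBracket (𝓡 m) (ext v) (ext w) p)

/-- Affine connections on `M`, i.e. covariant derivatives on the tangent bundle.
In Mathlib `cov Y p v` stands for `(∇_v Y)(p)`. -/
abbrev Conn (m : ℕ) (M : Type*) [TopologicalSpace M]
    [ChartedSpace (EuclideanSpace ℝ (Fin m)) M] [IsManifold (𝓡 m) ∞ M] :=
  CovariantDerivative (𝓡 m) (EuclideanSpace ℝ (Fin m)) (fun p : M => TangentSpace (𝓡 m) p)

/-- `(∇_v α)(w) = v(α(W)) - α(∇_v W)` for a one-form `α`. -/
def covOne (cov : Conn m M) (α : ∀ p : M, T m p → ℝ) (p : M) (v w : T m p) : ℝ :=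
  dirDeriv (fun q => α q (ext w q)) p v - α p (cov (ext w) p v)

/-- `(∇_u β)(v, w) = u(β(V, W)) - β(∇_u V, W) - β(V, ∇_u W)` for a `(0,2)`-tensor `β`. -/
def covTwo (cov : Conn m M) (β : ∀ p : M, T m p → T m p → ℝ) (p : M) (u v w : T m p) : ℝ :=
  dirDeriv (fun q => β q (ext v q) (ext w q)) p u
    - β p (cov (ext v) p u) w - β p v (cov (ext w) p u)

/-- `∇²f(v, w) = (∇_v df)(w)`. -/
def hess (cov : Conn m M) (f : M → ℝ) : ∀ p : M, T m p → T m p → ℝ :=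
  covOne cov (dirDeriv f)

/-- `∇³f(u, v, w) = (∇_u ∇²f)(v, w)`. -/
def third (cov : Conn m M) (f : M → ℝ) : ∀ p : M, T m p → T m p → T m p → ℝ :=
  covTwo cov (hess cov f)

/-- The curvature `R(a, b)c = ∇_a ∇_b c - ∇_b ∇_a c - ∇_{[a, b]} c`. -/
def curv (cov : Conn m M) (p : M) (a b c : T m p) : T m p :=
  cov (fun q => cov (ext c) q (ext b q)) p a - cov (fun q => cov (ext c) q (ext a q)) p b
    - cov (ext c) p (VectorField.mlieBracket (𝓡 m) (ext a) (ext b) p)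

end Calculus

/-! ### Quaternionic contact structures -/

section Structure

variable {n : ℕ} {M : Type*} [TopologicalSpace M]
  [ChartedSpace (EuclideanSpace ℝ (Fin (4 * n + 3))) M] [IsManifold (𝓡 (4 * n + 3)) ∞ M]

/-- A local description over `U` of a distribution `H` with a fibre metric `g` and a bundle `Q` of
endomorphisms as a quaternionic contact structure: smooth one-forms `η₁, η₂, η₃` with common kernel
`H`, almost complex structures `I₁, I₂, I₃` on `H` which generate `Q`, satisfy the identities of the
imaginary unit quaternions, are Hermitian for `g`, and satisfy `2 g(I_s X, Y) = dη_s(X, Y)`, and a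
smooth orthonormal frame `e_1, …, e_{4n}` of `H` (its existence expresses the smoothness of `H` and
`g`).  Values outside `U` are irrelevant.  The index set `{1, 2, 3}` is `Fin 3 = {0, 1, 2}`. -/
structure LocalFrame (H : ∀ p : M, Submodule ℝ (T (4 * n + 3) p))
    (g : ∀ p : M, LinearMap.BilinForm ℝ (H p))
    (Q : ∀ p : M, Submodule ℝ (Module.End ℝ (H p))) (U : Set M) where
  η : Fin 3 → ∀ p : M, T (4 * n + 3) p →L[ℝ] ℝ
  I : Fin 3 → ∀ p : M, Module.End ℝ (H p)
  e : Fin (4 * n) → ∀ p : M, H p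
  smooth_η : ∀ (s : Fin 3) (W : Set M), IsOpen W → W ⊆ U → ∀ X : ∀ p : M, T (4 * n + 3) p,
    SmoothOn X W → ContMDiffOn (𝓡 (4 * n + 3)) 𝓘(ℝ, ℝ) ∞ (fun p => η s p (X p)) W
  smooth_e : ∀ a, SmoothOn (fun p => (e a p : T (4 * n + 3) p)) U
  smooth_I : ∀ s a, SmoothOn (fun p => (I s p (e a p) : T (4 * n + 3) p)) U
  orthonormal : ∀ p ∈ U, ∀ a b, g p (e a p) (e b p) = if a = b then 1 else 0
  mem_H_iff : ∀ p ∈ U, ∀ v : T (4 * n + 3) p, v ∈ H p ↔ ∀ s, η s p v = 0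
  I_sq : ∀ p ∈ U, ∀ s, I s p * I s p = -1
  I_mul : ∀ p ∈ U, I 0 p * I 1 p = I 2 p
  I_mul' : ∀ p ∈ U, I 1 p * I 0 p = -I 2 p
  hermitian : ∀ p ∈ U, ∀ s (X Y : H p), g p (I s p X) (I s p Y) = g p X Y
  Q_eq : ∀ p ∈ U, Q p = Submodule.span ℝ (Set.range fun s => I s p)
  compat : ∀ p ∈ U, ∀ s (X Y : H p), 2 * g p (I s p X) Y = extDer (η s) p X Y

/-- The Reeb vector fields `ξ₁, ξ₂, ξ₃` of a local frame exist: `η_s(ξ_k) = δ_{sk}`,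
`(ξ_s ⌟ dη_s)|_H = 0` and `(ξ_s ⌟ dη_k)|_H = -(ξ_k ⌟ dη_s)|_H`. -/
def LocalFrame.HasReebFields {H : ∀ p : M, Submodule ℝ (T (4 * n + 3) p)}
    {g : ∀ p : M, LinearMap.BilinForm ℝ (H p)}
    {Q : ∀ p : M, Submodule ℝ (Module.End ℝ (H p))} {U : Set M} (F : LocalFrame H g Q U) : Prop :=
  ∃ ξ : Fin 3 → ∀ p : M, T (4 * n + 3) p, (∀ s, SmoothOn (ξ s) U) ∧
    ∀ p ∈ U, (∀ s k, F.η s p (ξ k p) = if s = k then 1 else 0) ∧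
      (∀ s, ∀ X : H p, extDer (F.η s) p (ξ s p) X = 0) ∧
      ∀ s k, ∀ X : H p, extDer (F.η k) p (ξ s p) X = -extDer (F.η s) p (ξ k p) X

variable (n M) in
/-- A quaternionic contact structure `(M, g, ℚ)` on a manifold of dimension `4n + 3`: a distribution
`H` of codimension three, a metric `g` on `H` and a rank three bundle `Q` of endomorphisms of `H`,
locally described as above.  In dimension seven the existence of Reeb vector fields is part of the
definition. -/
structure Structure where
  H : ∀ p : M, Submodule ℝ (T (4 * n + 3) p)
  g : ∀ p : M, LinearMap.BilinForm ℝ (H p)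
  Q : ∀ p : M, Submodule ℝ (Module.End ℝ (H p))
  finrank_H : ∀ p, Module.finrank ℝ (H p) = 4 * n
  g_symm : ∀ p (X Y : H p), g p X Y = g p Y X
  g_pos : ∀ p (X : H p), X ≠ 0 → 0 < g p X X
  exists_frame : ∀ p, ∃ U : Set M, IsOpen U ∧ p ∈ U ∧
    ∃ F : LocalFrame H g Q U, n = 1 → F.HasReebFields

namespace Structure

variable (S : Structure n M)

/-- Local frames of a qc structure over `U`. -/
abbrev Frame (U : Set M) := LocalFrame S.H S.g S.Q U

/-- An open neighbourhood of `p` carrying a local frame. -/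
def nhd (p : M) : Set M := (S.exists_frame p).choose

lemma mem_nhd (p : M) : p ∈ S.nhd p := (S.exists_frame p).choose_spec.2.1

lemma isOpen_nhd (p : M) : IsOpen (S.nhd p) := (S.exists_frame p).choose_spec.1

/-- A local frame near `p`.  The objects built from it at `p` do not depend on the choice. -/
def frame (p : M) : S.Frame (S.nhd p) := (S.exists_frame p).choose_spec.2.2.choose

/-- The members of an orthonormal basis `e_1, …, e_{4n}` of `H` at `p`. -/
def e (a : Fin (4 * n)) (p : M) : S.H p := (S.frame p).e a p

/-- A triple `I_1, I_2, I_3` of generators of `Q` at `p`, quaternionic and Hermitian. -/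
def I (s : Fin 3) (p : M) : Module.End ℝ (S.H p) := (S.frame p).I s p

/-- The one-forms at `p` that belong to `I_1, I_2, I_3`. -/
def η (s : Fin 3) (p : M) : T (4 * n + 3) p →L[ℝ] ℝ := (S.frame p).η s p

/-- The inner product `⟨A, B⟩ = ∑ g(A e_i, B e_i)` on `End H`. -/
def endInner (p : M) (A B : Module.End ℝ (S.H p)) : ℝ :=
  ∑ a, S.g p (A (S.e a p)) (B (S.e a p))

/-- `sp(n)` at `p`: the skew-symmetric endomorphisms of `H` that commute with `Q`. -/
def spn (p : M) : Submodule ℝ (Module.End ℝ (S.H p)) where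
  carrier := {A | (∀ J ∈ S.Q p, A * J = J * A) ∧ ∀ X Y, S.g p (A X) Y = -S.g p X (A Y)}
  add_mem' := by
    rintro A B ⟨hA, hA'⟩ ⟨hB, hB'⟩
    refine ⟨fun J hJ => by rw [add_mul, mul_add, hA J hJ, hB J hJ], fun X Y => ?_⟩
    simp only [LinearMap.add_apply, map_add, hA', hB']
    ring
  zero_mem' := ⟨fun J _ => by rw [zero_mul, mul_zero], fun X Y => by simp⟩
  smul_mem' := by
    rintro c A ⟨hA, hA'⟩
    refine ⟨fun J hJ => by rw [smul_mul_assoc, mul_smul_comm, hA J hJ], fun X Y => ?_⟩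
    simp only [LinearMap.smul_apply, map_smul, hA', smul_eq_mul]
    ring

/-- The natural identification `φ` of vertical vectors with elements of `sp(1) = Q`, which sends the
vertical vector `ξ_s` dual to `η_s` to `I_s`, in a local frame. -/
def phi {S : Structure n M} {U : Set M} (F : S.Frame U) (p : M) (ξ : T (4 * n + 3) p) :
    Module.End ℝ (S.H p) :=
  ∑ s, F.η s p ξ • F.I s p

/-- The Biquard connection `∇` of a qc structure with its supplementary distribution `V`. -/
structure Biquard where
  V : ∀ p : M, Submodule ℝ (T (4 * n + 3) p)
  isCompl : ∀ p, IsCompl (S.H p) (V p)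
  cov : Conn (4 * n + 3) M
  smooth_V : ∀ W : Set M, IsOpen W → ∀ X : ∀ p : M, T (4 * n + 3) p, SmoothOn X W →
    SmoothOn (fun p => (V p).projection (S.H p) (isCompl p).symm (X p)) W
  smooth_cov : CovariantDerivative.ContMDiffCovariantDerivative cov ∞
  -- (i): `∇` preserves `H` and `V`, the metric and `Q`, and `T(X, Y) = -[X, Y]_V` on `H`.
  cov_mem_H : ∀ (p : M) (Y : ∀ q : M, S.H q), DiffAt (fun q => (Y q : T (4 * n + 3) q)) p →
    ∀ v, cov (fun q => (Y q : T (4 * n + 3) q)) p v ∈ S.H p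
  cov_mem_V : ∀ (p : M) (ξ : ∀ q : M, V q), DiffAt (fun q => (ξ q : T (4 * n + 3) q)) p →
    ∀ v, cov (fun q => (ξ q : T (4 * n + 3) q)) p v ∈ V p
  cov_metric : ∀ (p : M) (Y Z : ∀ q : M, S.H q)
    (hY : DiffAt (fun q => (Y q : T (4 * n + 3) q)) p)
    (hZ : DiffAt (fun q => (Z q : T (4 * n + 3) q)) p) (v : T (4 * n + 3) p),
    dirDeriv (fun q => S.g q (Y q) (Z q)) p v =
      S.g p ⟨cov (fun q => (Y q : T (4 * n + 3) q)) p v, cov_mem_H p Y hY v⟩ (Z p)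
        + S.g p (Y p) ⟨cov (fun q => (Z q : T (4 * n + 3) q)) p v, cov_mem_H p Z hZ v⟩
  cov_Q : ∀ (U : Set M), IsOpen U → ∀ F : S.Frame U, ∀ p ∈ U, ∀ (s : Fin 3) (v : T (4 * n + 3) p),
    ∃ σ ∈ S.Q p, ∀ (Y : ∀ q : M, S.H q) (hY : DiffAt (fun q => (Y q : T (4 * n + 3) q)) p),
      cov (fun q => (F.I s q (Y q) : T (4 * n + 3) q)) p v
        - F.I s p ⟨cov (fun q => (Y q : T (4 * n + 3) q)) p v, cov_mem_H p Y hY v⟩ = σ (Y p)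
  torsion_H : ∀ (p : M) (X Y : ∀ q : M, S.H q), DiffAt (fun q => (X q : T (4 * n + 3) q)) p →
    DiffAt (fun q => (Y q : T (4 * n + 3) q)) p →
    cov.torsion p (X p) (Y p) = -(V p).projection (S.H p) (isCompl p).symm
      (VectorField.mlieBracket (𝓡 (4 * n + 3)) (fun q => (X q : T (4 * n + 3) q))
        (fun q => (Y q : T (4 * n + 3) q)) p)
  -- (ii): for `ξ ∈ V`, `T(ξ, ·)` is an endomorphism of `H` orthogonal to `sp(n) ⊕ sp(1)`.
  torsion_mem_H : ∀ (p : M), ∀ ξ ∈ V p, ∀ X : S.H p, cov.torsion p ξ X ∈ S.H p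
  torsion_perp : ∀ (p : M) (ξ : T (4 * n + 3) p) (hξ : ξ ∈ V p), ∀ A ∈ S.spn p ⊔ S.Q p,
    S.endInner p
      (((cov.torsion p ξ).toLinearMap.comp (S.H p).subtype).codRestrict (S.H p)
        (torsion_mem_H p ξ hξ)) A = 0
  -- (iii): `∇φ = 0`.
  cov_phi : ∀ (U : Set M), IsOpen U → ∀ F : S.Frame U, ∀ p ∈ U,
    ∀ (ξ : ∀ q : M, V q) (Y : ∀ q : M, S.H q), DiffAt (fun q => (ξ q : T (4 * n + 3) q)) p →
    ∀ (hY : DiffAt (fun q => (Y q : T (4 * n + 3) q)) p) (v : T (4 * n + 3) p),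
      cov (fun q => (phi F q (ξ q) (Y q) : T (4 * n + 3) q)) p v
        - phi F p (ξ p) ⟨cov (fun q => (Y q : T (4 * n + 3) q)) p v, cov_mem_H p Y hY v⟩
      = phi F p (cov (fun q => (ξ q : T (4 * n + 3) q)) p v) (Y p)

end Structure

end Structure

/-! ### Tensors of the Biquard connection -/

namespace Structure.Biquard

variable {n : ℕ} {M : Type*} [TopologicalSpace M]
  [ChartedSpace (EuclideanSpace ℝ (Fin (4 * n + 3))) M] [IsManifold (𝓡 (4 * n + 3)) ∞ M]
  {S : Structure n M} (B : S.Biquard)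

/-- The horizontal part of a tangent vector with respect to `TM = H ⊕ V`. -/
def hor (p : M) : T (4 * n + 3) p →ₗ[ℝ] S.H p := (S.H p).projectionOnto (B.V p) (B.isCompl p)

/-- `(η_1, η_2, η_3)` restricts to an isomorphism of `V` onto `ℝ³`. -/
lemma eta_injective (p : M) : Function.Injective
    ((LinearMap.pi fun s => (S.η s p).toLinearMap).comp (B.V p).subtype) := by
  rw [injective_iff_map_eq_zero]
  intro v hv
  have h1 : (v : T (4 * n + 3) p) ∈ S.H p := by
    rw [(S.frame p).mem_H_iff p (S.mem_nhd p)]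
    intro s
    exact congrFun hv s
  have h2 := Submodule.disjoint_def.1 (B.isCompl p).disjoint v h1 v.2
  exact Subtype.ext h2

lemma finrank_V (p : M) : Module.finrank ℝ (B.V p) = Module.finrank ℝ (Fin 3 → ℝ) := by
  have : FiniteDimensional ℝ (T (4 * n + 3) p) :=
    inferInstanceAs (FiniteDimensional ℝ (EuclideanSpace ℝ (Fin (4 * n + 3))))
  have h1 := Submodule.finrank_add_eq_of_isCompl (B.isCompl p)
  have h2 : Module.finrank ℝ (T (4 * n + 3) p) = 4 * n + 3 :=
    finrank_euclideanSpace_fin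
  rw [S.finrank_H p] at h1
  rw [Module.finrank_fin_fun]
  omega

/-- The vertical vectors `ξ_1, ξ_2, ξ_3` at `p`: `ξ_s ∈ V` and `η_t(ξ_s) = δ_{ts}`. -/
def xi (s : Fin 3) (p : M) : T (4 * n + 3) p :=
  haveI : FiniteDimensional ℝ (T (4 * n + 3) p) :=
    inferInstanceAs (FiniteDimensional ℝ (EuclideanSpace ℝ (Fin (4 * n + 3))))
  (LinearEquiv.ofInjectiveOfFinrankEq _ (B.eta_injective p) (B.finrank_V p)).symm (Pi.single s 1)

/-- The torsion endomorphism as a `(0,3)`-tensor, `T(ξ, X, Y) = g(T(ξ, X), Y)`. -/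
def tor (p : M) (ξ : T (4 * n + 3) p) (X Y : S.H p) : ℝ :=
  S.g p (B.hor p (B.cov.torsion p ξ X)) Y

/-- The symmetric part `T⁰(ξ, X, Y) = g(T⁰_ξ X, Y)` of the torsion endomorphism. -/
def torSymm (p : M) (ξ : T (4 * n + 3) p) (X Y : S.H p) : ℝ :=
  (B.tor p ξ X Y + B.tor p ξ Y X) / 2

/-- The skew-symmetric part `g(b_ξ X, Y)` of the torsion endomorphism. -/
def torSkew (p : M) (ξ : T (4 * n + 3) p) (X Y : S.H p) : ℝ :=
  (B.tor p ξ X Y - B.tor p ξ Y X) / 2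

/-- The tensor `T⁰(X, Y) = g((T⁰_{ξ_1} I_1 + T⁰_{ξ_2} I_2 + T⁰_{ξ_3} I_3) X, Y)`. -/
def T0 (p : M) (X Y : S.H p) : ℝ := ∑ s, B.torSymm p (B.xi s p) (S.I s p X) Y

/-- The tensor `U(X, Y) = g(uX, Y)`, where `b_{ξ_s} = I_s u` for `s = 1, 2, 3`.  Hence
`g(uX, Y) = g(b_{ξ_s} X, I_s Y)` for each `s`, and `U` is written as the mean over `s`. -/
def U (p : M) (X Y : S.H p) : ℝ := (∑ s, B.torSkew p (B.xi s p) X (S.I s p Y)) / 3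

/-- The normalized qc-scalar curvature, `8n(n+2) S = ∑ g(R(e_b, e_a) e_a, e_b)`. -/
def scal (p : M) : ℝ :=
  (∑ a, ∑ b, S.g p (B.hor p (curv B.cov p (S.e b p) (S.e a p) (S.e a p))) (S.e b p))
    / (8 * n * (n + 2))

/-- The horizontal gradient, `g(∇f, X) = df(X)`. -/
def grad (_ : S.Biquard) (f : M → ℝ) (p : M) : S.H p := ∑ a, dirDeriv f p (S.e a p : T (4 * n + 3) p) • S.e a p

/-- The sub-Laplacian `△f = -∑ ∇²f(e_a, e_a)`. -/
def subLap (f : M → ℝ) (p : M) : ℝ := -∑ a, hess B.cov f p (S.e a p) (S.e a p)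

/-- The `P`-form of `f`, a one-form on `H`; it is extended to `TM` by zero on `V`. -/
def P (f : M → ℝ) (p : M) (v : T (4 * n + 3) p) : ℝ :=
  let X : S.H p := B.hor p v
  let common : ℝ := (∑ b, third B.cov f p X (S.e b p) (S.e b p))
    + ∑ t, ∑ b, third B.cov f p (S.I t p X) (S.e b p) (S.I t p (S.e b p))
  if n = 1 then
    common - 4 * B.scal p * dirDeriv f p (X : T (4 * n + 3) p) + 4 * B.T0 p X (B.grad f p)
  else
    common - 4 * n * B.scal p * dirDeriv f p (X : T (4 * n + 3) p) + 4 * n * B.T0 p X (B.grad f p)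
      - 8 * n * ((n : ℝ) - 2) / ((n : ℝ) - 1) * B.U p X (B.grad f p)

/-- The `C`-operator `Cf = -∇^* P_f = ∑ (∇_{e_a} P_f)(e_a)`. -/
def C (f : M → ℝ) (p : M) : ℝ := ∑ a, covOne B.cov (B.P f) p (S.e a p) (S.e a p)

/-- The trace-free part `B_0` of the `[3]`-component of the horizontal Hessian,
`4 B_0(X, Y) = ∇²f(X, Y) + ∑ ∇²f(I_s X, I_s Y) + (1/n) △f g(X, Y)`; it is extended to `TM` by zero
on `V`. -/
def B0 (f : M → ℝ) (p : M) (v w : T (4 * n + 3) p) : ℝ :=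
  let X : S.H p := B.hor p v
  let Y : S.H p := B.hor p w
  (hess B.cov f p X Y + ∑ s, hess B.cov f p (S.I s p X) (S.I s p Y)
    + 1 / (n : ℝ) * B.subLap f p * S.g p X Y) / 4

/-! ### The volume form and the non-negativity of the `C`-operator -/

/-- The fundamental two-form `ω_s`: `ω_s(X, Y) = g(I_s X, Y)` on `H` and `ξ ⌟ ω_s = 0` on `V`. -/
def omega (s : Fin 3) (p : M) (v w : T (4 * n + 3) p) : ℝ :=
  S.g p (S.I s p (B.hor p v)) (B.hor p w)

/-- The volume form `η_1 ∧ η_2 ∧ η_3 ∧ ω_1^{2n}` at `p`. -/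
def volForm (p : M) (v : Fin (4 * n + 3) → T (4 * n + 3) p) : ℝ :=
  (∑ σ : Equiv.Perm (Fin (4 * n + 3)), ((Equiv.Perm.sign σ : ℤ) : ℝ) *
    (S.η 0 p (v (σ ⟨0, by omega⟩)) * S.η 1 p (v (σ ⟨1, by omega⟩)) * S.η 2 p (v (σ ⟨2, by omega⟩))
      * ∏ i : Fin (2 * n), B.omega 0 p (v (σ ⟨3 + 2 * i, by omega⟩))
          (v (σ ⟨4 + 2 * i, by omega⟩)))) / 2 ^ (2 * n)

/-- The `i`-th coordinate vector at `p` of the preferred chart around `x`. -/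
def coordVec (x p : M) (i : Fin (4 * n + 3)) : T (4 * n + 3) p :=
  (trivializationAt (EuclideanSpace ℝ (Fin (4 * n + 3))) (TangentSpace (𝓡 (4 * n + 3))) x).symm p
    (EuclideanSpace.single i 1)

/-- The measure of the volume form on the domain of the preferred chart around `x`: its density in
the chart is `|Vol_η(∂_1, …, ∂_{4n+3})|`. -/
def chartVol [MeasurableSpace M] (x : M) : Measure M :=
  (((volume : Measure (EuclideanSpace ℝ (Fin (4 * n + 3)))).restrict
      (extChartAt (𝓡 (4 * n + 3)) x).target).withDensity fun y =>
    ENNReal.ofReal |B.volForm ((extChartAt (𝓡 (4 * n + 3)) x).symm y)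
      (coordVec x ((extChartAt (𝓡 (4 * n + 3)) x).symm y))|).map
    (extChartAt (𝓡 (4 * n + 3)) x).symm

/-- The measure `Vol_η` on `M`.  The chart measures agree on overlaps, so that their least upper
bound is the measure obtained by gluing them. -/
def vol [MeasurableSpace M] : Measure M := ⨆ x : M, B.chartVol x

/-- The `C`-operator is non-negative: `∫ f · Cf = -∫ P_f(∇f) ≥ 0`, the integrals existing, for every
smooth `f` of compact support. -/
def COperatorNonneg [MeasurableSpace M] : Prop :=
  ∀ f : M → ℝ, ContMDiff (𝓡 (4 * n + 3)) 𝓘(ℝ, ℝ) ∞ f → HasCompactSupport f →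
    Integrable (fun p => f p * B.C f p) B.vol ∧ Integrable (fun p => B.P f p (B.grad f p)) B.vol ∧
      ∫ p, f p * B.C f p ∂B.vol = -∫ p, B.P f p (B.grad f p) ∂B.vol ∧
      0 ≤ ∫ p, f p * B.C f p ∂B.vol

end Structure.Biquard

end QC

end

open Bundle Filter MeasureTheory Topology
open scoped Manifold ContDiff
noncomputable section
set_option linter.unusedSectionVars false
set_option linter.unusedSimpArgs false
set_option linter.unusedVariables false
namespace QC

/-! ### Germs of smooth functions and vector fields -/

section SmoothFields

variable {m : ℕ} {M : Type*} [TopologicalSpace M] [ChartedSpace (EuclideanSpace ℝ (Fin m)) M]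
  [IsManifold (𝓡 m) ∞ M]

/-! The divergence formula. The metric and the bundle Q are parallel, so contractions over
orthonormal frames of H and over I_1, I_2, I_3 commute with ∇ (`covTwo_B0`), and four times the
divergence of B_0 is Σ ∇³f(e_a, e_a, X) + Σ_s Σ ∇³f(e_a, I_s e_a, I_s X) - (1/n) Σ ∇³f(X, e_b, e_b).
On H the torsion equals 2 Σ g(I_s X, Y) ξ_s and is parallel. Hence exchanging the last two arguments
of ∇³f costs terms ∇²f(·, ξ_s), exchanging the first two costs a curvature term and terms ∇²f(ξ_s,
·), and these two kinds of mixed second derivatives differ by df of the torsion endomorphisms. After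
the exchanges there remain Σ ∇³f(X, e_b, e_b), the sum Σ ∇²f(I_s X, ξ_s), which is the second term
of P_f up to the factor -4n, and df applied to an endomorphism made of the torsion, the Ricci
endomorphism and the contractions Σ R(e_a, I_s e_a) (`QCurv.sum_third`).

That endomorphism is found by linear algebra at a point. The first Bianchi identity on (X, Y, ξ_s),
read vertically, expresses the sp(1)-part of the curvature through the torsion (`vertical_bianchi`).
As that part is skew in its quaternionic indices, the symmetric part of each T_{ξ_s} anticommutes
with I_s. With orthogonality to sp(n) + sp(1) it follows that the skew part is I_s u with one common
trace-free u commuting with Q, and that the torsion of vertical vectors has a single scalar λ. The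
horizontal Bianchi identity, contracted in several ways, then gives the Ricci endomorphism and the
other contractions in terms of T⁰, u and λ (`ric_eq`, `ric_sub_half_sum`), and the trace of the
Ricci endomorphism identifies λ with S. All terms carry the factor n - 1 except the one with u; for
n = 1 that term is absent because u = 0 (`u_eq_zero`).

Non-negativity. For n ≥ 2 the formula says that P_f is 4n/(n-1) times the divergence of B_0.
Integrating the divergence of f P_f gives ∫ f Cf = -∫ P_f(∇f). The divergence of B_0(·, ∇f) is
(n-1)/(4n) P_f(∇f) plus the pairing of B_0 with the Hessian, and that pairing is |B_0|² because B_0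
is an orthogonal projection of the horizontal Hessian (`Quat.sum_proj_mul`). Hence ∫ f Cf = 4n/(n-1)
∫ |B_0|². If Cf = 0, continuity and the positivity of the measure on open sets force B_0 = 0, and
then P_f = 0 and Cf = 0 by the formula.

The divergence theorem is proved in charts. Up to sign and a constant, Vol_η is the determinant of
any local coframe made of the η_s and an orthonormal frame of H (`abs_volForm`). The connection
matrix of such a frame is skew, hence trace-free, and the torsion of a horizontal vector has zero
trace. So the coordinate divergence of a horizontal field is the trace of ∇Y over H (`div_density`).
The chart measures glue by the change of variables formula, and a partition of unity reduces the
theorem to compactly supported functions on Euclidean space. -/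

instance isManifold_minSmoothness_two : IsManifold (𝓡 m) (minSmoothness ℝ 2) M := by
  rw [minSmoothness_of_isRCLikeNormedField]; infer_instance

instance isManifold_minSmoothness_three : IsManifold (𝓡 m) (minSmoothness ℝ 3) M := by
  rw [minSmoothness_of_isRCLikeNormedField]; infer_instance

instance finiteDimensional_tangent (p : M) : FiniteDimensional ℝ (T m p) :=
  inferInstanceAs (FiniteDimensional ℝ (EuclideanSpace ℝ (Fin m)))

variable (m) in
/-- The function `h` is smooth near `p`. -/
def SmF (h : M → ℝ) (p : M) : Prop := ∀ᶠ q in 𝓝 p, ContMDiffAt (𝓡 m) 𝓘(ℝ, ℝ) ∞ h q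

/-- The vector field `X` is smooth near `p`. -/
def Sm (X : ∀ q : M, T m q) (p : M) : Prop :=
  ∀ᶠ q in 𝓝 p, ContMDiffAt (𝓡 m) (𝓡 m).tangent ∞
    (fun q => (TotalSpace.mk' (EuclideanSpace ℝ (Fin m)) q (X q) : TangentBundle (𝓡 m) M)) q

variable {h k : M → ℝ} {X Y Z : ∀ q : M, T m q} {p : M}

/-- Smoothness is asked at all nearby points so that it is an open condition. At a single point,
smoothness of order ∞ only provides neighbourhoods that may shrink with the order, which is too weak
for differentiating along fields again. -/
lemma SmF.eventually (hh : SmF m h p) : ∀ᶠ q in 𝓝 p, SmF m h q := eventually_eventually_nhds.2 hh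

lemma Sm.eventually (hX : Sm X p) : ∀ᶠ q in 𝓝 p, Sm X q := eventually_eventually_nhds.2 hX

lemma SmF.contMDiffAt (hh : SmF m h p) : ContMDiffAt (𝓡 m) 𝓘(ℝ, ℝ) ∞ h p := hh.self_of_nhds

lemma Sm.contMDiffAt (hX : Sm X p) : ContMDiffAt (𝓡 m) (𝓡 m).tangent ∞
    (fun q => (TotalSpace.mk' (EuclideanSpace ℝ (Fin m)) q (X q) : TangentBundle (𝓡 m) M)) p :=
  hX.self_of_nhds

lemma SmF.mdiffAt (hh : SmF m h p) : MDifferentiableAt (𝓡 m) 𝓘(ℝ, ℝ) h p :=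
  hh.contMDiffAt.mdifferentiableAt (by simp)

lemma Sm.diffAt (hX : Sm X p) : DiffAt X p :=
  hX.contMDiffAt.mdifferentiableAt (by simp)

lemma SmF.congr (hh : SmF m h p) (e : ∀ᶠ q in 𝓝 p, k q = h q) : SmF m k p := by
  filter_upwards [hh, eventually_eventually_nhds.2 e] with q h1 h2
  exact h1.congr_of_eventuallyEq h2

lemma Sm.congr (hX : Sm X p) (e : ∀ᶠ q in 𝓝 p, Y q = X q) : Sm Y p := by
  filter_upwards [hX, eventually_eventually_nhds.2 e] with q h1 h2
  exact h1.congr_of_eventuallyEq (h2.mono fun x hx => by simp only [hx])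

lemma SmF.const (c : ℝ) : SmF m (fun _ : M => c) p := .of_forall fun _ => contMDiffAt_const

lemma SmF.add (hh : SmF m h p) (hk : SmF m k p) : SmF m (fun q => h q + k q) p := by
  filter_upwards [hh, hk] with q h1 h2 using h1.add h2

lemma SmF.sub (hh : SmF m h p) (hk : SmF m k p) : SmF m (fun q => h q - k q) p := by
  filter_upwards [hh, hk] with q h1 h2 using h1.sub h2

lemma SmF.mul (hh : SmF m h p) (hk : SmF m k p) : SmF m (fun q => h q * k q) p := by
  filter_upwards [hh, hk] with q h1 h2 using h1.mul h2

lemma SmF.inv (hh : SmF m h p) (h0 : h p ≠ 0) : SmF m (fun q => (h q)⁻¹) p := by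
  filter_upwards [hh, hh.contMDiffAt.continuousAt.eventually_ne h0] with q h1 h2
  exact ContMDiffAt.comp q (contDiffAt_inv ℝ h2).contMDiffAt h1

lemma SmF.sum {ι : Type*} {s : Finset ι} {h : ι → M → ℝ} (hh : ∀ i ∈ s, SmF m (h i) p) :
    SmF m (fun q => ∑ i ∈ s, h i q) p := by
  classical
  induction s using Finset.induction_on with
  | empty => simpa using SmF.const (m := m) (p := p) 0
  | insert a s ha ih =>
    simp only [Finset.sum_insert ha]
    exact (hh a (by simp)).add (ih fun i hi => hh i (by simp [hi]))

lemma SmF.prod {ι : Type*} {s : Finset ι} {h : ι → M → ℝ} (hh : ∀ i ∈ s, SmF m (h i) p) :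
    SmF m (fun q => ∏ i ∈ s, h i q) p := by
  classical
  induction s using Finset.induction_on with
  | empty => simpa using SmF.const (m := m) (p := p) 1
  | insert a s ha ih =>
    simp only [Finset.prod_insert ha]
    exact (hh a (by simp)).mul (ih fun i hi => hh i (by simp [hi]))

lemma Sm.add (hX : Sm X p) (hY : Sm Y p) : Sm (fun q => X q + Y q) p := by
  filter_upwards [hX, hY] with q h1 h2 using h1.add_section h2

lemma Sm.sub (hX : Sm X p) (hY : Sm Y p) : Sm (fun q => X q - Y q) p := by
  filter_upwards [hX, hY] with q h1 h2 using h1.sub_section h2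

lemma Sm.neg (hX : Sm X p) : Sm (fun q => -X q) p := by
  filter_upwards [hX] with q h1 using h1.neg_section

lemma Sm.smul (hh : SmF m h p) (hX : Sm X p) : Sm (fun q => h q • X q) p := by
  filter_upwards [hh, hX] with q h1 h2 using h1.smul_section h2

lemma Sm.zero : Sm (fun q : M => (0 : T m q)) p :=
  .of_forall fun q => Bundle.contMDiff_zeroSection ℝ (TangentSpace (𝓡 m) : M → Type) q

lemma Sm.sum {ι : Type*} {s : Finset ι} {X : ι → ∀ q : M, T m q} (hX : ∀ i ∈ s, Sm (X i) p) :
    Sm (fun q => ∑ i ∈ s, X i q) p := by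
  classical
  induction s using Finset.induction_on with
  | empty => simpa using Sm.zero
  | insert a s ha ih =>
    simp only [Finset.sum_insert ha]
    exact (hX a (by simp)).add (ih fun i hi => hX i (by simp [hi]))

lemma Sm.ext (v : T m p) : Sm (ext v) p := by
  obtain ⟨s, hs, h⟩ := FiberBundle.exists_contMDiffOn_extend (k := ∞) (𝓡 m) (EuclideanSpace ℝ (Fin m)) v
  filter_upwards [eventually_mem_nhds_iff.2 hs] with q hq using h.contMDiffAt hq

@[simp] lemma ext_self (v : T m p) : ext v p = v := FiberBundle.extend_apply_self _ v

lemma smF_of_contMDiff (hh : ContMDiff (𝓡 m) 𝓘(ℝ, ℝ) ∞ h) : SmF m h p := .of_forall hh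

lemma SmoothOn.sm {s : Set M} (hs : IsOpen s) (hp : p ∈ s) (hX : SmoothOn X s) : Sm X p := by
  filter_upwards [hs.mem_nhds hp] with q hq using hX.contMDiffAt (hs.mem_nhds hq)

lemma Sm.exists_smoothOn (hX : Sm X p) : ∃ s : Set M, IsOpen s ∧ p ∈ s ∧ SmoothOn X s := by
  obtain ⟨s, h, hs, hp⟩ := eventually_nhds_iff.1 hX
  exact ⟨s, hs, hp, fun q hq => (h q hq).contMDiffWithinAt⟩

/-- A field smooth near `p` agrees near `p` with a globally smooth field. -/
lemma Sm.exists_global [T2Space M] (hX : Sm X p) : ∃ X' : ∀ q : M, T m q,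
    (∀ q, Sm X' q) ∧ (∀ᶠ q in 𝓝 p, X' q = X q) ∧ SmoothOn X' Set.univ := by
  obtain ⟨s, hs, hp, h⟩ := hX.exists_smoothOn
  obtain ⟨ψ, hψ⟩ := (SmoothBumpFunction.nhds_basis_tsupport (I := 𝓡 m) p).mem_iff.1
    (hs.mem_nhds hp)
  have key : ContMDiff (𝓡 m) (𝓡 m).tangent ∞
      (fun q => (TotalSpace.mk' (EuclideanSpace ℝ (Fin m)) q (((ψ : M → ℝ) • X) q)
        : TangentBundle (𝓡 m) M)) :=
    ContMDiffOn.smul_section_of_tsupport ψ.contMDiff.contMDiffOn hs hψ.2 h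
  refine ⟨(ψ : M → ℝ) • X, fun q => .of_forall key, ?_, key.contMDiffOn⟩
  filter_upwards [ψ.eventuallyEq_one] with q hq
  simp [hq]

/-! ### Directional derivatives -/

lemma dirDeriv_vadd (h : M → ℝ) (v w : T m p) :
    dirDeriv h p (v + w) = dirDeriv h p v + dirDeriv h p w := map_add _ _ _

lemma dirDeriv_vsub (h : M → ℝ) (v w : T m p) :
    dirDeriv h p (v - w) = dirDeriv h p v - dirDeriv h p w := map_sub _ _ _

lemma dirDeriv_vsmul (h : M → ℝ) (c : ℝ) (v : T m p) :
    dirDeriv h p (c • v) = c * dirDeriv h p v := map_smul _ _ _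

lemma dirDeriv_vsum {ι : Type*} (s : Finset ι) (h : M → ℝ) (v : ι → T m p) :
    dirDeriv h p (∑ i ∈ s, v i) = ∑ i ∈ s, dirDeriv h p (v i) := map_sum _ _ _

lemma dirDeriv_vzero (h : M → ℝ) : dirDeriv h p (0 : T m p) = 0 := map_zero _

lemma dirDeriv_congr (e : ∀ᶠ q in 𝓝 p, h q = k q) (v : T m p) :
    dirDeriv h p v = dirDeriv k p v := by
  have : mfderiv (𝓡 m) 𝓘(ℝ, ℝ) h p = mfderiv (𝓡 m) 𝓘(ℝ, ℝ) k p :=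
    Filter.EventuallyEq.mfderiv_eq e
  have e' : h p = k p := e.self_of_nhds
  unfold dirDeriv mvfderiv
  simp only [ContinuousLinearMap.comp_apply]
  exact congrArg (fun L : T m p →L[ℝ] ℝ => L v) this

lemma dirDeriv_const (c : ℝ) (v : T m p) : dirDeriv (fun _ : M => c) p v = 0 := by
  unfold dirDeriv; rw [mvfderiv_const]; rfl

lemma dirDeriv_add (hh : SmF m h p) (hk : SmF m k p) (v : T m p) :
    dirDeriv (fun q => h q + k q) p v = dirDeriv h p v + dirDeriv k p v := by
  unfold dirDeriv; rw [mvfderiv_fun_add hh.mdiffAt hk.mdiffAt]; rfl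

lemma dirDeriv_sub (hh : SmF m h p) (hk : SmF m k p) (v : T m p) :
    dirDeriv (fun q => h q - k q) p v = dirDeriv h p v - dirDeriv k p v := by
  unfold dirDeriv; rw [mvfderiv_fun_sub hh.mdiffAt hk.mdiffAt]; rfl

lemma dirDeriv_neg (v : T m p) :
    dirDeriv (fun q => -h q) p v = -dirDeriv h p v := by
  unfold dirDeriv; rw [mvfderiv_fun_neg]; rfl

lemma dirDeriv_mul (hh : SmF m h p) (hk : SmF m k p) (v : T m p) :
    dirDeriv (fun q => h q * k q) p v = h p * dirDeriv k p v + dirDeriv h p v * k p := by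
  unfold dirDeriv; rw [mvfderiv_fun_mul hh.mdiffAt hk.mdiffAt]
  simp [mul_comm]

lemma dirDeriv_const_mul (c : ℝ) (hk : SmF m k p) (v : T m p) :
    dirDeriv (fun q => c * k q) p v = c * dirDeriv k p v := by
  rw [dirDeriv_mul (SmF.const c) hk, dirDeriv_const]; ring

lemma dirDeriv_sum {ι : Type*} {s : Finset ι} {h : ι → M → ℝ} (hh : ∀ i ∈ s, SmF m (h i) p)
    (v : T m p) : dirDeriv (fun q => ∑ i ∈ s, h i q) p v = ∑ i ∈ s, dirDeriv (h i) p v := by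
  classical
  induction s using Finset.induction_on with
  | empty => simp [dirDeriv_const]
  | insert a s ha ih =>
    simp only [Finset.sum_insert ha]
    rw [dirDeriv_add (hh a (by simp)) (SmF.sum fun i hi => hh i (by simp [hi])),
      ih fun i hi => hh i (by simp [hi])]

lemma smF_dirDeriv (hh : SmF m h p) (hX : Sm X p) : SmF m (fun q => dirDeriv h q (X q)) p := by
  obtain ⟨s, h1, hs, hp⟩ := eventually_nhds_iff.1 hh
  have h1' : ContMDiffOn (𝓡 m) 𝓘(ℝ, ℝ) ∞ h s := fun q hq => (h1 q hq).contMDiffWithinAt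
  have h2 := h1'.contMDiffOn_tangentMapWithin (m := ∞) (by simp) hs.uniqueMDiffOn
  filter_upwards [hX, hs.mem_nhds hp] with q hq hqs
  have h3 : ContMDiffAt (𝓡 m).tangent 𝓘(ℝ, ℝ).tangent ∞ (tangentMapWithin (𝓡 m) 𝓘(ℝ, ℝ) h s)
      (TotalSpace.mk' (EuclideanSpace ℝ (Fin m)) q (X q) : TangentBundle (𝓡 m) M) :=
    h2.contMDiffAt ((hs.preimage (FiberBundle.continuous_proj _ _)).mem_nhds hqs)
  have h4 := (contMDiff_snd_tangentBundle_modelSpace (n := ∞) ℝ 𝓘(ℝ, ℝ)).contMDiffAt.comp q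
    (h3.comp q hq)
  refine h4.congr_of_eventuallyEq ?_
  filter_upwards [hs.mem_nhds hqs] with x hx
  change _ = (mfderivWithin (𝓡 m) 𝓘(ℝ, ℝ) h s x) (X x)
  rw [mfderivWithin_of_isOpen hs hx]
  rfl

lemma Sm.mlieBracket (hX : Sm X p) (hY : Sm Y p) :
    Sm (fun q => VectorField.mlieBracket (𝓡 m) X Y q) p := by
  filter_upwards [hX, hY] with q h1 h2
  have : IsManifold (𝓡 m) (((⊤ : ℕ∞) : WithTop ℕ∞) + 1) M := by
    simpa using (inferInstance : IsManifold (𝓡 m) ∞ M)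
  exact ContMDiffAt.mlieBracket_vectorField (n := ⊤) (m := ⊤) h1 h2 (by simp [minSmoothness_of_isRCLikeNormedField])

/-! ### Covariant derivatives -/

variable {cov : Conn m M}

lemma cov_add (hX : Sm X p) (hY : Sm Y p) (v : T m p) :
    cov (fun q => X q + Y q) p v = cov X p v + cov Y p v := by
  have := cov.isCovariantDerivativeOnUniv.add hX.diffAt hY.diffAt
  exact congrArg (fun L : T m p →L[ℝ] T m p => L v) this

lemma cov_smul (hh : SmF m h p) (hX : Sm X p) (v : T m p) :
    cov (fun q => h q • X q) p v = h p • cov X p v + dirDeriv h p v • X p := by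
  have := cov.isCovariantDerivativeOnUniv.leibniz hX.diffAt hh.mdiffAt
  exact congrArg (fun L : T m p →L[ℝ] T m p => L v) this

lemma cov_neg (hX : Sm X p) (v : T m p) :
    cov (fun q => -X q) p v = -cov X p v := by
  have := cov_smul (cov := cov) (SmF.const (m := m) (p := p) (-1)) hX v
  simpa [dirDeriv_const] using this

lemma cov_sub (hX : Sm X p) (hY : Sm Y p) (v : T m p) :
    cov (fun q => X q - Y q) p v = cov X p v - cov Y p v := by
  have := cov_add (cov := cov) hX hY.neg v
  rw [cov_neg hY] at this
  simpa [sub_eq_add_neg] using this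

lemma cov_zero (v : T m p) : cov (fun q : M => (0 : T m q)) p v = 0 := by
  have := CovariantDerivative.zero cov
  exact congrArg (fun L : (q : M) → T m q →L[ℝ] T m q => L p v) this

lemma cov_sum {ι : Type*} {s : Finset ι} {X : ι → ∀ q : M, T m q} (hX : ∀ i ∈ s, Sm (X i) p)
    (v : T m p) : cov (fun q => ∑ i ∈ s, X i q) p v = ∑ i ∈ s, cov (X i) p v := by
  classical
  induction s using Finset.induction_on with
  | empty => simpa using cov_zero v
  | insert a s ha ih =>
    simp only [Finset.sum_insert ha]
    rw [cov_add (hX a (by simp)) (Sm.sum fun i hi => hX i (by simp [hi])),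
      ih fun i hi => hX i (by simp [hi])]

lemma cov_congr (hX : Sm X p) (e : ∀ᶠ q in 𝓝 p, Y q = X q) (v : T m p) :
    cov Y p v = cov X p v := by
  rw [cov.isCovariantDerivativeOnUniv.congr_of_eventuallyEq (hX.congr e).diffAt hX.diffAt
    univ_mem e]

/-- The regularity of a connection concerns sections smooth on the whole manifold, so Y is replaced
by a global field with the same germ. The bump function used for this is where the Hausdorff
property enters. -/
lemma Sm.nabla [T2Space M] (hc : CovariantDerivative.ContMDiffCovariantDerivative cov ∞)
    (hX : Sm X p) (hY : Sm Y p) : Sm (fun q => cov Y q (X q)) p := by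
  obtain ⟨Y', h1, h2, h3⟩ := hY.exists_global
  have h4 := hc.contMDiff.contMDiff (σ := Y') (by
    rw [show (∞ : WithTop ℕ∞) + 1 = ∞ by simp]; exact h3)
  have h5 : Sm (fun q => cov Y' q (X q)) p := by
    filter_upwards [hX] with q hq
    exact ContMDiffAt.clm_bundle_apply (h4.contMDiffAt univ_mem) hq
  refine h5.congr ?_
  filter_upwards [eventually_eventually_nhds.2 h2] with q hq
  rw [cov_congr (h1 q) (hq.mono fun _ h => h.symm)]

lemma torsion_eq (hX : Sm X p) (hY : Sm Y p) : cov.torsion p (X p) (Y p) =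
    cov Y p (X p) - cov X p (Y p) - VectorField.mlieBracket (𝓡 m) X Y p :=
  cov.torsion_apply hX.diffAt hY.diffAt

lemma Sm.torsion [T2Space M] (hc : CovariantDerivative.ContMDiffCovariantDerivative cov ∞)
    (hX : Sm X p) (hY : Sm Y p) : Sm (fun q => cov.torsion q (X q) (Y q)) p := by
  refine (((hY.nabla (cov := cov) hc hX).neg.add (hX.nabla (cov := cov) hc hY)).sub
    (hX.mlieBracket hY)).congr ?_
  filter_upwards [hX.eventually, hY.eventually] with q h1 h2
  rw [torsion_eq h1 h2]
  abel

end SmoothFields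

/-! ### Tensoriality, and covariant derivatives of forms and two-tensors -/

section Tensors

variable {m : ℕ} {M : Type*} [TopologicalSpace M] [ChartedSpace (EuclideanSpace ℝ (Fin m)) M]
  [IsManifold (𝓡 m) ∞ M]
  {h k : M → ℝ} {X Y Z W : ∀ q : M, T m q} {p : M}

/-- An operation on vector fields which is additive and homogeneous over smooth functions. -/
structure SmTensorial {A : Type*} [AddCommGroup A] [Module ℝ A] (Φ : (∀ q : M, T m q) → A)
    (p : M) : Prop where
  smul : ∀ {h : M → ℝ} {X : ∀ q : M, T m q}, SmF m h p → Sm X p →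
    Φ (fun q => h q • X q) = h p • Φ X
  add : ∀ {X Y : ∀ q : M, T m q}, Sm X p → Sm Y p → Φ (fun q => X q + Y q) = Φ X + Φ Y

namespace SmTensorial

variable {A : Type*} [AddCommGroup A] [Module ℝ A] {Φ : (∀ q : M, T m q) → A}

lemma congr_nhds (hΦ : SmTensorial Φ p) (hX : Sm X p) (hY : Sm Y p)
    (e : ∀ᶠ q in 𝓝 p, X q = Y q) : Φ X = Φ Y := by
  classical
  -- The function ψ equals 1 near p, so it is smooth there however wild it is elsewhere, and ψ X = ψ
  -- Y holds everywhere. Homogeneity over ψ then makes the operation local.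
  let ψ (q : M) : ℝ := if X q = Y q then 1 else 0
  have h1 : SmF m ψ p := (SmF.const 1).congr (e.mono fun q hq => by simp [ψ, hq])
  have h2 : ψ p = 1 := by simp [ψ, e.self_of_nhds]
  have h3 : (fun q => ψ q • X q) = fun q => ψ q • Y q := by
    funext q
    by_cases hq : X q = Y q <;> simp [ψ, hq]
  have h4 := hΦ.smul h1 hX
  rw [h3, hΦ.smul h1 hY, h2, one_smul, one_smul] at h4
  exact h4.symm

lemma zero (hΦ : SmTensorial Φ p) : Φ (fun _ => 0) = 0 := by
  have := hΦ.smul (SmF.const (m := m) (p := p) 0) (Sm.zero (m := m) (p := p))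
  simpa using this

lemma sum (hΦ : SmTensorial Φ p) {ι : Type*} {s : Finset ι} {X : ι → ∀ q : M, T m q}
    (hX : ∀ i ∈ s, Sm (X i) p) : Φ (fun q => ∑ i ∈ s, X i q) = ∑ i ∈ s, Φ (X i) := by
  classical
  induction s using Finset.induction_on with
  | empty => simpa using hΦ.zero
  | insert a s ha ih =>
    simp only [Finset.sum_insert ha]
    rw [hΦ.add (hX a (by simp)) (Sm.sum fun i hi => hX i (by simp [hi])),
      ih fun i hi => hX i (by simp [hi])]

/-- A tensorial operation depends only on the value of the field at the point. -/
lemma pointwise (hΦ : SmTensorial Φ p) (hX : Sm X p) (hY : Sm Y p) (e : X p = Y p) :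
    Φ X = Φ Y := by
  let F := EuclideanSpace ℝ (Fin m)
  let t := trivializationAt F (TangentSpace (𝓡 m) : M → Type) p
  have hp : p ∈ t.baseSet := FiberBundle.mem_baseSet_trivializationAt' p
  let b := Module.Basis.ofVectorSpace ℝ F
  let s := t.localFrame b
  let c := t.localFrameCoeff (𝓡 m) b
  have hs (i) : Sm (s i) p := by
    filter_upwards [t.open_baseSet.mem_nhds hp] with q hq
    exact contMDiffAt_localFrame_of_mem ∞ t b i hq
  have hc {X : ∀ q : M, T m q} (hX : Sm X p) (i) : SmF m (fun q => c i q (X q)) p := by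
    filter_upwards [t.open_baseSet.mem_nhds hp, hX] with q hq hX
    exact contMDiffAt_localFrameCoeff b hq hX i
  have key {X : ∀ q : M, T m q} (hX : Sm X p) : Φ X = ∑ i, c i p (X p) • Φ (s i) := by
    rw [hΦ.congr_nhds hX (Sm.sum (s := Finset.univ) fun i _ => (hs i).smul (hc hX i))
      (t.eventually_eq_localFrame_sum_coeff_smul b hp), hΦ.sum fun i _ => (hs i).smul (hc hX i)]
    exact Finset.sum_congr rfl fun i _ => hΦ.smul (hc hX i) (hs i)
  rw [key hX, key hY, e]

end SmTensorial

/-- A smooth one-form, as a function on tangent vectors. -/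
structure SmForm (α : ∀ p : M, T m p → ℝ) : Prop where
  add : ∀ p v w, α p (v + w) = α p v + α p w
  smul : ∀ p (c : ℝ) v, α p (c • v) = c * α p v
  smooth : ∀ {p : M} {X : ∀ q : M, T m q}, Sm X p → SmF m (fun q => α q (X q)) p

/-- A smooth covariant tensor of rank two. -/
structure SmForm₂ (β : ∀ p : M, T m p → T m p → ℝ) : Prop where
  add_left : ∀ p u v w, β p (u + v) w = β p u w + β p v w
  smul_left : ∀ p (c : ℝ) v w, β p (c • v) w = c * β p v w
  add_right : ∀ p u v w, β p u (v + w) = β p u v + β p u w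
  smul_right : ∀ p (c : ℝ) v w, β p v (c • w) = c * β p v w
  smooth : ∀ {p : M} {X Y : ∀ q : M, T m q}, Sm X p → Sm Y p →
    SmF m (fun q => β q (X q) (Y q)) p

variable {cov : Conn m M} {α : ∀ p : M, T m p → ℝ} {β : ∀ p : M, T m p → T m p → ℝ}

/-- The definition uses one chosen extension of the vector. The right-hand side is tensorial in W,
the Leibniz terms cancelling, so any smooth field with the same value may be used. -/
lemma covOne_eq (hα : SmForm α) (hW : Sm W p) (v : T m p) :
    covOne cov α p v (W p) = dirDeriv (fun q => α q (W q)) p v - α p (cov W p v) := by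
  have : SmTensorial (fun W => dirDeriv (fun q => α q (W q)) p v - α p (cov W p v)) p := by
    refine ⟨fun {h X} hh hX => ?_, fun {X Y} hX hY => ?_⟩
    · simp only [hα.smul, cov_smul hh hX, hα.add, dirDeriv_mul hh (hα.smooth hX), smul_eq_mul]
      ring
    · simp only [hα.add, cov_add hX hY, dirDeriv_add (hα.smooth hX) (hα.smooth hY)]
      ring
  have h1 := this.pointwise hW (Sm.ext (W p)) (by simp)
  rw [h1, covOne]

lemma covTwo_eq (hβ : SmForm₂ β) (hX : Sm X p) (hY : Sm Y p) (u : T m p) :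
    covTwo cov β p u (X p) (Y p) = dirDeriv (fun q => β q (X q) (Y q)) p u
      - β p (cov X p u) (Y p) - β p (X p) (cov Y p u) := by
  have h1 (Y : ∀ q : M, T m q) (hY : Sm Y p) : SmTensorial (fun X =>
      dirDeriv (fun q => β q (X q) (Y q)) p u
        - β p (cov X p u) (Y p) - β p (X p) (cov Y p u)) p := by
    refine ⟨fun {h X} hh hX => ?_, fun {X X'} hX hX' => ?_⟩
    · simp only [hβ.smul_left, cov_smul hh hX, hβ.add_left, dirDeriv_mul hh (hβ.smooth hX hY),
        smul_eq_mul]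
      ring
    · simp only [hβ.add_left, cov_add hX hX', dirDeriv_add (hβ.smooth hX hY) (hβ.smooth hX' hY)]
      ring
  have h2 (X : ∀ q : M, T m q) (hX : Sm X p) : SmTensorial (fun Y =>
      dirDeriv (fun q => β q (X q) (Y q)) p u
        - β p (cov X p u) (Y p) - β p (X p) (cov Y p u)) p := by
    refine ⟨fun {h Y} hh hY => ?_, fun {Y Y'} hY hY' => ?_⟩
    · simp only [hβ.smul_right, cov_smul hh hY, hβ.add_right, dirDeriv_mul hh (hβ.smooth hX hY),
        smul_eq_mul]
      ring
    · simp only [hβ.add_right, cov_add hY hY', dirDeriv_add (hβ.smooth hX hY) (hβ.smooth hX hY')]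
      ring
  have h3 := (h1 Y hY).pointwise hX (Sm.ext (X p)) (by simp)
  have h4 := (h2 _ (Sm.ext (X p))).pointwise hY (Sm.ext (Y p)) (by simp)
  simp only [ext_self] at h3 h4
  rw [h3, h4, covTwo]

lemma SmForm.dirDeriv (hh : ∀ p, SmF m h p) : SmForm (m := m) (dirDeriv h) where
  add _ v w := dirDeriv_vadd h v w
  smul _ c v := dirDeriv_vsmul h c v
  smooth hX := smF_dirDeriv (hh _) hX

lemma SmForm.map_zero (hα : SmForm α) : α p 0 = 0 := by
  have := hα.smul p 0 0
  simpa using this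

lemma SmForm.map_sum (hα : SmForm α) {ι : Type*} (s : Finset ι) (v : ι → T m p) :
    α p (∑ i ∈ s, v i) = ∑ i ∈ s, α p (v i) := by
  classical
  induction s using Finset.induction_on with
  | empty => simpa using hα.map_zero
  | insert a s ha ih => rw [Finset.sum_insert ha, Finset.sum_insert ha, hα.add, ih]

/-- A smooth rank two tensor at a point, as a bilinear form. -/
def SmForm₂.bilin (hβ : SmForm₂ β) (p : M) : T m p →ₗ[ℝ] T m p →ₗ[ℝ] ℝ :=
  LinearMap.mk₂ ℝ (β p) (hβ.add_left p) (hβ.smul_left p) (hβ.add_right p) (hβ.smul_right p)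

lemma SmForm.covOne [T2Space M] (hc : CovariantDerivative.ContMDiffCovariantDerivative cov ∞)
    (hα : SmForm α) : SmForm₂ (covOne cov α) where
  add_left p u v w := by
    unfold QC.covOne
    rw [dirDeriv_vadd, _root_.map_add, hα.add]; ring
  smul_left p c v w := by
    unfold QC.covOne
    rw [dirDeriv_vsmul, _root_.map_smul, hα.smul]; ring
  add_right p u v w := by
    have h1 := covOne_eq (cov := cov) hα ((Sm.ext v).add (Sm.ext w)) u
    simp only [ext_self] at h1
    rw [h1]
    simp only [hα.add, cov_add (Sm.ext v) (Sm.ext w),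
      dirDeriv_add (hα.smooth (Sm.ext v)) (hα.smooth (Sm.ext w))]
    unfold QC.covOne
    ring
  smul_right p c v w := by
    have h1 := covOne_eq (cov := cov) hα ((Sm.ext w).smul (SmF.const c)) v
    simp only [ext_self] at h1
    rw [h1]
    simp only [hα.smul, cov_smul (SmF.const c) (Sm.ext w), dirDeriv_const, zero_smul, add_zero,
      dirDeriv_const_mul c (hα.smooth (Sm.ext w))]
    unfold QC.covOne
    ring
  smooth {p X Y} hX hY := by
    refine ((smF_dirDeriv (hα.smooth hY) hX).sub (hα.smooth (hX.nabla hc hY))).congr ?_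
    filter_upwards [hY.eventually] with q hq
    exact covOne_eq hα hq (X q)

lemma covTwo_add_left (hβ : SmForm₂ β) (u u' v w : T m p) :
    covTwo cov β p (u + u') v w = covTwo cov β p u v w + covTwo cov β p u' v w := by
  unfold covTwo
  rw [dirDeriv_vadd, _root_.map_add, _root_.map_add, hβ.add_left, hβ.add_right]; ring

lemma covTwo_smul_left (hβ : SmForm₂ β) (c : ℝ) (u v w : T m p) :
    covTwo cov β p (c • u) v w = c * covTwo cov β p u v w := by
  unfold covTwo
  rw [dirDeriv_vsmul, _root_.map_smul, _root_.map_smul, hβ.smul_left, hβ.smul_right]; ring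

lemma covTwo_add_mid (hβ : SmForm₂ β) (u v v' w : T m p) :
    covTwo cov β p u (v + v') w = covTwo cov β p u v w + covTwo cov β p u v' w := by
  have h1 := covTwo_eq (cov := cov) hβ ((Sm.ext v).add (Sm.ext v')) (Sm.ext w) u
  simp only [ext_self] at h1
  rw [h1]
  simp only [hβ.add_left, cov_add (Sm.ext v) (Sm.ext v'),
    dirDeriv_add (hβ.smooth (Sm.ext v) (Sm.ext w)) (hβ.smooth (Sm.ext v') (Sm.ext w))]
  unfold covTwo
  ring

lemma covTwo_add_right (hβ : SmForm₂ β) (u v w w' : T m p) :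
    covTwo cov β p u v (w + w') = covTwo cov β p u v w + covTwo cov β p u v w' := by
  have h1 := covTwo_eq (cov := cov) hβ (Sm.ext v) ((Sm.ext w).add (Sm.ext w')) u
  simp only [ext_self] at h1
  rw [h1]
  simp only [hβ.add_right, cov_add (Sm.ext w) (Sm.ext w'),
    dirDeriv_add (hβ.smooth (Sm.ext v) (Sm.ext w)) (hβ.smooth (Sm.ext v) (Sm.ext w'))]
  unfold covTwo
  ring

lemma covTwo_smul_mid (hβ : SmForm₂ β) (c : ℝ) (u v w : T m p) :
    covTwo cov β p u (c • v) w = c * covTwo cov β p u v w := by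
  have h1 := covTwo_eq (cov := cov) hβ ((Sm.ext v).smul (SmF.const c)) (Sm.ext w) u
  simp only [ext_self] at h1
  rw [h1]
  simp only [hβ.smul_left, cov_smul (SmF.const c) (Sm.ext v), dirDeriv_const, zero_smul, add_zero,
    dirDeriv_const_mul c (hβ.smooth (Sm.ext v) (Sm.ext w))]
  unfold covTwo
  ring

lemma covTwo_smul_right (hβ : SmForm₂ β) (c : ℝ) (u v w : T m p) :
    covTwo cov β p u v (c • w) = c * covTwo cov β p u v w := by
  have h1 := covTwo_eq (cov := cov) hβ (Sm.ext v) ((Sm.ext w).smul (SmF.const c)) u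
  simp only [ext_self] at h1
  rw [h1]
  simp only [hβ.smul_right, cov_smul (SmF.const c) (Sm.ext w), dirDeriv_const, zero_smul, add_zero,
    dirDeriv_const_mul c (hβ.smooth (Sm.ext v) (Sm.ext w))]
  unfold covTwo
  ring

/-- The covariant derivative of a smooth rank two tensor at a point, as a trilinear form. -/
def SmForm₂.trilin (hβ : SmForm₂ β) (cov : Conn m M) (p : M) :
    T m p →ₗ[ℝ] T m p →ₗ[ℝ] T m p →ₗ[ℝ] ℝ :=
  LinearMap.mk₂ ℝ (fun u v =>
      { toFun := covTwo cov β p u v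
        map_add' := covTwo_add_right hβ u v
        map_smul' := fun c w => covTwo_smul_right hβ c u v w })
    (fun u u' v => LinearMap.ext fun w => covTwo_add_left hβ u u' v w)
    (fun c u v => LinearMap.ext fun w => covTwo_smul_left hβ c u v w)
    (fun u v v' => LinearMap.ext fun w => covTwo_add_mid hβ u v v' w)
    (fun c u v => LinearMap.ext fun w => covTwo_smul_mid hβ c u v w)

@[simp] lemma SmForm₂.trilin_apply (hβ : SmForm₂ β) (u v w : T m p) :
    hβ.trilin cov p u v w = covTwo cov β p u v w := rfl

@[simp] lemma SmForm₂.bilin_apply (hβ : SmForm₂ β) (v w : T m p) :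
    hβ.bilin p v w = β p v w := rfl

lemma smF_covTwo [T2Space M] (hc : CovariantDerivative.ContMDiffCovariantDerivative cov ∞)
    (hβ : SmForm₂ β) (hX : Sm X p) (hY : Sm Y p) (hZ : Sm Z p) :
    SmF m (fun q => covTwo cov β q (X q) (Y q) (Z q)) p := by
  refine (((smF_dirDeriv (hβ.smooth hY hZ) hX).sub (hβ.smooth (hX.nabla hc hY) hZ)).sub
    (hβ.smooth hY (hX.nabla hc hZ))).congr ?_
  filter_upwards [hY.eventually, hZ.eventually] with q hq hq'
  exact covTwo_eq hβ hq hq' (X q)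

/-- The derivation of functions given by a Lie bracket is the commutator. -/
lemma dirDeriv_mlieBracket (hh : SmF m h p) (hX : Sm X p) (hY : Sm Y p) :
    dirDeriv h p (VectorField.mlieBracket (𝓡 m) X Y p)
      = dirDeriv (fun q => dirDeriv h q (Y q)) p (X p)
        - dirDeriv (fun q => dirDeriv h q (X q)) p (Y p) := by
  -- The argument tests the bracket against a nonzero tangent vector, which does not exist in
  -- dimension zero.
  by_cases hs : ∀ w : T m p, w = 0
  · rw [hs (VectorField.mlieBracket (𝓡 m) X Y p), hs (X p), hs (Y p)]
    simp [dirDeriv_vzero]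
  push Not at hs
  obtain ⟨w, hw⟩ := hs
  have hW := Sm.ext w
  set W := ext w with hWdef
  have smul_right {X Y : ∀ q : M, T m q} {h : M → ℝ} {q : M} (hh : SmF m h q) (hY : Sm Y q) :
      VectorField.mlieBracket (𝓡 m) X (fun q => h q • Y q) q
        = dirDeriv h q (X q) • Y q + h q • VectorField.mlieBracket (𝓡 m) X Y q :=
    VectorField.mlieBracket_smul_right hh.mdiffAt hY.diffAt
  have bracket {X Y : ∀ q : M, T m q} (hX : Sm X p) (hY : Sm Y p) :
      VectorField.mlieBracket (𝓡 m) X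
          (fun q => VectorField.mlieBracket (𝓡 m) Y (fun q => h q • W q) q) p
        = dirDeriv (fun q => dirDeriv h q (Y q)) p (X p) • w
          + dirDeriv h p (Y p) • VectorField.mlieBracket (𝓡 m) X W p
          + (dirDeriv h p (X p) • VectorField.mlieBracket (𝓡 m) Y W p
          + h p • VectorField.mlieBracket (𝓡 m) X
            (fun q => VectorField.mlieBracket (𝓡 m) Y W q) p) := by
    have e : ∀ᶠ q in 𝓝 p, VectorField.mlieBracket (𝓡 m) Y (fun q => h q • W q) q
        = dirDeriv h q (Y q) • W q + h q • VectorField.mlieBracket (𝓡 m) Y W q := by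
      filter_upwards [hh.eventually, hW.eventually] with q h1 h2 using smul_right h1 h2
    have hA : Sm (fun q => dirDeriv h q (Y q) • W q) p := hW.smul (smF_dirDeriv hh hY)
    have hB : Sm (fun q => h q • VectorField.mlieBracket (𝓡 m) Y W q) p :=
      (hY.mlieBracket hW).smul hh
    rw [Filter.EventuallyEq.mlieBracket_vectorField_eq (EventuallyEq.refl _ X) e]
    have := VectorField.mlieBracket_add_right (V := X) hA.diffAt hB.diffAt
    refine this.trans ?_
    rw [smul_right (smF_dirDeriv hh hY) hW, smul_right hh (hY.mlieBracket hW), hWdef, ext_self]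
  have two : (2 : WithTop ℕ∞) ≤ ∞ :=
    show ((2 : ℕ∞) : WithTop ℕ∞) ≤ ((⊤ : ℕ∞) : WithTop ℕ∞) from WithTop.coe_le_coe.2 le_top
  -- The Jacobi identity is applied to X, Y and hW, and to X, Y and W. Comparing the two leaves a
  -- multiple of W(p) whose coefficient is the difference between [X, Y]h and XYh - YXh; since W(p)
  -- ≠ 0 the coefficient vanishes.
  have jac {Z : ∀ q : M, T m q} (hZ : Sm Z p) :=
    VectorField.leibniz_identity_mlieBracket_apply
      (hX.contMDiffAt.of_le (by simpa [minSmoothness_of_isRCLikeNormedField] using two))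
      (hY.contMDiffAt.of_le (by simpa [minSmoothness_of_isRCLikeNormedField] using two))
      (hZ.contMDiffAt.of_le (by simpa [minSmoothness_of_isRCLikeNormedField] using two))
  have j1 := jac (hW.smul hh)
  have j2 := jac hW
  have b1 := bracket hX hY
  have b2 := bracket hY hX
  have b3 := smul_right (X := VectorField.mlieBracket (𝓡 m) X Y) hh hW
  have e1 : VectorField.mlieBracket (𝓡 m) X
          (VectorField.mlieBracket (𝓡 m) Y (fun q => h q • W q)) p = _ := b1
  have e2 : VectorField.mlieBracket (𝓡 m) Y
          (VectorField.mlieBracket (𝓡 m) X (fun q => h q • W q)) p = _ := b2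
  rw [e1, e2, b3] at j1
  have e3 : VectorField.mlieBracket (𝓡 m) X
          (fun q => VectorField.mlieBracket (𝓡 m) Y W q) p = _ := j2
  rw [e3] at j1
  have key : (dirDeriv h p (VectorField.mlieBracket (𝓡 m) X Y p)
      - (dirDeriv (fun q => dirDeriv h q (Y q)) p (X p)
        - dirDeriv (fun q => dirDeriv h q (X q)) p (Y p))) • w = 0 := by
    rw [hWdef, ext_self] at j1
    rw [sub_smul, sub_smul, sub_eq_zero, eq_comm, ← sub_eq_zero]
    rw [← sub_eq_zero] at j1
    rw [← j1]
    change _ = _ - (_ + (_ + _ + (_ + h p • VectorField.mlieBracket (𝓡 m) Y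
      (VectorField.mlieBracket (𝓡 m) X (ext w)) p)))
    module
  rcases smul_eq_zero.1 key with h0 | h0
  · linarith
  · exact absurd h0 hw

end Tensors

/-! ### Curvature, Ricci identity and first Bianchi identity with torsion -/

section Curvature

variable {m : ℕ} {M : Type*} [TopologicalSpace M] [ChartedSpace (EuclideanSpace ℝ (Fin m)) M]
  [IsManifold (𝓡 m) ∞ M]
  {h k : M → ℝ} {X Y Z W : ∀ q : M, T m q} {p : M} {cov : Conn m M}

lemma mlieBracket_fun_smul_right (hh : SmF m h p) (hY : Sm Y p) :
    VectorField.mlieBracket (𝓡 m) X (fun q => h q • Y q) p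
      = dirDeriv h p (X p) • Y p + h p • VectorField.mlieBracket (𝓡 m) X Y p :=
  VectorField.mlieBracket_smul_right hh.mdiffAt hY.diffAt

lemma mlieBracket_fun_add_right (hY : Sm Y p) (hZ : Sm Z p) :
    VectorField.mlieBracket (𝓡 m) X (fun q => Y q + Z q) p
      = VectorField.mlieBracket (𝓡 m) X Y p + VectorField.mlieBracket (𝓡 m) X Z p :=
  VectorField.mlieBracket_add_right hY.diffAt hZ.diffAt

/-- The curvature evaluated on vector fields. -/
def curvField (cov : Conn m M) (X Y Z : ∀ q : M, T m q) (p : M) : T m p :=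
  cov (fun q => cov Z q (Y q)) p (X p) - cov (fun q => cov Z q (X q)) p (Y p)
    - cov Z p (VectorField.mlieBracket (𝓡 m) X Y p)

lemma curvField_swap (X Y Z : ∀ q : M, T m q) (p : M) :
    curvField cov X Y Z p = -curvField cov Y X Z p := by
  unfold curvField
  rw [VectorField.mlieBracket_swap_apply, map_neg]
  abel

variable [T2Space M] (hc : CovariantDerivative.ContMDiffCovariantDerivative cov ∞)
include hc

lemma curvField_tensorial_right (hX : Sm X p) (hY : Sm Y p) :
    SmTensorial (fun Z => curvField cov X Y Z p) p := by
  refine ⟨fun {h Z} hh hZ => ?_, fun {Z W} hZ hW => ?_⟩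
  · have key {X Y : ∀ q : M, T m q} (hX : Sm X p) (hY : Sm Y p) :
        cov (fun q => cov (fun q => h q • Z q) q (Y q)) p (X p)
        = h p • cov (fun q => cov Z q (Y q)) p (X p) + dirDeriv h p (X p) • cov Z p (Y p)
          + (dirDeriv h p (Y p) • cov Z p (X p)
            + dirDeriv (fun q => dirDeriv h q (Y q)) p (X p) • Z p) := by
      have e : ∀ᶠ q in 𝓝 p, cov (fun q => h q • Z q) q (Y q)
          = h q • cov Z q (Y q) + dirDeriv h q (Y q) • Z q := by
        filter_upwards [hh.eventually, hZ.eventually] with q h1 h2 using cov_smul h1 h2 _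
      have hA := Sm.smul hh (hY.nabla hc hZ)
      have hB := Sm.smul (smF_dirDeriv hh hY) hZ
      rw [cov_congr (hA.add hB) e, cov_add hA hB, cov_smul hh (hY.nabla hc hZ),
        cov_smul (smF_dirDeriv hh hY) hZ]
    simp only [curvField]
    rw [key hX hY, key hY hX, cov_smul hh hZ, dirDeriv_mlieBracket hh hX hY]
    module
  · have key {X Y : ∀ q : M, T m q} (hX : Sm X p) (hY : Sm Y p) :
        cov (fun q => cov (fun q => Z q + W q) q (Y q)) p (X p)
        = cov (fun q => cov Z q (Y q)) p (X p) + cov (fun q => cov W q (Y q)) p (X p) := by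
      have e : ∀ᶠ q in 𝓝 p, cov (fun q => Z q + W q) q (Y q)
          = cov Z q (Y q) + cov W q (Y q) := by
        filter_upwards [hZ.eventually, hW.eventually] with q h1 h2 using cov_add h1 h2 _
      rw [cov_congr ((hY.nabla hc hZ).add (hY.nabla hc hW)) e,
        cov_add (hY.nabla hc hZ) (hY.nabla hc hW)]
    simp only [curvField]
    rw [key hX hY, key hY hX, cov_add hZ hW]
    abel

lemma curvField_tensorial_mid (hX : Sm X p) (hZ : Sm Z p) :
    SmTensorial (fun Y => curvField cov X Y Z p) p := by
  refine ⟨fun {h Y} hh hY => ?_, fun {Y W} hY hW => ?_⟩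
  · simp only [curvField, map_smul]
    rw [cov_smul hh (hY.nabla hc hZ), mlieBracket_fun_smul_right hh hY, map_add, map_smul,
      map_smul]
    module
  · simp only [curvField, map_add]
    rw [cov_add (hY.nabla hc hZ) (hW.nabla hc hZ), mlieBracket_fun_add_right hY hW, map_add]
    abel

lemma curvField_tensorial_left (hY : Sm Y p) (hZ : Sm Z p) :
    SmTensorial (fun X => curvField cov X Y Z p) p := by
  have := curvField_tensorial_mid hc hY hZ
  refine ⟨fun {h X} hh hX => ?_, fun {X W} hX hW => ?_⟩
  · simp only [curvField_swap _ Y Z p]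
    rw [this.smul hh hX, smul_neg]
  · simp only [curvField_swap _ Y Z p]
    rw [this.add hX hW, neg_add]

/-- Tensoriality in the three arguments allows replacing the chosen extensions in `curv` one after
the other. -/
lemma curv_eq (hX : Sm X p) (hY : Sm Y p) (hZ : Sm Z p) :
    curv cov p (X p) (Y p) (Z p) = curvField cov X Y Z p := by
  have h1 := (curvField_tensorial_left hc hY hZ).pointwise hX (Sm.ext (X p)) (by simp)
  have h2 := (curvField_tensorial_mid hc (Sm.ext (X p)) hZ).pointwise hY (Sm.ext (Y p)) (by simp)
  have h3 := (curvField_tensorial_right hc (Sm.ext (X p)) (Sm.ext (Y p))).pointwise hZ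
    (Sm.ext (Z p)) (by simp)
  rw [h1, h2, h3]
  simp only [curvField, curv, ext_self]

lemma curv_add_left (u u' v w : T m p) :
    curv cov p (u + u') v w = curv cov p u v w + curv cov p u' v w := by
  have h1 := curv_eq hc ((Sm.ext u).add (Sm.ext u')) (Sm.ext v) (Sm.ext w)
  rw [(curvField_tensorial_left hc (Sm.ext v) (Sm.ext w)).add (Sm.ext u) (Sm.ext u'),
    ← curv_eq hc (Sm.ext u) (Sm.ext v) (Sm.ext w),
    ← curv_eq hc (Sm.ext u') (Sm.ext v) (Sm.ext w)] at h1
  simpa using h1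

lemma curv_smul_left (c : ℝ) (u v w : T m p) :
    curv cov p (c • u) v w = c • curv cov p u v w := by
  have h1 := curv_eq hc ((Sm.ext u).smul (SmF.const c)) (Sm.ext v) (Sm.ext w)
  rw [(curvField_tensorial_left hc (Sm.ext v) (Sm.ext w)).smul (SmF.const c) (Sm.ext u),
    ← curv_eq hc (Sm.ext u) (Sm.ext v) (Sm.ext w)] at h1
  simpa using h1

omit hc [T2Space M] in
lemma curv_swap (u v w : T m p) : curv cov p u v w = -curv cov p v u w := by
  unfold curv
  rw [VectorField.mlieBracket_swap_apply, map_neg]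
  abel

lemma curv_add_mid (u v v' w : T m p) :
    curv cov p u (v + v') w = curv cov p u v w + curv cov p u v' w := by
  rw [curv_swap, curv_add_left hc, curv_swap u v, curv_swap u v']
  abel

lemma curv_smul_mid (c : ℝ) (u v w : T m p) :
    curv cov p u (c • v) w = c • curv cov p u v w := by
  rw [curv_swap, curv_smul_left hc, curv_swap u v, smul_neg]

lemma curv_add_right (u v w w' : T m p) :
    curv cov p u v (w + w') = curv cov p u v w + curv cov p u v w' := by
  have h1 := curv_eq hc (Sm.ext u) (Sm.ext v) ((Sm.ext w).add (Sm.ext w'))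
  rw [(curvField_tensorial_right hc (Sm.ext u) (Sm.ext v)).add (Sm.ext w) (Sm.ext w'),
    ← curv_eq hc (Sm.ext u) (Sm.ext v) (Sm.ext w),
    ← curv_eq hc (Sm.ext u) (Sm.ext v) (Sm.ext w')] at h1
  simpa using h1

lemma curv_smul_right (c : ℝ) (u v w : T m p) :
    curv cov p u v (c • w) = c • curv cov p u v w := by
  have h1 := curv_eq hc (Sm.ext u) (Sm.ext v) ((Sm.ext w).smul (SmF.const c))
  rw [(curvField_tensorial_right hc (Sm.ext u) (Sm.ext v)).smul (SmF.const c) (Sm.ext w),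
    ← curv_eq hc (Sm.ext u) (Sm.ext v) (Sm.ext w)] at h1
  simpa using h1

/-! ### Second and third covariant derivatives of functions -/

variable (hh : ∀ p, SmF m h p)
include hh

lemma smForm₂_hess : SmForm₂ (hess cov h) := SmForm.covOne hc (SmForm.dirDeriv hh)

omit hc [T2Space M] in
lemma hess_eq (hY : Sm Y p) (v : T m p) :
    hess cov h p v (Y p) = dirDeriv (fun q => dirDeriv h q (Y q)) p v - dirDeriv h p (cov Y p v) :=
  covOne_eq (SmForm.dirDeriv hh) hY v

omit hc [T2Space M] in
lemma hess_sub_hess (v w : T m p) :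
    hess cov h p v w - hess cov h p w v = -dirDeriv h p (cov.torsion p v w) := by
  have h1 := hess_eq (cov := cov) hh (Sm.ext w) v
  have h2 := hess_eq (cov := cov) hh (Sm.ext v) w
  have h3 := torsion_eq (cov := cov) (Sm.ext v) (Sm.ext w)
  have h4 := dirDeriv_mlieBracket (hh p) (Sm.ext v) (Sm.ext w)
  simp only [ext_self] at h1 h2 h3 h4
  rw [h1, h2, h3, dirDeriv_vsub, dirDeriv_vsub, h4]
  ring

/-- The Ricci identity for functions. -/
lemma third_sub_third (u v w : T m p) :
    third cov h p u v w - third cov h p v u w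
      = -dirDeriv h p (curv cov p u v w) - hess cov h p (cov.torsion p u v) w := by
  have hH := smForm₂_hess hc hh
  set X := ext u with hXd
  set Y := ext v with hYd
  set Z := ext w with hZd
  have hX : Sm X p := Sm.ext u
  have hY : Sm Y p := Sm.ext v
  have hZ : Sm Z p := Sm.ext w
  have e1 : X p = u := ext_self u
  have e2 : Y p = v := ext_self v
  have e3 : Z p = w := ext_self w
  have key {X Y : ∀ q : M, T m q} (hX : Sm X p) (hY : Sm Y p) :
      third cov h p (X p) (Y p) (Z p)
      = dirDeriv (fun q => dirDeriv (fun q => dirDeriv h q (Z q)) q (Y q)) p (X p)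
        - dirDeriv (fun q => dirDeriv h q (cov Z q (Y q))) p (X p)
        - hess cov h p (cov Y p (X p)) (Z p)
        - (dirDeriv (fun q => dirDeriv h q (cov Z q (X q))) p (Y p)
          - dirDeriv h p (cov (fun q => cov Z q (X q)) p (Y p))) := by
    rw [third, covTwo_eq hH hY hZ, ← hess_eq hh (hX.nabla hc hZ)]
    have e : ∀ᶠ q in 𝓝 p, hess cov h q (Y q) (Z q)
        = dirDeriv (fun q => dirDeriv h q (Z q)) q (Y q) - dirDeriv h q (cov Z q (Y q)) := by
      filter_upwards [hZ.eventually] with q hq using hess_eq hh hq _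
    rw [dirDeriv_congr e, dirDeriv_sub (smF_dirDeriv (smF_dirDeriv (hh p) hZ) hY)
      (smF_dirDeriv (hh p) (hY.nabla hc hZ))]
  have h1 := key hX hY
  have h2 := key hY hX
  have h3 := torsion_eq (cov := cov) hX hY
  have h4 := dirDeriv_mlieBracket (smF_dirDeriv (hh p) hZ) hX hY
  have h5 := curv_eq hc hX hY hZ
  have h6 := hess_eq (cov := cov) hh hZ (VectorField.mlieBracket (𝓡 m) X Y p)
  rw [e1, e2, e3] at h1 h2 h5
  rw [e1, e2] at h3 h4
  rw [e3] at h6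
  rw [h1, h2, h3, h5, curvField, dirDeriv_vsub, dirDeriv_vsub]
  have l1 := (hH.bilin p).map_sub₂
  simp only [SmForm₂.bilin_apply] at l1
  rw [l1, l1, h6, h4, e1, e2]
  ring

omit hh in
/-- The first Bianchi identity of a connection with torsion. -/
lemma first_bianchi (hX : Sm X p) (hY : Sm Y p) (hZ : Sm Z p) :
    curv cov p (X p) (Y p) (Z p) + curv cov p (Y p) (Z p) (X p) + curv cov p (Z p) (X p) (Y p)
      = cov (fun q => cov.torsion q (Y q) (Z q)) p (X p)
        + cov.torsion p (X p) (VectorField.mlieBracket (𝓡 m) Y Z p)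
        + (cov (fun q => cov.torsion q (Z q) (X q)) p (Y p)
        + cov.torsion p (Y p) (VectorField.mlieBracket (𝓡 m) Z X p))
        + (cov (fun q => cov.torsion q (X q) (Y q)) p (Z p)
        + cov.torsion p (Z p) (VectorField.mlieBracket (𝓡 m) X Y p)) := by
  -- The identity is kept in the form d^∇ T = R ∧ id, with the exterior covariant derivative of the
  -- torsion. Expanding each cyclic summand by the definition of the torsion leaves the curvature
  -- terms and double brackets, which the Jacobi identity removes.
  have key {X Y Z : ∀ q : M, T m q} (hX : Sm X p) (hY : Sm Y p) (hZ : Sm Z p) :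
      cov (fun q => cov.torsion q (Y q) (Z q)) p (X p)
        + cov.torsion p (X p) (VectorField.mlieBracket (𝓡 m) Y Z p)
      = cov (fun q => cov Z q (Y q)) p (X p) - cov (fun q => cov Y q (Z q)) p (X p)
        - cov X p (VectorField.mlieBracket (𝓡 m) Y Z p)
        - VectorField.mlieBracket (𝓡 m) X (VectorField.mlieBracket (𝓡 m) Y Z) p := by
    have e : ∀ᶠ q in 𝓝 p, cov.torsion q (Y q) (Z q)
        = cov Z q (Y q) - cov Y q (Z q) - VectorField.mlieBracket (𝓡 m) Y Z q := by
      filter_upwards [hY.eventually, hZ.eventually] with q h1 h2 using torsion_eq h1 h2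
    have hA := hY.nabla hc hZ
    have hB := hZ.nabla hc hY
    have hC := hY.mlieBracket hZ
    rw [cov_congr ((hA.sub hB).sub hC) e, cov_sub (hA.sub hB) hC, cov_sub hA hB]
    have t := torsion_eq (cov := cov) hX hC
    rw [t]
    abel
  rw [key hX hY hZ, key hY hZ hX, key hZ hX hY, curv_eq hc hX hY hZ, curv_eq hc hY hZ hX,
    curv_eq hc hZ hX hY]
  have two : (2 : WithTop ℕ∞) ≤ ∞ :=
    show ((2 : ℕ∞) : WithTop ℕ∞) ≤ ((⊤ : ℕ∞) : WithTop ℕ∞) from WithTop.coe_le_coe.2 le_top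
  have jac := VectorField.leibniz_identity_mlieBracket_apply
      (hX.contMDiffAt.of_le (by simpa [minSmoothness_of_isRCLikeNormedField] using two))
      (hY.contMDiffAt.of_le (by simpa [minSmoothness_of_isRCLikeNormedField] using two))
      (hZ.contMDiffAt.of_le (by simpa [minSmoothness_of_isRCLikeNormedField] using two))
  have s1 : VectorField.mlieBracket (𝓡 m) (VectorField.mlieBracket (𝓡 m) X Y) Z p
      = -VectorField.mlieBracket (𝓡 m) Z (VectorField.mlieBracket (𝓡 m) X Y) p :=
    VectorField.mlieBracket_swap_apply
  have s2 : VectorField.mlieBracket (𝓡 m) Y (VectorField.mlieBracket (𝓡 m) X Z) p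
      = -VectorField.mlieBracket (𝓡 m) Y (VectorField.mlieBracket (𝓡 m) Z X) p := by
    have h1 : VectorField.mlieBracket (𝓡 m) X Z = fun q => (-1 : ℝ) •
        VectorField.mlieBracket (𝓡 m) Z X q := by
      rw [VectorField.mlieBracket_swap]; funext q; simp
    rw [h1, mlieBracket_fun_smul_right (SmF.const _) (hZ.mlieBracket hX), dirDeriv_const]
    simp
  rw [s1, s2] at jac
  rw [jac]
  simp only [curvField]
  abel

end Curvature

/-! ### Linear algebra of a quaternionic Hermitian space -/

/-- A quaternionic Hermitian structure on a vector space, with an orthonormal basis. -/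
structure Quat (n : ℕ) (V : Type*) [AddCommGroup V] [Module ℝ V] where
  g : LinearMap.BilinForm ℝ V
  e : Fin (4 * n) → V
  I : Fin 3 → Module.End ℝ V
  symm : ∀ X Y, g X Y = g Y X
  orth : ∀ a b, g (e a) (e b) = if a = b then 1 else 0
  expand : ∀ X, X = ∑ a, g X (e a) • e a
  I_sq : ∀ s, I s * I s = -1
  I_mul : I 0 * I 1 = I 2
  I_mul' : I 1 * I 0 = -I 2
  herm : ∀ s X Y, g (I s X) (I s Y) = g X Y

namespace Quat

variable {n : ℕ} {V : Type*} [AddCommGroup V] [Module ℝ V] (D : Quat n V)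

lemma sum_apply (f : V →ₗ[ℝ] ℝ) (X : V) : ∑ a, D.g (D.e a) X * f (D.e a) = f X := by
  conv_rhs => rw [D.expand X, map_sum]
  exact Finset.sum_congr rfl fun a _ => by rw [map_smul, D.symm, smul_eq_mul]

lemma eq_zero_of_g {X : V} (h : ∀ Y, D.g X Y = 0) : X = 0 := by
  rw [D.expand X]; simp [h]

lemma op_ext {A B : Module.End ℝ V} (h : ∀ X Y, D.g (A X) Y = D.g (B X) Y) : A = B := by
  refine LinearMap.ext fun X => sub_eq_zero.1 (D.eq_zero_of_g fun Y => ?_)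
  rw [map_sub, LinearMap.sub_apply, h, sub_self]

lemma I12 : D.I 1 * D.I 2 = D.I 0 := by
  have := D.I_mul'
  rw [← D.I_mul, ← mul_assoc, this, neg_mul, ← D.I_mul, mul_assoc, D.I_sq]; simp

lemma I21 : D.I 2 * D.I 1 = -D.I 0 := by
  rw [← D.I_mul, mul_assoc, D.I_sq]; simp

lemma I20 : D.I 2 * D.I 0 = D.I 1 := by
  have : D.I 2 = -(D.I 1 * D.I 0) := by rw [D.I_mul', neg_neg]
  rw [this, neg_mul, mul_assoc, D.I_sq]; simp

lemma I02 : D.I 0 * D.I 2 = -D.I 1 := by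
  rw [← D.I_mul, ← mul_assoc, D.I_sq]; simp

lemma I_I (s : Fin 3) (X : V) : D.I s (D.I s X) = -X := by
  have := congrArg (fun A : Module.End ℝ V => A X) (D.I_sq s)
  simpa using this

lemma g_I (s : Fin 3) (X Y : V) : D.g (D.I s X) Y = -D.g X (D.I s Y) := by
  rw [← D.herm s (D.I s X), D.I_I]; simp

/-- The trace of an endomorphism. -/
def tr : Module.End ℝ V →ₗ[ℝ] ℝ where
  toFun A := ∑ a, D.g (A (D.e a)) (D.e a)
  map_add' A B := by simp [Finset.sum_add_distrib]
  map_smul' c A := by simp [Finset.mul_sum]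

lemma tr_apply (A : Module.End ℝ V) : D.tr A = ∑ a, D.g (A (D.e a)) (D.e a) := rfl

lemma tr_one : D.tr 1 = 4 * n := by
  simp [tr_apply, D.orth]

lemma tr_mul_comm (A B : Module.End ℝ V) : D.tr (A * B) = D.tr (B * A) := by
  have h (A B : Module.End ℝ V) : D.tr (A * B)
      = ∑ a, ∑ b, D.g (B (D.e a)) (D.e b) * D.g (A (D.e b)) (D.e a) := by
    rw [tr_apply]
    refine Finset.sum_congr rfl fun a _ => ?_
    conv_lhs => rw [Module.End.mul_apply, D.expand (B (D.e a))]
    simp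
  rw [h, h, Finset.sum_comm]
  exact Finset.sum_congr rfl fun a _ => Finset.sum_congr rfl fun b _ => mul_comm _ _

/-- The adjoint endomorphism. -/
def adj (A : Module.End ℝ V) : Module.End ℝ V where
  toFun Y := ∑ a, D.g (A (D.e a)) Y • D.e a
  map_add' X Y := by simp [add_smul, Finset.sum_add_distrib]
  map_smul' c Y := by simp [Finset.smul_sum, mul_smul]

lemma g_adj (A : Module.End ℝ V) (X Y : V) : D.g (D.adj A X) Y = D.g X (A Y) := by
  simp only [adj, LinearMap.coe_mk, AddHom.coe_mk, map_sum, LinearMap.sum_apply, map_smul,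
    LinearMap.smul_apply, smul_eq_mul]
  have := D.sum_apply ((D.g X).comp A) Y
  rw [LinearMap.comp_apply] at this
  rw [← this]
  exact Finset.sum_congr rfl fun a _ => by
    rw [LinearMap.comp_apply, D.symm (A (D.e a)), mul_comm]

lemma g_adj' (A : Module.End ℝ V) (X Y : V) : D.g X (D.adj A Y) = D.g (A X) Y := by
  rw [D.symm, g_adj, D.symm]

lemma adj_eq_of {A B : Module.End ℝ V} (h : ∀ X Y, D.g (B X) Y = D.g X (A Y)) : D.adj A = B :=
  D.op_ext fun X Y => by rw [g_adj, h]

lemma adj_adj (A : Module.End ℝ V) : D.adj (D.adj A) = A :=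
  D.adj_eq_of fun X Y => by rw [g_adj']

lemma adj_mul (A B : Module.End ℝ V) : D.adj (A * B) = D.adj B * D.adj A :=
  D.adj_eq_of fun X Y => by rw [Module.End.mul_apply, g_adj, g_adj, Module.End.mul_apply]

lemma adj_I (s : Fin 3) : D.adj (D.I s) = -D.I s :=
  D.adj_eq_of fun X Y => by rw [LinearMap.neg_apply, map_neg, LinearMap.neg_apply, g_I, neg_neg]

lemma adj_add (A B : Module.End ℝ V) : D.adj (A + B) = D.adj A + D.adj B :=
  D.adj_eq_of fun X Y => by simp [g_adj]

lemma adj_sub (A B : Module.End ℝ V) : D.adj (A - B) = D.adj A - D.adj B :=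
  D.adj_eq_of fun X Y => by simp [g_adj]

lemma adj_neg (A : Module.End ℝ V) : D.adj (-A) = -D.adj A :=
  D.adj_eq_of fun X Y => by simp [g_adj]

lemma adj_smul (c : ℝ) (A : Module.End ℝ V) : D.adj (c • A) = c • D.adj A :=
  D.adj_eq_of fun X Y => by simp [g_adj]

lemma tr_adj (A : Module.End ℝ V) : D.tr (D.adj A) = D.tr A := by
  rw [tr_apply, tr_apply]
  exact Finset.sum_congr rfl fun a _ => by rw [g_adj, D.symm]

lemma g_e_sum (X Y : V) : D.g X Y = ∑ a, D.g X (D.e a) * D.g Y (D.e a) := by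
  conv_lhs => rw [D.expand Y]
  simp only [map_sum, map_smul, smul_eq_mul]
  exact Finset.sum_congr rfl fun a _ => mul_comm _ _

lemma g_self_nonneg (X : V) : 0 ≤ D.g X X := by
  rw [g_e_sum]
  exact Finset.sum_nonneg fun a _ => mul_self_nonneg _

lemma eq_zero_of_g_self {X : V} (h : D.g X X = 0) : X = 0 := by
  rw [D.g_e_sum] at h
  have h2 := (Finset.sum_eq_zero_iff_of_nonneg fun a _ => mul_self_nonneg (D.g X (D.e a))).1 h
  rw [D.expand X]
  exact Finset.sum_eq_zero fun a ha => by rw [mul_self_eq_zero.1 (h2 a ha), zero_smul]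

lemma eq_zero_of_tr {A : Module.End ℝ V} (h : D.tr (D.adj A * A) = 0) : A = 0 := by
  rw [tr_apply] at h
  simp only [Module.End.mul_apply, g_adj] at h
  have h2 := (Finset.sum_eq_zero_iff_of_nonneg fun a _ => D.g_self_nonneg (A (D.e a))).1 h
  refine LinearMap.ext fun X => ?_
  rw [D.expand X, map_sum]
  simpa using Finset.sum_eq_zero fun a ha => by
    rw [D.eq_zero_of_g_self (h2 a ha), smul_zero]

/-- The structure constants of the imaginary quaternions. -/
def eps : Fin 3 → Fin 3 → Fin 3 → ℝ :=
  ![![![0, 0, 0], ![0, 0, 1], ![0, -1, 0]], ![![0, 0, -1], ![0, 0, 0], ![1, 0, 0]],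
    ![![0, 1, 0], ![-1, 0, 0], ![0, 0, 0]]]

lemma I_mul_I (s t : Fin 3) :
    D.I s * D.I t = (if s = t then (-1 : ℝ) else 0) • 1 + ∑ k, eps s t k • D.I k := by
  fin_cases s <;> fin_cases t <;>
    simp [eps, Fin.sum_univ_three, D.I_sq, D.I_mul, D.I_mul', D.I12, D.I21, D.I20, D.I02]

lemma tr_I (s : Fin 3) : D.tr (D.I s) = 0 := by
  have := D.tr_adj (D.I s)
  rw [D.adj_I, map_neg] at this
  linarith

lemma tr_I_mul_I (s t : Fin 3) : D.tr (D.I s * D.I t) = if s = t then -(4 * n : ℝ) else 0 := by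
  rw [I_mul_I, map_add, map_sum, map_smul, D.tr_one]
  simp [D.tr_I]

end Quat
-- Reduction rules for words in the complex structures
section Ring
variable {A : Type*} [Ring A] [Algebra ℝ A] {i j k x y b c : A}

lemma eq_zero_of_two_smul (h : (2 : ℝ) • x = 0) : x = 0 :=
  (smul_eq_zero.1 h).resolve_left (by norm_num)

/-- The two expressions xi + ix and bi - ib are eigenvectors of conjugation y ↦ iyi, with
eigenvalues -1 and 1. The hypothesis says that their difference vanishes, hence each of them
vanishes. -/
lemma commute_split (hi : i * i = -1) (h : (x - b) * i + i * (x + b) = 0) :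
    x * i + i * x = 0 ∧ b * i = i * b := by
  have h1 : i * ((x - b) * i + i * (x + b)) * i = 0 := by rw [h]; simp
  have hx (y : A) : i * (i * y) = -y := by rw [← mul_assoc, hi]; simp
  simp only [mul_add, add_mul, mul_sub, sub_mul, mul_assoc, hi, hx, mul_neg, mul_one, neg_mul] at h h1
  constructor
  · have : (2 : ℝ) • (x * i + i * x) = 0 := by
      linear_combination (norm := module) h - h1
    exact eq_zero_of_two_smul this
  · have : (2 : ℝ) • (b * i - i * b) = 0 := by
      linear_combination (norm := module) - h - h1
    exact sub_eq_zero.1 (eq_zero_of_two_smul this)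

end Ring

namespace Quat

variable {n : ℕ} {V : Type*} [AddCommGroup V] [Module ℝ V] (D : Quat n V)

/-- This and the following rules are the multiplication table with a trailing factor, so that
simplification reduces right-associated words. -/
lemma I_sq_mul (s : Fin 3) (x : Module.End ℝ V) : D.I s * (D.I s * x) = -x := by
  rw [← mul_assoc, D.I_sq, neg_mul, one_mul]
lemma I01_mul (x : Module.End ℝ V) : D.I 0 * (D.I 1 * x) = D.I 2 * x := by
  rw [← mul_assoc, D.I_mul]
lemma I10_mul (x : Module.End ℝ V) : D.I 1 * (D.I 0 * x) = -(D.I 2 * x) := by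
  rw [← mul_assoc, D.I_mul', neg_mul]
lemma I12_mul (x : Module.End ℝ V) : D.I 1 * (D.I 2 * x) = D.I 0 * x := by
  rw [← mul_assoc, D.I12]
lemma I21_mul (x : Module.End ℝ V) : D.I 2 * (D.I 1 * x) = -(D.I 0 * x) := by
  rw [← mul_assoc, D.I21, neg_mul]
lemma I20_mul (x : Module.End ℝ V) : D.I 2 * (D.I 0 * x) = D.I 1 * x := by
  rw [← mul_assoc, D.I20]
lemma I02_mul (x : Module.End ℝ V) : D.I 0 * (D.I 2 * x) = -(D.I 1 * x) := by
  rw [← mul_assoc, D.I02, neg_mul]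

/-- Cyclic permutation of the complex structures. -/
def rot : Quat n V where
  g := D.g
  e := D.e
  I s := D.I (s + 1)
  symm := D.symm
  orth := D.orth
  expand := D.expand
  I_sq s := D.I_sq _
  I_mul := D.I12
  I_mul' := D.I21
  herm s := D.herm _

end Quat

/-! ### Pointwise algebra of the torsion -/

/-- The algebraic properties of the torsion and of the horizontal curvature of the Biquard
connection at a point. -/
structure QCurv {n : ℕ} {V : Type*} [AddCommGroup V] [Module ℝ V] (D : Quat n V) where
  Tn : Fin 3 → Module.End ℝ V
  c : Fin 3 → Fin 3 → Fin 3 → ℝ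
  R : V →ₗ[ℝ] V →ₗ[ℝ] Module.End ℝ V
  ρ : Fin 3 → Fin 3 → V → V → ℝ
  c_anti : ∀ r s t, c r s t = -c s r t
  perp_sp : ∀ s (A : Module.End ℝ V), (∀ t, A * D.I t = D.I t * A) →
    (∀ X Y, D.g (A X) Y = -D.g X (A Y)) → ∑ a, D.g (Tn s (D.e a)) (A (D.e a)) = 0
  perp_I : ∀ s t, ∑ a, D.g (Tn s (D.e a)) (D.I t (D.e a)) = 0
  R_skew : ∀ X Y Z W, D.g (R X Y Z) W = -D.g Z (R X Y W)
  R_anti : ∀ X Y, R X Y = -R Y X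
  R_I : ∀ s X Y, R X Y * D.I s - D.I s * R X Y = ∑ t, ρ s t X Y • D.I t
  bianchi : ∀ X Y Z W, D.g (R X Y Z) W + D.g (R Y Z X) W + D.g (R Z X Y) W
    = 2 * ∑ s, (D.g (D.I s X) Y * D.g (Tn s Z) W + D.g (D.I s Y) Z * D.g (Tn s X) W
        + D.g (D.I s Z) X * D.g (Tn s Y) W)
  vert : ∀ s t X Y, ρ s t X Y = 2 * D.g (D.I t X) (Tn s Y) + 2 * D.g (D.I t (Tn s X)) Y
    + 2 * ∑ r, c r s t * D.g (D.I r X) Y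

namespace QCurv

variable {n : ℕ} {V : Type*} [AddCommGroup V] [Module ℝ V] {D : Quat n V} (C : QCurv D)

lemma sum_rot {E : Type*} [AddCommMonoid E] (f : Fin 3 → E) : ∑ s, f (s + 1) = ∑ s, f s := by
  simp only [Fin.sum_univ_three]
  have h0 : (0 : Fin 3) + 1 = 1 := rfl
  have h1 : (1 : Fin 3) + 1 = 2 := rfl
  have h2 : (2 : Fin 3) + 1 = 0 := rfl
  rw [h0, h1, h2]
  abel

/-- Cyclic permutation of the vertical indices. -/
def rot : QCurv D.rot where
  Tn s := C.Tn (s + 1)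
  c r s t := C.c (r + 1) (s + 1) (t + 1)
  R := C.R
  ρ s t := C.ρ (s + 1) (t + 1)
  c_anti _ _ _ := C.c_anti _ _ _
  perp_sp s A hA hA' := C.perp_sp _ A (fun t => by
    have := hA (t - 1)
    change A * D.I (t - 1 + 1) = D.I (t - 1 + 1) * A at this
    rwa [sub_add_cancel] at this) hA'
  perp_I _ _ := C.perp_I _ _
  R_skew := C.R_skew
  R_anti := C.R_anti
  R_I s X Y := (C.R_I (s + 1) X Y).trans (sum_rot fun t => C.ρ (s + 1) t X Y • D.I t).symm
  bianchi X Y Z W := (C.bianchi X Y Z W).trans (congrArg (2 * ·) (sum_rot _).symm)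
  vert s t X Y := (C.vert (s + 1) (t + 1) X Y).trans (congrArg (_ + 2 * ·)
    (sum_rot fun r => C.c r (s + 1) (t + 1) * D.g (D.I r X) Y).symm)

/-- The commutator [R(X, Y), I_s] is paired with I_t in the trace form, for which the I_s are
orthogonal. The left side is skew in s, t and in X, Y, so both skew-symmetries pass to ρ. -/
lemma tr_R_I_I (s t : Fin 3) (X Y : V) :
    D.tr (C.R X Y * (D.I s * D.I t)) - D.tr (C.R X Y * (D.I t * D.I s))
      = -(4 * n) * C.ρ s t X Y := by
  have h1 := congrArg (fun A => D.tr (A * D.I t)) (C.R_I s X Y)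
  simp only [sub_mul, Finset.sum_mul, smul_mul_assoc, map_sub, map_sum, map_smul, D.tr_I_mul_I,
    smul_eq_mul, mul_ite, mul_zero, Finset.sum_ite_eq', Finset.mem_univ, if_true] at h1
  have h2 : D.tr (D.I s * C.R X Y * D.I t) = D.tr (C.R X Y * (D.I t * D.I s)) := by
    rw [mul_assoc, D.tr_mul_comm, mul_assoc]
  rw [mul_assoc, h2] at h1
  linarith

lemma rho_anti (hn : 1 ≤ n) (s t : Fin 3) (X Y : V) : C.ρ s t X Y = -C.ρ t s X Y := by
  have h1 := C.tr_R_I_I s t X Y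
  have h2 := C.tr_R_I_I t s X Y
  have h3 : (4 * n : ℝ) ≠ 0 := by positivity
  have : (4 * n : ℝ) * (C.ρ s t X Y + C.ρ t s X Y) = 0 := by linarith
  linarith [(mul_eq_zero.1 this).resolve_left h3]

/-- The endomorphism which represents `ρ s t`. -/
def P (s t : Fin 3) : Module.End ℝ V :=
  (2 : ℝ) • (D.adj (C.Tn s) * D.I t + D.I t * C.Tn s + ∑ r, C.c r s t • D.I r)

lemma rho_eq (s t : Fin 3) (X Y : V) : C.ρ s t X Y = D.g (C.P s t X) Y := by
  rw [C.vert, P]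
  simp only [LinearMap.smul_apply, LinearMap.add_apply, map_smul, map_add, smul_eq_mul,
    Module.End.mul_apply, D.g_adj, LinearMap.sum_apply, map_sum]
  ring

lemma P_anti (hn : 1 ≤ n) (s t : Fin 3) : C.P s t = -C.P t s :=
  D.op_ext fun X Y => by
    rw [LinearMap.neg_apply, map_neg, LinearMap.neg_apply, ← rho_eq, ← rho_eq, C.rho_anti hn]

lemma rho_swap (hn : 1 ≤ n) (s t : Fin 3) (X Y : V) : C.ρ s t X Y = -C.ρ s t Y X := by
  have h1 := C.tr_R_I_I s t X Y
  have h2 := C.tr_R_I_I s t Y X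
  rw [C.R_anti, neg_mul, neg_mul, map_neg, map_neg] at h1
  have h3 : (4 * n : ℝ) ≠ 0 := by positivity
  have : (4 * n : ℝ) * (C.ρ s t X Y + C.ρ s t Y X) = 0 := by linarith
  linarith [(mul_eq_zero.1 this).resolve_left h3]

lemma g_P (hn : 1 ≤ n) (s t : Fin 3) (X Y : V) : D.g (C.P s t X) Y = -D.g X (C.P s t Y) := by
  rw [D.symm X, ← rho_eq, ← rho_eq, C.rho_swap hn]

lemma tr_Tn_I (s t : Fin 3) : D.tr (C.Tn s * D.I t) = 0 := by
  rw [D.tr_mul_comm, D.tr_apply, ← neg_eq_zero, ← Finset.sum_neg_distrib, ← C.perp_I s t]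
  exact Finset.sum_congr rfl fun a _ => by rw [Module.End.mul_apply, D.g_I, neg_neg]

/-- Pairing with I_r isolates the coefficient c r s t, up to traces of T_s against products of two
complex structures, which are shown below to vanish. -/
lemma tr_P_I (s t r : Fin 3) :
    D.tr (C.P s t * D.I r) = 4 * D.tr (C.Tn s * (D.I r * D.I t)) - 8 * n * C.c r s t := by
  have h1 : D.tr (D.adj (C.Tn s) * D.I t * D.I r) = D.tr (C.Tn s * (D.I r * D.I t)) := by
    rw [← D.tr_adj, D.adj_mul, D.adj_mul, D.adj_adj, D.adj_I, D.adj_I, D.tr_mul_comm (C.Tn s)]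
    simp [mul_assoc]
  have h2 : D.tr (D.I t * C.Tn s * D.I r) = D.tr (C.Tn s * (D.I r * D.I t)) := by
    rw [mul_assoc, D.tr_mul_comm, mul_assoc]
  simp only [P, smul_mul_assoc, add_mul, map_smul, map_add, Finset.sum_mul, map_sum, h1, h2,
    D.tr_I_mul_I, smul_eq_mul, mul_ite, mul_zero, Finset.sum_ite_eq', Finset.mem_univ, if_true]
  ring

/-- Skew-symmetry gives P_ss = 0 and c_sss = 0, so the trace of P_ss I_s reduces to -4 tr T_s.
Orthogonality to sp(1) alone would only give tr(T_s I_t) = 0. -/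
lemma tr_Tn (hn : 1 ≤ n) (s : Fin 3) : D.tr (C.Tn s) = 0 := by
  have h := C.tr_P_I s s s
  have h1 := C.P_anti hn s s
  have h2 := C.c_anti s s s
  have h3 : C.P s s = 0 := by
    refine eq_zero_of_two_smul ?_
    nth_rewrite 1 [two_smul, h1]
    exact neg_add_cancel _
  have h4 : C.c s s s = 0 := by linarith
  rw [h3, h4, D.I_sq] at h
  simpa using h

lemma tr_Tn_I_I (hn : 1 ≤ n) (s r t : Fin 3) : D.tr (C.Tn s * (D.I r * D.I t)) = 0 := by
  rw [D.I_mul_I]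
  simp only [mul_add, Finset.mul_sum, mul_smul_comm, mul_one, map_add, map_sum, map_smul,
    C.tr_Tn_I, C.tr_Tn hn, smul_zero, Finset.sum_const_zero, add_zero]

/-- The traces of P_st I_r and P_ts I_r are opposite, and the torsion contributes nothing to them.
With the skew-symmetry in the first two indices this makes c totally skew. -/
lemma c_anti' (hn : 1 ≤ n) (r s t : Fin 3) : C.c r s t = -C.c r t s := by
  have h := C.tr_P_I s t r
  have h1 := C.tr_P_I t s r
  rw [C.P_anti hn, neg_mul, map_neg] at h
  rw [C.tr_Tn_I_I hn] at h h1
  have h3 : (8 * n : ℝ) ≠ 0 := by positivity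
  have : (8 * n : ℝ) * (C.c r s t + C.c r t s) = 0 := by linarith
  linarith [(mul_eq_zero.1 this).resolve_left h3]

/-- The normalized trace of the vertical torsion. -/
def lam : ℝ := -C.c 0 1 2

/-- The symmetric part of the torsion. -/
def Sy (s : Fin 3) : Module.End ℝ V := (1 / 2 : ℝ) • (C.Tn s + D.adj (C.Tn s))

/-- The skew-symmetric part of the torsion. -/
def Sk (s : Fin 3) : Module.End ℝ V := (1 / 2 : ℝ) • (C.Tn s - D.adj (C.Tn s))

lemma Tn_eq (s : Fin 3) : C.Tn s = C.Sy s + C.Sk s := by rw [Sy, Sk]; module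

lemma adj_Tn_eq (s : Fin 3) : D.adj (C.Tn s) = C.Sy s - C.Sk s := by rw [Sy, Sk]; module

lemma adj_Sy (s : Fin 3) : D.adj (C.Sy s) = C.Sy s := by
  rw [Sy, D.adj_smul, D.adj_add, D.adj_adj, add_comm]

lemma adj_Sk (s : Fin 3) : D.adj (C.Sk s) = -C.Sk s := by
  rw [Sk, D.adj_smul, D.adj_sub, D.adj_adj, ← smul_neg, neg_sub]

/-- This is P_st + P_ts = 0, in which the terms with c cancel; the torsion is written through its
symmetric and skew parts. -/
lemma mixed (hn : 1 ≤ n) (s t : Fin 3) : (C.Sy s - C.Sk s) * D.I t + D.I t * (C.Sy s + C.Sk s)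
    + ((C.Sy t - C.Sk t) * D.I s + D.I s * (C.Sy t + C.Sk t)) = 0 := by
  have h := C.P_anti hn s t
  have h2 : ∑ r, C.c r s t • D.I r = -∑ r, C.c r t s • D.I r := by
    rw [← Finset.sum_neg_distrib]
    exact Finset.sum_congr rfl fun r _ => by rw [C.c_anti' hn, neg_smul]
  rw [P, P, h2] at h
  simp only [← Tn_eq, ← adj_Tn_eq]
  refine eq_zero_of_two_smul ?_
  linear_combination (norm := module) h

lemma self_rel (hn : 1 ≤ n) (s : Fin 3) : C.Sy s * D.I s + D.I s * C.Sy s = 0 ∧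
    C.Sk s * D.I s = D.I s * C.Sk s := by
  refine commute_split (D.I_sq s) (eq_zero_of_two_smul ?_)
  rw [← C.mixed hn s s]; module

lemma Sy_I (hn : 1 ≤ n) (s : Fin 3) : C.Sy s * D.I s = -(D.I s * C.Sy s) :=
  eq_neg_of_add_eq_zero_left (C.self_rel hn s).1

lemma Sk_I (hn : 1 ≤ n) (s : Fin 3) : C.Sk s * D.I s = D.I s * C.Sk s := (C.self_rel hn s).2

/-- Orthogonality to sp(n). The endomorphism w below is four times the part of b that commutes with
Q, and it is skew, so it lies in sp(n) and is orthogonal to T_s. It is orthogonal to the symmetric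
part for parity reasons, hence to b. Each term I_t b I_t pairs with w to a multiple of tr(wb), so
tr(ww) = 0, and positivity gives w = 0. -/
lemma Sk_proj (s : Fin 3) : C.Sk s = ∑ t, D.I t * C.Sk s * D.I t := by
  set b := C.Sk s with hb
  set w := b - ∑ t, D.I t * b * D.I t with hw
  have hadj : D.adj w = -w := by
    rw [hw]
    simp only [Fin.sum_univ_three, D.adj_sub, D.adj_add, D.adj_mul, D.adj_I, hb, C.adj_Sk]
    noncomm_ring
  have hcomm (t : Fin 3) : w * D.I t = D.I t * w := by
    rw [hw]
    fin_cases t <;>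
    · simp only [Fin.sum_univ_three, Fin.zero_eta, Fin.mk_one, Fin.reduceFinMk, sub_mul, add_mul,
        mul_sub, mul_add, mul_assoc, D.I_sq, D.I_mul, D.I_mul', D.I12, D.I21, D.I20, D.I02,
        D.I_sq_mul, D.I01_mul, D.I10_mul, D.I12_mul, D.I21_mul, D.I20_mul, D.I02_mul, mul_neg,
        mul_one]
      abel
  have h1 : D.tr (w * C.Tn s) = 0 := by
    have := C.perp_sp s w hcomm fun X Y => by
      rw [← D.g_adj', hadj]; simp
    rw [← neg_eq_zero, ← map_neg, ← neg_mul, ← hadj, D.tr_apply]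
    simpa [D.g_adj] using this
  have h2 : D.tr (w * C.Sy s) = 0 := by
    have := D.tr_adj (w * C.Sy s)
    rw [D.adj_mul, hadj, C.adj_Sy, mul_neg, map_neg, D.tr_mul_comm] at this
    linarith
  have h3 : D.tr (w * b) = 0 := by
    rw [C.Tn_eq, mul_add, map_add, h2, zero_add] at h1
    exact h1
  have h4 : D.tr (w * w) = 0 := by
    conv_lhs => rw [hw, mul_sub, Finset.mul_sum, ← hw]
    have (t : Fin 3) : D.tr (w * (D.I t * b * D.I t)) = 0 := by
      rw [← mul_assoc, D.tr_mul_comm, ← mul_assoc, ← mul_assoc, ← hcomm t, mul_assoc w, D.I_sq]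
      simp [h3]
    rw [map_sub, map_sum, h3]
    simp [this]
  have h5 : w = 0 := D.eq_zero_of_tr (by rw [hadj, neg_mul, map_neg, h4, neg_zero])
  exact sub_eq_zero.1 h5

/-- For b commuting with I_0 one has I_0 b I_0 = -b and I_2 b I_2 = I_1 b I_1. Then the relation
`Sk_proj` becomes b = I_1 b I_1. -/
lemma Sk0_I1 (hn : 1 ≤ n) : C.Sk 0 * D.I 1 = -(D.I 1 * C.Sk 0) := by
  have h := C.Sk_proj 0
  have hc := C.Sk_I hn 0
  have hc' (x : Module.End ℝ V) : C.Sk 0 * (D.I 0 * x) = D.I 0 * (C.Sk 0 * x) := by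
    rw [← mul_assoc, hc, mul_assoc]
  have h2 : D.I 2 * C.Sk 0 * D.I 2 = D.I 1 * C.Sk 0 * D.I 1 := by
    conv_lhs => rw [← D.I_mul]
    rw [mul_assoc (D.I 0 * D.I 1), hc', ← mul_assoc, mul_assoc (D.I 0), D.I_mul',
      ← D.I_mul, mul_neg, D.I_sq_mul, neg_neg, mul_assoc]
  rw [Fin.sum_univ_three, h2, mul_assoc (D.I 0), hc, D.I_sq_mul] at h
  have h3 : C.Sk 0 = D.I 1 * C.Sk 0 * D.I 1 := by
    refine sub_eq_zero.1 (eq_zero_of_two_smul ?_)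
    linear_combination (norm := module) h
  conv_rhs => rw [h3]
  rw [mul_assoc, D.I_sq_mul, neg_neg]

lemma Sk0_I2 (hn : 1 ≤ n) : C.Sk 0 * D.I 2 = -(D.I 2 * C.Sk 0) := by
  rw [← D.I_mul, ← mul_assoc, C.Sk_I hn, mul_assoc, C.Sk0_I1 hn, mul_neg, mul_assoc]

lemma Sk1_I0 (hn : 1 ≤ n) : C.Sk 1 * D.I 0 = -(D.I 0 * C.Sk 1) := C.rot.Sk0_I2 hn

/-- Conjugation by I_0 changes the sign of the symmetric contribution to `mixed` and fixes the skew
one, so each of them vanishes separately. -/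
lemma mixed01 (hn : 1 ≤ n) : C.Sy 0 * D.I 1 + D.I 1 * C.Sy 0 + C.Sy 1 * D.I 0 + D.I 0 * C.Sy 1 = 0
    ∧ D.I 1 * C.Sk 0 + D.I 0 * C.Sk 1 = 0 := by
  have h := C.mixed hn 0 1
  have h1 := congrArg (fun A => D.I 0 * A * D.I 0) h
  have e0 (x : Module.End ℝ V) : C.Sy 0 * (D.I 0 * x) = -(D.I 0 * (C.Sy 0 * x)) := by
    rw [← mul_assoc, C.Sy_I hn, neg_mul, mul_assoc]
  have e1 : C.Sy 0 * D.I 2 = -(D.I 0 * (C.Sy 0 * D.I 1)) := by rw [← D.I_mul, e0]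
  simp only [sub_mul, add_mul, mul_sub, mul_add, mul_assoc, D.I_sq, D.I_mul, D.I_mul', D.I12, D.I21,
        D.I20, D.I02, D.I_sq_mul, D.I01_mul, D.I10_mul, D.I12_mul, D.I21_mul, D.I20_mul, D.I02_mul,
        mul_neg, neg_mul, mul_one, mul_zero, zero_mul, C.Sk_I hn, C.Sk0_I1 hn, C.Sk0_I2 hn, C.Sk1_I0 hn, C.Sy_I hn, e0, e1]
    at h h1
  constructor
  · refine eq_zero_of_two_smul ?_
    linear_combination (norm := module) h - h1
  · refine eq_zero_of_two_smul (eq_zero_of_two_smul ?_)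
    linear_combination (norm := module) h + h1

lemma mixed_skew_all (hn : 1 ≤ n) : D.I 2 * C.Sk 1 + D.I 1 * C.Sk 2 = 0
    ∧ D.I 0 * C.Sk 2 + D.I 2 * C.Sk 0 = 0 :=
  ⟨(C.rot.mixed01 hn).2, (C.rot.rot.mixed01 hn).2⟩

lemma mixed12 (hn : 1 ≤ n) :
    C.Sy 1 * D.I 2 + D.I 2 * C.Sy 1 + C.Sy 2 * D.I 1 + D.I 1 * C.Sy 2 = 0 := (C.rot.mixed01 hn).1

lemma mixed20 (hn : 1 ≤ n) :
    C.Sy 2 * D.I 0 + D.I 0 * C.Sy 2 + C.Sy 0 * D.I 2 + D.I 2 * C.Sy 0 = 0 :=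
  (C.rot.rot.mixed01 hn).1

/-- The endomorphism `u` with `b_s = I_s u`. -/
def u : Module.End ℝ V := -(D.I 0 * C.Sk 0)

/-- The skew halves of the mixed relations say that I_1 b_0 = -I_0 b_1 and I_0 b_2 = -I_2 b_0;
multiplication by I_0 turns them into b_s = I_s u with the u obtained from b_0. -/
lemma Sk_eq (hn : 1 ≤ n) (s : Fin 3) : C.Sk s = D.I s * C.u := by
  have h1 := congrArg (D.I 0 * ·) (C.mixed01 hn).2
  have h2 := congrArg (D.I 0 * ·) (C.mixed_skew_all hn).2
  simp only [mul_add, D.I_sq_mul, D.I01_mul, D.I02_mul, mul_zero] at h1 h2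
  fin_cases s
  · simp [u, mul_neg, D.I_sq_mul]
  · simp only [Fin.mk_one, u, mul_neg, D.I10_mul]
    linear_combination (norm := module) -h1
  · simp only [Fin.reduceFinMk, u, mul_neg, D.I20_mul]
    linear_combination (norm := module) -h2

lemma u_I (hn : 1 ≤ n) (s : Fin 3) : C.u * D.I s = D.I s * C.u := by
  fin_cases s
  · simp [u, mul_assoc, C.Sk_I hn]
  · simp [u, mul_assoc, C.Sk0_I1 hn, D.I01_mul, D.I10_mul]
  · simp [u, mul_assoc, C.Sk0_I2 hn, D.I02_mul, D.I20_mul]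

lemma adj_u (hn : 1 ≤ n) : D.adj C.u = C.u := by
  simp [u, D.adj_neg, D.adj_mul, D.adj_I, C.adj_Sk, C.Sk_I hn]

lemma tr_Sy_I (hn : 1 ≤ n) (s : Fin 3) : D.tr (C.Sy s * D.I s) = 0 := by
  have := D.tr_mul_comm (C.Sy s) (D.I s)
  rw [C.Sy_I hn, map_neg] at this
  rw [C.Sy_I hn, map_neg]
  linarith

lemma tr_u (hn : 1 ≤ n) : D.tr C.u = 0 := by
  have h := C.tr_Tn_I 0 0
  rw [C.Tn_eq, add_mul, map_add, C.tr_Sy_I hn, C.Sk_I hn, zero_add] at h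
  rw [u, map_neg, h, neg_zero]

/-- A totally skew array on three indices is a multiple of the structure constants, so the vertical
torsion has a single scalar, identified later with S. -/
lemma c_eq (hn : 1 ≤ n) (r s t : Fin 3) : C.c r s t = -C.lam * Quat.eps r s t := by
  have a := C.c_anti
  have b := C.c_anti' hn
  have z (s t) : C.c s s t = 0 := by linarith [a s s t]
  have z' (s t) : C.c t s s = 0 := by linarith [b t s s]
  have z'' (s t) : C.c s t s = 0 := by rw [a, z', neg_zero]
  have h1 := a 1 0 2
  have h2 := b 0 2 1
  have h3 := a 2 0 1
  have h4 := b 1 2 0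
  have h5 := a 2 1 0
  fin_cases r <;> fin_cases s <;> fin_cases t <;>
    simp [Quat.eps, lam, z, z', z''] <;> linarith

/-- The rules from here to `Sy2_eq` form a normal form: every word in the symmetric parts becomes a
combination of Sy_0, Sy_0 I_1 and Sy_1 with complex structures on the left. Long identities are then
decided by `module`. -/
lemma Sy0_I2 (hn : 1 ≤ n) : C.Sy 0 * D.I 2 = -(D.I 0 * (C.Sy 0 * D.I 1)) := by
  rw [← D.I_mul, ← mul_assoc, C.Sy_I hn, neg_mul, mul_assoc]

lemma Sy1_I0 (hn : 1 ≤ n) :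
    C.Sy 1 * D.I 0 = -(D.I 0 * C.Sy 1) - C.Sy 0 * D.I 1 - D.I 1 * C.Sy 0 := by
  linear_combination (norm := module) (C.mixed01 hn).1

lemma Sy1_I2 (hn : 1 ≤ n) :
    C.Sy 1 * D.I 2 = D.I 2 * C.Sy 1 - D.I 1 * (C.Sy 0 * D.I 1) + C.Sy 0 := by
  have : C.Sy 1 * D.I 2 = D.I 1 * (C.Sy 1 * D.I 0) := by
    have h : D.I 2 = -(D.I 1 * D.I 0) := by rw [D.I_mul', neg_neg]
    rw [h, mul_neg, ← mul_assoc, C.Sy_I hn, neg_mul, neg_neg, mul_assoc]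
  rw [this, C.Sy1_I0 hn]
  simp only [mul_sub, mul_neg, D.I_sq_mul, D.I10_mul]
  module

/-- The third symmetric part is redundant: multiplying the relation between the indices 1 and 2 by
I_1 and eliminating all words with Sy_2 on the left of a complex structure leaves twice Sy_2. -/
lemma Sy2_eq (hn : 1 ≤ n) : C.Sy 2 = C.Sy 0 * D.I 1 + D.I 0 * C.Sy 1 := by
  have h1 : C.Sy 2 * D.I 1 = -(D.I 2 * (C.Sy 2 * D.I 0)) := by
    rw [← D.I20, ← mul_assoc, C.Sy_I hn, neg_mul, mul_assoc]
  have h2 : C.Sy 2 * D.I 0 = -(D.I 0 * C.Sy 2) - C.Sy 0 * D.I 2 - D.I 2 * C.Sy 0 := by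
    linear_combination (norm := module) C.mixed20 hn
  have h3 := congrArg (D.I 1 * ·) (C.mixed12 hn)
  simp only [h1, h2, C.Sy0_I2 hn, C.Sy1_I2 hn, mul_add, mul_sub, mul_neg, D.I_sq_mul, D.I20_mul,
    D.I12_mul, D.I10_mul, mul_zero] at h3
  refine sub_eq_zero.1 (eq_zero_of_two_smul ?_)
  linear_combination (norm := module) -h3

end QCurv
-- Contractions of the horizontal curvature
namespace QCurv

variable {n : ℕ} {V : Type*} [AddCommGroup V] [Module ℝ V] {D : Quat n V} (C : QCurv D)

/-- The horizontal Ricci endomorphism. -/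
def ric : Module.End ℝ V := -∑ a, (C.R (D.e a)).flip (D.e a)

lemma ric_apply (X : V) : C.ric X = -∑ a, C.R (D.e a) X (D.e a) := by simp [ric]

lemma g_ric (X Y : V) : D.g (C.ric X) Y = ∑ a, D.g (C.R (D.e a) X Y) (D.e a) := by
  rw [ric_apply]
  simp only [map_neg, map_sum, LinearMap.neg_apply, LinearMap.sum_apply, ← Finset.sum_neg_distrib]
  exact Finset.sum_congr rfl fun a _ => by rw [C.R_skew, D.symm, neg_neg]

lemma R_I_apply (s : Fin 3) (X Y Z : V) :
    C.R X Y (D.I s Z) = D.I s (C.R X Y Z) + ∑ t, C.ρ s t X Y • D.I t Z := by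
  have := congrArg (fun A : Module.End ℝ V => A Z) (C.R_I s X Y)
  simp only [LinearMap.sub_apply, Module.End.mul_apply, LinearMap.sum_apply,
    LinearMap.smul_apply] at this
  rw [← this]; abel

lemma sum_apply' (f : V →ₗ[ℝ] ℝ) (X : V) : ∑ a, D.g X (D.e a) * f (D.e a) = f X := by
  rw [← D.sum_apply f X]
  exact Finset.sum_congr rfl fun a _ => by rw [D.symm]

lemma sum_rho (s t : Fin 3) (X Y : V) :
    ∑ a, D.g Y (D.e a) * C.ρ s t (D.e a) X = D.g (C.P s t Y) X := by
  simp only [C.rho_eq]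
  exact sum_apply' ((D.g.flip X).comp (C.P s t)) Y

/-- Moving I_s across the curvature endomorphism produces the Ricci endomorphism at the price of the
sp(1)-terms ρ. -/
lemma sum_R_I (s : Fin 3) (X Y : V) : ∑ a, D.g (C.R (D.e a) X Y) (D.I s (D.e a))
    = D.g (D.I s (C.ric X)) Y + ∑ x, D.g (C.P s x (D.I x Y)) X := by
  have h (a) : D.g (C.R (D.e a) X Y) (D.I s (D.e a)) = -D.g (C.R (D.e a) X (D.I s Y)) (D.e a)
      + ∑ x, D.g (D.I x Y) (D.e a) * C.ρ s x (D.e a) X := by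
    rw [D.symm, D.g_I, D.symm, C.R_I_apply, map_add, map_sum, LinearMap.add_apply,
      LinearMap.sum_apply, neg_add, add_assoc, ← Finset.sum_neg_distrib, ← Finset.sum_add_distrib]
    simp [mul_comm]
  simp only [h, Finset.sum_add_distrib]
  rw [Finset.sum_comm, Finset.sum_neg_distrib, ← C.g_ric, D.g_I]
  simp only [sum_rho]

lemma sum_g_comp (A : Module.End ℝ V) (X Y : V) :
    ∑ a, D.g X (D.e a) * D.g Y (A (D.e a)) = D.g Y (A X) :=
  sum_apply' ((D.g Y).comp A) X

/-- The horizontal Bianchi identity is contracted in its third argument against A. The hypothesis on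
A kills the one torsion term in which T_x meets the contracted vector; it is used for A = 1 and A =
I_s. -/
lemma sum_bianchi (A : Module.End ℝ V) (hA : ∀ x, ∑ a, D.g (C.Tn x (D.e a)) (A (D.e a)) = 0)
    (X Y : V) : ∑ a, D.g (C.R X Y (D.e a)) (A (D.e a)) - ∑ a, D.g (C.R (D.e a) Y X) (A (D.e a))
      + ∑ a, D.g (C.R (D.e a) X Y) (A (D.e a))
    = 2 * ∑ x, (D.g (C.Tn x X) (A (D.I x Y)) - D.g (C.Tn x Y) (A (D.I x X))) := by
  have h := congrArg (fun f : Fin (4 * n) → ℝ => ∑ a, f a)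
    (funext fun a => C.bianchi X Y (D.e a) (A (D.e a)))
  have h1 (a) : C.R Y (D.e a) X = -C.R (D.e a) Y X := by rw [C.R_anti]; rfl
  simp only [h1, map_neg, LinearMap.neg_apply, ← Finset.mul_sum] at h
  rw [Finset.sum_add_distrib, Finset.sum_add_distrib, Finset.sum_neg_distrib] at h
  rw [sub_eq_add_neg, h, Finset.sum_comm]
  congr 1
  refine Finset.sum_congr rfl fun x _ => ?_
  rw [Finset.sum_add_distrib, Finset.sum_add_distrib, ← Finset.mul_sum, hA, mul_zero, zero_add,
    sum_g_comp]
  have : ∀ a, D.g (D.I x (D.e a)) X = -D.g (D.I x X) (D.e a) := fun a => by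
    rw [D.g_I, D.symm]
  simp only [this, neg_mul, Finset.sum_neg_distrib]
  rw [sum_g_comp, sub_eq_add_neg]

lemma g_P_I (hn : 1 ≤ n) (s x : Fin 3) (X Y : V) :
    D.g (C.P s x (D.I x Y)) X = D.g (D.I x (C.P s x X)) Y := by
  rw [C.g_P hn, D.g_I, D.symm, D.g_I, D.symm, neg_neg]

/-- For A = 1 the full contraction of R(X, Y) vanishes by skewness, and the torsion terms vanish one
by one because T_x^* I_x + I_x T_x = 0. -/
lemma ric_symm (hn : 1 ≤ n) (X Y : V) : D.g (C.ric X) Y = D.g (C.ric Y) X := by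
  have h := C.sum_bianchi 1 (fun x => C.tr_Tn hn x) X Y
  have h0 (a) : D.g (C.R X Y (D.e a)) (D.e a) = 0 := by
    have := C.R_skew X Y (D.e a) (D.e a)
    rw [D.symm (D.e a)] at this
    linarith
  have h1 (x) : D.g (C.Tn x X) (D.I x Y) - D.g (C.Tn x Y) (D.I x X) = 0 := by
    have e1 : D.g (C.Tn x X) (D.I x Y) = -D.g (D.I x (C.Tn x X)) Y := by rw [D.g_I, neg_neg]
    have e2 : D.g (C.Tn x Y) (D.I x X) = D.g (D.adj (C.Tn x) (D.I x X)) Y := by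
      rw [D.g_adj, D.symm]
    have e3 : D.adj (C.Tn x) * D.I x + D.I x * C.Tn x = 0 := by
      rw [C.adj_Tn_eq, C.Tn_eq, sub_mul, mul_add, C.Sy_I hn, C.Sk_I hn]; abel
    have e4 := congrArg (fun A : Module.End ℝ V => D.g (A X) Y) e3
    simp only [LinearMap.add_apply, Module.End.mul_apply, map_add, LinearMap.zero_apply,
      map_zero] at e4
    linarith
  simp only [Module.End.one_apply, h0, h1, Finset.sum_const_zero, mul_zero, zero_sub,
    ← C.g_ric] at h
  linarith

/-- The contraction with A = I_s. Since 2 I_s is the commutator of I_t and I_q, the trace of I_s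
R(X, Y) is a multiple of ρ_tq, which explains the coefficient 2n; the other two curvature terms give
the anticommutator of I_s with the Ricci endomorphism. -/
lemma ric_rel (hn : 1 ≤ n) {s t q : Fin 3} (h1 : D.I t * D.I q = D.I s)
    (h2 : D.I q * D.I t = -D.I s) :
    D.I s * C.ric + C.ric * D.I s + (2 * n : ℝ) • C.P t q
      + ∑ x, (D.I x * C.P s x - C.P s x * D.I x)
      + (2 : ℝ) • ∑ x, (D.adj (C.Tn x) * D.I s * D.I x - D.I x * D.I s * C.Tn x) = 0 := by
  refine D.op_ext fun X Y => ?_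
  have h := C.sum_bianchi (D.I s) (fun x => C.perp_I x s) X Y
  have h3 := C.tr_R_I_I t q X Y
  rw [h1, h2, mul_neg, map_neg, D.tr_mul_comm, C.rho_eq] at h3
  have h4 : ∑ a, D.g (C.R X Y (D.e a)) (D.I s (D.e a)) = -D.tr (D.I s * C.R X Y) := by
    rw [D.tr_apply, ← Finset.sum_neg_distrib]
    exact Finset.sum_congr rfl fun a _ => by rw [Module.End.mul_apply, D.g_I, neg_neg]
  rw [h4, C.sum_R_I, C.sum_R_I] at h
  have h5 : D.g (D.I s (C.ric Y)) X = -D.g (C.ric (D.I s X)) Y := by rw [D.g_I, C.ric_symm hn]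
  have h7 (x) : D.g (C.Tn x X) (D.I s (D.I x Y)) = D.g (D.I x (D.I s (C.Tn x X))) Y := by
    rw [D.g_I, D.g_I, neg_neg]
  have h8 (x) : D.g (C.Tn x Y) (D.I s (D.I x X)) = D.g (D.adj (C.Tn x) (D.I s (D.I x X))) Y := by
    rw [D.g_adj, D.symm]
  simp only [h5, C.g_P_I hn s _ X Y, h7, h8] at h
  simp only [LinearMap.add_apply, Module.End.mul_apply, map_add, LinearMap.zero_apply, map_zero,
    LinearMap.smul_apply, LinearMap.sum_apply, LinearMap.sub_apply, map_sum, map_sub, map_smul,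
    smul_eq_mul, Finset.sum_sub_distrib] at h ⊢
  linarith

lemma sum_I_left (β : V →ₗ[ℝ] V →ₗ[ℝ] ℝ) (s : Fin 3) :
    ∑ a, β (D.I s (D.e a)) (D.e a) = -∑ a, β (D.e a) (D.I s (D.e a)) := by
  have h1 (a) : β (D.I s (D.e a)) (D.e a) = ∑ b, D.g (D.I s (D.e a)) (D.e b) * β (D.e b) (D.e a) := by
    conv_lhs => rw [D.expand (D.I s (D.e a))]
    simp
  have h2 (b) : β (D.e b) (D.I s (D.e b)) = ∑ a, D.g (D.I s (D.e b)) (D.e a) * β (D.e b) (D.e a) := by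
    conv_lhs => rw [D.expand (D.I s (D.e b))]
    simp
  simp only [h1, h2]
  rw [Finset.sum_comm, ← Finset.sum_neg_distrib]
  refine Finset.sum_congr rfl fun b _ => ?_
  rw [← Finset.sum_neg_distrib]
  refine Finset.sum_congr rfl fun a _ => ?_
  rw [D.g_I, D.symm, neg_mul]

/-- In the Bianchi identity on e_a, I_s e_a and Z the second and third curvature terms have the same
sum, because I_s can be moved across a contraction with a change of sign. That sum is again a Ricci
contraction corrected by ρ. -/
lemma sum_R_e_I_e (hn : 1 ≤ n) (s : Fin 3) :
    ∑ a, C.R (D.e a) (D.I s (D.e a)) = (8 * n : ℝ) • C.Tn s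
    + (4 : ℝ) • ∑ x, C.Tn x * D.I s * D.I x
    - (2 : ℝ) • (D.I s * C.ric + ∑ x, D.I x * C.P s x) := by
  refine D.op_ext fun Z W => ?_
  have h := congrArg (fun f : Fin (4 * n) → ℝ => ∑ a, f a)
    (funext fun a => C.bianchi (D.e a) (D.I s (D.e a)) Z W)
  simp only [Finset.sum_add_distrib, ← Finset.mul_sum] at h
  have h1 : ∑ a, D.g (C.R (D.I s (D.e a)) Z (D.e a)) W
      = -∑ a, D.g (C.R (D.e a) Z (D.I s (D.e a))) W :=
    sum_I_left (LinearMap.mk₂ ℝ (fun x y => D.g (C.R x Z y) W) (by simp) (by simp) (by simp)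
      (by simp)) s
  have h2 (a) : D.g (C.R Z (D.e a) (D.I s (D.e a))) W
      = -D.g (C.R (D.e a) Z (D.I s (D.e a))) W := by rw [C.R_anti]; simp
  have h3 : ∑ a, D.g (C.R (D.e a) Z (D.I s (D.e a))) W
      = -D.g (D.I s (C.ric Z)) W - ∑ x, D.g (D.I x (C.P s x Z)) W := by
    have e1 (a) : D.g (C.R (D.e a) Z (D.I s (D.e a))) W = D.g (D.I s (C.R (D.e a) Z (D.e a))) W
        - ∑ x, D.g (D.I x W) (D.e a) * C.ρ s x (D.e a) Z := by
      rw [C.R_I_apply, map_add, map_sum, LinearMap.add_apply, LinearMap.sum_apply, sub_eq_add_neg,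
        ← Finset.sum_neg_distrib]
      congr 1
      refine Finset.sum_congr rfl fun x _ => ?_
      rw [map_smul, LinearMap.smul_apply, D.g_I, D.symm, smul_eq_mul]
      ring
    simp only [e1, Finset.sum_sub_distrib]
    rw [Finset.sum_comm]
    simp only [sum_rho, C.g_P_I hn, ric_apply, map_neg, map_sum, LinearMap.neg_apply, neg_neg,
      LinearMap.sum_apply]
  have h4 (x) : ∑ a, D.g (D.I x (D.e a)) (D.I s (D.e a)) = if s = x then (4 * n : ℝ) else 0 := by
    have : ∑ a, D.g (D.I x (D.e a)) (D.I s (D.e a)) = -D.tr (D.I s * D.I x) := by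
      rw [D.tr_apply, ← Finset.sum_neg_distrib]
      exact Finset.sum_congr rfl fun a _ => by rw [Module.End.mul_apply, D.g_I s, neg_neg]
    rw [this, D.tr_I_mul_I]
    split_ifs <;> simp
  have h5 (x) : ∑ a, D.g (D.I x (D.I s (D.e a))) Z * D.g (C.Tn x (D.e a)) W
      = D.g (C.Tn x (D.I s (D.I x Z))) W := by
    refine Eq.trans ?_ (sum_apply' (D := D) ((D.g.flip W).comp (C.Tn x)) (D.I s (D.I x Z)))
    exact Finset.sum_congr rfl fun a _ => by rw [D.g_I, D.g_I, neg_neg, D.symm]; rfl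
  have h6 (x) : ∑ a, D.g (D.I x Z) (D.e a) * D.g (C.Tn x (D.I s (D.e a))) W
      = D.g (C.Tn x (D.I s (D.I x Z))) W :=
    sum_apply' ((D.g.flip W).comp (C.Tn x * D.I s)) (D.I x Z)
  rw [h1] at h
  simp only [h2, Finset.sum_neg_distrib, h3] at h
  rw [Finset.sum_comm, Finset.sum_comm (f := fun a x => D.g (D.I x (D.I s (D.e a))) Z * _),
    Finset.sum_comm (f := fun a x => D.g (D.I x Z) (D.e a) * _)] at h
  simp only [← Finset.sum_mul, h4, h5, h6, ite_mul, zero_mul,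
    Finset.sum_ite_eq, Finset.mem_univ, if_true] at h
  simp only [LinearMap.add_apply, Module.End.mul_apply, map_add,
    LinearMap.smul_apply, LinearMap.sum_apply, LinearMap.sub_apply, map_sum, map_sub, map_smul,
    smul_eq_mul]
  linarith

/-- The trace of the torsion against the complex structures. -/
def Th : Module.End ℝ V := ∑ s, C.Sy s * D.I s

lemma sum_eps (hn : 1 ≤ n) (s t : Fin 3) : C.P s t = (2 : ℝ) • (D.adj (C.Tn s) * D.I t
    + D.I t * C.Tn s - C.lam • ∑ r, Quat.eps r s t • D.I r) := by
  simp only [P, C.c_eq hn, mul_smul, neg_smul, ← Finset.smul_sum, Finset.sum_neg_distrib,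
    sub_eq_add_neg]

lemma ric_eq (hn : 1 ≤ n) : C.ric = (2 * n + 2 : ℝ) • C.Th + (4 * n + 10 : ℝ) • C.u
    + ((2 * n + 4) * C.lam) • (1 : Module.End ℝ V) := by
  -- These multiplications are chosen so that the anticommutator parts become -ric + I_0 ric I_0,
  -- -I_0 ric I_0 - I_2 ric I_2 and -ric + I_2 ric I_2. They add up to -2 ric, whence the factor
  -- -1/2 at the end.
  have r0 := congrArg (D.I 0 * ·) (C.ric_rel hn D.I12 D.I21)
  have r1 := congrArg (D.I 2 * ·) (C.ric_rel hn D.I20 D.I02)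
  have r2 := congrArg (D.I 2 * ·) (C.ric_rel hn D.I_mul D.I_mul')
  replace r1 := congrArg (· * D.I 0) r1
  have u0 (s) (x : Module.End ℝ V) : C.u * (D.I s * x) = D.I s * (C.u * x) := by
    rw [← mul_assoc, C.u_I hn, mul_assoc]
  have e0 (x : Module.End ℝ V) : C.Sy 0 * (D.I 0 * x) = -(D.I 0 * (C.Sy 0 * x)) := by
    rw [← mul_assoc, C.Sy_I hn, neg_mul, mul_assoc]
  simp only [C.sum_eps hn, C.adj_Tn_eq] at r0 r1 r2
  simp only [Quat.eps, C.Tn_eq, C.adj_Tn_eq, C.Sk_eq hn, Fin.sum_univ_three,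
    Matrix.cons_val_zero, Matrix.cons_val_one, Matrix.cons_val, zero_smul, one_smul, neg_smul,
    add_zero, zero_add, smul_add, smul_sub, smul_neg, C.Sy2_eq hn,
    mul_add, mul_sub, add_mul, sub_mul, mul_assoc, mul_smul_comm, smul_mul_assoc, mul_neg, neg_mul,
    D.I_sq, D.I_mul, D.I_mul', D.I12, D.I21, D.I20, D.I02, D.I_sq_mul, D.I01_mul, D.I10_mul,
    D.I12_mul, D.I21_mul, D.I20_mul, D.I02_mul, C.u_I hn, u0, e0, C.Sy_I hn, C.Sy0_I2 hn,
    C.Sy1_I0 hn, C.Sy1_I2 hn, mul_one, mul_zero, zero_mul, neg_neg, smul_zero] at r0 r1 r2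
  simp only [Th, Fin.sum_univ_three, C.Sy_I hn, C.Sy2_eq hn, add_mul, mul_assoc, C.Sy1_I2 hn,
    D.I_mul, D.I12, mul_add, mul_sub, D.I01_mul, D.I02_mul, D.I20_mul, D.I_sq_mul, C.Sy0_I2 hn, C.Sy1_I0 hn]
  linear_combination (norm := module) (-1 / 2 : ℝ) • (r0 + r1 + r2)

lemma sum_Tn_I (hn : 1 ≤ n) : ∑ s, C.Tn s * D.I s = C.Th - (3 : ℝ) • C.u := by
  have h0 (s : Fin 3) : D.I s * C.u * D.I s = -C.u := by rw [mul_assoc, C.u_I hn, D.I_sq_mul]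
  simp only [C.Tn_eq, add_mul, C.Sk_eq hn, Finset.sum_add_distrib, h0, Th]
  simp only [Fin.sum_univ_three]
  module

/-- The combination of curvature traces which enters the divergence of `B_0`. -/
lemma ric_sub_half_sum (hn : 1 ≤ n) :
    C.ric - (1 / 2 : ℝ) • ∑ s, (∑ a, C.R (D.e a) (D.I s (D.e a))) * D.I s
      = (-4 * (n - 1) * C.lam) • (1 : Module.End ℝ V) - (2 : ℝ) • C.Th
        + (4 * n + 10 : ℝ) • C.u := by
  have u0 (s) (x : Module.End ℝ V) : C.u * (D.I s * x) = D.I s * (C.u * x) := by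
    rw [← mul_assoc, C.u_I hn, mul_assoc]
  have e0 (x : Module.End ℝ V) : C.Sy 0 * (D.I 0 * x) = -(D.I 0 * (C.Sy 0 * x)) := by
    rw [← mul_assoc, C.Sy_I hn, neg_mul, mul_assoc]
  simp only [C.sum_R_e_I_e hn, C.ric_eq hn]
  simp only [C.sum_eps hn, C.adj_Tn_eq]
  simp only [Th, Quat.eps, C.Tn_eq, C.Sk_eq hn, Fin.sum_univ_three,
    Matrix.cons_val_zero, Matrix.cons_val_one, Matrix.cons_val, zero_smul, one_smul, neg_smul,
    add_zero, zero_add, smul_add, smul_sub, smul_neg, C.Sy2_eq hn,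
    mul_add, mul_sub, add_mul, sub_mul, mul_assoc, mul_smul_comm, smul_mul_assoc, mul_neg, neg_mul,
    D.I_sq, D.I_mul, D.I_mul', D.I12, D.I21, D.I20, D.I02, D.I_sq_mul, D.I01_mul, D.I10_mul,
    D.I12_mul, D.I21_mul, D.I20_mul, D.I02_mul, C.u_I hn, u0, e0, C.Sy_I hn, C.Sy0_I2 hn,
    C.Sy1_I0 hn, C.Sy1_I2 hn, mul_one, mul_zero, zero_mul, neg_neg, smul_zero]
  module

/-- Only the scalar part has a trace, since u and all Sy_s I_s are trace-free. This identifies λ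
with the normalized scalar curvature. -/
lemma tr_ric (hn : 1 ≤ n) : D.tr C.ric = 8 * n * (n + 2) * C.lam := by
  rw [C.ric_eq hn, map_add, map_add, map_smul, map_smul, map_smul, C.tr_u hn, D.tr_one, Th, map_sum]
  simp only [C.tr_Sy_I hn, smul_eq_mul, Finset.sum_const_zero]
  ring

lemma g_Th (X Y : V) : D.g (C.Th X) Y
    = ∑ s, (D.g (C.Tn s (D.I s X)) Y + D.g (C.Tn s Y) (D.I s X)) / 2 := by
  simp only [Th, LinearMap.sum_apply, map_sum]
  refine Finset.sum_congr rfl fun s _ => ?_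
  rw [Module.End.mul_apply, Sy, LinearMap.smul_apply, map_smul, LinearMap.add_apply, map_add,
    LinearMap.smul_apply, LinearMap.add_apply, D.g_adj, D.symm (C.Tn s Y), smul_eq_mul]
  ring

/-- Every summand equals g(uX, Y), so the mean over s in the definition of U represents u. -/
lemma g_u (hn : 1 ≤ n) (X Y : V) : D.g (C.u X) Y
    = (∑ s, (D.g (C.Tn s X) (D.I s Y) - D.g (C.Tn s (D.I s Y)) X) / 2) / 3 := by
  have h (s) : (D.g (C.Tn s X) (D.I s Y) - D.g (C.Tn s (D.I s Y)) X) / 2 = D.g (C.u X) Y := by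
    have e : D.g (C.Sk s X) (D.I s Y) = D.g (C.u X) Y := by
      rw [C.Sk_eq hn, Module.End.mul_apply, D.herm]
    rw [← e, Sk, LinearMap.smul_apply, map_smul, LinearMap.sub_apply, map_sub,
      LinearMap.smul_apply, LinearMap.sub_apply, D.g_adj, D.symm X, smul_eq_mul]
    ring
  simp only [h, Fin.sum_univ_three]
  ring

end QCurv

/-! ### Smooth dependence of solutions of linear systems -/

section LinearSystems

variable {m : ℕ} {M : Type*} [TopologicalSpace M] [ChartedSpace (EuclideanSpace ℝ (Fin m)) M]
  [IsManifold (𝓡 m) ∞ M] {p : M} {ι : Type*} [Fintype ι] [DecidableEq ι]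

lemma SmF.det {A : M → Matrix ι ι ℝ} (hA : ∀ i j, SmF m (fun q => A q i j) p) :
    SmF m (fun q => (A q).det) p := by
  simp only [Matrix.det_apply']
  exact SmF.sum fun σ _ => (SmF.const _).mul (SmF.prod fun i _ => hA _ _)

lemma SmF.eventually_ne {h : M → ℝ} (hh : SmF m h p) (h0 : h p ≠ 0) : ∀ᶠ q in 𝓝 p, h q ≠ 0 :=
  hh.contMDiffAt.continuousAt.eventually_ne h0

lemma SmF.inv_matrix {A : M → Matrix ι ι ℝ} (hA : ∀ i j, SmF m (fun q => A q i j) p)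
    (h0 : (A p).det ≠ 0) (i j : ι) : SmF m (fun q => (A q)⁻¹ i j) p := by
  have h1 : SmF m (fun q => (A q).det⁻¹ * (A q).adjugate i j) p := by
    refine ((SmF.det hA).inv h0).mul ?_
    simp only [Matrix.adjugate_apply]
    refine SmF.det fun k l => ?_
    simp only [Matrix.updateRow_apply]
    split_ifs with hk
    · exact SmF.const _
    · exact hA _ _
  refine h1.congr (.of_forall fun q => ?_)
  rw [Matrix.inv_def, Matrix.smul_apply, Ring.inverse_eq_inv', smul_eq_mul]

/-- The coefficients of a smooth vector field in a smooth frame are smooth. -/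
lemma SmF.coeff {E : ι → ∀ q : M, T m q} {y : ι → M → ℝ} {Y : ∀ q : M, T m q}
    (hι : Fintype.card ι = m) (hE : ∀ i, Sm (E i) p)
    (hli : LinearIndependent ℝ fun i => E i p) (hY : Sm Y p)
    (h : ∀ᶠ q in 𝓝 p, Y q = ∑ i, y i q • E i q) (i : ι) : SmF m (y i) p := by
  let F := EuclideanSpace ℝ (Fin m)
  let t := trivializationAt F (TangentSpace (𝓡 m) : M → Type) p
  have hp : p ∈ t.baseSet := FiberBundle.mem_baseSet_trivializationAt' p
  let b : Module.Basis ι ℝ F := (EuclideanSpace.basisFun (Fin m) ℝ).toBasis.reindex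
    (Fintype.equivFinOfCardEq hι).symm
  let c := t.localFrameCoeff (𝓡 m) b
  have hc {X : ∀ q : M, T m q} (hX : Sm X p) (i) : SmF m (fun q => c i q (X q)) p := by
    filter_upwards [t.open_baseSet.mem_nhds hp, hX] with q hq hX
    exact contMDiffAt_localFrameCoeff b hq hX i
  let A (q : M) : Matrix ι ι ℝ := .of fun i j => c i q (E j q)
  have hA : ∀ i j, SmF m (fun q => A q i j) p := fun i j => hc (hE j) i
  have h0 : (A p).det ≠ 0 := by
    intro h0
    obtain ⟨v, hv, hv'⟩ := Matrix.exists_mulVec_eq_zero_iff.2 h0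
    refine hv (funext fun j => ?_)
    have : ∑ j, v j • E j p = 0 := by
      have e := t.eq_sum_localFrameCoeff_smul (I := 𝓡 m) (b := b)
        (s := fun q => ∑ j, v j • E j q) hp
      rw [e]
      refine Finset.sum_eq_zero fun i _ => ?_
      have := congrFun hv' i
      simp only [Matrix.mulVec, dotProduct, A, Matrix.of_apply, Pi.zero_apply] at this
      have e2 : t.localFrameCoeff (𝓡 m) b i p (∑ j, v j • E j p) = 0 := by
        rw [map_sum, ← this]
        exact Finset.sum_congr rfl fun j _ => by rw [map_smul, smul_eq_mul, mul_comm]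
      rw [e2, zero_smul]
    exact Fintype.linearIndependent_iff.1 hli v this j
  have hs : SmF m (fun q => ∑ j, (A q)⁻¹ i j * c j q (Y q)) p :=
    SmF.sum fun j _ => (SmF.inv_matrix hA h0 i j).mul (hc hY j)
  refine hs.congr ?_
  filter_upwards [h, (SmF.det hA).eventually_ne h0] with q hq hd
  have e : (fun j => c j q (Y q)) = (A q).mulVec fun i => y i q := by
    funext j
    rw [hq, map_sum]
    exact Finset.sum_congr rfl fun k _ => by rw [map_smul, smul_eq_mul, mul_comm]; rfl
  have e2 : (A q)⁻¹.mulVec (fun j => c j q (Y q)) = fun i => y i q := by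
    rw [e, Matrix.mulVec_mulVec, Matrix.nonsing_inv_mul _ (isUnit_iff_ne_zero.2 hd),
      Matrix.one_mulVec]
  exact (congrFun e2 i).symm

end LinearSystems

/-! ### Smooth frames adapted to the splitting TM = H ⊕ V -/

section Frames

variable {n : ℕ} {M : Type*} [TopologicalSpace M]
  [ChartedSpace (EuclideanSpace ℝ (Fin (4 * n + 3))) M] [IsManifold (𝓡 (4 * n + 3)) ∞ M]
  {S : Structure n M}

namespace Structure.Biquard

variable (B : S.Biquard) {p : M} {X Y : ∀ q : M, T (4 * n + 3) q}

lemma coe_hor (v : T (4 * n + 3) p) :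
    (B.hor p v : T (4 * n + 3) p) = v - (B.V p).projection (S.H p) (B.isCompl p).symm v := by
  rw [eq_sub_iff_add_eq]
  exact Submodule.projection_add_projection_eq_self (B.isCompl p) v

lemma sm_hor (hX : Sm X p) : Sm (fun q => (B.hor q (X q) : T (4 * n + 3) q)) p := by
  obtain ⟨s, hs, hp, h⟩ := hX.exists_smoothOn
  have h1 : Sm (fun q => (B.V q).projection (S.H q) (B.isCompl q).symm (X q)) p :=
    (B.smooth_V s hs X h).sm hs hp
  exact (hX.sub h1).congr (.of_forall fun q => B.coe_hor (X q))

@[simp] lemma hor_coe (v : S.H p) : B.hor p (v : T (4 * n + 3) p) = v :=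
  Submodule.projectionOnto_apply_left (B.isCompl p) v

lemma hor_of_mem {v : T (4 * n + 3) p} (hv : v ∈ S.H p) : (B.hor p v : T (4 * n + 3) p) = v :=
  congrArg Subtype.val (B.hor_coe ⟨v, hv⟩)

lemma hor_of_mem_V {v : T (4 * n + 3) p} (hv : v ∈ B.V p) : B.hor p v = 0 :=
  (Submodule.projectionOnto_apply_eq_zero_iff (B.isCompl p)).2 hv

end Structure.Biquard

namespace LocalFrame

variable {U : Set M} (F : S.Frame U) (B : S.Biquard) {p : M} {X Y : ∀ q : M, T (4 * n + 3) q}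

lemma smF_η (hU : IsOpen U) (hp : p ∈ U) (s : Fin 3) (hX : Sm X p) :
    SmF (4 * n + 3) (fun q => F.η s q (X q)) p := by
  obtain ⟨t, ht, hpt, h⟩ := hX.exists_smoothOn
  have h1 := F.smooth_η s (t ∩ U) (ht.inter hU) Set.inter_subset_right X
    (h.mono Set.inter_subset_left)
  filter_upwards [(ht.inter hU).mem_nhds ⟨hpt, hp⟩] with q hq
  exact h1.contMDiffAt ((ht.inter hU).mem_nhds hq)

lemma η_hor (hp : p ∈ U) (s : Fin 3) (v : S.H p) : F.η s p (v : T (4 * n + 3) p) = 0 :=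
  (F.mem_H_iff p hp v).1 v.2 s

lemma eq_of_mem_V (hp : p ∈ U) {v w : T (4 * n + 3) p} (hv : v ∈ B.V p) (hw : w ∈ B.V p)
    (h : ∀ s, F.η s p v = F.η s p w) : v = w := by
  have h1 : v - w ∈ S.H p := (F.mem_H_iff p hp _).2 fun s => by rw [map_sub, h, sub_self]
  exact sub_eq_zero.1 (Submodule.disjoint_def.1 (B.isCompl p).disjoint _ h1 (sub_mem hv hw))

lemma exists_vert (hp : p ∈ U) (s : Fin 3) :
    ∃ v ∈ B.V p, ∀ t, F.η t p v = if t = s then 1 else 0 := by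
  have hinj : Function.Injective
      ((LinearMap.pi fun s => (F.η s p).toLinearMap).comp (B.V p).subtype) := fun v w h =>
    Subtype.ext (F.eq_of_mem_V B hp v.2 w.2 fun s => congrFun h s)
  have hsurj := (LinearMap.injective_iff_surjective_of_finrank_eq_finrank (B.finrank_V p)).1 hinj
  obtain ⟨v, hv⟩ := hsurj fun t => if t = s then 1 else 0
  exact ⟨v, v.2, fun t => congrFun hv t⟩

open Classical in
/-- The vertical fields dual to the one-forms of a local frame. -/
def vert (s : Fin 3) (q : M) : B.V q :=
  if h : ∃ v : B.V q, ∀ t, F.η t q (v : T (4 * n + 3) q) = if t = s then 1 else 0 then h.choose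
  else 0

lemma η_vert (hp : p ∈ U) (s t : Fin 3) :
    F.η t p (F.vert B s p : T (4 * n + 3) p) = if t = s then 1 else 0 := by
  have h : ∃ v : B.V p, ∀ t, F.η t p (v : T (4 * n + 3) p) = if t = s then 1 else 0 := by
    obtain ⟨v, hv, h⟩ := F.exists_vert B hp s
    exact ⟨⟨v, hv⟩, h⟩
  rw [vert, dif_pos h]
  exact h.choose_spec t

lemma expand (hp : p ∈ U) (v : T (4 * n + 3) p) :
    v = B.hor p v + ∑ s, F.η s p v • (F.vert B s p : T (4 * n + 3) p) := by
  have h1 : v - B.hor p v ∈ B.V p := by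
    rw [B.coe_hor, sub_sub_cancel]
    exact Submodule.projection_apply_mem _ _
  refine sub_eq_iff_eq_add'.1 (F.eq_of_mem_V B hp h1
    (Submodule.sum_mem _ fun s _ => Submodule.smul_mem _ _ (F.vert B s p).2) fun t => ?_)
  rw [map_sub, F.η_hor hp, map_sum]
  simp [F.η_vert B hp]

lemma sm_vert (hU : IsOpen U) (hp : p ∈ U) (s : Fin 3) :
    Sm (fun q => (F.vert B s q : T (4 * n + 3) q)) p := by
  -- The fields W_k are vertical, smooth near p and equal to the dual vectors at p. The matrix of
  -- the η_s on them is the identity at p, hence invertible nearby, and its inverse yields the dual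
  -- frame smoothly.
  let W (k : Fin 3) (q : M) : T (4 * n + 3) q :=
    ext (F.vert B k p : T (4 * n + 3) p) q - B.hor q (ext (F.vert B k p : T (4 * n + 3) p) q)
  have hW (k) : Sm (W k) p := (Sm.ext _).sub (B.sm_hor (Sm.ext _))
  have hWV (k q) : W k q ∈ B.V q := by
    simp only [W]
    rw [B.coe_hor, sub_sub_cancel]
    exact Submodule.projection_apply_mem _ _
  let A (q : M) : Matrix (Fin 3) (Fin 3) ℝ := .of fun s k => F.η s q (W k q)
  have hA : ∀ i j, SmF (4 * n + 3) (fun q => A q i j) p := fun i j => F.smF_η hU hp i (hW j)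
  have h0 : A p = 1 := by
    ext i j
    simp only [A, W, Matrix.of_apply, ext_self, B.hor_of_mem_V (F.vert B j p).2,
      ZeroMemClass.coe_zero, sub_zero, F.η_vert B hp, Matrix.one_apply]
  have hd : (A p).det ≠ 0 := by rw [h0]; simp
  refine (Sm.sum (s := Finset.univ) fun k _ => Sm.smul (SmF.inv_matrix hA hd k s) (hW k)).congr ?_
  filter_upwards [(SmF.det hA).eventually_ne hd, hU.mem_nhds hp] with q hq hqU
  refine F.eq_of_mem_V B hqU (F.vert B s q).2
    (Submodule.sum_mem _ fun s _ => Submodule.smul_mem _ _ (hWV s q)) fun t => ?_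
  rw [F.η_vert B hqU, map_sum]
  have := congrFun (congrFun (Matrix.mul_nonsing_inv (A q) (isUnit_iff_ne_zero.2 hq)) t) s
  rw [Matrix.mul_apply, Matrix.one_apply] at this
  rw [← this]
  exact Finset.sum_congr rfl fun k _ => by rw [map_smul, smul_eq_mul, mul_comm]; rfl

/-- The quaternionic Hermitian structure of the horizontal space given by a local frame. -/
def quat (hp : p ∈ U) : Quat n (S.H p) where
  g := S.g p
  e a := F.e a p
  I s := F.I s p
  symm := S.g_symm p
  orth := F.orthonormal p hp
  expand X := by
    have hli : LinearIndependent ℝ fun a => F.e a p := by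
      rw [Fintype.linearIndependent_iff]
      intro c hc a
      have := congrArg (fun X => S.g p X (F.e a p)) hc
      simpa [F.orthonormal p hp] using this
    have : FiniteDimensional ℝ (S.H p) := FiniteDimensional.finiteDimensional_submodule _
    let b := basisOfLinearIndependentOfCardEqFinrank' _ hli (by simp [S.finrank_H])
    have hb (a) : b a = F.e a p := by simp [b]
    have h1 := b.sum_repr X
    have h2 (a) : b.repr X a = S.g p X (F.e a p) := by
      conv_rhs => rw [← h1]
      simp [hb, F.orthonormal p hp]
    conv_lhs => rw [← h1]
    exact Finset.sum_congr rfl fun a _ => by rw [h2, hb]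
  I_sq := F.I_sq p hp
  I_mul := F.I_mul p hp
  I_mul' := F.I_mul' p hp
  herm := F.hermitian p hp

lemma sm_e (hU : IsOpen U) (hp : p ∈ U) (a : Fin (4 * n)) :
    Sm (fun q => (F.e a q : T (4 * n + 3) q)) p := (F.smooth_e a).sm hU hp

/-- Smoothness of g is only encoded by the orthonormal frames. Together with the dual vertical
fields such a frame spans the tangent bundle, and g(X, e_a) is the coefficient of X on e_a. -/
lemma smF_g_e (hU : IsOpen U) (hp : p ∈ U) (hX : Sm X p) (a : Fin (4 * n)) :
    SmF (4 * n + 3) (fun q => S.g q (B.hor q (X q)) (F.e a q)) p := by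
  let E : Fin (4 * n) ⊕ Fin 3 → ∀ q : M, T (4 * n + 3) q :=
    Sum.elim (fun a q => F.e a q) (fun s q => F.vert B s q)
  let y : Fin (4 * n) ⊕ Fin 3 → M → ℝ :=
    Sum.elim (fun a q => S.g q (B.hor q (X q)) (F.e a q)) (fun s q => F.η s q (X q))
  refine SmF.coeff (E := E) (y := y) (Y := X) (by simp) ?_ ?_ hX ?_ (Sum.inl a)
  · rintro (b | s)
    · exact F.sm_e hU hp b
    · exact F.sm_vert B hU hp s
  · rw [Fintype.linearIndependent_iff]
    intro c hc
    rw [Fintype.sum_sum_type] at hc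
    simp only [E, Sum.elim_inl, Sum.elim_inr] at hc
    have h2 (s) : c (Sum.inr s) = 0 := by
      have := congrArg (F.η s p) hc
      simpa [F.η_hor hp, F.η_vert B hp] using this
    have h1 (b) : c (Sum.inl b) = 0 := by
      have := congrArg (fun v => S.g p (B.hor p v) (F.e b p)) hc
      simpa [h2, F.orthonormal p hp] using this
    rintro (b | s)
    · exact h1 b
    · exact h2 s
  · filter_upwards [hU.mem_nhds hp] with q hq
    rw [Fintype.sum_sum_type]
    simp only [E, y, Sum.elim_inl, Sum.elim_inr]
    conv_lhs => rw [F.expand B hq (X q)]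
    congr 1
    conv_lhs => rw [(F.quat hq).expand (B.hor q (X q))]
    simp [quat]

/-- The almost complex structure `I_s` extended by zero to the vertical directions. -/
def J (s : Fin 3) (q : M) (v : T (4 * n + 3) q) : T (4 * n + 3) q := F.I s q (B.hor q v)

lemma sm_J (hU : IsOpen U) (hp : p ∈ U) (s : Fin 3) (hX : Sm X p) :
    Sm (fun q => F.J B s q (X q)) p := by
  refine (Sm.sum (s := Finset.univ) fun a _ =>
    Sm.smul (F.smF_g_e B hU hp hX a) ((F.smooth_I s a).sm hU hp)).congr ?_
  filter_upwards [hU.mem_nhds hp] with q hq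
  rw [J]
  conv_lhs => rw [(F.quat hq).expand (B.hor q (X q))]
  simp [quat]

end LocalFrame

lemma Structure.Biquard.smF_g (B : S.Biquard) {p : M} {X Y : ∀ q : M, T (4 * n + 3) q}
    (hX : Sm X p) (hY : Sm Y p) :
    SmF (4 * n + 3) (fun q => S.g q (B.hor q (X q)) (B.hor q (Y q))) p := by
  refine (SmF.sum (s := Finset.univ) fun a _ =>
    ((S.frame p).smF_g_e B (S.isOpen_nhd p) (S.mem_nhd p) hX a).mul ((S.frame p).smF_g_e B (S.isOpen_nhd p) (S.mem_nhd p) hY a)).congr ?_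
  filter_upwards [(S.isOpen_nhd p).mem_nhds (S.mem_nhd p)] with q hq
  exact ((S.frame p).quat hq).g_e_sum _ _

end Frames

/-- Differentiating a contraction over a local frame produces the connection matrix, which is skew,
paired with an expression symmetric in the two indices; this is why the frame terms disappear. -/
lemma sum_antisymm {E : Type*} [AddCommGroup E] [Module ℝ E] {ι : Type*} [Fintype ι]
    {α : ι → ι → ℝ} (hα : ∀ s t, α s t = -α t s) (f : ι → ι → E) :
    ∑ s, ∑ t, α s t • (f s t + f t s) = 0 := by
  simp only [smul_add, Finset.sum_add_distrib]
  rw [Finset.sum_comm (f := fun s t => α s t • f t s), ← Finset.sum_add_distrib]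
  refine Finset.sum_eq_zero fun s _ => ?_
  rw [← Finset.sum_add_distrib]
  exact Finset.sum_eq_zero fun t _ => by rw [hα s t, neg_smul, neg_add_cancel]

/-! ### Parallelism of the projection, of the metric and of φ -/

section Parallel

variable {n : ℕ} {M : Type*} [TopologicalSpace M]
  [ChartedSpace (EuclideanSpace ℝ (Fin (4 * n + 3))) M] [IsManifold (𝓡 (4 * n + 3)) ∞ M]
  {S : Structure n M}

namespace Structure.Biquard

variable (B : S.Biquard) {p : M} {X Y : ∀ q : M, T (4 * n + 3) q}

lemma sub_hor_mem (v : T (4 * n + 3) p) : v - B.hor p v ∈ B.V p := by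
  rw [B.coe_hor, sub_sub_cancel]
  exact Submodule.projection_apply_mem _ _

/-- The horizontal projection is parallel. -/
lemma cov_hor (hX : Sm X p) (v : T (4 * n + 3) p) :
    B.cov (fun q => (B.hor q (X q) : T (4 * n + 3) q)) p v = B.hor p (B.cov X p v) := by
  have h1 := B.cov_mem_H p (fun q => B.hor q (X q)) (B.sm_hor hX).diffAt v
  have h2 := B.cov_mem_V p (fun q => ⟨_, B.sub_hor_mem (X q)⟩) (hX.sub (B.sm_hor hX)).diffAt v
  have h3 := cov_sub (cov := B.cov) hX (B.sm_hor hX) v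
  simp only at h2
  rw [h3] at h2
  have h4 := B.hor_of_mem_V h2
  rw [map_sub, sub_eq_zero] at h4
  rw [h4, B.hor_of_mem h1]

lemma cov_mem_of_eventually_mem (hX : Sm X p) (h : ∀ᶠ q in 𝓝 p, X q ∈ S.H q)
    (v : T (4 * n + 3) p) : B.cov X p v ∈ S.H p := by
  rw [cov_congr (B.sm_hor hX) (h.mono fun q hq => (B.hor_of_mem hq).symm), B.cov_hor hX]
  exact (B.hor p _).2

lemma cov_mem_V_of_eventually_mem (hX : Sm X p) (h : ∀ᶠ q in 𝓝 p, X q ∈ B.V q)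
    (v : T (4 * n + 3) p) : B.hor p (B.cov X p v) = 0 := by
  have h1 := B.cov_hor hX v
  rw [cov_congr Sm.zero (h.mono fun q hq => by rw [B.hor_of_mem_V hq]; rfl), cov_zero] at h1
  exact Subtype.ext h1.symm

/-- The metric, extended by zero to the vertical directions. -/
def gg (p : M) (v w : T (4 * n + 3) p) : ℝ := S.g p (B.hor p v) (B.hor p w)

lemma smForm₂_gg : SmForm₂ B.gg where
  add_left p u v w := by simp [gg]
  smul_left p c v w := by simp [gg]
  add_right p u v w := by simp [gg]
  smul_right p c v w := by simp [gg]
  smooth hX hY := B.smF_g hX hY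

/-- The metric is parallel. -/
lemma dirDeriv_gg (hX : Sm X p) (hY : Sm Y p) (v : T (4 * n + 3) p) :
    dirDeriv (fun q => B.gg q (X q) (Y q)) p v
      = B.gg p (B.cov X p v) (Y p) + B.gg p (X p) (B.cov Y p v) := by
  have h := B.cov_metric p (fun q => B.hor q (X q)) (fun q => B.hor q (Y q)) (B.sm_hor hX).diffAt
    (B.sm_hor hY).diffAt v
  simp only [B.cov_hor hX, B.cov_hor hY] at h
  exact h

end Structure.Biquard

namespace LocalFrame

variable {U : Set M} (F : S.Frame U) (B : S.Biquard) {p : M} {X Y ξ : ∀ q : M, T (4 * n + 3) q}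

lemma eta_sub_hor (hp : p ∈ U) (s : Fin 3) (v : T (4 * n + 3) p) :
    F.η s p (v - B.hor p v) = F.η s p v := by
  rw [map_sub, F.η_hor hp, sub_zero]

lemma J_add (s : Fin 3) (v w : T (4 * n + 3) p) : F.J B s p (v + w) = F.J B s p v + F.J B s p w := by
  simp [J]

lemma J_smul (s : Fin 3) (c : ℝ) (v : T (4 * n + 3) p) : F.J B s p (c • v) = c • F.J B s p v := by
  simp [J]

/-- The pairing `(ξ, v) ↦ φ(ξ) v`. -/
def Phi (q : M) (ξ v : T (4 * n + 3) q) : T (4 * n + 3) q := ∑ s, F.η s q ξ • F.J B s q v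

lemma Phi_eq (q : M) (ξ v : T (4 * n + 3) q) :
    F.Phi B q ξ v = (Structure.phi F q ξ (B.hor q v) : T (4 * n + 3) q) := by
  simp [Phi, Structure.phi, J]

lemma Phi_vert (hp : p ∈ U) (s : Fin 3) (v : T (4 * n + 3) p) :
    F.Phi B p (F.vert B s p) v = F.J B s p v := by
  simp [Phi, F.η_vert B hp]

variable (hU : IsOpen U) (hp : p ∈ U)
include hU hp

lemma sm_Phi (hξ : Sm ξ p) (hX : Sm X p) : Sm (fun q => F.Phi B q (ξ q) (X q)) p :=
  Sm.sum fun s _ => Sm.smul (F.smF_η hU hp s hξ) (F.sm_J B hU hp s hX)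

/-- The identification of vertical vectors with elements of `Q` is parallel. -/
lemma cov_Phi (hξ : Sm ξ p) (hX : Sm X p) (v : T (4 * n + 3) p) :
    B.cov (fun q => F.Phi B q (ξ q) (X q)) p v
      = F.Phi B p (B.cov ξ p v) (X p) + F.Phi B p (ξ p) (B.cov X p v) := by
  have h1 := B.cov_phi U hU F p hp (fun q => ⟨_, B.sub_hor_mem (ξ q)⟩) (fun q => B.hor q (X q))
    (hξ.sub (B.sm_hor hξ)).diffAt (B.sm_hor hX).diffAt v
  simp only [B.cov_hor hX, cov_sub hξ (B.sm_hor hξ), B.cov_hor hξ] at h1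
  have h2 (q) (hq : q ∈ U) (ζ w : T (4 * n + 3) q) :
      (Structure.phi F q (ζ - B.hor q ζ) (B.hor q w) : T (4 * n + 3) q) = F.Phi B q ζ w := by
    rw [Phi_eq]
    simp only [Structure.phi, F.eta_sub_hor B hq]
  have h3 := cov_congr (cov := B.cov) (F.sm_Phi B hU hp hξ hX)
    ((hU.eventually_mem hp).mono fun q hq => h2 q hq (ξ q) (X q)) v
  rw [h3, h2 p hp] at h1
  have h4 : F.Phi B p (ξ p) (B.cov X p v) =
      (Structure.phi F p (ξ p - B.hor p (ξ p)) ⟨B.hor p (B.cov X p v), (B.hor p (B.cov X p v)).2⟩ :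
        T (4 * n + 3) p) := (h2 p hp _ _).symm
  rw [sub_eq_iff_eq_add] at h1
  rw [h1, h4, h2 p hp]

/-- The connection coefficients of the vertical frame. -/
def conn (s t : Fin 3) (p : M) (v : T (4 * n + 3) p) : ℝ :=
  F.η t p (B.cov (fun q => (F.vert B s q : T (4 * n + 3) q)) p v)

lemma cov_vert (s : Fin 3) (v : T (4 * n + 3) p) :
    B.cov (fun q => (F.vert B s q : T (4 * n + 3) q)) p v
      = ∑ t, F.conn B s t p v • (F.vert B t p : T (4 * n + 3) p) := by
  have h := B.cov_mem_V p (F.vert B s) (F.sm_vert B hU hp s).diffAt v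
  conv_lhs => rw [F.expand B hp (B.cov _ p v), B.hor_of_mem_V h]
  simp [conn]

/-- Since φ is parallel and sends ξ_s to I_s, the complex structures have the same connection
coefficients as the vertical frame. -/
lemma cov_J (hX : Sm X p) (s : Fin 3) (v : T (4 * n + 3) p) :
    B.cov (fun q => F.J B s q (X q)) p v
      = F.J B s p (B.cov X p v) + ∑ t, F.conn B s t p v • F.J B t p (X p) := by
  have h1 := F.cov_Phi B hU hp (F.sm_vert B hU hp s) hX v
  rw [cov_congr (F.sm_J B hU hp s hX) ((hU.eventually_mem hp).mono fun q hq =>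
    F.Phi_vert B hq s (X q)), F.Phi_vert B hp] at h1
  rw [h1, add_comm (F.J B s p _)]
  rfl

/-- The covariant derivative of I_s I_t + I_t I_s = -2 δ_st gives the skew-symmetry of the
coefficients. -/
lemma conn_antisymm (hn : 1 ≤ n) (s t : Fin 3) (v : T (4 * n + 3) p) :
    F.conn B s t p v = -F.conn B t s p v := by
  let D := F.quat hp
  have hJJ (q) (hq : q ∈ U) (s t : Fin 3) (w : T (4 * n + 3) q) :
      F.J B s q (F.J B t q w) + F.J B t q (F.J B s q w)
        = (if s = t then (-2 : ℝ) else 0) • (B.hor q w : T (4 * n + 3) q) := by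
    have h : (F.quat hq).I s * (F.quat hq).I t + (F.quat hq).I t * (F.quat hq).I s
        = (if s = t then (-2 : ℝ) else 0) • 1 := by
      rw [Quat.I_mul_I, Quat.I_mul_I]
      fin_cases s <;> fin_cases t <;> simp [Quat.eps, Fin.sum_univ_three] <;> module
    have h2 := congrArg (fun A : Module.End ℝ (S.H q) => (A (B.hor q w) : T (4 * n + 3) q)) h
    simp only [LinearMap.add_apply, Module.End.mul_apply, LinearMap.smul_apply,
      Module.End.one_apply] at h2
    simp only [J, B.hor_coe]
    exact h2
  -- A horizontal field without zeros is needed to read off the scalar coefficient; it exists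
  -- because n ≥ 1.
  have i0 : Fin (4 * n) := ⟨0, by omega⟩
  let X : ∀ q, T (4 * n + 3) q := fun q => F.e i0 q
  have hX : Sm X p := F.sm_e hU hp i0
  have hJ (s) := F.sm_J B hU hp s hX
  have hJ2 (s t) := F.sm_J B hU hp s (hJ t)
  have h1 := cov_congr (cov := B.cov) (Sm.smul (SmF.const (if s = t then (-2 : ℝ) else 0))
    (B.sm_hor hX)) ((hU.eventually_mem hp).mono fun q hq => hJJ q hq s t (X q)) v
  rw [cov_add (hJ2 s t) (hJ2 t s), F.cov_J B hU hp (hJ t), F.cov_J B hU hp (hJ s),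
    F.cov_J B hU hp hX, F.cov_J B hU hp hX, cov_smul (SmF.const _) (B.sm_hor hX), B.cov_hor hX,
    dirDeriv_const, zero_smul, add_zero] at h1
  have h2 (s t : Fin 3) : F.J B s p (∑ u, F.conn B t u p v • F.J B u p (X p))
      = ∑ u, F.conn B t u p v • F.J B s p (F.J B u p (X p)) := by
    simp [J]
  have h3 := hJJ p hp s t (B.cov X p v)
  simp only [J_add, h2] at h1
  have h4 : ∑ u, F.conn B s u p v • (F.J B u p (F.J B t p (X p)) + F.J B t p (F.J B u p (X p)))
      + ∑ u, F.conn B t u p v • (F.J B u p (F.J B s p (X p)) + F.J B s p (F.J B u p (X p))) = 0 := by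
    simp only [smul_add, Finset.sum_add_distrib]
    rw [← h3] at h1
    linear_combination (norm := module) h1
  simp only [hJJ p hp, smul_smul, ← Finset.sum_smul, ← add_smul] at h4
  have h5 : (B.hor p (X p) : T (4 * n + 3) p) ≠ 0 := by
    intro h0
    have := F.orthonormal p hp i0 i0
    rw [B.hor_of_mem (F.e i0 p).2] at h0
    have h6 : F.e i0 p = 0 := Subtype.ext h0
    rw [h6] at this
    simp at this
  have h6 := (smul_eq_zero.1 h4).resolve_right h5
  simp only [mul_ite, mul_zero, Finset.sum_ite_eq', Finset.mem_univ, if_true] at h6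
  linarith

end LocalFrame

end Parallel
-- The torsion on horizontal vectors
section Curvature

variable {n : ℕ} {M : Type*} [TopologicalSpace M]
  [ChartedSpace (EuclideanSpace ℝ (Fin (4 * n + 3))) M] [IsManifold (𝓡 (4 * n + 3)) ∞ M]
  {S : Structure n M}

namespace LocalFrame

variable {U : Set M} (F : S.Frame U) (B : S.Biquard) {p : M} {X Y Z W ξ : ∀ q : M, T (4 * n + 3) q}

section
variable (hU : IsOpen U) (hp : p ∈ U)
include hU hp

lemma cov_e (a : Fin (4 * n)) (v : T (4 * n + 3) p) :
    B.cov (fun q => (F.e a q : T (4 * n + 3) q)) p v = ∑ b,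
      B.gg p (B.cov (fun q => (F.e a q : T (4 * n + 3) q)) p v) (F.e b p) •
        (F.e b p : T (4 * n + 3) p) := by
  have h1 := B.cov_mem_of_eventually_mem (F.sm_e hU hp a) (.of_forall fun q => (F.e a q).2) v
  conv_lhs => rw [← B.hor_of_mem h1, (F.quat hp).expand (B.hor p _)]
  simp [Structure.Biquard.gg, quat]

/-- The functions g(e_a, e_b) are locally constant and g is parallel. -/
lemma conn_e_antisymm (a b : Fin (4 * n)) (v : T (4 * n + 3) p) :
    B.gg p (B.cov (fun q => (F.e a q : T (4 * n + 3) q)) p v) (F.e b p)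
      = -B.gg p (B.cov (fun q => (F.e b q : T (4 * n + 3) q)) p v) (F.e a p) := by
  have h := B.dirDeriv_gg (F.sm_e hU hp a) (F.sm_e hU hp b) v
  rw [dirDeriv_congr (k := fun _ => if a = b then 1 else 0)
    ((hU.eventually_mem hp).mono fun q hq => by
      rw [Structure.Biquard.gg, B.hor_coe, B.hor_coe, F.orthonormal q hq]), dirDeriv_const] at h
  rw [Structure.Biquard.gg, Structure.Biquard.gg, S.g_symm p (B.hor p (F.e a p))] at h
  simp only [Structure.Biquard.gg]
  linarith

/-- The right-hand side is tensorial in both fields, so the extensions chosen in `extDer` do not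
matter. -/
lemma extDer_eq (s : Fin 3) (hX : Sm X p) (hY : Sm Y p) :
    extDer (F.η s) p (X p) (Y p) = dirDeriv (fun q => F.η s q (Y q)) p (X p)
      - dirDeriv (fun q => F.η s q (X q)) p (Y p)
      - F.η s p (VectorField.mlieBracket (𝓡 (4 * n + 3)) X Y p) := by
  have hη {X : ∀ q : M, T (4 * n + 3) q} (hX : Sm X p) := F.smF_η hU hp s hX
  have h1 {X : ∀ q : M, T (4 * n + 3) q} (hX : Sm X p) :
      SmTensorial (fun Y => dirDeriv (fun q => F.η s q (Y q)) p (X p)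
      - dirDeriv (fun q => F.η s q (X q)) p (Y p)
      - F.η s p (VectorField.mlieBracket (𝓡 (4 * n + 3)) X Y p)) p := by
    refine ⟨fun {h Y} hh hY => ?_, fun {Y Z} hY hZ => ?_⟩
    · simp only [map_smul, smul_eq_mul]
      rw [dirDeriv_mul hh (hη hY), dirDeriv_vsmul, mlieBracket_fun_smul_right hh hY, map_add,
        map_smul, map_smul]
      simp only [smul_eq_mul]
      ring
    · simp only [map_add]
      rw [dirDeriv_add (hη hY) (hη hZ), dirDeriv_vadd, mlieBracket_fun_add_right hY hZ, map_add]
      ring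
  have h2 := (h1 (Sm.ext (X p))).pointwise hY (Sm.ext (Y p)) (by simp)
  have h3 := (h1 hY).pointwise hX (Sm.ext (X p)) (by simp)
  have hs (X Y : ∀ q : M, T (4 * n + 3) q) : F.η s p (VectorField.mlieBracket (𝓡 (4 * n + 3)) X Y p)
      = -F.η s p (VectorField.mlieBracket (𝓡 (4 * n + 3)) Y X p) := by
    rw [VectorField.mlieBracket_swap_apply, map_neg]
  simp only [ext_self] at h2 h3
  rw [hs Y X, hs Y (ext (X p))] at h3
  unfold extDer
  linarith

/-- The torsion on the horizontal space. -/
lemma torsion_hor (v w : T (4 * n + 3) p) :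
    B.cov.torsion p (B.hor p v) (B.hor p w)
      = ∑ s, (2 * B.gg p (F.J B s p v) w) • (F.vert B s p : T (4 * n + 3) p) := by
  let X (q : M) := B.hor q (ext v q)
  let Y (q : M) := B.hor q (ext w q)
  have hX : Sm (fun q => (X q : T (4 * n + 3) q)) p := B.sm_hor (Sm.ext v)
  have hY : Sm (fun q => (Y q : T (4 * n + 3) q)) p := B.sm_hor (Sm.ext w)
  have h1 := B.torsion_H p X Y hX.diffAt hY.diffAt
  have hXp : X p = B.hor p v := by simp [X]
  have hYp : Y p = B.hor p w := by simp [Y]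
  have h2 (s) := F.extDer_eq hU hp s hX hY
  have h0 (Z : ∀ q, S.H q) (s) (v : T (4 * n + 3) p) :
      dirDeriv (fun q => F.η s q (Z q : T (4 * n + 3) q)) p v = 0 := by
    rw [dirDeriv_congr (k := fun _ => 0) ((hU.eventually_mem hp).mono fun q hq => F.η_hor hq s _),
      dirDeriv_const]
  simp only [h0, sub_zero, zero_sub] at h2
  rw [hXp, hYp] at h1
  simp only [hXp, hYp] at h2
  have h3 (s) := F.compat p hp s (B.hor p v) (B.hor p w)
  rw [h1]
  refine F.eq_of_mem_V B hp (neg_mem (Submodule.projection_apply_mem _ _))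
    (Submodule.sum_mem _ fun s _ => Submodule.smul_mem _ _ (F.vert B s p).2) fun s => ?_
  rw [map_neg, map_sum]
  have h4 := F.eta_sub_hor B hp s (VectorField.mlieBracket (𝓡 (4 * n + 3))
    (fun q => (X q : T (4 * n + 3) q)) (fun q => (Y q : T (4 * n + 3) q)) p)
  rw [B.coe_hor, sub_sub_cancel] at h4
  rw [h4, ← h2, ← h3]
  simp [F.η_vert B hp, Structure.Biquard.gg, J]

include F in
/-- The torsion of horizontal vectors is parallel. -/
lemma cov_torsion_hor (hn : 1 ≤ n) (hX : Sm X p) (hY : Sm Y p) (v : T (4 * n + 3) p) :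
    B.cov (fun q => B.cov.torsion q (B.hor q (X q)) (B.hor q (Y q))) p v
      = B.cov.torsion p (B.hor p (B.cov X p v)) (B.hor p (Y p))
        + B.cov.torsion p (B.hor p (X p)) (B.hor p (B.cov Y p v)) := by
  have hs (s) : SmF (4 * n + 3) (fun q => 2 * B.gg q (F.J B s q (X q)) (Y q)) p :=
    (SmF.const 2).mul (B.smForm₂_gg.smooth (F.sm_J B hU hp s hX) hY)
  have hv (s) := F.sm_vert B hU hp s
  rw [cov_congr (Sm.sum (s := Finset.univ) fun s _ => Sm.smul (hs s) (hv s))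
    ((hU.eventually_mem hp).mono fun q hq => F.torsion_hor B hU hq (X q) (Y q)),
    cov_sum fun s _ => Sm.smul (hs s) (hv s), F.torsion_hor B hU hp, F.torsion_hor B hU hp]
  -- The derivative of each summand splits into the two expected terms and one term carrying the
  -- connection coefficient. The latter is symmetric under exchange of s and t apart from that
  -- coefficient, so it disappears in the sum.
  have h1 (s) : B.cov (fun q => (2 * B.gg q (F.J B s q (X q)) (Y q)) •
        (F.vert B s q : T (4 * n + 3) q)) p v
      = ((2 * B.gg p (F.J B s p (B.cov X p v)) (Y p)) • (F.vert B s p : T (4 * n + 3) p)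
        + (2 * B.gg p (F.J B s p (X p)) (B.cov Y p v)) • (F.vert B s p : T (4 * n + 3) p))
        + ∑ t, F.conn B s t p v •
          ((2 * B.gg p (F.J B s p (X p)) (Y p)) • (F.vert B t p : T (4 * n + 3) p)
            + (2 * B.gg p (F.J B t p (X p)) (Y p)) • (F.vert B s p : T (4 * n + 3) p)) := by
    have hb := B.smForm₂_gg
    rw [cov_smul (hs s) (hv s), dirDeriv_const_mul 2 (hb.smooth (F.sm_J B hU hp s hX) hY),
      B.dirDeriv_gg (F.sm_J B hU hp s hX) hY, F.cov_J B hU hp hX, F.cov_vert B hU hp,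
      hb.add_left]
    have h2 : B.gg p (∑ t, F.conn B s t p v • F.J B t p (X p)) (Y p)
        = ∑ t, F.conn B s t p v * B.gg p (F.J B t p (X p)) (Y p) := by
      simp [Structure.Biquard.gg, map_sum]
    rw [h2]
    simp only [smul_add, Finset.sum_add_distrib, Finset.smul_sum, add_smul, mul_add,
      Finset.mul_sum, Finset.sum_smul, smul_smul]
    have e1 : ∑ t, (2 * B.gg p (F.J B s p (X p)) (Y p) * F.conn B s t p v) •
        (F.vert B t p : T (4 * n + 3) p) = ∑ t, (F.conn B s t p v *
          (2 * B.gg p (F.J B s p (X p)) (Y p))) • (F.vert B t p : T (4 * n + 3) p) :=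
      Finset.sum_congr rfl fun t _ => by rw [mul_comm (F.conn B s t p v)]
    have e2 : ∑ t, (2 * (F.conn B s t p v * B.gg p (F.J B t p (X p)) (Y p))) •
        (F.vert B s p : T (4 * n + 3) p) = ∑ t, (F.conn B s t p v *
          (2 * B.gg p (F.J B t p (X p)) (Y p))) • (F.vert B s p : T (4 * n + 3) p) :=
      Finset.sum_congr rfl fun t _ => by rw [mul_left_comm (F.conn B s t p v)]
    rw [e1, e2]
    abel
  rw [Finset.sum_congr rfl fun s _ => h1 s, Finset.sum_add_distrib, Finset.sum_add_distrib,
    sum_antisymm (fun s t => F.conn_antisymm B hU hp hn s t v)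
    (fun s t => (2 * B.gg p (F.J B s p (X p)) (Y p)) • (F.vert B t p : T (4 * n + 3) p)), add_zero]

end

end LocalFrame

end Curvature
-- Curvature, the metric and the quaternionic structure
section CurvatureIdentities

variable {n : ℕ} {M : Type*} [TopologicalSpace M] [T2Space M]
  [ChartedSpace (EuclideanSpace ℝ (Fin (4 * n + 3))) M] [IsManifold (𝓡 (4 * n + 3)) ∞ M]
  {S : Structure n M}

section
variable (B : S.Biquard) {p : M} {X Y Z W ξ : ∀ q : M, T (4 * n + 3) q}

namespace Structure.Biquard

lemma curv_hor_field (hX : Sm X p) (hY : Sm Y p) (hZ : Sm Z p) :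
    curvField B.cov X Y (fun q => B.hor q (Z q)) p = B.hor p (curvField B.cov X Y Z p) := by
  have h {X Y : ∀ q : M, T (4 * n + 3) q} (hX : Sm X p) (hY : Sm Y p) :
      B.cov (fun q => B.cov (fun q => (B.hor q (Z q) : T (4 * n + 3) q)) q (Y q)) p (X p)
        = B.hor p (B.cov (fun q => B.cov Z q (Y q)) p (X p)) := by
    have h1 := hY.nabla B.smooth_cov hZ
    rw [← B.cov_hor h1, cov_congr (B.sm_hor h1)
      (hZ.eventually.mono fun q hq => B.cov_hor hq (Y q))]
  simp only [curvField]
  rw [h hX hY, h hY hX, B.cov_hor hZ, map_sub, map_sub]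
  rfl

lemma curv_hor (u v w : T (4 * n + 3) p) :
    curv B.cov p u v (B.hor p w) = B.hor p (curv B.cov p u v w) := by
  have h1 := B.curv_hor_field (Sm.ext u) (Sm.ext v) (Sm.ext w)
  have h2 := curv_eq B.smooth_cov (Sm.ext u) (Sm.ext v) (Sm.ext w)
  have h3 := curv_eq B.smooth_cov (Sm.ext u) (Sm.ext v) (B.sm_hor (Sm.ext w))
  simp only [ext_self] at h2 h3
  rw [h2, h3, h1]

lemma curv_mem_H (u v : T (4 * n + 3) p) {w : T (4 * n + 3) p} (hw : w ∈ S.H p) :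
    curv B.cov p u v w ∈ S.H p := by
  have := B.curv_hor u v w
  rw [B.hor_of_mem hw] at this
  rw [this]
  exact (B.hor p _).2

/-- The commutator of the derivations X and Y on the function g(Z, W) equals [X, Y] on it. Expanding
both sides with the parallel metric leaves exactly the two curvature terms. -/
lemma curv_gg (u v w z : T (4 * n + 3) p) :
    B.gg p (curv B.cov p u v w) z = -B.gg p w (curv B.cov p u v z) := by
  have hb := B.smForm₂_gg
  set X := ext u with hXd
  set Y := ext v with hYd
  set Z := ext w with hZd
  set W := ext z with hWd
  have hX : Sm X p := Sm.ext u
  have hY : Sm Y p := Sm.ext v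
  have hZ : Sm Z p := Sm.ext w
  have hW : Sm W p := Sm.ext z
  have h1 := curv_eq B.smooth_cov hX hY hZ
  have h2 := curv_eq B.smooth_cov hX hY hW
  have h3 := dirDeriv_mlieBracket (hb.smooth hZ hW) hX hY
  have key {X Y : ∀ q : M, T (4 * n + 3) q} (hX : Sm X p) (hY : Sm Y p) :
      dirDeriv (fun q => dirDeriv (fun q => B.gg q (Z q) (W q)) q (Y q)) p (X p)
        = B.gg p (B.cov (fun q => B.cov Z q (Y q)) p (X p)) (W p)
          + B.gg p (B.cov Z p (Y p)) (B.cov W p (X p))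
          + (B.gg p (B.cov Z p (X p)) (B.cov W p (Y p))
          + B.gg p (Z p) (B.cov (fun q => B.cov W q (Y q)) p (X p))) := by
    have hYZ := hY.nabla B.smooth_cov hZ
    have hYW := hY.nabla B.smooth_cov hW
    rw [dirDeriv_congr ((hZ.eventually.and hW.eventually).mono fun q hq =>
      B.dirDeriv_gg hq.1 hq.2 (Y q)), dirDeriv_add (hb.smooth hYZ hW) (hb.smooth hZ hYW),
      B.dirDeriv_gg hYZ hW, B.dirDeriv_gg hZ hYW]
  rw [key hX hY, key hY hX, B.dirDeriv_gg hZ hW] at h3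
  simp only [hXd, hYd, hZd, hWd, ext_self] at h1 h2 h3
  have hl := (hb.bilin p).map_sub₂
  have hr := fun a => map_sub (hb.bilin p a)
  simp only [SmForm₂.bilin_apply] at hl hr
  rw [h1, h2]
  simp only [curvField, ext_self, hl, hr]
  linarith

end Structure.Biquard

namespace LocalFrame

variable {U : Set M} (F : S.Frame U)

/-- The curvature acts as a derivation on the parallel pairing φ; the cross terms with one
derivative on each factor are symmetric in X and Y and cancel. -/
lemma curv_Phi (hU : IsOpen U) (hp : p ∈ U) (u v ζ w : T (4 * n + 3) p) :
    curv B.cov p u v (F.Phi B p ζ w)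
      = F.Phi B p (curv B.cov p u v ζ) w + F.Phi B p ζ (curv B.cov p u v w) := by
  set X := ext u with hXd
  set Y := ext v with hYd
  set Z := ext w with hZd
  set ξ := ext ζ with hξd
  have hX : Sm X p := Sm.ext u
  have hY : Sm Y p := Sm.ext v
  have hZ : Sm Z p := Sm.ext w
  have hξ : Sm ξ p := Sm.ext ζ
  have h1 := curv_eq B.smooth_cov hX hY hZ
  have h2 := curv_eq B.smooth_cov hX hY hξ
  have h3 := curv_eq B.smooth_cov hX hY (F.sm_Phi B hU hp hξ hZ)
  have key {X Y : ∀ q : M, T (4 * n + 3) q} (hX : Sm X p) (hY : Sm Y p) :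
      B.cov (fun q => B.cov (fun q => F.Phi B q (ξ q) (Z q)) q (Y q)) p (X p)
        = F.Phi B p (B.cov (fun q => B.cov ξ q (Y q)) p (X p)) (Z p)
          + F.Phi B p (B.cov ξ p (Y p)) (B.cov Z p (X p))
          + (F.Phi B p (B.cov ξ p (X p)) (B.cov Z p (Y p))
          + F.Phi B p (ξ p) (B.cov (fun q => B.cov Z q (Y q)) p (X p))) := by
    have hYZ := hY.nabla B.smooth_cov hZ
    have hYξ := hY.nabla B.smooth_cov hξ
    have e1 := F.sm_Phi B hU hp hYξ hZ
    have e2 := F.sm_Phi B hU hp hξ hYZ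
    rw [cov_congr (e1.add e2) ((hZ.eventually.and (hξ.eventually.and (hU.eventually_mem hp))).mono
      fun q hq => F.cov_Phi B hU hq.2.2 hq.2.1 hq.1 (Y q)), cov_add e1 e2,
      F.cov_Phi B hU hp hYξ hZ, F.cov_Phi B hU hp hξ hYZ]
  have hl (a b c : T (4 * n + 3) p) : F.Phi B p (a - b) c = F.Phi B p a c - F.Phi B p b c := by
    simp [Phi, sub_smul]
  have hr (a b c : T (4 * n + 3) p) : F.Phi B p a (b - c) = F.Phi B p a b - F.Phi B p a c := by
    simp [Phi, J, smul_sub]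
  simp only [hXd, hYd, hZd, hξd, ext_self] at h1 h2 h3
  rw [h1, h2, h3]
  simp only [curvField]
  rw [key hX hY, key hY hX, F.cov_Phi B hU hp hξ hZ]
  simp only [hXd, hYd, hZd, hξd, ext_self, hl, hr]
  abel

end LocalFrame
end

namespace Structure.Biquard

variable (B : S.Biquard) (p : M)

/-- The torsion endomorphism of the horizontal space. -/
def torEnd (ξ : T (4 * n + 3) p) : Module.End ℝ (S.H p) :=
  B.hor p ∘ₗ (B.cov.torsion p ξ).toLinearMap ∘ₗ (S.H p).subtype

lemma coe_torEnd {ξ : T (4 * n + 3) p} (hξ : ξ ∈ B.V p) (X : S.H p) :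
    (B.torEnd p ξ X : T (4 * n + 3) p) = B.cov.torsion p ξ X :=
  B.hor_of_mem (B.torsion_mem_H p ξ hξ X)

/-- The horizontal curvature. -/
def curvEnd : S.H p →ₗ[ℝ] S.H p →ₗ[ℝ] Module.End ℝ (S.H p) :=
  LinearMap.mk₂ ℝ (fun X Y =>
      { toFun := fun Z => B.hor p (curv B.cov p X Y Z)
        map_add' := fun Z W => by
          rw [Submodule.coe_add, curv_add_right B.smooth_cov, map_add]
        map_smul' := fun c Z => by
          rw [Submodule.coe_smul, curv_smul_right B.smooth_cov, map_smul, RingHom.id_apply] })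
    (fun X Y Z => LinearMap.ext fun W => by
      simp [curv_add_left B.smooth_cov])
    (fun c X Y => LinearMap.ext fun W => by
      simp [curv_smul_left B.smooth_cov])
    (fun X Y Z => LinearMap.ext fun W => by
      simp [curv_add_mid B.smooth_cov])
    (fun c X Y => LinearMap.ext fun W => by
      simp [curv_smul_mid B.smooth_cov])

lemma coe_curvEnd (X Y Z : S.H p) :
    (B.curvEnd p X Y Z : T (4 * n + 3) p) = curv B.cov p X Y Z :=
  B.hor_of_mem (B.curv_mem_H _ _ Z.2)

end Structure.Biquard

end CurvatureIdentities
-- The two components of the first Bianchi identity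
section Bianchi

variable {n : ℕ} {M : Type*} [TopologicalSpace M] [T2Space M]
  [ChartedSpace (EuclideanSpace ℝ (Fin (4 * n + 3))) M] [IsManifold (𝓡 (4 * n + 3)) ∞ M]
  {S : Structure n M}

namespace LocalFrame

variable {U : Set M} (F : S.Frame U) (B : S.Biquard) {p : M}

/-- The sp(1)-part of the horizontal curvature is the curvature of the vertical frame, because φ
intertwines the two. -/
lemma curv_I (hU : IsOpen U) (hp : p ∈ U) (s : Fin 3) (X Y : S.H p) :
    B.curvEnd p X Y * F.I s p - F.I s p * B.curvEnd p X Y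
      = ∑ t, F.η t p (curv B.cov p X Y (F.vert B s p)) • F.I t p := by
  refine LinearMap.ext fun Z => Subtype.ext ?_
  have h := F.curv_Phi B hU hp X Y (F.vert B s p) Z
  rw [F.Phi_vert B hp, F.Phi_vert B hp] at h
  have e1 : F.J B s p Z = F.I s p Z := by rw [J, B.hor_coe]
  have e2 : F.J B s p (curv B.cov p X Y Z) = F.I s p (B.curvEnd p X Y Z) := by
    rw [J, ← B.coe_curvEnd, B.hor_coe]
  have e3 := B.coe_curvEnd p X Y (F.I s p Z)
  rw [e1, e2] at h
  simp only [LinearMap.sub_apply, Module.End.mul_apply, AddSubgroupClass.coe_sub, e3, h,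
    add_sub_cancel_right]
  simp [Phi, J]

lemma torsion_sub_sub (p : M) (v a b c : T (4 * n + 3) p) : B.cov.torsion p v (a - b - c)
    = B.cov.torsion p v a - B.cov.torsion p v b - B.cov.torsion p v c := by
  rw [ContinuousLinearMap.map_sub, ContinuousLinearMap.map_sub]

lemma torEnd_eq_neg (hp : p ∈ U) (s : Fin 3) (X : S.H p) :
    B.cov.torsion p X (F.vert B s p) = -(B.torEnd p (F.vert B s p) X : T (4 * n + 3) p) := by
  rw [B.coe_torEnd p (F.vert B s p).2, B.cov.torsion_antisymm]

lemma torsion_hor' (hU : IsOpen U) (hp : p ∈ U) (X Y : S.H p) :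
    B.cov.torsion p X Y
      = ∑ s, (2 * S.g p (F.I s p X) Y) • (F.vert B s p : T (4 * n + 3) p) := by
  have h := F.torsion_hor B hU hp X Y
  simp only [J, Structure.Biquard.gg, B.hor_coe] at h
  exact h

lemma η_torsion_hor (hU : IsOpen U) (hp : p ∈ U) (t : Fin 3) (X Y : S.H p) :
    F.η t p (B.cov.torsion p X Y) = 2 * S.g p (F.I t p X) Y := by
  rw [F.torsion_hor' B hU hp, map_sum]
  simp [F.η_vert B hp]

set_option maxHeartbeats 1000000 in
-- In the horizontal component the derivative of T(Y, Z) drops out, since T(Y, Z) is vertical and V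
-- is parallel. In T(X, [Y, Z]) only the vertical part -T(Y, Z) of the bracket counts, because the
-- torsion of two horizontal vectors is vertical; this gives torsion endomorphisms with coefficients
-- 2 g(I_s Y, Z).
lemma horizontal_bianchi (hU : IsOpen U) (hp : p ∈ U) (X Y Z : S.H p) :
    B.curvEnd p X Y Z + B.curvEnd p Y Z X + B.curvEnd p Z X Y
      = ∑ s, ((2 * S.g p (F.I s p X) Y) • B.torEnd p (F.vert B s p) Z
        + (2 * S.g p (F.I s p Y) Z) • B.torEnd p (F.vert B s p) X
        + (2 * S.g p (F.I s p Z) X) • B.torEnd p (F.vert B s p) Y) := by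
  let E (X : S.H p) (q : M) : T (4 * n + 3) q := B.hor q (ext (X : T (4 * n + 3) p) q)
  have hE (X) : Sm (E X) p := B.sm_hor (Sm.ext _)
  have hEp (X : S.H p) : E X p = X := by simp only [E, ext_self, B.hor_coe]
  have hEH (X q) : E X q ∈ S.H q := (B.hor q _).2
  have key (X Y Z : S.H p) : B.hor p (B.cov (fun q => B.cov.torsion q (E Y q) (E Z q)) p (E X p)
      + B.cov.torsion p (E X p) (VectorField.mlieBracket (𝓡 (4 * n + 3)) (E Y) (E Z) p))
      = ∑ s, (2 * S.g p (F.I s p Y) Z) • B.torEnd p (F.vert B s p) X := by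
    have h1 : B.hor p (B.cov (fun q => B.cov.torsion q (E Y q) (E Z q)) p (E X p)) = 0 := by
      refine B.cov_mem_V_of_eventually_mem ((hE Y).torsion B.smooth_cov (hE Z)) ?_ _
      filter_upwards [hU.mem_nhds hp] with q hq
      have := F.torsion_hor B hU hq (E Y q) (E Z q)
      rw [B.hor_of_mem (hEH Y q), B.hor_of_mem (hEH Z q)] at this
      rw [this]
      exact Submodule.sum_mem _ fun s _ => Submodule.smul_mem _ _ (F.vert B s q).2
    have hb : VectorField.mlieBracket (𝓡 (4 * n + 3)) (E Y) (E Z) p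
        = B.cov (E Z) p (E Y p) - B.cov (E Y) p (E Z p) - B.cov.torsion p (E Y p) (E Z p) := by
      rw [torsion_eq (hE Y) (hE Z)]; abel
    have h3 (A : S.H p) (w : T (4 * n + 3) p) (hw : w ∈ S.H p) :
        B.hor p (B.cov.torsion p A w) = 0 := by
      have := F.torsion_hor' B hU hp A ⟨w, hw⟩
      simp only at this
      rw [this, map_sum]
      exact Finset.sum_eq_zero fun s _ => by rw [map_smul, B.hor_of_mem_V (F.vert B s p).2, smul_zero]
    rw [LinearMap.map_add, h1, zero_add, hb, hEp, torsion_sub_sub, LinearMap.map_sub,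
      LinearMap.map_sub,
      h3 _ _ (B.cov_mem_of_eventually_mem (hE Z) (.of_forall (hEH Z)) _),
      h3 _ _ (B.cov_mem_of_eventually_mem (hE Y) (.of_forall (hEH Y)) _), sub_zero, zero_sub,
      hEp, hEp, F.torsion_hor' B hU hp, map_sum, map_sum, ← Finset.sum_neg_distrib]
    refine Finset.sum_congr rfl fun s _ => ?_
    rw [map_smul, map_smul, F.torEnd_eq_neg B hp, map_neg, B.hor_coe, smul_neg, neg_neg]
  have h := congrArg (B.hor p) (first_bianchi B.smooth_cov (hE X) (hE Y) (hE Z))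
  simp only [map_add] at h key
  rw [key X Y Z, key Y Z X, key Z X Y] at h
  simp only [hEp] at h
  simp only [Finset.sum_add_distrib]
  exact Eq.trans h (add_rotate _ _ _).symm

set_option maxHeartbeats 1000000 in
-- The identity is evaluated on (X, Y, ξ_s) and paired with η_t. The curvature terms acting on X and
-- Y are horizontal and drop out. As the torsion on H is parallel, its derivative along ξ_s cancels
-- against the covariant derivatives inside the brackets; there remain the torsion endomorphism T_s
-- and the torsion of pairs of vertical vectors.
lemma vertical_bianchi (hn : 1 ≤ n) (hU : IsOpen U) (hp : p ∈ U) (s t : Fin 3) (X Y : S.H p) :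
    F.η t p (curv B.cov p X Y (F.vert B s p))
      = 2 * S.g p (F.I t p X) (B.torEnd p (F.vert B s p) Y)
        + 2 * S.g p (F.I t p (B.torEnd p (F.vert B s p) X)) Y
        + 2 * ∑ r, F.η t p (B.cov.torsion p (F.vert B r p) (F.vert B s p))
          * S.g p (F.I r p X) Y := by
  let E (X : S.H p) (q : M) : T (4 * n + 3) q := B.hor q (ext (X : T (4 * n + 3) p) q)
  have hE (X) : Sm (E X) p := B.sm_hor (Sm.ext _)
  have hEp (X : S.H p) : E X p = X := by simp only [E, ext_self, B.hor_coe]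
  have hEH (X q) : E X q ∈ S.H q := (B.hor q _).2
  let ξ (q : M) : T (4 * n + 3) q := F.vert B s q
  have hξ : Sm ξ p := F.sm_vert B hU hp s
  have hξV (q) : ξ q ∈ B.V q := (F.vert B s q).2
  have hηH {v : T (4 * n + 3) p} (hv : v ∈ S.H p) : F.η t p v = 0 := F.η_hor hp t ⟨v, hv⟩
  have hTV {v w : T (4 * n + 3) p} (hv : v ∈ B.V p) (hw : w ∈ S.H p) :
      F.η t p (B.cov.torsion p v w) = 0 := hηH (B.torsion_mem_H p v hv ⟨w, hw⟩)
  have hTV' {v w : T (4 * n + 3) p} (hv : v ∈ B.V p) (hw : w ∈ S.H p) :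
      F.η t p (B.cov.torsion p w v) = 0 := by
    rw [B.cov.torsion_antisymm, map_neg, hTV hv hw, neg_zero]
  have hDE (X) (v : T (4 * n + 3) p) : B.cov (E X) p v ∈ S.H p :=
    B.cov_mem_of_eventually_mem (hE X) (.of_forall (hEH X)) v
  have hDξ (v : T (4 * n + 3) p) : B.cov ξ p v ∈ B.V p := by
    have h1 := B.cov_mem_V_of_eventually_mem hξ (.of_forall hξV) v
    have h2 := B.sub_hor_mem (B.cov ξ p v)
    rwa [h1, ZeroMemClass.coe_zero, sub_zero] at h2
  have hb {A C : ∀ q : M, T (4 * n + 3) q} (hA : Sm A p) (hC : Sm C p) :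
      VectorField.mlieBracket (𝓡 (4 * n + 3)) A C p
        = B.cov C p (A p) - B.cov A p (C p) - B.cov.torsion p (A p) (C p) := by
    rw [torsion_eq hA hC]; abel
  have hcov {A : ∀ q : M, T (4 * n + 3) q} (hA : Sm A p) (h : ∀ q, A q ∈ S.H q)
      (v : T (4 * n + 3) p) : F.η t p (B.cov A p v) = 0 :=
    hηH (B.cov_mem_of_eventually_mem hA (.of_forall h) v)
  have h := congrArg (F.η t p) (first_bianchi B.smooth_cov (hE X) (hE Y) hξ)
  have c1 : F.η t p (curv B.cov p (E Y p) (ξ p) (E X p)) = 0 :=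
    hηH (B.curv_mem_H _ _ (hEH X p))
  have c2 : F.η t p (curv B.cov p (ξ p) (E X p) (E Y p)) = 0 :=
    hηH (B.curv_mem_H _ _ (hEH Y p))
  have t1 : F.η t p (B.cov (fun q => B.cov.torsion q (E Y q) (ξ q)) p (E X p)) = 0 := by
    refine hcov ((hE Y).torsion B.smooth_cov hξ) (fun q => ?_) _
    rw [B.cov.torsion_antisymm]
    exact neg_mem (B.torsion_mem_H q _ (hξV q) ⟨_, hEH Y q⟩)
  have t2 : F.η t p (B.cov (fun q => B.cov.torsion q (ξ q) (E X q)) p (E Y p)) = 0 :=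
    hcov (hξ.torsion B.smooth_cov (hE X)) (fun q => B.torsion_mem_H q _ (hξV q) ⟨_, hEH X q⟩) _
  -- This is the place where parallelism of the horizontal torsion is used; both terms reappear with
  -- opposite sign in b1 and b2.
  have t3 : F.η t p (B.cov (fun q => B.cov.torsion q (E X q) (E Y q)) p (ξ p))
      = 2 * S.g p (F.I t p (B.hor p (B.cov (E X) p (ξ p)))) Y
        + 2 * S.g p (F.I t p X) (B.hor p (B.cov (E Y) p (ξ p))) := by
    have h1 := F.cov_torsion_hor B hU hp hn (hE X) (hE Y) (ξ p)
    have h2 (X q) : B.hor q (E X q) = B.hor q (ext (X : T (4 * n + 3) p) q) := B.hor_coe _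
    simp only [h2] at h1
    rw [h1, map_add]
    simp only [ext_self, B.hor_coe]
    rw [F.η_torsion_hor B hU hp, F.η_torsion_hor B hU hp]
  have b1 : F.η t p (B.cov.torsion p (E X p) (VectorField.mlieBracket (𝓡 (4 * n + 3)) (E Y) ξ p))
      = -(2 * S.g p (F.I t p X) (B.hor p (B.cov (E Y) p (ξ p))))
        + 2 * S.g p (F.I t p X) (B.torEnd p (F.vert B s p) Y) := by
    rw [hb (hE Y) hξ, torsion_sub_sub, ContinuousLinearMap.map_sub,
      ContinuousLinearMap.map_sub, hTV' (hDξ _) (hEH X p)]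
    have e1 := F.η_torsion_hor B hU hp t X (B.hor p (B.cov (E Y) p (ξ p)))
    have e2 := F.η_torsion_hor B hU hp t X (B.torEnd p (F.vert B s p) Y)
    rw [B.hor_of_mem (hDE Y _)] at e1
    have e3 : B.cov.torsion p (E Y p) (ξ p) = -(B.torEnd p (F.vert B s p) Y : T (4 * n + 3) p) := by
      rw [hEp, F.torEnd_eq_neg B hp]
    rw [e3, map_neg, map_neg, hEp, e1, e2]
    ring
  have b2 : F.η t p (B.cov.torsion p (E Y p) (VectorField.mlieBracket (𝓡 (4 * n + 3)) ξ (E X) p))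
      = 2 * S.g p (F.I t p Y) (B.hor p (B.cov (E X) p (ξ p)))
        - 2 * S.g p (F.I t p Y) (B.torEnd p (F.vert B s p) X) := by
    rw [hb hξ (hE X), torsion_sub_sub, ContinuousLinearMap.map_sub,
      ContinuousLinearMap.map_sub, hTV' (hDξ _) (hEH Y p)]
    have e1 := F.η_torsion_hor B hU hp t Y (B.hor p (B.cov (E X) p (ξ p)))
    have e2 := F.η_torsion_hor B hU hp t Y (B.torEnd p (F.vert B s p) X)
    rw [B.hor_of_mem (hDE X _)] at e1
    have e3 : B.cov.torsion p (ξ p) (E X p) = (B.torEnd p (F.vert B s p) X : T (4 * n + 3) p) := by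
      rw [hEp, B.coe_torEnd p (hξV p)]
    rw [e3, hEp, e1, e2]
    ring
  have b3 : F.η t p (B.cov.torsion p (ξ p) (VectorField.mlieBracket (𝓡 (4 * n + 3)) (E X) (E Y) p))
      = 2 * ∑ r, F.η t p (B.cov.torsion p (F.vert B r p) (F.vert B s p))
          * S.g p (F.I r p X) Y := by
    rw [hb (hE X) (hE Y), torsion_sub_sub, ContinuousLinearMap.map_sub,
      ContinuousLinearMap.map_sub, hTV (hξV p) (hDE _ _),
      hTV (hξV p) (hDE _ _), hEp, hEp, F.torsion_hor' B hU hp, map_sum, map_sum, sub_zero, zero_sub,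
      ← Finset.sum_neg_distrib, Finset.mul_sum]
    refine Finset.sum_congr rfl fun r _ => ?_
    rw [map_smul, map_smul, smul_eq_mul, B.cov.torsion_antisymm, map_neg]
    ring
  simp only [map_add] at h
  rw [c1, c2, t1, t2, t3, b1, b2, b3, hEp, hEp] at h
  have g1 := (F.quat hp).g_I t Y (B.hor p (B.cov (E X) p (ξ p)))
  have g2 := (F.quat hp).g_I t Y (B.torEnd p (F.vert B s p) X)
  rw [(F.quat hp).symm Y] at g1 g2
  simp only [quat] at g1 g2
  rw [g1, g2] at h
  linarith

end LocalFrame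

namespace Structure.Biquard

variable (B : S.Biquard)

/-- The torsion and the horizontal curvature at a point. -/
def qcurv (hn : 1 ≤ n) (p : M) : QCurv ((S.frame p).quat (S.mem_nhd p)) where
  Tn s := B.torEnd p ((S.frame p).vert B s p)
  c r s t := (S.frame p).η t p
    (B.cov.torsion p ((S.frame p).vert B r p) ((S.frame p).vert B s p))
  R := B.curvEnd p
  ρ s t X Y := (S.frame p).η t p (curv B.cov p X Y ((S.frame p).vert B s p))
  c_anti r s t := by rw [B.cov.torsion_antisymm, map_neg]
  perp_sp s A hA hA' := by
    have h : A ∈ S.spn p := by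
      refine ⟨fun J hJ => ?_, hA'⟩
      rw [(S.frame p).Q_eq p (S.mem_nhd p)] at hJ
      induction hJ using Submodule.span_induction with
      | mem J hJ => obtain ⟨t, rfl⟩ := hJ; exact hA t
      | zero => simp
      | add J K _ _ h1 h2 => rw [mul_add, add_mul, h1, h2]
      | smul c J _ h1 => rw [mul_smul_comm, smul_mul_assoc, h1]
    have := B.torsion_perp p _ ((S.frame p).vert B s p).2 A (Submodule.mem_sup_left h)
    rw [← this]
    refine Finset.sum_congr rfl fun a _ => ?_
    congr 2
    exact Subtype.ext (B.coe_torEnd p ((S.frame p).vert B s p).2 _)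
  perp_I s t := by
    have h : (S.frame p).I t p ∈ S.Q p := by
      rw [(S.frame p).Q_eq p (S.mem_nhd p)]
      exact Submodule.subset_span ⟨t, rfl⟩
    have := B.torsion_perp p _ ((S.frame p).vert B s p).2 _ (Submodule.mem_sup_right h)
    rw [← this]
    refine Finset.sum_congr rfl fun a _ => ?_
    congr 2
    exact Subtype.ext (B.coe_torEnd p ((S.frame p).vert B s p).2 _)
  R_skew X Y Z W := by
    have h := B.curv_gg (X : T (4 * n + 3) p) Y Z W
    simp only [gg, B.hor_coe] at h
    exact h
  R_anti X Y := LinearMap.ext fun Z => Subtype.ext (by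
    rw [LinearMap.neg_apply, NegMemClass.coe_neg, B.coe_curvEnd, B.coe_curvEnd, curv_swap])
  R_I s X Y := (S.frame p).curv_I B (S.isOpen_nhd p) (S.mem_nhd p) s X Y
  bianchi X Y Z W := by
    have h := congrArg (fun v => S.g p v W)
      ((S.frame p).horizontal_bianchi B (S.isOpen_nhd p) (S.mem_nhd p) X Y Z)
    simp only [map_add, map_sum, map_smul, LinearMap.add_apply, LinearMap.sum_apply,
      LinearMap.smul_apply, smul_eq_mul, mul_assoc, ← mul_add, ← Finset.mul_sum] at h
    exact h
  vert s t X Y := (S.frame p).vertical_bianchi B hn (S.isOpen_nhd p) (S.mem_nhd p) s t X Y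

end Structure.Biquard

end Bianchi
-- Commutation of the third covariant derivatives
namespace QCurv

variable {n : ℕ} {V : Type*} [AddCommGroup V] [Module ℝ V] {D : Quat n V} (C : QCurv D)

lemma sum_g_I_I (s t : Fin 3) :
    ∑ a, D.g (D.I s (D.e a)) (D.I t (D.e a)) = if s = t then (4 * n : ℝ) else 0 := by
  have : ∑ a, D.g (D.I s (D.e a)) (D.I t (D.e a)) = -D.tr (D.I t * D.I s) := by
    rw [D.tr_apply, ← Finset.sum_neg_distrib]
    exact Finset.sum_congr rfl fun a _ => by rw [Module.End.mul_apply, D.g_I t, neg_neg]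
  rw [this, D.tr_I_mul_I]
  by_cases h : s = t
  · simp [h]
  · simp [h, Ne.symm h]

lemma sum_g_I_mul (s : Fin 3) (X : V) (f : V →ₗ[ℝ] ℝ) :
    ∑ a, D.g (D.I s (D.e a)) X * f (D.e a) = -f (D.I s X) := by
  rw [← D.sum_apply f, ← Finset.sum_neg_distrib]
  exact Finset.sum_congr rfl fun a _ => by rw [D.g_I, neg_mul]

section Commutation

variable {τ : V →ₗ[ℝ] V →ₗ[ℝ] V →ₗ[ℝ] ℝ} {df : V →ₗ[ℝ] ℝ} {hv hv' : Fin 3 → V →ₗ[ℝ] ℝ}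

/-- Contraction with the skew I_t sees only the skew part in the last two arguments, which is given
by the torsion. It makes the second term of P_f a mixed second derivative in the direction ξ_t. -/
lemma sum_third_I (h1 : ∀ u X Y, τ u X Y - τ u Y X = -∑ s, 2 * D.g (D.I s X) Y * hv s u)
    (t : Fin 3) (Z : V) : ∑ b, τ Z (D.e b) (D.I t (D.e b)) = -(4 * n) * hv t Z := by
  have e1 := sum_I_left (D := D) (τ Z) t
  have e2 : ∑ b, (τ Z (D.e b) (D.I t (D.e b)) - τ Z (D.I t (D.e b)) (D.e b))
      = -(8 * n) * hv t Z := by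
    simp only [h1, Finset.sum_neg_distrib]
    rw [Finset.sum_comm]
    simp only [← Finset.sum_mul, ← Finset.mul_sum, sum_g_I_I, mul_ite, ite_mul, mul_zero, zero_mul,
      Finset.sum_ite_eq', Finset.mem_univ, if_true]
    ring
  rw [Finset.sum_sub_distrib, e1] at e2
  linarith

/-- The contractions of the third covariant derivative of a function. -/
lemma sum_third (hn : 1 ≤ n)
    (h1 : ∀ u X Y, τ u X Y - τ u Y X = -∑ s, 2 * D.g (D.I s X) Y * hv s u)
    (h2 : ∀ X Y Z, τ X Y Z - τ Y X Z
      = -df (C.R X Y Z) - ∑ s, 2 * D.g (D.I s X) Y * hv' s Z)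
    (h3 : ∀ s X, hv' s X - hv s X = -df (C.Tn s X)) (X : V) :
    n * (∑ a, τ (D.e a) (D.e a) X + ∑ s, ∑ a, τ (D.e a) (D.I s (D.e a)) (D.I s X))
        - ∑ a, τ X (D.e a) (D.e a)
      = (n - 1) * (∑ a, τ X (D.e a) (D.e a) + ∑ t, ∑ b, τ (D.I t X) (D.e b) (D.I t (D.e b))
          - 4 * n * C.lam * df X + 4 * n * df (C.Th X)) - 8 * n * (n - 2) * df (C.u X) := by
  have a1 : ∑ a, τ (D.e a) (D.e a) X = ∑ a, τ (D.e a) X (D.e a) + 2 * ∑ s, hv s (D.I s X) := by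
    rw [← sub_eq_iff_eq_add', ← Finset.sum_sub_distrib]
    simp only [h1, Finset.sum_neg_distrib]
    rw [Finset.sum_comm]
    simp only [mul_assoc, ← Finset.mul_sum, sum_g_I_mul, Finset.sum_neg_distrib]
    ring
  have a2 : ∑ a, τ (D.e a) X (D.e a) = ∑ a, τ X (D.e a) (D.e a) + df (C.ric X)
      + 2 * ∑ s, hv' s (D.I s X) := by
    rw [add_assoc, ← sub_eq_iff_eq_add', ← Finset.sum_sub_distrib]
    simp only [h2, Finset.sum_sub_distrib, Finset.sum_neg_distrib]
    rw [Finset.sum_comm]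
    simp only [mul_assoc, ← Finset.mul_sum, sum_g_I_mul, Finset.sum_neg_distrib, ric_apply,
      map_neg, map_sum]
    ring
  have a3 (s : Fin 3) (Z : V) : ∑ a, τ (D.e a) (D.I s (D.e a)) Z
      = -(1 / 2) * df ((∑ a, C.R (D.e a) (D.I s (D.e a))) Z) - 4 * n * hv' s Z := by
    have e1 := sum_I_left (D := D) (LinearMap.mk₂ ℝ (fun x y => τ x y Z) (by simp) (by simp)
      (by simp) (by simp)) s
    simp only [LinearMap.mk₂_apply] at e1
    have e2 : ∑ a, (τ (D.e a) (D.I s (D.e a)) Z - τ (D.I s (D.e a)) (D.e a) Z)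
        = -df ((∑ a, C.R (D.e a) (D.I s (D.e a))) Z) - 8 * n * hv' s Z := by
      simp only [h2, Finset.sum_sub_distrib, Finset.sum_neg_distrib]
      rw [Finset.sum_comm]
      simp only [← Finset.sum_mul, ← Finset.mul_sum, sum_g_I_I, mul_ite, ite_mul, mul_zero,
        zero_mul, Finset.sum_ite_eq', Finset.mem_univ, if_true, LinearMap.sum_apply, map_sum]
      ring
    rw [Finset.sum_sub_distrib, e1] at e2
    linarith
  -- Exchanging the two arguments of the mixed Hessian costs df(T_s ·), and Σ T_s I_s = Θ - 3u, with
  -- Θ the symmetric contraction `Th`.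
  have a4 : ∑ s, hv' s (D.I s X) = ∑ s, hv s (D.I s X) - df (C.Th X) + 3 * df (C.u X) := by
    have e := congrArg (fun A : Module.End ℝ V => df (A X)) (C.sum_Tn_I hn)
    simp only [LinearMap.sum_apply, map_sum, Module.End.mul_apply, LinearMap.sub_apply, map_sub,
      LinearMap.smul_apply, map_smul, smul_eq_mul] at e
    have e2 : ∑ s, (hv' s (D.I s X) - hv s (D.I s X)) = -∑ s, df (C.Tn s (D.I s X)) := by
      rw [← Finset.sum_neg_distrib]
      exact Finset.sum_congr rfl fun s _ => h3 s _
    rw [Finset.sum_sub_distrib] at e2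
    linarith
  have a5 := congrArg (fun A : Module.End ℝ V => df (A X)) (C.ric_sub_half_sum hn)
  simp only [LinearMap.sum_apply, map_sum, Module.End.mul_apply, LinearMap.sub_apply, map_sub,
    LinearMap.smul_apply, map_smul, smul_eq_mul, LinearMap.add_apply, map_add,
    Module.End.one_apply] at a5
  have a6 : ∑ t, ∑ b, τ (D.I t X) (D.e b) (D.I t (D.e b)) = -(4 * n) * ∑ t, hv t (D.I t X) := by
    simp only [sum_third_I h1, ← Finset.mul_sum]
  have a7 : ∑ s, ∑ a, τ (D.e a) (D.I s (D.e a)) (D.I s X)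
      = -(1 / 2) * ∑ s, ∑ a, df (C.R (D.e a) (D.I s (D.e a)) (D.I s X))
        - 4 * n * ∑ s, hv' s (D.I s X) := by
    simp only [a3, Finset.sum_sub_distrib, ← Finset.mul_sum, LinearMap.sum_apply, map_sum]
  rw [a1, a2, a7, a6]
  -- After the substitutions the mixed terms have coefficient 2 in hv and 2 - 4n in hv'. Rewriting
  -- hv' by hv gives 4 - 4n times Σ hv, in accordance with the second term of P_f, and adds (4n -
  -- 2)Θ + (6 - 12n)u to the curvature part.
  linear_combination (n : ℝ) * a5 + (2 - 4 * n) * n * a4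

end Commutation

/-- In dimension seven the tensor `u` vanishes. -/
lemma u_eq_zero (hn : n = 1) : C.u = 0 := by
  have hn' : 1 ≤ n := hn.ge
  subst hn
  let X := D.e 0
  have h00 : D.g X X = 1 := by simp [X, D.orth]
  have hs (s) : D.g (D.I s X) X = 0 := by
    have := D.g_I s X X
    rw [D.symm X] at this
    linarith
  have hs' (s) : D.g X (D.I s X) = 0 := by rw [D.symm, hs]
  have hst (s t) : D.g (D.I s X) (D.I t X) = if s = t then 1 else 0 := by
    have h1 : D.g (D.I s X) (D.I t X) = -D.g ((D.I t * D.I s) X) X := by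
      rw [Module.End.mul_apply, D.g_I t, neg_neg]
    rw [h1, D.I_mul_I]
    simp only [LinearMap.add_apply, LinearMap.smul_apply, LinearMap.sum_apply, map_add, map_sum,
      map_smul, Module.End.one_apply, hs, h00, smul_zero, Finset.sum_const_zero, smul_eq_mul]
    by_cases h : s = t
    · simp [h]
    · simp [h, Ne.symm h]
  -- The vectors X, I_1 X, I_2 X, I_3 X are orthonormal. The parts of the e_a orthogonal to them
  -- have total square norm 4 - 1 - 3 = 0, so these vectors span the space.
  have hw (a) : D.e a = D.g (D.e a) X • X + ∑ s, D.g (D.e a) (D.I s X) • D.I s X := by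
    let w (a) := D.e a - (D.g (D.e a) X • X + ∑ s, D.g (D.e a) (D.I s X) • D.I s X)
    have h1 (a) : D.g (w a) (w a) = 1 - D.g (D.e a) X * D.g (D.e a) X
        - ∑ s, D.g (D.e a) (D.I s X) * D.g (D.e a) (D.I s X) := by
      simp only [w, map_sub, map_add, map_sum, map_smul, LinearMap.sub_apply, LinearMap.add_apply,
        LinearMap.sum_apply, LinearMap.smul_apply, smul_eq_mul, hs, hs', hst, h00, D.orth,
        D.symm X (D.e a), D.symm (D.I _ X) (D.e a), if_true, mul_zero, mul_one, add_zero, mul_ite,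
        Finset.sum_ite_eq, Finset.sum_ite_eq', Finset.mem_univ, Finset.sum_const_zero, zero_add,
        sub_zero]
      ring_nf
      simp
    have h2 : ∑ a, D.g (w a) (w a) = 0 := by
      simp only [h1, Finset.sum_sub_distrib]
      rw [Finset.sum_comm]
      have e (Y : V) : ∑ a, D.g (D.e a) Y * D.g (D.e a) Y = D.g Y Y := by
        rw [D.g_e_sum]
        exact Finset.sum_congr rfl fun a _ => by rw [D.symm]
      simp only [e, h00, hst]
      norm_num
    have h3 := (Finset.sum_eq_zero_iff_of_nonneg fun a _ => D.g_self_nonneg (w a)).1 h2 a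
      (Finset.mem_univ a)
    exact sub_eq_zero.1 (D.eq_zero_of_g_self h3)
  have hu (A Y : V) : D.g (C.u A) Y = D.g A (C.u Y) := by
    rw [← D.g_adj, C.adj_u hn']
  have hI (s) (Y : V) : C.u (D.I s Y) = D.I s (C.u Y) :=
    congrArg (fun A : Module.End ℝ V => A Y) (C.u_I hn' s)
  -- As u is symmetric and commutes with Q, uX is orthogonal to every I_s X. Hence uX = cX, then u =
  -- c on the whole space, and the vanishing trace gives c = 0.
  have h0 (s) : D.g (C.u X) (D.I s X) = 0 := by
    have h1 := D.g_I s (C.u X) X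
    rw [← hI, hu, D.symm] at h1
    linarith
  obtain ⟨c, hc⟩ : ∃ c, c = D.g (C.u X) X := ⟨_, rfl⟩
  have hX : C.u X = c • X := by
    rw [D.expand (C.u X)]
    refine Eq.trans ?_ (congrArg (c • ·) (D.expand X).symm)
    rw [Finset.smul_sum]
    refine Finset.sum_congr rfl fun a _ => ?_
    rw [smul_smul, hw a]
    simp only [map_add, map_sum, map_smul, smul_eq_mul, h0, h00, hs', mul_zero, mul_one, ← hc,
      Finset.sum_const_zero, add_zero]
    rw [mul_comm]
  have he (a) : C.u (D.e a) = c • D.e a := by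
    rw [hw a]
    simp only [map_add, map_sum, map_smul, hI, smul_add, Finset.smul_sum, hX]
    simp only [smul_comm c]
  have ht := C.tr_u hn'
  simp only [D.tr_apply, he, map_smul, LinearMap.smul_apply, D.orth, if_true] at ht
  simp at ht
  refine LinearMap.ext fun Y => ?_
  rw [D.expand Y, map_sum]
  simp [he, ht]

end QCurv

/-! ### Independence of the frame and of the generators of Q -/

namespace Quat

variable {n : ℕ} {V : Type*} [AddCommGroup V] [Module ℝ V] {D D' : Quat n V}

/-- The trace of a bilinear form depends on the metric only. -/
lemma sum_e_eq (hg : D.g = D'.g) (β : V →ₗ[ℝ] V →ₗ[ℝ] ℝ) :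
    ∑ a, β (D.e a) (D.e a) = ∑ a, β (D'.e a) (D'.e a) := by
  have h1 (a) : β (D.e a) (D.e a) = ∑ b, D'.g (D.e a) (D'.e b) * β (D'.e b) (D.e a) := by
    have := congrArg (fun x => β x (D.e a)) (D'.expand (D.e a))
    simpa only [map_sum, map_smul, LinearMap.sum_apply, LinearMap.smul_apply, smul_eq_mul] using this
  simp only [h1]
  rw [Finset.sum_comm]
  refine Finset.sum_congr rfl fun b _ => ?_
  rw [← hg]
  exact D.sum_apply (β (D'.e b)) (D'.e b)

/-- The contraction over the three complex structures depends on their span only. -/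
lemma sum_I_eq (hn : 1 ≤ n)
    (hQ : Submodule.span ℝ (Set.range D.I) = Submodule.span ℝ (Set.range D'.I))
    (β : V →ₗ[ℝ] V →ₗ[ℝ] ℝ) (X Y : V) :
    ∑ s, β (D.I s X) (D.I s Y) = ∑ s, β (D'.I s X) (D'.I s Y) := by
  have h1 (s) : ∃ c : Fin 3 → ℝ, ∑ t, c t • D.I t = D'.I s := by
    have : D'.I s ∈ Submodule.span ℝ (Set.range D.I) := by
      rw [hQ]; exact Submodule.subset_span ⟨s, rfl⟩
    exact (Submodule.mem_span_range_iff_exists_fun ℝ).1 this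
  choose O hO using h1
  have hn0 : (n : ℝ) ≠ 0 := by exact_mod_cast (by omega : n ≠ 0)
  have hJ (s t) : D'.I s * D'.I t + D'.I t * D'.I s = (if s = t then (-2 : ℝ) else 0) • 1 := by
    rw [I_mul_I, I_mul_I]
    fin_cases s <;> fin_cases t <;> simp [eps, Fin.sum_univ_three] <;> module
  -- Both triples are orthonormal up to the same factor for the trace form, so the matrix of the
  -- change of generators is orthogonal.
  have h2 (s t) : ∑ k, O s k * O t k = if s = t then 1 else 0 := by
    have h3 (s t) : D.tr (D'.I s * D'.I t) = -(4 * n) * ∑ k, O s k * O t k := by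
      rw [← hO s, ← hO t, Finset.sum_mul_sum, map_sum, Finset.mul_sum]
      refine Finset.sum_congr rfl fun k _ => ?_
      rw [map_sum]
      simp only [smul_mul_smul_comm, map_smul, D.tr_I_mul_I, smul_eq_mul, mul_ite, mul_zero,
        Finset.sum_ite_eq, Finset.mem_univ, if_true]
      ring
    have h4 := congrArg D.tr (hJ s t)
    rw [map_add, h3, h3, map_smul, D.tr_one] at h4
    have h5 : ∑ k, O t k * O s k = ∑ k, O s k * O t k :=
      Finset.sum_congr rfl fun k _ => mul_comm _ _
    rw [h5] at h4
    have h6 : (8 * n : ℝ) * (∑ k, O s k * O t k - if s = t then 1 else 0) = 0 := by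
      split_ifs at h4 ⊢ <;> simp only [smul_eq_mul] at h4 <;> linarith
    exact sub_eq_zero.1 ((mul_eq_zero.1 h6).resolve_left (by positivity))
  let A : Matrix (Fin 3) (Fin 3) ℝ := .of O
  have hA : A * A.transpose = 1 := by
    ext s t
    rw [Matrix.mul_apply, Matrix.one_apply, ← h2]
    rfl
  have hA' : A.transpose * A = 1 := mul_eq_one_comm.1 hA
  have h3 (t k) : ∑ s, O s t * O s k = if t = k then 1 else 0 := by
    have := congrFun (congrFun hA' t) k
    rw [Matrix.mul_apply, Matrix.one_apply] at this
    exact this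
  have h4 (s) : β (D'.I s X) (D'.I s Y)
      = ∑ t, ∑ k, (O s t * O s k) * β (D.I t X) (D.I k Y) := by
    simp only [← hO s, LinearMap.sum_apply, LinearMap.smul_apply, map_sum, map_smul, smul_eq_mul,
      Finset.mul_sum]
    rw [Finset.sum_comm]
    exact Finset.sum_congr rfl fun t _ => Finset.sum_congr rfl fun k _ => by ring
  simp only [h4]
  rw [Finset.sum_comm]
  refine Finset.sum_congr rfl fun t _ => ?_
  rw [Finset.sum_comm]
  simp only [← Finset.sum_mul, h3, ite_mul, one_mul, zero_mul, Finset.sum_ite_eq, Finset.mem_univ,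
    if_true]

end Quat

/-! ### Covariant derivatives of contracted tensors -/

section Contractions

variable {n : ℕ} {M : Type*} [TopologicalSpace M]
  [ChartedSpace (EuclideanSpace ℝ (Fin (4 * n + 3))) M] [IsManifold (𝓡 (4 * n + 3)) ∞ M]
  {S : Structure n M}

/-- A rank two tensor at a point, restricted to horizontal vectors. -/
def SmForm₂.horBilin {β : ∀ p : M, T (4 * n + 3) p → T (4 * n + 3) p → ℝ} (hβ : SmForm₂ β)
    (S : Structure n M) (p : M) : S.H p →ₗ[ℝ] S.H p →ₗ[ℝ] ℝ :=
  (hβ.bilin p).compl₁₂ (S.H p).subtype (S.H p).subtype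

lemma SmForm₂.horBilin_apply {β : ∀ p : M, T (4 * n + 3) p → T (4 * n + 3) p → ℝ} (hβ : SmForm₂ β)
    (S : Structure n M) (p : M) (X Y : S.H p) : hβ.horBilin S p X Y = β p X Y := rfl

namespace LocalFrame

variable {U : Set M} (F : S.Frame U) (B : S.Biquard) {p : M} {X Y : ∀ q : M, T (4 * n + 3) q}
  {β : ∀ p : M, T (4 * n + 3) p → T (4 * n + 3) p → ℝ}

/-- The vectors `S.e a q` come from a frame selected separately at each point and need not vary
continuously. Their contractions agree with those over one local frame, which are smooth and can be
differentiated. -/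
lemma sum_e_eq (hβ : SmForm₂ β) (hp : p ∈ U) :
    ∑ a, β p (S.e a p) (S.e a p) = ∑ a, β p (F.e a p) (F.e a p) :=
  Quat.sum_e_eq (D := (S.frame p).quat (S.mem_nhd p)) (D' := F.quat hp) rfl (hβ.horBilin S p)

lemma sum_I_eq (hn : 1 ≤ n) (hβ : SmForm₂ β) (hp : p ∈ U) (X Y : S.H p) :
    ∑ s, β p (S.I s p X) (S.I s p Y) = ∑ s, β p (F.I s p X) (F.I s p Y) :=
  Quat.sum_I_eq (D := (S.frame p).quat (S.mem_nhd p)) (D' := F.quat hp) hn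
    (((S.frame p).Q_eq p (S.mem_nhd p)).symm.trans (F.Q_eq p hp)) (hβ.horBilin S p) X Y

variable (hU : IsOpen U) (hp : p ∈ U)
include hU hp

/-- The trace commutes with ∇: the derivatives of the frame enter through a skew matrix against a
symmetric expression. -/
lemma dirDeriv_sum_e (hβ : SmForm₂ β) (u : T (4 * n + 3) p) :
    dirDeriv (fun q => ∑ a, β q (F.e a q) (F.e a q)) p u
      = ∑ a, covTwo B.cov β p u (F.e a p) (F.e a p) := by
  have he (a) := F.sm_e hU hp a
  rw [dirDeriv_sum fun a _ => hβ.smooth (he a) (he a)]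
  have h1 (a) : dirDeriv (fun q => β q (F.e a q) (F.e a q)) p u
      = covTwo B.cov β p u (F.e a p) (F.e a p) + ∑ b,
        B.gg p (B.cov (fun q => (F.e a q : T (4 * n + 3) q)) p u) (F.e b p) •
          (β p (F.e a p) (F.e b p) + β p (F.e b p) (F.e a p)) := by
    rw [covTwo_eq hβ (he a) (he a)]
    have h2 : β p (B.cov (fun q => (F.e a q : T (4 * n + 3) q)) p u) (F.e a p)
        = ∑ b, B.gg p (B.cov (fun q => (F.e a q : T (4 * n + 3) q)) p u) (F.e b p) *
          β p (F.e b p) (F.e a p) := by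
      rw [← SmForm₂.bilin_apply hβ]
      conv_lhs => rw [F.cov_e B hU hp]
      simp
    have h3 : β p (F.e a p) (B.cov (fun q => (F.e a q : T (4 * n + 3) q)) p u)
        = ∑ b, B.gg p (B.cov (fun q => (F.e a q : T (4 * n + 3) q)) p u) (F.e b p) *
          β p (F.e a p) (F.e b p) := by
      rw [← SmForm₂.bilin_apply hβ]
      conv_lhs => rw [F.cov_e B hU hp]
      simp
    simp only [smul_eq_mul, mul_add, Finset.sum_add_distrib]
    rw [h2, h3]
    ring
  simp only [h1, Finset.sum_add_distrib]
  rw [sum_antisymm (fun a b => F.conn_e_antisymm B hU hp a b u)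
    (fun a b => β p (F.e a p) (F.e b p)), add_zero]

lemma dirDeriv_sum_J (hn : 1 ≤ n) (hβ : SmForm₂ β) (hX : Sm X p) (hY : Sm Y p)
    (u : T (4 * n + 3) p) :
    dirDeriv (fun q => ∑ s, β q (F.J B s q (X q)) (F.J B s q (Y q))) p u
      = ∑ s, covTwo B.cov β p u (F.J B s p (X p)) (F.J B s p (Y p))
        + ∑ s, β p (F.J B s p (B.cov X p u)) (F.J B s p (Y p))
        + ∑ s, β p (F.J B s p (X p)) (F.J B s p (B.cov Y p u)) := by
  have hJX (s) := F.sm_J B hU hp s hX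
  have hJY (s) := F.sm_J B hU hp s hY
  rw [dirDeriv_sum fun s _ => hβ.smooth (hJX s) (hJY s)]
  have h1 (s) : dirDeriv (fun q => β q (F.J B s q (X q)) (F.J B s q (Y q))) p u
      = covTwo B.cov β p u (F.J B s p (X p)) (F.J B s p (Y p))
        + β p (F.J B s p (B.cov X p u)) (F.J B s p (Y p))
        + β p (F.J B s p (X p)) (F.J B s p (B.cov Y p u))
        + ∑ t, F.conn B s t p u • (β p (F.J B s p (X p)) (F.J B t p (Y p))
          + β p (F.J B t p (X p)) (F.J B s p (Y p))) := by
    rw [covTwo_eq hβ (hJX s) (hJY s), F.cov_J B hU hp hX, F.cov_J B hU hp hY]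
    simp only [← SmForm₂.bilin_apply hβ, map_add, map_sum, map_smul, LinearMap.add_apply,
      LinearMap.sum_apply, LinearMap.smul_apply, smul_eq_mul, mul_add, Finset.sum_add_distrib]
    ring
  simp only [h1, Finset.sum_add_distrib]
  rw [sum_antisymm (fun s t => F.conn_antisymm B hU hp hn s t u)
    (fun s t => β p (F.J B s p (X p)) (F.J B t p (Y p))), add_zero]

end LocalFrame

namespace Structure.Biquard

variable [T2Space M] (B : S.Biquard) {f : M → ℝ} (hf : ∀ p, SmF (4 * n + 3) f p) {p : M}
include hf

lemma B0_eq (hn : 1 ≤ n) {U : Set M} (F : S.Frame U) (hp : p ∈ U) (v w : T (4 * n + 3) p) :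
    B.B0 f p v w = (hess B.cov f p (B.hor p v) (B.hor p w)
      + ∑ s, hess B.cov f p (F.J B s p v) (F.J B s p w)
      - 1 / n * (∑ a, hess B.cov f p (F.e a p) (F.e a p)) * B.gg p v w) / 4 := by
  have hβ := smForm₂_hess B.smooth_cov hf
  rw [← F.sum_e_eq hβ hp]
  simp only [LocalFrame.J]
  rw [← F.sum_I_eq hn hβ hp]
  simp only [B0, subLap, gg]
  ring

lemma smForm₂_B0 (hn : 1 ≤ n) : SmForm₂ (B.B0 f) := by
  have hβ := smForm₂_hess B.smooth_cov hf
  have hg := B.smForm₂_gg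
  refine ⟨fun p u v w => ?_, fun p c v w => ?_, fun p u v w => ?_, fun p c v w => ?_,
    fun {p X Y} hX hY => ?_⟩
  · simp only [B.B0_eq hf hn (S.frame p) (S.mem_nhd p), LocalFrame.J_add, map_add,
      Submodule.coe_add, hβ.add_left, hg.add_left, Finset.sum_add_distrib]
    ring
  · simp only [B.B0_eq hf hn (S.frame p) (S.mem_nhd p), LocalFrame.J_smul, map_smul,
      Submodule.coe_smul, hβ.smul_left, hg.smul_left, ← Finset.mul_sum]
    ring
  · simp only [B.B0_eq hf hn (S.frame p) (S.mem_nhd p), LocalFrame.J_add, map_add,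
      Submodule.coe_add, hβ.add_right, hg.add_right, Finset.sum_add_distrib]
    ring
  · simp only [B.B0_eq hf hn (S.frame p) (S.mem_nhd p), LocalFrame.J_smul, map_smul,
      Submodule.coe_smul, hβ.smul_right, hg.smul_right, ← Finset.mul_sum]
    ring
  · have hU := S.isOpen_nhd p
    have hp := S.mem_nhd p
    have h1 := (((hβ.smooth (B.sm_hor hX) (B.sm_hor hY)).add (SmF.sum (s := Finset.univ) fun s _ =>
      hβ.smooth ((S.frame p).sm_J B hU hp s hX) ((S.frame p).sm_J B hU hp s hY))).sub
      (((SmF.const (1 / (n : ℝ))).mul (SmF.sum (s := Finset.univ) fun a _ =>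
        hβ.smooth ((S.frame p).sm_e hU hp a) ((S.frame p).sm_e hU hp a))).mul
        (hg.smooth hX hY))).mul (SmF.const (1 / 4))
    refine h1.congr ((hU.eventually_mem hp).mono fun q hq => ?_)
    rw [B.B0_eq hf hn (S.frame p) hq]
    ring

/-- The metric, the trace over H and the sum over the generators of Q are parallel, although the
individual I_s are not. So the derivative passes to the Hessian, with no further correction. -/
lemma covTwo_B0 (hn : 1 ≤ n) {U : Set M} (F : S.Frame U) (hU : IsOpen U) (hp : p ∈ U)
    (u v w : T (4 * n + 3) p) :
    4 * covTwo B.cov (B.B0 f) p u v w = third B.cov f p u (B.hor p v) (B.hor p w)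
      + ∑ s, third B.cov f p u (F.J B s p v) (F.J B s p w)
      - 1 / n * (∑ a, third B.cov f p u (F.e a p) (F.e a p)) * B.gg p v w := by
  have hβ := smForm₂_hess B.smooth_cov hf
  have hg := B.smForm₂_gg
  obtain ⟨X, hX, rfl⟩ : ∃ X : ∀ q : M, T (4 * n + 3) q, Sm X p ∧ X p = v :=
    ⟨ext v, Sm.ext v, ext_self v⟩
  obtain ⟨Y, hY, rfl⟩ : ∃ Y : ∀ q : M, T (4 * n + 3) q, Sm Y p ∧ Y p = w :=
    ⟨ext w, Sm.ext w, ext_self w⟩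
  have e1 := hβ.smooth (B.sm_hor hX) (B.sm_hor hY)
  have e2 : SmF (4 * n + 3) (fun q => ∑ s, hess B.cov f q (F.J B s q (X q)) (F.J B s q (Y q))) p :=
    SmF.sum fun s _ => hβ.smooth (F.sm_J B hU hp s hX) (F.sm_J B hU hp s hY)
  have e3 : SmF (4 * n + 3) (fun q => ∑ a, hess B.cov f q (F.e a q) (F.e a q)) p :=
    SmF.sum fun a _ => hβ.smooth (F.sm_e hU hp a) (F.sm_e hU hp a)
  have e4 := hg.smooth hX hY
  have h1 := covTwo_eq (cov := B.cov) hβ (B.sm_hor hX) (B.sm_hor hY) u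
  rw [B.cov_hor hX, B.cov_hor hY] at h1
  rw [covTwo_eq (B.smForm₂_B0 hf hn) hX hY, dirDeriv_congr
    (k := fun q => 1 / 4 * ((hess B.cov f q (B.hor q (X q)) (B.hor q (Y q))
      + ∑ s, hess B.cov f q (F.J B s q (X q)) (F.J B s q (Y q)))
      - 1 / n * ((∑ a, hess B.cov f q (F.e a q) (F.e a q)) * B.gg q (X q) (Y q))))
    ((hU.eventually_mem hp).mono fun q hq => by rw [B.B0_eq hf hn F hq]; ring),
    dirDeriv_const_mul _ ((e1.add e2).sub ((SmF.const _).mul (e3.mul e4))),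
    dirDeriv_sub (e1.add e2) ((SmF.const _).mul (e3.mul e4)), dirDeriv_add e1 e2,
    dirDeriv_const_mul _ (e3.mul e4), dirDeriv_mul e3 e4, B.dirDeriv_gg hX hY,
    F.dirDeriv_sum_e B hU hp hβ, F.dirDeriv_sum_J B hU hp hn hβ hX hY,
    B.B0_eq hf hn F hp, B.B0_eq hf hn F hp]
  unfold third
  linear_combination -h1

end Structure.Biquard

end Contractions
-- The divergence formula
section Divergence

variable {n : ℕ} {M : Type*} [TopologicalSpace M]
  [ChartedSpace (EuclideanSpace ℝ (Fin (4 * n + 3))) M] [IsManifold (𝓡 (4 * n + 3)) ∞ M]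
  {S : Structure n M}

/-- A rank three tensor at a point, restricted to horizontal vectors. -/
def SmForm₂.horTrilin {β : ∀ p : M, T (4 * n + 3) p → T (4 * n + 3) p → ℝ} (hβ : SmForm₂ β)
    (cov : Conn (4 * n + 3) M) (S : Structure n M) (p : M) :
    S.H p →ₗ[ℝ] S.H p →ₗ[ℝ] S.H p →ₗ[ℝ] ℝ :=
  LinearMap.mk₂ ℝ (fun X Y => (hβ.trilin cov p X Y).comp (S.H p).subtype)
    (fun X X' Y => by ext; simp [SmForm₂.trilin]) (fun c X Y => by ext; simp [SmForm₂.trilin])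
    (fun X Y Y' => by ext; simp [SmForm₂.trilin, covTwo_add_mid hβ])
    (fun c X Y => by ext; simp [SmForm₂.trilin, covTwo_smul_mid hβ])

lemma SmForm₂.horTrilin_apply {β : ∀ p : M, T (4 * n + 3) p → T (4 * n + 3) p → ℝ}
    (hβ : SmForm₂ β) (cov : Conn (4 * n + 3) M) (S : Structure n M) (p : M) (X Y Z : S.H p) :
    hβ.horTrilin cov S p X Y Z = covTwo cov β p X Y Z := rfl

namespace Structure.Biquard

variable (B : S.Biquard) (p : M)

lemma xi_mem (s : Fin 3) : B.xi s p ∈ B.V p := Subtype.mem _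

lemma η_xi (s t : Fin 3) : S.η t p (B.xi s p) = if t = s then 1 else 0 := by
  have : FiniteDimensional ℝ (T (4 * n + 3) p) :=
    inferInstanceAs (FiniteDimensional ℝ (EuclideanSpace ℝ (Fin (4 * n + 3))))
  have h := LinearEquiv.apply_symm_apply
    (LinearEquiv.ofInjectiveOfFinrankEq _ (B.eta_injective p) (B.finrank_V p))
    (Pi.single s (1 : ℝ))
  have h2 := congrFun h t
  rw [Pi.single_apply] at h2
  exact h2

lemma xi_eq (s : Fin 3) : B.xi s p = (S.frame p).vert B s p :=
  (S.frame p).eq_of_mem_V B (S.mem_nhd p) (B.xi_mem p s) ((S.frame p).vert B s p).2 fun t => by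
    rw [(S.frame p).η_vert B (S.mem_nhd p)]
    exact B.η_xi p s t

lemma g_grad (f : M → ℝ) (X : S.H p) :
    S.g p X (B.grad f p) = dirDeriv f p (X : T (4 * n + 3) p) := by
  have h := ((S.frame p).quat (S.mem_nhd p)).expand X
  have h2 := congrArg (fun X : S.H p => dirDeriv f p (X : T (4 * n + 3) p)) h
  simp only [Submodule.coe_sum, Submodule.coe_smul, dirDeriv_vsum, dirDeriv_vsmul] at h2
  rw [h2]
  simp only [grad, map_sum, map_smul, smul_eq_mul]
  exact Finset.sum_congr rfl fun a _ => mul_comm _ _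

section Tensors

variable [T2Space M] (hn : 1 ≤ n)

lemma T0_eq (X Y : S.H p) : B.T0 p X Y = S.g p ((B.qcurv hn p).Th X) Y := by
  refine Eq.trans ?_ ((B.qcurv hn p).g_Th X Y).symm
  simp only [T0, torSymm, tor, xi_eq]
  rfl

lemma U_eq (X Y : S.H p) : B.U p X Y = S.g p ((B.qcurv hn p).u X) Y := by
  refine Eq.trans ?_ ((B.qcurv hn p).g_u hn X Y).symm
  simp only [U, torSkew, tor, xi_eq]
  rfl

/-- The double sum defining S is the trace of the Ricci endomorphism. -/
lemma scal_eq : B.scal p = (B.qcurv hn p).lam := by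
  have h := (B.qcurv hn p).tr_ric hn
  rw [Quat.tr_apply] at h
  simp only [QCurv.g_ric] at h
  have h0 : (8 * n * (n + 2) : ℝ) ≠ 0 := by positivity
  rw [scal, div_eq_iff h0, mul_comm (B.qcurv hn p).lam, ← h]
  rfl

variable {f : M → ℝ} (hf : ∀ p, SmF (4 * n + 3) f p) {p}
include hn hf

/-- Commuting the last two arguments of the third covariant derivative. -/
lemma third_swap_right (u : T (4 * n + 3) p) (X Y : S.H p) :
    third B.cov f p u X Y - third B.cov f p u Y X
      = -∑ s, 2 * S.g p (S.I s p X) Y * hess B.cov f p u (B.xi s p) := by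
  have hU := S.isOpen_nhd p
  have hp := S.mem_nhd p
  have hβ := smForm₂_hess B.smooth_cov hf
  let E (X : S.H p) (q : M) : T (4 * n + 3) q := B.hor q (ext (X : T (4 * n + 3) p) q)
  have hE (X) : Sm (E X) p := B.sm_hor (Sm.ext _)
  have hEp (X : S.H p) : E X p = X := by simp only [E, ext_self, B.hor_coe]
  have hD (X) : B.cov (E X) p u ∈ S.H p :=
    B.cov_mem_of_eventually_mem (hE X) (.of_forall fun q => (B.hor q _).2) u
  have h1 := covTwo_eq (cov := B.cov) hβ (hE X) (hE Y) u
  have h2 := covTwo_eq (cov := B.cov) hβ (hE Y) (hE X) u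
  have hT : Sm (fun q => B.cov.torsion q (E X q) (E Y q)) p := (hE X).torsion B.smooth_cov (hE Y)
  have h3 : dirDeriv (fun q => hess B.cov f q (E X q) (E Y q)) p u
      - dirDeriv (fun q => hess B.cov f q (E Y q) (E X q)) p u
      = -dirDeriv (fun q => dirDeriv f q (B.cov.torsion q (E X q) (E Y q))) p u := by
    rw [← dirDeriv_sub (hβ.smooth (hE X) (hE Y)) (hβ.smooth (hE Y) (hE X)), ← dirDeriv_neg]
    exact dirDeriv_congr (.of_forall fun q => hess_sub_hess hf _ _) u
  have h4 := hess_eq (cov := B.cov) hf hT u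
  -- The skew part of the Hessian is -df of the torsion. Parallelism of the torsion makes the terms
  -- with derivatives of the extensions cancel, leaving a second derivative in the direction T(X,
  -- Y).
  have h5 := (S.frame p).cov_torsion_hor B hU hp hn (hE X) (hE Y) u
  have hh (X : S.H p) (q) : B.hor q (E X q) = B.hor q (ext (X : T (4 * n + 3) p) q) := B.hor_coe _
  simp only [hh] at h5
  simp only [ext_self, B.hor_coe] at h5
  rw [B.hor_of_mem (hD X), B.hor_of_mem (hD Y)] at h5
  have h6 := hess_sub_hess (cov := B.cov) hf (B.cov (E X) p u) (Y : T (4 * n + 3) p)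
  have h7 := hess_sub_hess (cov := B.cov) hf (X : T (4 * n + 3) p) (B.cov (E Y) p u)
  have h8 := congrArg (hess B.cov f p u) ((S.frame p).torsion_hor' B hU hp X Y)
  have h9 : hess B.cov f p u (∑ s, (2 * S.g p ((S.frame p).I s p X) Y) •
      ((S.frame p).vert B s p : T (4 * n + 3) p))
      = ∑ s, 2 * S.g p (S.I s p X) Y * hess B.cov f p u (B.xi s p) := by
    simp only [← SmForm₂.bilin_apply hβ, map_sum, map_smul, smul_eq_mul, xi_eq]
    rfl
  rw [hEp, hEp] at h1 h2
  rw [h9] at h8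
  rw [hEp, hEp, h8] at h4
  have h10 : dirDeriv f p (B.cov (fun q => B.cov.torsion q (E X q) (E Y q)) p u)
      = dirDeriv f p (B.cov.torsion p (B.cov (E X) p u) Y)
        + dirDeriv f p (B.cov.torsion p X (B.cov (E Y) p u)) := by
    rw [← dirDeriv_vadd, ← h5]
  unfold third
  linarith

/-- The divergence formula for the trace-free part of the horizontal Hessian. -/
theorem div_B0 (X : S.H p) :
    4 * ∑ a, covTwo B.cov (B.B0 f) p (S.e a p) (S.e a p) X = ((n : ℝ) - 1) / n * B.P f p X := by
  have hU := S.isOpen_nhd p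
  have hp := S.mem_nhd p
  have hβ := smForm₂_hess B.smooth_cov hf
  let C := B.qcurv hn p
  let τ := hβ.horTrilin B.cov S p
  let df : S.H p →ₗ[ℝ] ℝ :=
    { toFun := fun X => dirDeriv f p (X : T (4 * n + 3) p)
      map_add' := fun X Y => dirDeriv_vadd f _ _
      map_smul' := fun c X => dirDeriv_vsmul f c _ }
  let hv (s : Fin 3) : S.H p →ₗ[ℝ] ℝ := ((hβ.bilin p).flip (B.xi s p)).comp (S.H p).subtype
  let hv' (s : Fin 3) : S.H p →ₗ[ℝ] ℝ := (hβ.bilin p (B.xi s p)).comp (S.H p).subtype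
  have key := C.sum_third (τ := τ) (df := df) (hv := hv) (hv' := hv') hn
    (fun u X Y => B.third_swap_right hn hf (u : T (4 * n + 3) p) X Y)
    (fun X Y Z => by
      have h := third_sub_third (cov := B.cov) B.smooth_cov hf (X : T (4 * n + 3) p) Y Z
      have h2 := congrArg (fun v => hβ.bilin p v (Z : T (4 * n + 3) p))
        ((S.frame p).torsion_hor' B hU hp X Y)
      simp only [map_sum, map_smul, LinearMap.sum_apply, LinearMap.smul_apply, smul_eq_mul] at h2
      simp only [SmForm₂.bilin_apply] at h2
      rw [h2, ← B.coe_curvEnd] at h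
      simp only [hv', xi_eq]
      exact h)
    (fun s X => by
      have h := hess_sub_hess (cov := B.cov) hf (B.xi s p) (X : T (4 * n + 3) p)
      rw [xi_eq, ← B.coe_torEnd p ((S.frame p).vert B s p).2] at h
      simp only [hv, hv', xi_eq]
      exact h) X
  have h1 (a) := B.covTwo_B0 hf hn (S.frame p) hU hp (S.e a p) (S.e a p) X
  have h2 : ∑ a, B.gg p (S.e a p) X
      * (∑ b, third B.cov f p (S.e a p) ((S.frame p).e b p) ((S.frame p).e b p))
      = ∑ b, third B.cov f p X (S.e b p) (S.e b p) := by
    have := ((S.frame p).quat hp).sum_apply (∑ b, (τ.flip (S.e b p)).flip (S.e b p)) X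
    simp only [LinearMap.sum_apply, LinearMap.flip_apply] at this
    simp only [gg, B.hor_coe]
    exact this
  have h3 : 4 * ∑ a, covTwo B.cov (B.B0 f) p (S.e a p) (S.e a p) X
      = ∑ a, third B.cov f p (S.e a p) (S.e a p) X
        + ∑ s, ∑ a, third B.cov f p (S.e a p) (S.I s p (S.e a p)) (S.I s p X)
        - 1 / n * ∑ b, third B.cov f p X (S.e b p) (S.e b p) := by
    rw [Finset.mul_sum, ← h2, Finset.mul_sum, Finset.sum_comm, ← Finset.sum_add_distrib,
      ← Finset.sum_sub_distrib]
    refine Finset.sum_congr rfl fun a _ => ?_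
    rw [h1]
    simp only [LocalFrame.J, B.hor_coe]
    rw [mul_assoc, mul_comm (∑ b, third B.cov f p (S.e a p) ((S.frame p).e b p) _)]
    rfl
  have h4 : (n : ℝ) * (∑ a, third B.cov f p (S.e a p) (S.e a p) X
      + ∑ s, ∑ a, third B.cov f p (S.e a p) (S.I s p (S.e a p)) (S.I s p X))
      - ∑ b, third B.cov f p X (S.e b p) (S.e b p) = (n - 1) * (∑ b, third B.cov f p X (S.e b p) (S.e b p)
        + ∑ t, ∑ b, third B.cov f p (S.I t p X) (S.e b p) (S.I t p (S.e b p))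
        - 4 * n * B.scal p * dirDeriv f p (X : T (4 * n + 3) p) + 4 * n * B.T0 p X (B.grad f p))
        - 8 * n * (n - 2) * B.U p X (B.grad f p) := by
    rw [B.T0_eq p hn, B.U_eq p hn, B.scal_eq p hn, g_grad, g_grad]
    exact key
  have hn0 : (n : ℝ) ≠ 0 := by positivity
  rw [h3]
  -- For n = 1 the term with u has no factor n - 1 to be absorbed, but u itself is zero and both
  -- sides vanish. For n ≥ 2 one divides by n - 1, which produces the coefficient of U in P_f.
  by_cases h : n = 1
  · have hu : B.U p X (B.grad f p) = 0 := by
      rw [B.U_eq p hn, C.u_eq_zero h]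
      simp
    have hnr : (n : ℝ) = 1 := by exact_mod_cast h
    rw [hu, hnr] at h4
    rw [hnr]
    linarith
  · have h5 : (n : ℝ) - 1 ≠ 0 := sub_ne_zero.2 (by exact_mod_cast h)
    simp only [P, h, if_false, B.hor_coe]
    field_simp
    linarith

end Tensors

end Structure.Biquard

end Divergence
-- The algebra of η₁ ∧ η₂ ∧ η₃ ∧ ω₁ ∧ ⋯ ∧ ω₁
section Wedge

/-- Three indices for the vertical directions and `2n` pairs of indices for the horizontal ones. -/
abbrev Ix (n : ℕ) := Fin 3 ⊕ (Fin (2 * n) × Fin 2)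

/-- The numbering of the indices in the definition of the volume form. -/
def ixEquiv (n : ℕ) : Ix n ≃ Fin (4 * n + 3) :=
  (Equiv.sumCongr (Equiv.refl _) finProdFinEquiv).trans (finSumFinEquiv.trans (finCongr (by omega)))

lemma ixEquiv_inl (n : ℕ) (s : Fin 3) : ixEquiv n (.inl s) = ⟨s, by omega⟩ := by
  ext; simp [ixEquiv]

lemma ixEquiv_zero (n : ℕ) (i : Fin (2 * n)) : ixEquiv n (.inr (i, 0)) = ⟨3 + 2 * i, by omega⟩ := by
  ext; simp [ixEquiv]

lemma ixEquiv_one (n : ℕ) (i : Fin (2 * n)) : ixEquiv n (.inr (i, 1)) = ⟨4 + 2 * i, by omega⟩ := by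
  ext; simp [ixEquiv]; omega

variable {n : ℕ} {V : Type*} [AddCommGroup V] [Module ℝ V]

/-- The factors of `η₁ ⊗ η₂ ⊗ η₃ ⊗ w₂ ⊗ ⋯ ⊗ w₂`. -/
def tensorFactor (η : Fin 3 → V →ₗ[ℝ] ℝ) (w₂ : V →ₗ[ℝ] V →ₗ[ℝ] ℝ) :
    Fin 3 ⊕ Fin (2 * n) → (Ix n → V) → ℝ
  | .inl s, w => η s (w (.inl s))
  | .inr i, w => w₂ (w (.inr (i, 0))) (w (.inr (i, 1)))

/-- The position of the factor which contains a given index. -/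
def factorIx : Ix n → Fin 3 ⊕ Fin (2 * n)
  | .inl s => .inl s
  | .inr i => .inr i.1

lemma tensorFactor_update_ne [DecidableEq (Ix n)] (η : Fin 3 → V →ₗ[ℝ] ℝ)
    (w₂ : V →ₗ[ℝ] V →ₗ[ℝ] ℝ) {j : Ix n} {k : Fin 3 ⊕ Fin (2 * n)} (h : k ≠ factorIx j)
    (w : Ix n → V) (x : V) :
    tensorFactor η w₂ k (Function.update w j x) = tensorFactor η w₂ k w := by
  have h1 {l : Ix n} (hl : factorIx l = k) : Function.update w j x l = w l :=
    Function.update_of_ne (by rintro rfl; exact h hl.symm) _ _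
  rcases k with s | i
  · simp only [tensorFactor]
    rw [h1 rfl]
  · simp only [tensorFactor]
    rw [h1 rfl, h1 rfl]

lemma tensorFactor_update_add [DecidableEq (Ix n)] (η : Fin 3 → V →ₗ[ℝ] ℝ)
    (w₂ : V →ₗ[ℝ] V →ₗ[ℝ] ℝ) (j : Ix n) (w : Ix n → V) (x y : V) :
    tensorFactor η w₂ (factorIx j) (Function.update w j (x + y))
      = tensorFactor η w₂ (factorIx j) (Function.update w j x)
        + tensorFactor η w₂ (factorIx j) (Function.update w j y) := by
  rcases j with s | ⟨i, ε⟩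
  · simp [tensorFactor, factorIx]
  · fin_cases ε <;> simp [tensorFactor, factorIx, Function.update_apply]

lemma tensorFactor_update_smul [DecidableEq (Ix n)] (η : Fin 3 → V →ₗ[ℝ] ℝ)
    (w₂ : V →ₗ[ℝ] V →ₗ[ℝ] ℝ) (j : Ix n) (w : Ix n → V) (c : ℝ) (x : V) :
    tensorFactor η w₂ (factorIx j) (Function.update w j (c • x))
      = c * tensorFactor η w₂ (factorIx j) (Function.update w j x) := by
  rcases j with s | ⟨i, ε⟩
  · simp [tensorFactor, factorIx]
  · fin_cases ε <;> simp [tensorFactor, factorIx, Function.update_apply]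

/-- The multilinear form `η₁ ⊗ η₂ ⊗ η₃ ⊗ w₂ ⊗ ⋯ ⊗ w₂`. -/
def tensorForm (n : ℕ) (η : Fin 3 → V →ₗ[ℝ] ℝ) (w₂ : V →ₗ[ℝ] V →ₗ[ℝ] ℝ) :
    MultilinearMap ℝ (fun _ : Ix n => V) ℝ where
  toFun w := ∏ k, tensorFactor η w₂ k w
  map_update_add' w j x y := by
    have h (x : V) := Finset.mul_prod_erase Finset.univ
      (fun k => tensorFactor η w₂ k (Function.update w j x)) (Finset.mem_univ (factorIx j))
    have h2 (x : V) : ∏ k ∈ Finset.univ.erase (factorIx j),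
        tensorFactor η w₂ k (Function.update w j x)
        = ∏ k ∈ Finset.univ.erase (factorIx j), tensorFactor η w₂ k w :=
      Finset.prod_congr rfl fun k hk => tensorFactor_update_ne η w₂ (Finset.ne_of_mem_erase hk) w x
    rw [← h, ← h, ← h, h2, h2, h2, tensorFactor_update_add, add_mul]
  map_update_smul' w j c x := by
    have h (x : V) := Finset.mul_prod_erase Finset.univ
      (fun k => tensorFactor η w₂ k (Function.update w j x)) (Finset.mem_univ (factorIx j))
    have h2 (x : V) : ∏ k ∈ Finset.univ.erase (factorIx j),
        tensorFactor η w₂ k (Function.update w j x)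
        = ∏ k ∈ Finset.univ.erase (factorIx j), tensorFactor η w₂ k w :=
      Finset.prod_congr rfl fun k hk => tensorFactor_update_ne η w₂ (Finset.ne_of_mem_erase hk) w x
    rw [← h, ← h, h2, h2, tensorFactor_update_smul, smul_eq_mul, mul_assoc]

/-- The alternating form `η₁ ∧ η₂ ∧ η₃ ∧ w₂ ∧ ⋯ ∧ w₂`, without a normalizing factor. -/
def wedgeForm (n : ℕ) (η : Fin 3 → V →ₗ[ℝ] ℝ) (w₂ : V →ₗ[ℝ] V →ₗ[ℝ] ℝ) : V [⋀^Ix n]→ₗ[ℝ] ℝ :=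
  MultilinearMap.alternatization (tensorForm n η w₂)

lemma wedgeForm_apply (η : Fin 3 → V →ₗ[ℝ] ℝ) (w₂ : V →ₗ[ℝ] V →ₗ[ℝ] ℝ) (w : Ix n → V) :
    wedgeForm n η w₂ w = ∑ τ : Equiv.Perm (Ix n), ((Equiv.Perm.sign τ : ℤ) : ℝ) *
      ((∏ s, η s (w (τ (.inl s)))) * ∏ i, w₂ (w (τ (.inr (i, 0)))) (w (τ (.inr (i, 1))))) := by
  rw [wedgeForm, MultilinearMap.alternatization_apply]
  refine Finset.sum_congr rfl fun τ _ => ?_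
  rw [MultilinearMap.domDomCongr_apply]
  simp only [tensorForm, MultilinearMap.coe_mk, Fintype.prod_sum_type, tensorFactor]
  rw [Units.smul_def, zsmul_eq_mul]

/-- The standard symplectic matrix. -/
def sympl : Ix n → Ix n → ℝ
  | .inr (i, ε), .inr (j, δ) => if i = j then !![0, 1; -1, 0] ε δ else 0
  | _, _ => 0

/-- The value of `η₁ ∧ η₂ ∧ η₃ ∧ w₂ ∧ ⋯ ∧ w₂` on a symplectic basis. -/
def wedgeConst (n : ℕ) : ℝ := ∑ τ : Equiv.Perm (Ix n), ((Equiv.Perm.sign τ : ℤ) : ℝ) *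
  ((∏ s : Fin 3, if τ (.inl s) = .inl s then 1 else 0)
    * ∏ i, sympl (τ (.inr (i, 0))) (τ (.inr (i, 1))))

lemma sympl_eq_sign (ρ : Equiv.Perm (Fin 2)) :
    (!![0, 1; -1, 0] : Matrix (Fin 2) (Fin 2) ℝ) (ρ 0) (ρ 1) = ((Equiv.Perm.sign ρ : ℤ) : ℝ) := by
  have h : ρ = 1 ∨ ρ = Equiv.swap 0 1 := by
    revert ρ; decide
  rcases h with rfl | rfl
  · simp
  · simp [Equiv.Perm.sign_swap]

/-- A permutation contributes only if it fixes the three vertical indices and carries pairs to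
pairs, possibly reversing some. Its sign and the product of the symplectic entries are then both the
product of the signs of the reversals, so each nonzero contribution is a square, and the identity
contributes 1. -/
lemma wedgeConst_pos (n : ℕ) : 0 < wedgeConst n := by
  refine Finset.sum_pos' (fun τ _ => ?_) ⟨1, Finset.mem_univ _, by simp [sympl]⟩
  by_cases h0 : (∏ s : Fin 3, if τ (.inl s) = .inl s then (1 : ℝ) else 0)
    * ∏ i, sympl (τ (.inr (i, 0))) (τ (.inr (i, 1))) = 0
  · rw [h0, mul_zero]
  have h1 := left_ne_zero_of_mul h0
  have h2 := right_ne_zero_of_mul h0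
  have h3 (s : Fin 3) : τ (.inl s) = .inl s := by
    have := Finset.prod_ne_zero_iff.1 h1 s (Finset.mem_univ s)
    by_contra hs
    simp [hs] at this
  have h4 (i : Fin (2 * n)) : ∃ (a : Fin (2 * n)) (ρ : Equiv.Perm (Fin 2)),
      ∀ ε, τ (.inr (i, ε)) = .inr (a, ρ ε) := by
    have := Finset.prod_ne_zero_iff.1 h2 i (Finset.mem_univ i)
    rcases e0 : τ (.inr (i, 0)) with s | ⟨a, ε⟩
    · simp [e0, sympl] at this
    rcases e1 : τ (.inr (i, 1)) with s | ⟨b, δ⟩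
    · simp [e1, sympl] at this
    rw [e0, e1] at this
    simp only [sympl] at this
    split_ifs at this with hab
    · subst hab
      fin_cases ε <;> fin_cases δ
      · simp at this
      · exact ⟨a, 1, fun x => by fin_cases x <;> simp [e0, e1]⟩
      · exact ⟨a, Equiv.swap 0 1, fun x => by fin_cases x <;> simp [e0, e1]⟩
      · simp at this
    · exact absurd rfl this
  choose σ ρ hσ using h4
  have hinj : Function.Injective σ := fun i j hij => by
    have e : τ (.inr (i, (ρ i).symm 0)) = τ (.inr (j, (ρ j).symm 0)) := by
      rw [hσ, hσ, Equiv.apply_symm_apply, Equiv.apply_symm_apply, hij]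
    exact congrArg Prod.fst (Sum.inr_injective (τ.injective e))
  let σ' : Equiv.Perm (Fin (2 * n)) := Equiv.ofBijective σ (Finite.injective_iff_bijective.1 hinj)
  have hτ : τ = Equiv.Perm.sumCongr 1
      (Equiv.prodCongrLeft (fun _ => σ') * Equiv.prodCongrRight ρ) := by
    ext1 x
    rcases x with s | ⟨i, ε⟩
    · simp [h3]
    · simp [hσ, σ']
  -- The permutation of the pairs acts on both members of every pair, so its sign enters squared.
  have hs : (Equiv.Perm.sign τ : ℤ) = ∏ i, (Equiv.Perm.sign (ρ i) : ℤ) := by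
    rw [hτ, Equiv.Perm.sign_sumCongr, Equiv.Perm.sign_mul, Equiv.Perm.sign_prodCongrLeft,
      Equiv.Perm.sign_prodCongrRight]
    simp
  have hp : ∏ i, sympl (τ (.inr (i, 0))) (τ (.inr (i, 1)))
      = ∏ i, ((Equiv.Perm.sign (ρ i) : ℤ) : ℝ) :=
    Finset.prod_congr rfl fun i _ => by rw [hσ, hσ, ← sympl_eq_sign]; simp [sympl]
  rw [hp, hs]
  simp only [h3, if_true, Finset.prod_const_one, one_mul, Int.cast_prod]
  exact mul_self_nonneg _

lemma wedgeForm_symplectic {η : Fin 3 → V →ₗ[ℝ] ℝ} {w₂ : V →ₗ[ℝ] V →ₗ[ℝ] ℝ} {b : Ix n → V}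
    (h1 : ∀ s k, η s (b k) = if k = .inl s then 1 else 0) (h2 : ∀ k l, w₂ (b k) (b l) = sympl k l) :
    wedgeForm n η w₂ b = wedgeConst n := by
  rw [wedgeForm_apply, wedgeConst]
  simp only [h1, h2]

/-- The determinant between bases that are orthonormal for the same form is `±1`. -/
lemma abs_det_of_orthonormal {ι : Type*} [Fintype ι] [DecidableEq ι] (b b' : Module.Basis ι ℝ V)
    (G : V →ₗ[ℝ] V →ₗ[ℝ] ℝ) (h : ∀ i j, G (b i) (b j) = if i = j then 1 else 0)
    (h' : ∀ i j, G (b' i) (b' j) = if i = j then 1 else 0) : |b.det b'| = 1 := by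
  let Q := b.toMatrix b'
  have h1 (j) : b' j = ∑ i, Q i j • b i := (b.sum_toMatrix_smul_self b' j).symm
  have h2 : Q.transpose * Q = 1 := by
    ext j k
    have h3 := h' j k
    rw [h1 j, h1 k] at h3
    simp only [map_sum, map_smul, LinearMap.sum_apply, LinearMap.smul_apply, smul_eq_mul, h,
      mul_ite, mul_one, mul_zero, Finset.sum_ite_eq, Finset.sum_ite_eq', Finset.mem_univ,
      if_true] at h3
    rw [Matrix.mul_apply, Matrix.one_apply, ← h3]
    exact Finset.sum_congr rfl fun i _ => by rw [Matrix.transpose_apply, mul_comm]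
  have h3 := congrArg Matrix.det h2
  rw [Matrix.det_mul, Matrix.det_transpose, Matrix.det_one] at h3
  rw [b.det_apply]
  exact (abs_eq (by norm_num)).2 (mul_self_eq_one_iff.1 h3)

/-- Alternating forms of top degree which take the same value up to sign on orthonormal bases. -/
lemma abs_alternating_eq {ι : Type*} [Fintype ι] [DecidableEq ι] (b b' : Module.Basis ι ℝ V)
    (G : V →ₗ[ℝ] V →ₗ[ℝ] ℝ) (h : ∀ i j, G (b i) (b j) = if i = j then 1 else 0)
    (h' : ∀ i j, G (b' i) (b' j) = if i = j then 1 else 0) (Ω : V [⋀^ι]→ₗ[ℝ] ℝ) (v : ι → V) :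
    |Ω v| = |Ω b| * |b'.det v| := by
  have e1 := congrArg (fun Ω : V [⋀^ι]→ₗ[ℝ] ℝ => Ω v) (Ω.eq_smul_basis_det b')
  have e2 := congrArg (fun Ω : V [⋀^ι]→ₗ[ℝ] ℝ => Ω b') (Ω.eq_smul_basis_det b)
  simp only [AlternatingMap.smul_apply, smul_eq_mul] at e1 e2
  rw [e1, e2, abs_mul, abs_mul, abs_det_of_orthonormal b b' G h h', mul_one]

end Wedge

namespace Quat

variable {n : ℕ} {V : Type*} [AddCommGroup V] [Module ℝ V] (D : Quat n V)

/-- Partial unitary bases for one of the complex structures. -/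
lemma exists_unitary (s : Fin 3) (k : ℕ) (hk : k ≤ 2 * n) : ∃ E : Fin k → V,
    (∀ i j, D.g (E i) (E j) = if i = j then 1 else 0) ∧ ∀ i j, D.g (D.I s (E i)) (E j) = 0 := by
  induction k with
  | zero => exact ⟨Fin.elim0, fun i => i.elim0, fun i => i.elim0⟩
  | succ k ih =>
    obtain ⟨E, h1, h2⟩ := ih (by omega)
    let b : Module.Basis (Fin (4 * n)) ℝ V := Module.Basis.mk (v := D.e)
      (by
        rw [Fintype.linearIndependent_iff]
        intro c hc a
        have := congrArg (fun X => D.g X (D.e a)) hc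
        simpa [D.orth] using this)
      (fun X _ => by
        rw [D.expand X]
        exact Submodule.sum_mem _ fun a _ => Submodule.smul_mem _ _ (Submodule.subset_span ⟨a, rfl⟩))
    have hfd : FiniteDimensional ℝ V := b.finiteDimensional_of_finite
    have hfr : Module.finrank ℝ V = 4 * n := by
      rw [Module.finrank_eq_card_basis b, Fintype.card_fin]
    -- Orthogonality to E_i and I_s E_i for i < k amounts to 2k conditions, and 2k < 4n, so a
    -- nonzero solution exists.
    let L : V →ₗ[ℝ] (Fin k ⊕ Fin k → ℝ) := LinearMap.pi
      (Sum.elim (fun i => D.g (E i)) fun i => D.g (D.I s (E i)))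
    obtain ⟨X, hX, hX0⟩ : ∃ X, L X = 0 ∧ X ≠ 0 := by
      by_contra! hcon
      have := LinearMap.finrank_le_finrank_of_injective
        ((injective_iff_map_eq_zero L).2 fun X hX => hcon X hX)
      rw [hfr, Module.finrank_fintype_fun_eq_card, Fintype.card_sum, Fintype.card_fin] at this
      omega
    have hE (i) : D.g (E i) X = 0 := congrFun hX (Sum.inl i)
    have hIE (i) : D.g (D.I s (E i)) X = 0 := congrFun hX (Sum.inr i)
    have hpos : 0 < D.g X X := lt_of_le_of_ne (D.g_self_nonneg X) fun h =>
      hX0 (D.eq_zero_of_g_self h.symm)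
    let c := (Real.sqrt (D.g X X))⁻¹
    have hc : c * (c * D.g X X) = 1 := by
      have hs := Real.mul_self_sqrt hpos.le
      have h0 : Real.sqrt (D.g X X) ≠ 0 := (Real.sqrt_pos.2 hpos).ne'
      simp only [c]
      field_simp
      linarith
    have hIX : D.g (D.I s X) X = 0 := by
      have := D.g_I s X X
      rw [D.symm X] at this
      linarith
    refine ⟨Fin.snoc E (c • X), fun i j => ?_, fun i j => ?_⟩
    · refine Fin.lastCases ?_ (fun i => ?_) i <;> refine Fin.lastCases ?_ (fun j => ?_) j
      · simp [hc]
      · simp [D.symm X, hE, Ne.symm (Fin.castSucc_lt_last j).ne]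
      · simp [hE, (Fin.castSucc_lt_last i).ne]
      · simp [h1]
    · refine Fin.lastCases ?_ (fun i => ?_) i <;> refine Fin.lastCases ?_ (fun j => ?_) j
      · simp [hIX]
      · have : D.g (D.I s X) (E j) = 0 := by
          rw [D.g_I, D.symm, hIE, neg_zero]
        simp [this]
      · simp [hIE]
      · simp [h2]

end Quat
-- The volume form in an adapted frame
section Volume

variable {n : ℕ} {M : Type*} [TopologicalSpace M]
  [ChartedSpace (EuclideanSpace ℝ (Fin (4 * n + 3))) M] [IsManifold (𝓡 (4 * n + 3)) ∞ M]
  {S : Structure n M}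

lemma finrank_T {m : ℕ} [ChartedSpace (EuclideanSpace ℝ (Fin m)) M] (p : M) :
    Module.finrank ℝ (T m p) = m :=
  finrank_euclideanSpace_fin

/-- The indices of the members of a frame of the tangent bundle. -/
abbrev FIx (n : ℕ) := Fin 3 ⊕ Fin (4 * n)

/-- The horizontal indices in pairs. -/
def pairEquiv (n : ℕ) : FIx n ≃ Ix n :=
  Equiv.sumCongr (Equiv.refl _) ((finCongr (by omega)).trans finProdFinEquiv.symm)

/-- The numbering of the members of a frame. -/
def frameIx (n : ℕ) : FIx n ≃ Fin (4 * n + 3) := (pairEquiv n).trans (ixEquiv n)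

namespace LocalFrame

variable {U : Set M} (F : S.Frame U) (B : S.Biquard) {p : M}

/-- The frame of the tangent bundle which consists of the vertical and the horizontal frame. -/
def vec : FIx n → ∀ q : M, T (4 * n + 3) q :=
  Sum.elim (fun s q => F.vert B s q) (fun a q => F.e a q)

/-- The coframe dual to `LocalFrame.vec`. -/
def coord : FIx n → ∀ q : M, T (4 * n + 3) q → ℝ :=
  Sum.elim (fun s q v => F.η s q v) (fun a q v => B.gg q v (F.e a q))

@[simp] lemma vec_inl (s : Fin 3) (q : M) : F.vec B (.inl s) q = F.vert B s q := rfl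
@[simp] lemma vec_inr (a : Fin (4 * n)) (q : M) : F.vec B (.inr a) q = F.e a q := rfl
@[simp] lemma coord_inl (s : Fin 3) (q : M) (v : T (4 * n + 3) q) :
    F.coord B (.inl s) q v = F.η s q v := rfl
@[simp] lemma coord_inr (a : Fin (4 * n)) (q : M) (v : T (4 * n + 3) q) :
    F.coord B (.inr a) q v = B.gg q v (F.e a q) := rfl

lemma coord_add (k : FIx n) (v w : T (4 * n + 3) p) :
    F.coord B k p (v + w) = F.coord B k p v + F.coord B k p w := by
  rcases k with s | a
  · simp
  · simp [Structure.Biquard.gg]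

lemma coord_smul (k : FIx n) (c : ℝ) (v : T (4 * n + 3) p) :
    F.coord B k p (c • v) = c * F.coord B k p v := by
  rcases k with s | a
  · simp
  · simp [Structure.Biquard.gg]

lemma coord_sum (k : FIx n) {ι : Type*} (s : Finset ι) (v : ι → T (4 * n + 3) p) :
    F.coord B k p (∑ i ∈ s, v i) = ∑ i ∈ s, F.coord B k p (v i) := by
  rcases k with s | a
  · simp
  · simp [Structure.Biquard.gg]

lemma coord_vec (hp : p ∈ U) (k l : FIx n) :
    F.coord B k p (F.vec B l p) = if k = l then 1 else 0 := by
  rcases k with s | a <;> rcases l with t | b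
  · simp [F.η_vert B hp]
  · simp [F.η_hor hp]
  · simp [Structure.Biquard.gg, B.hor_of_mem_V (F.vert B t p).2]
  · simp [Structure.Biquard.gg, F.orthonormal p hp, eq_comm]

lemma sum_coord (hp : p ∈ U) (v : T (4 * n + 3) p) :
    ∑ k, F.coord B k p v • F.vec B k p = v := by
  have h1 := congrArg Subtype.val ((F.quat hp).expand (B.hor p v))
  rw [Fintype.sum_sum_type]
  refine (add_comm (∑ s, F.coord B (.inl s) p v • F.vec B (.inl s) p) _).trans ?_
  conv_rhs => rw [F.expand B hp v, h1]
  simp [Structure.Biquard.gg, quat]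

/-- The frame of the tangent bundle at a point, as a basis. -/
def basis (hp : p ∈ U) : Module.Basis (FIx n) ℝ (T (4 * n + 3) p) :=
  Module.Basis.ofEquivFun
    { toFun := fun v k => F.coord B k p v
      invFun := fun c => ∑ k, c k • F.vec B k p
      map_add' := fun v w => funext fun k => F.coord_add B k v w
      map_smul' := fun c v => funext fun k => F.coord_smul B k c v
      left_inv := fun v => F.sum_coord B hp v
      right_inv := fun c => funext fun k => by
        simp only [coord_sum, coord_smul, F.coord_vec B hp]
        simp }

lemma basis_repr (hp : p ∈ U) (v : T (4 * n + 3) p) (k : FIx n) :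
    (F.basis B hp).repr v k = F.coord B k p v := rfl

lemma basis_apply (hp : p ∈ U) (k : FIx n) : F.basis B hp k = F.vec B k p := by
  refine (F.basis B hp).repr.injective (Finsupp.ext fun l => ?_)
  rw [Module.Basis.repr_self, basis_repr, F.coord_vec B hp, Finsupp.single_apply]
  simp [eq_comm]

/-- The Riemannian metric for which the frame is orthonormal. -/
def metric (p : M) : T (4 * n + 3) p →ₗ[ℝ] T (4 * n + 3) p →ₗ[ℝ] ℝ :=
  B.smForm₂_gg.bilin p + ∑ s, (F.η s p).toLinearMap.smulRight (F.η s p).toLinearMap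

lemma metric_apply (v w : T (4 * n + 3) p) :
    F.metric B p v w = B.gg p v w + ∑ s, F.η s p v * F.η s p w := by
  simp [metric, LinearMap.sum_apply]

lemma metric_basis (hp : p ∈ U) (k l : FIx n) :
    F.metric B p (F.basis B hp k) (F.basis B hp l) = if k = l then 1 else 0 := by
  rw [basis_apply, basis_apply, metric_apply]
  rcases k with s | a <;> rcases l with t | b
  · simp [F.η_vert B hp, Structure.Biquard.gg, B.hor_of_mem_V (F.vert B _ p).2, eq_comm]
  · simp [F.η_hor hp, Structure.Biquard.gg, B.hor_of_mem_V (F.vert B _ p).2]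
  · simp [F.η_hor hp, Structure.Biquard.gg, B.hor_of_mem_V (F.vert B _ p).2]
  · simp [F.η_hor hp, Structure.Biquard.gg, F.orthonormal p hp]

/-- The metric does not depend on the frame. -/
lemma metric_eq [T2Space M] (hn : 1 ≤ n) (hU : IsOpen U) (hp : p ∈ U) {U' : Set M} (F' : S.Frame U')
    (hU' : IsOpen U') (hp' : p ∈ U') : F.metric B p = F'.metric B p := by
  let A : Matrix (Fin 3) (Fin 3) ℝ := .of fun s t => F'.η s p (F.vert B t p)
  have h1 (s) (v : T (4 * n + 3) p) : F'.η s p v = ∑ t, A s t * F.η t p v := by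
    conv_lhs => rw [F.expand B hp v]
    rw [map_add, F'.η_hor hp', zero_add, map_sum]
    exact Finset.sum_congr rfl fun t _ => by rw [map_smul, smul_eq_mul, mul_comm]; rfl
  -- The torsion on H does not depend on the frame and pairs with η_s to 2 g(I_s X, Y). So a change
  -- of frame transforms the η_s and the I_s by the same matrix A, and the trace form of the I_s
  -- shows that A is orthogonal.
  have h2 (s) : F'.I s p = ∑ t, A s t • F.I t p := by
    refine (F.quat hp).op_ext fun X Y => ?_
    have e1 := F'.η_torsion_hor B hU' hp' s X Y
    have e2 (t) := F.η_torsion_hor B hU hp t X Y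
    rw [h1] at e1
    simp only [e2] at e1
    simp only [LinearMap.sum_apply, LinearMap.smul_apply, map_sum, map_smul, smul_eq_mul]
    have e3 : ∑ t, A s t * (2 * S.g p (F.I t p X) Y) = 2 * ∑ t, A s t * S.g p (F.I t p X) Y := by
      rw [Finset.mul_sum]
      exact Finset.sum_congr rfl fun t _ => by ring
    rw [e3] at e1
    have := mul_left_cancel₀ (two_ne_zero' ℝ) e1
    exact this.symm
  have hn0 : (4 * n : ℝ) ≠ 0 := by positivity
  have h3 : A * A.transpose = 1 := by
    ext s t
    have e1 : (F.quat hp).tr (F'.I s p * F'.I t p) = if s = t then -(4 * n : ℝ) else 0 := by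
      have e0 : (F.quat hp).tr (F'.I s p * F'.I t p)
          = (F'.quat hp').tr (F'.I s p * F'.I t p) := by
        let g₀ : S.H p →ₗ[ℝ] S.H p →ₗ[ℝ] ℝ := S.g p
        let β : S.H p →ₗ[ℝ] S.H p →ₗ[ℝ] ℝ := g₀ ∘ₗ (F'.I s p * F'.I t p)
        exact Quat.sum_e_eq (D := F.quat hp) (D' := F'.quat hp') rfl β
      rw [e0]
      exact (F'.quat hp').tr_I_mul_I s t
    have e2 (k l) : (F.quat hp).tr (F.I k p * F.I l p) = if k = l then -(4 * n : ℝ) else 0 :=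
      (F.quat hp).tr_I_mul_I k l
    rw [h2 s, h2 t, Finset.sum_mul_sum, map_sum] at e1
    simp only [map_sum, smul_mul_smul_comm, map_smul, e2, smul_eq_mul, mul_ite, mul_zero,
      Finset.sum_ite_eq, Finset.mem_univ, if_true] at e1
    rw [← Finset.sum_mul] at e1
    rw [Matrix.mul_apply, Matrix.one_apply]
    simp only [Matrix.transpose_apply]
    split_ifs at e1 ⊢
    · exact mul_right_cancel₀ (neg_ne_zero.2 hn0) (by rw [e1, one_mul])
    · exact (mul_eq_zero.1 e1).resolve_right (neg_ne_zero.2 hn0)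
  have h4 : A.transpose * A = 1 := mul_eq_one_comm.1 h3
  refine LinearMap.ext fun v => LinearMap.ext fun w => ?_
  rw [metric_apply, metric_apply]
  congr 1
  simp only [h1, Finset.sum_mul_sum]
  rw [Finset.sum_comm]
  refine Finset.sum_congr rfl fun k _ => ?_
  rw [Finset.sum_comm]
  have e (l) : ∑ s, A s k * F.η k p v * (A s l * F.η l p w)
      = (if k = l then 1 else 0) * (F.η k p v * F.η l p w) := by
    have e1 := congrFun (congrFun h4 k) l
    rw [Matrix.mul_apply, Matrix.one_apply] at e1
    rw [← e1, Finset.sum_mul]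
    exact Finset.sum_congr rfl fun s _ => by rw [Matrix.transpose_apply]; ring
  simp only [e, ite_mul, one_mul, zero_mul, Finset.sum_ite_eq, Finset.mem_univ, if_true]

/-- The matrix of a family of tangent vectors with respect to the frame. -/
def matrix (p : M) (v : Fin (4 * n + 3) → T (4 * n + 3) p) : Matrix (FIx n) (FIx n) ℝ :=
  .of fun k l => F.coord B k p (v (frameIx n l))

end LocalFrame

namespace Structure.Biquard

variable (B : S.Biquard) {p : M}

/-- The fundamental two-form as a bilinear form. -/
def omegaBilin (s : Fin 3) (p : M) : T (4 * n + 3) p →ₗ[ℝ] T (4 * n + 3) p →ₗ[ℝ] ℝ :=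
  LinearMap.mk₂ ℝ (B.omega s p) (by simp [omega]) (by simp [omega]) (by simp [omega])
    (by simp [omega])

lemma volForm_eq (v : Fin (4 * n + 3) → T (4 * n + 3) p) :
    B.volForm p v = wedgeForm n (fun s => (S.η s p).toLinearMap) (B.omegaBilin 0 p)
      (v ∘ ixEquiv n) / 2 ^ (2 * n) := by
  rw [volForm, wedgeForm_apply]
  congr 1
  refine Fintype.sum_equiv (ixEquiv n).symm.permCongr _ _ fun σ => ?_
  have h (k) : ixEquiv n ((ixEquiv n).symm.permCongr σ k) = σ (ixEquiv n k) := by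
    simp [Equiv.permCongr_apply]
  rw [Equiv.Perm.sign_permCongr]
  simp only [Function.comp_apply, h, ixEquiv_inl, ixEquiv_zero, ixEquiv_one, Fin.prod_univ_three]
  rfl

variable (n) in
/-- The value of the volume form on adapted bases. -/
def volConst : ℝ := wedgeConst n / 2 ^ (2 * n)

lemma volConst_pos : 0 < volConst n := div_pos (wedgeConst_pos n) (by positivity)

/-- The volume form is, up to sign, a constant multiple of the determinant with respect to any
local frame. -/
theorem abs_volForm [T2Space M] (hn : 1 ≤ n) {U : Set M} (F : S.Frame U) (hU : IsOpen U) (hp : p ∈ U)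
    (v : Fin (4 * n + 3) → T (4 * n + 3) p) :
    |B.volForm p v| = volConst n * |(F.matrix B p v).det| := by
  let F₀ := S.frame p
  have hp₀ := S.mem_nhd p
  let D := F₀.quat hp₀
  -- The vectors ξ_s, E_i, I_1 E_i are a symplectic basis for ω_1 on H, on which the wedge has the
  -- value `wedgeConst n`, and also an orthonormal basis of the metric g + Σ η_s². Any other
  -- orthonormal basis differs from it by determinant ±1.
  obtain ⟨E, hE, hIE⟩ := D.exists_unitary 0 (2 * n) le_rfl
  let b (k : Ix n) : T (4 * n + 3) p := match k with
    | .inl s => F₀.vert B s p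
    | .inr (i, ε) => if ε = 0 then E i else D.I 0 (E i)
  have hEI (i j) : D.g (E i) (D.I 0 (E j)) = 0 := by rw [D.symm, hIE]
  have hη (s k) : S.η s p (b k) = if k = .inl s then 1 else 0 := by
    rcases k with t | ⟨i, ε⟩
    · simp only [b]
      rw [Structure.η, F₀.η_vert B hp₀]
      simp [eq_comm]
    · simp only [b]
      split_ifs with h1 h2 h2
      · exact absurd h2 (by simp)
      · exact F₀.η_hor hp₀ s _
      · exact absurd h2 (by simp)
      · exact F₀.η_hor hp₀ s _
  have hgg (k l) : B.gg p (b (.inr k)) (b (.inr l)) = if k = l then 1 else 0 := by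
    obtain ⟨i, ε⟩ := k
    obtain ⟨j, δ⟩ := l
    have h1 : D.g (E i) (E j) = if i = j then 1 else 0 := hE i j
    have h2 := D.herm 0 (E i) (E j)
    rw [h1] at h2
    have hD : S.g p = D.g := rfl
    fin_cases ε <;> fin_cases δ
    · simpa [b, gg, hD] using h1
    · simpa [b, gg, hD] using hEI i j
    · simpa [b, gg, hD] using hIE i j
    · simpa [b, gg, hD] using h2
  have hver (s) : B.hor p (b (.inl s)) = 0 := B.hor_of_mem_V (F₀.vert B s p).2
  have hω (k l) : B.omegaBilin 0 p (b k) (b l) = sympl k l := by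
    have e (v w : T (4 * n + 3) p) : B.omegaBilin 0 p v w
      = D.g (D.I 0 (B.hor p v)) (B.hor p w) := rfl
    rw [e]
    rcases k with s | ⟨i, ε⟩
    · rw [hver]; simp [sympl]
    rcases l with s | ⟨j, δ⟩
    · rw [hver]; simp [sympl]
    have h2 := D.herm 0 (E i) (E j)
    rw [hE] at h2
    fin_cases ε <;> fin_cases δ
    · simpa [b, sympl] using hIE i j
    · simpa [b, sympl] using h2
    · simp [b, sympl, D.I_I, hE]
      split_ifs <;> simp
    · simp [b, sympl, D.I_I, hEI]
  have hG (k l) : F₀.metric B p (b k) (b l) = if k = l then 1 else 0 := by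
    rw [F₀.metric_apply]
    have hη' (s k) : F₀.η s p (b k) = if k = .inl s then 1 else 0 := hη s k
    simp only [hη']
    rcases k with s | k
    · rw [gg, hver]
      rcases l with t | l <;> simp [eq_comm]
    rcases l with t | l
    · rw [gg, hver]; simp
    · rw [hgg]; simp
  have hli : LinearIndependent ℝ b := by
    rw [Fintype.linearIndependent_iff]
    intro c hc k
    have := congrArg (fun v => F₀.metric B p v (b k)) hc
    simpa only [map_sum, map_smul, LinearMap.sum_apply, LinearMap.smul_apply, hG, smul_eq_mul,
      mul_ite, mul_one, mul_zero, Finset.sum_ite_eq', Finset.mem_univ, if_true, map_zero,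
      LinearMap.zero_apply] using this
  have hcard : Fintype.card (Ix n) = Module.finrank ℝ (T (4 * n + 3) p) := by
    rw [finrank_T, Fintype.card_congr (ixEquiv n), Fintype.card_fin]
  let b₀ := basisOfLinearIndependentOfCardEqFinrank' b hli hcard
  have hb₀ : ⇑b₀ = b := coe_basisOfLinearIndependentOfCardEqFinrank' _ _ _
  let b' := (F.basis B hp).reindex (pairEquiv n)
  have hb' (k) : b' k = F.basis B hp ((pairEquiv n).symm k) := by simp [b']
  have key := abs_alternating_eq b₀ b' (F₀.metric B p) (by rw [hb₀]; exact hG) (fun k l => by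
    rw [F₀.metric_eq B hn (S.isOpen_nhd p) hp₀ F hU hp, hb', hb', F.metric_basis B hp]
    simp) (wedgeForm n (fun s => (S.η s p).toLinearMap) (B.omegaBilin 0 p)) (v ∘ ixEquiv n)
  rw [hb₀, wedgeForm_symplectic hη hω, abs_of_pos (wedgeConst_pos n),
    Module.Basis.det_reindex, Module.Basis.det_apply] at key
  rw [volForm_eq, abs_div, key, abs_of_pos (show (0 : ℝ) < 2 ^ (2 * n) by positivity), volConst]
  rw [mul_div_right_comm]
  congr 3

end Structure.Biquard

end Volume
-- Coordinate fields and coordinate functions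
section Coordinates

variable {n : ℕ} {M : Type*} [TopologicalSpace M]
  [ChartedSpace (EuclideanSpace ℝ (Fin (4 * n + 3))) M] [IsManifold (𝓡 (4 * n + 3)) ∞ M]

open Structure.Biquard (coordVec)

instance isManifold_one : IsManifold (𝓡 (4 * n + 3)) 1 M := IsManifold.of_le (n := ∞) (by simp)

variable {x p : M}

/-- The `i`-th coordinate function of the preferred chart around `x`. -/
def coordFun (x : M) (i : Fin (4 * n + 3)) (q : M) : ℝ := (extChartAt (𝓡 (4 * n + 3)) x q) i

lemma coordVec_eq (hp : p ∈ (chartAt (EuclideanSpace ℝ (Fin (4 * n + 3))) x).source)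
    (i : Fin (4 * n + 3)) : coordVec x p i
      = (trivializationAt (EuclideanSpace ℝ (Fin (4 * n + 3))) (TangentSpace (𝓡 (4 * n + 3)))
        x).symmL ℝ p (EuclideanSpace.single i 1) := by
  rw [Trivialization.symmL_apply _ (by simpa using hp)]
  rfl

lemma smF_coordFun (hp : p ∈ (chartAt (EuclideanSpace ℝ (Fin (4 * n + 3))) x).source)
    (i : Fin (4 * n + 3)) : SmF (4 * n + 3) (coordFun x i) p := by
  filter_upwards [(chartAt (EuclideanSpace ℝ (Fin (4 * n + 3))) x).open_source.mem_nhds hp] with q hq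
  have h1 : ContMDiffAt (𝓡 (4 * n + 3)) 𝓘(ℝ, EuclideanSpace ℝ (Fin (4 * n + 3))) ∞
    (extChartAt (𝓡 (4 * n + 3)) x) q := contMDiffAt_extChartAt' hq
  exact (EuclideanSpace.proj (𝕜 := ℝ) i).contMDiff.contMDiffAt.comp q h1

lemma dirDeriv_coordFun (hp : p ∈ (chartAt (EuclideanSpace ℝ (Fin (4 * n + 3))) x).source)
    (i : Fin (4 * n + 3)) (v : T (4 * n + 3) p) : dirDeriv (coordFun x i) p v
      = ((trivializationAt (EuclideanSpace ℝ (Fin (4 * n + 3))) (TangentSpace (𝓡 (4 * n + 3)))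
        x).continuousLinearMapAt ℝ p v) i := by
  rw [TangentBundle.continuousLinearMapAt_trivializationAt hp]
  have h1 : MDifferentiableAt (𝓡 (4 * n + 3)) 𝓘(ℝ, EuclideanSpace ℝ (Fin (4 * n + 3)))
    (extChartAt (𝓡 (4 * n + 3)) x) p := mdifferentiableAt_extChartAt hp
  have h2 := mfderiv_comp (I'' := 𝓘(ℝ, ℝ)) p (EuclideanSpace.proj (𝕜 := ℝ) i).mdifferentiableAt h1
  have h3 := congrArg (fun L => L v) h2
  rw [ContinuousLinearMap.mfderiv_eq] at h3
  exact h3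

lemma dirDeriv_coordFun_coordVec
    (hp : p ∈ (chartAt (EuclideanSpace ℝ (Fin (4 * n + 3))) x).source) (i j : Fin (4 * n + 3)) :
    dirDeriv (coordFun x i) p (coordVec x p j) = if i = j then 1 else 0 := by
  rw [dirDeriv_coordFun hp, coordVec_eq hp,
    Trivialization.continuousLinearMapAt_symmL _ (by simpa using hp)]
  simp [Pi.single_apply]

lemma sum_coordVec (hp : p ∈ (chartAt (EuclideanSpace ℝ (Fin (4 * n + 3))) x).source)
    (v : T (4 * n + 3) p) : ∑ i, dirDeriv (coordFun x i) p v • coordVec x p i = v := by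
  let t := trivializationAt (EuclideanSpace ℝ (Fin (4 * n + 3))) (TangentSpace (𝓡 (4 * n + 3))) x
  have h1 : t.symmL ℝ p (t.continuousLinearMapAt ℝ p v) = v :=
    t.symmL_continuousLinearMapAt (by simpa [t] using hp) v
  have h2 : t.continuousLinearMapAt ℝ p v = ∑ i, (t.continuousLinearMapAt ℝ p v) i •
      EuclideanSpace.single i (1 : ℝ) := by
    ext j
    simp [Pi.single_apply]
  have h3 := congrArg (t.symmL ℝ p) h2
  rw [h1, map_sum] at h3
  refine Eq.trans (Finset.sum_congr rfl fun i _ => ?_) h3.symm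
  rw [map_smul, dirDeriv_coordFun hp, coordVec_eq hp]

lemma sm_coordVec (hp : p ∈ (chartAt (EuclideanSpace ℝ (Fin (4 * n + 3))) x).source)
    (i : Fin (4 * n + 3)) : Sm (fun q => coordVec x q i) p := by
  let t := trivializationAt (EuclideanSpace ℝ (Fin (4 * n + 3))) (TangentSpace (𝓡 (4 * n + 3))) x
  let b := (EuclideanSpace.basisFun (Fin (4 * n + 3)) ℝ).toBasis
  have hp' : p ∈ t.baseSet := by simpa [t] using hp
  filter_upwards [t.open_baseSet.mem_nhds hp'] with q hq
  have h1 := contMDiffAt_localFrame_of_mem (I := 𝓡 (4 * n + 3)) (n := ∞) t b i hq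
  refine h1.congr_of_eventuallyEq ?_
  filter_upwards [t.open_baseSet.mem_nhds hq] with y hy
  have h2 : t.localFrame b i y = coordVec x y i := by
    rw [Trivialization.localFrame_apply_of_mem_baseSet _ _ hy, coordVec_eq (by simpa [t] using hy)]
    simp [Trivialization.basisAt, b, t, Trivialization.symmL_apply _ hy]
  rw [h2]

/-- The derivative along a coordinate vector is a partial derivative in the chart. -/
lemma fderiv_chart {h : M → ℝ} {y : EuclideanSpace ℝ (Fin (4 * n + 3))}
    (hy : y ∈ (extChartAt (𝓡 (4 * n + 3)) x).target)
    (hh : SmF (4 * n + 3) h ((extChartAt (𝓡 (4 * n + 3)) x).symm y)) (i : Fin (4 * n + 3)) :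
    fderiv ℝ (h ∘ (extChartAt (𝓡 (4 * n + 3)) x).symm) y (EuclideanSpace.single i 1)
      = dirDeriv h ((extChartAt (𝓡 (4 * n + 3)) x).symm y)
        (coordVec x ((extChartAt (𝓡 (4 * n + 3)) x).symm y) i) := by
  have hp : (extChartAt (𝓡 (4 * n + 3)) x).symm y
      ∈ (chartAt (EuclideanSpace ℝ (Fin (4 * n + 3))) x).source := by
    rw [← extChartAt_source (𝓡 (4 * n + 3))]
    exact (extChartAt (𝓡 (4 * n + 3)) x).map_target hy
  have h1 : MDifferentiableAt 𝓘(ℝ, EuclideanSpace ℝ (Fin (4 * n + 3))) (𝓡 (4 * n + 3))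
      (extChartAt (𝓡 (4 * n + 3)) x).symm y := by
    have := mdifferentiableWithinAt_extChartAt_symm (I := 𝓡 (4 * n + 3)) hy
    rwa [modelWithCornersSelf_coe, Set.range_id, mdifferentiableWithinAt_univ] at this
  have h2 := mfderiv_comp y hh.mdiffAt h1
  rw [mfderiv_eq_fderiv] at h2
  have h3 := congrArg (fun L => L (EuclideanSpace.single i (1 : ℝ))) h2
  rw [coordVec_eq hp, TangentBundle.symmL_trivializationAt hp,
    (extChartAt (𝓡 (4 * n + 3)) x).right_inv hy]
  simp only [modelWithCornersSelf_coe, Set.range_id, mfderivWithin_univ]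
  exact h3

end Coordinates

/-! ### Derivatives of determinants -/

section Determinant

variable {m : ℕ} {M : Type*} [TopologicalSpace M] [ChartedSpace (EuclideanSpace ℝ (Fin m)) M]
  [IsManifold (𝓡 m) ∞ M] {p : M} {ι : Type*} [DecidableEq ι]

lemma dirDeriv_prod {s : Finset ι} {h : ι → M → ℝ} (hh : ∀ i ∈ s, SmF m (h i) p) (v : T m p) :
    dirDeriv (fun q => ∏ i ∈ s, h i q) p v
      = ∑ i ∈ s, (∏ j ∈ s.erase i, h j p) * dirDeriv (h i) p v := by
  induction s using Finset.induction_on with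
  | empty => simp [dirDeriv_const]
  | insert a s ha ih =>
    have h1 : SmF m (fun q => ∏ i ∈ s, h i q) p :=
      SmF.prod fun i hi => hh i (Finset.mem_insert_of_mem hi)
    simp only [Finset.prod_insert ha]
    rw [dirDeriv_mul (hh a (Finset.mem_insert_self a s)) h1, Finset.sum_insert ha,
      Finset.erase_insert ha, ih fun i hi => hh i (Finset.mem_insert_of_mem hi), Finset.mul_sum,
      add_comm (∑ i ∈ s, _), mul_comm (dirDeriv (h a) p v)]
    congr 1
    refine Finset.sum_congr rfl fun i hi => ?_
    have hai : a ≠ i := fun h => ha (h ▸ hi)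
    rw [Finset.erase_insert_of_ne hai, Finset.prod_insert (fun h => ha (Finset.mem_of_mem_erase h)),
      mul_assoc]

/-- Jacobi's formula. -/
lemma dirDeriv_det [Fintype ι] {A : M → Matrix ι ι ℝ} (hA : ∀ i j, SmF m (fun q => A q i j) p)
    (v : T m p) : dirDeriv (fun q => (A q).det) p v
      = ((A p).adjugate * Matrix.of fun i j => dirDeriv (fun q => A q i j) p v).trace := by
  let D : Matrix ι ι ℝ := .of fun i j => dirDeriv (fun q => A q i j) p v
  have h1 : ((A p).adjugate * D).trace
      = ∑ j, ((A p).updateCol j fun i => D i j).det := by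
    rw [Matrix.trace]
    refine Finset.sum_congr rfl fun j _ => ?_
    rw [← Matrix.cramer_apply, Matrix.cramer_eq_adjugate_mulVec]
    rfl
  have h2 (σ : Equiv.Perm ι) : SmF m (fun q => ∏ i, A q (σ i) i) p := SmF.prod fun i _ => hA _ _
  rw [h1]
  simp only [Matrix.det_apply']
  rw [dirDeriv_sum fun σ _ => (SmF.const _).mul (h2 σ), Finset.sum_comm]
  refine Finset.sum_congr rfl fun σ _ => ?_
  rw [dirDeriv_const_mul _ (h2 σ), dirDeriv_prod fun i _ => hA _ _, Finset.mul_sum]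
  refine Finset.sum_congr rfl fun j _ => ?_
  rw [← Finset.prod_erase_mul _ _ (Finset.mem_univ j)]
  congr 2
  · exact Finset.prod_congr rfl fun i hi => by
      rw [Matrix.updateCol_ne (Finset.ne_of_mem_erase hi)]
  · simp [D]

end Determinant

/-! ### The divergence of a horizontal field in coordinates -/

section Density

variable {n : ℕ} {M : Type*} [TopologicalSpace M] [T2Space M]
  [ChartedSpace (EuclideanSpace ℝ (Fin (4 * n + 3))) M] [IsManifold (𝓡 (4 * n + 3)) ∞ M]
  {S : Structure n M}

open Structure.Biquard (coordVec)

namespace LocalFrame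

variable {U : Set M} (F : S.Frame U) (B : S.Biquard) {p x : M} {X Y : ∀ q : M, T (4 * n + 3) q}

section
variable (hU : IsOpen U) (hp : p ∈ U)
include hU hp

lemma sm_vec (k : FIx n) : Sm (F.vec B k) p := by
  rcases k with s | a
  · exact F.sm_vert B hU hp s
  · exact F.sm_e hU hp a

lemma smF_coord (hX : Sm X p) (k : FIx n) :
    SmF (4 * n + 3) (fun q => F.coord B k q (X q)) p := by
  rcases k with s | a
  · exact F.smF_η hU hp s hX
  · exact B.smForm₂_gg.smooth hX (F.sm_e hU hp a)

lemma dirDeriv_coord (hX : Sm X p) (l : FIx n) (u : T (4 * n + 3) p) :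
    dirDeriv (fun q => F.coord B l q (X q)) p u = F.coord B l p (B.cov X p u)
      - ∑ k, F.coord B l p (B.cov (F.vec B k) p u) * F.coord B k p (X p) := by
  have hc (k) := F.smF_coord B hU hp hX k
  have hv (k) := F.sm_vec B hU hp k
  have h1 := cov_congr (cov := B.cov) (Sm.sum (s := Finset.univ) fun k _ => Sm.smul (hc k) (hv k))
    ((hU.eventually_mem hp).mono fun q hq => (F.sum_coord B hq (X q)).symm) u
  rw [cov_sum fun k _ => Sm.smul (hc k) (hv k)] at h1
  simp only [cov_smul (hc _) (hv _)] at h1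
  rw [h1, coord_sum]
  simp only [coord_add, coord_smul, F.coord_vec B hp, Finset.sum_add_distrib, mul_ite, mul_one,
    mul_zero, Finset.sum_ite_eq, Finset.mem_univ, if_true]
  refine eq_sub_of_add_eq ((add_comm _ _).trans (congrArg (· + _) ?_))
  exact Finset.sum_congr rfl fun k _ => mul_comm _ _

/-- The connection preserves the volume form: both blocks of the connection matrix of the adapted
frame are skew, hence the trace is zero. -/
lemma sum_coord_cov_vec (hn : 1 ≤ n) (u : T (4 * n + 3) p) :
    ∑ k, F.coord B k p (B.cov (F.vec B k) p u) = 0 := by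
  rw [Fintype.sum_sum_type, Finset.sum_eq_zero fun s _ => ?_, Finset.sum_eq_zero fun a _ => ?_,
    add_zero]
  · have := F.conn_e_antisymm B hU hp a a u
    simp only [coord_inr]
    exact self_eq_neg.1 this
  · have := F.conn_antisymm B hU hp hn s s u
    exact self_eq_neg.1 this

variable (hx : p ∈ (chartAt (EuclideanSpace ℝ (Fin (4 * n + 3))) x).source)
include hx

omit [T2Space M] hU in
lemma matrix_mul :
    F.matrix B p (coordVec x p) * (.of fun k l => dirDeriv (coordFun x (frameIx n k)) p (F.vec B l p))
      = 1 := by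
  ext k l
  rw [Matrix.mul_apply, Matrix.one_apply, ← F.coord_vec B hp k l]
  conv_rhs => rw [← sum_coordVec hx (F.vec B l p), coord_sum]
  refine Fintype.sum_equiv (frameIx n) _ _ fun i => ?_
  rw [coord_smul, mul_comm]
  rfl

omit [T2Space M] hU in
lemma det_matrix_ne_zero : (F.matrix B p (coordVec x p)).det ≠ 0 := by
  intro h
  have := congrArg Matrix.det (F.matrix_mul B hp hx)
  rw [Matrix.det_mul, h, zero_mul, Matrix.det_one] at this
  exact zero_ne_one this

lemma smF_matrix (k l : FIx n) :
    SmF (4 * n + 3) (fun q => F.matrix B q (coordVec x q) k l) p :=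
  F.smF_coord B hU hp (sm_coordVec hx _) k

/-- If A is the matrix of the coordinate fields in the frame, then A' = AQ - ΓA with Q and Γ the
connection matrices of the coordinate fields and of the frame. By Jacobi's formula the determinant
has logarithmic derivative tr Q - tr Γ, and tr Γ = 0. -/
lemma dirDeriv_det_matrix (hn : 1 ≤ n) (u : T (4 * n + 3) p) :
    dirDeriv (fun q => (F.matrix B q (coordVec x q)).det) p u
      = (F.matrix B p (coordVec x p)).det
        * ∑ j : Fin (4 * n + 3), dirDeriv (coordFun x j) p (B.cov (fun q => coordVec x q j) p u) := by
  rw [dirDeriv_det fun k l => F.smF_matrix B hU hp hx k l]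
  let A := F.matrix B p (coordVec x p)
  let Γ : Matrix (FIx n) (FIx n) ℝ := .of fun k l => F.coord B k p (B.cov (F.vec B l) p u)
  let Q : Matrix (FIx n) (FIx n) ℝ := .of fun k l => dirDeriv (coordFun x (frameIx n k)) p
    (B.cov (fun q => coordVec x q (frameIx n l)) p u)
  have h1 : (Matrix.of fun k l => dirDeriv (fun q => F.matrix B q (coordVec x q) k l) p u)
      = A * Q - Γ * A := by
    ext k l
    rw [Matrix.sub_apply, Matrix.mul_apply, Matrix.mul_apply]
    refine (F.dirDeriv_coord B hU hp (sm_coordVec hx (frameIx n l)) k u).trans ?_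
    congr 1
    conv_lhs => rw [← sum_coordVec hx (B.cov (fun q => coordVec x q (frameIx n l)) p u), coord_sum]
    refine (Fintype.sum_equiv (frameIx n) _ _ fun i => ?_).symm
    rw [coord_smul, mul_comm]
    rfl
  have h2 : Γ.trace = 0 := F.sum_coord_cov_vec B hU hp hn u
  rw [h1, mul_sub, Matrix.trace_sub, ← mul_assoc, Matrix.adjugate_mul, ← mul_assoc,
    Matrix.trace_mul_comm _ A, ← mul_assoc, Matrix.mul_adjugate, Matrix.smul_mul, Matrix.smul_mul,
    one_mul, one_mul, Matrix.trace_smul, Matrix.trace_smul, h2, smul_zero, sub_zero, smul_eq_mul]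
  congr 1
  exact Fintype.sum_equiv (frameIx n) _ _ fun i => rfl

omit hU [T2Space M] in
/-- The trace of an endomorphism, computed in coordinates and in the frame. -/
lemma sum_coordFun_eq (L : T (4 * n + 3) p →ₗ[ℝ] T (4 * n + 3) p) :
    ∑ j : Fin (4 * n + 3), dirDeriv (coordFun x j) p (L (coordVec x p j))
      = ∑ k, F.coord B k p (L (F.vec B k p)) := by
  have h1 (k) : F.coord B k p (L (F.vec B k p))
      = ∑ j : Fin (4 * n + 3), dirDeriv (coordFun x j) p (F.vec B k p) * F.coord B k p (L (coordVec x p j)) := by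
    conv_lhs => rw [← sum_coordVec hx (F.vec B k p), map_sum, coord_sum]
    exact Finset.sum_congr rfl fun j _ => by rw [map_smul, coord_smul]
  simp only [h1]
  rw [Finset.sum_comm]
  refine Finset.sum_congr rfl fun j _ => ?_
  conv_lhs => rw [← F.sum_coord B hp (L (coordVec x p j)), dirDeriv_vsum]
  exact Finset.sum_congr rfl fun k _ => by rw [dirDeriv_vsmul, mul_comm]

/-- From ∇_Y ∂_j = T(Y, ∂_j) + ∇_{∂_j} Y + [Y, ∂_j] the trace of the left side is tr T(Y, ·) + tr ∇Y
- Σ ∂_j Y^j. For horizontal Y the torsion T(Y, ·) maps H to V and V to H, so its trace vanishes, and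
∇Y has values in H. -/
lemma div_det_matrix (hn : 1 ≤ n) (hY : Sm Y p) (hYH : ∀ᶠ q in 𝓝 p, Y q ∈ S.H q) :
    dirDeriv (fun q => (F.matrix B q (coordVec x q)).det) p (Y p)
      + (F.matrix B p (coordVec x p)).det
        * ∑ j : Fin (4 * n + 3), dirDeriv (fun q => dirDeriv (coordFun x j) q (Y q)) p (coordVec x p j)
      = (F.matrix B p (coordVec x p)).det * ∑ a, B.gg p (B.cov Y p (F.e a p)) (F.e a p) := by
  have hYp := hYH.self_of_nhds
  have h1 (j : Fin (4 * n + 3)) : dirDeriv (coordFun x j) p (B.cov (fun q => coordVec x q j) p (Y p))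
      = dirDeriv (coordFun x j) p (B.cov.torsion p (Y p) (coordVec x p j))
        + dirDeriv (coordFun x j) p (B.cov Y p (coordVec x p j))
        - dirDeriv (fun q => dirDeriv (coordFun x j) q (Y q)) p (coordVec x p j) := by
    have e1 := torsion_eq (cov := B.cov) hY (sm_coordVec hx j)
    have e2 := dirDeriv_mlieBracket (smF_coordFun hx j) hY (sm_coordVec hx j)
    have e3 : dirDeriv (fun q => dirDeriv (coordFun x j) q (coordVec x q j)) p (Y p) = 0 := by
      rw [dirDeriv_congr (k := fun _ => 1) (((chartAt _ x).open_source.eventually_mem hx).mono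
        fun q hq => by rw [dirDeriv_coordFun_coordVec hq, if_pos rfl]), dirDeriv_const]
    rw [e3] at e2
    rw [e1, dirDeriv_vsub, dirDeriv_vsub, e2]
    ring
  have h2 := F.sum_coordFun_eq B hp hx (B.cov.torsion p (Y p)).toLinearMap
  have h3 := F.sum_coordFun_eq B hp hx (B.cov Y p).toLinearMap
  have h4 : ∑ k, F.coord B k p (B.cov.torsion p (Y p) (F.vec B k p)) = 0 := by
    rw [Fintype.sum_sum_type, Finset.sum_eq_zero fun s _ => ?_, Finset.sum_eq_zero fun a _ => ?_,
      add_zero]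
    · have e := F.torsion_hor' B hU hp ⟨Y p, hYp⟩ (F.e a p)
      have e2 : B.hor p (B.cov.torsion p (Y p) (F.e a p)) = 0 := by
        refine B.hor_of_mem_V ?_
        simp only at e
        rw [e]
        exact Submodule.sum_mem _ fun s _ => Submodule.smul_mem _ _ (F.vert B s p).2
      simp only [coord_inr, vec_inr, Structure.Biquard.gg]
      rw [e2]
      simp
    · simp only [coord_inl, vec_inl]
      rw [B.cov.torsion_antisymm, map_neg]
      have := F.η_hor hp s ⟨_, B.torsion_mem_H p _ (F.vert B s p).2 ⟨Y p, hYp⟩⟩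
      simp only at this
      rw [this, neg_zero]
  have h5 : ∑ k, F.coord B k p (B.cov Y p (F.vec B k p))
      = ∑ a, B.gg p (B.cov Y p (F.e a p)) (F.e a p) := by
    rw [Fintype.sum_sum_type, Finset.sum_eq_zero fun s _ => ?_, zero_add]
    · rfl
    · exact F.η_hor hp s ⟨_, B.cov_mem_of_eventually_mem hY hYH _⟩
  simp only [ContinuousLinearMap.coe_coe] at h2 h3
  rw [F.dirDeriv_det_matrix B hU hp hx hn, ← mul_add]
  congr 1
  simp only [h1, Finset.sum_sub_distrib, Finset.sum_add_distrib]
  rw [h2, h3, h4, h5]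
  ring

end

end LocalFrame

namespace Structure.Biquard

variable (B : S.Biquard) {p x : M} {X Y : ∀ q : M, T (4 * n + 3) q}

/-- The density of the volume form in the preferred chart around `x`. -/
def density (x q : M) : ℝ := |B.volForm q (coordVec x q)|

variable (hn : 1 ≤ n) (hx : p ∈ (chartAt (EuclideanSpace ℝ (Fin (4 * n + 3))) x).source)
include hn hx

lemma density_pos : 0 < B.density x p := by
  rw [density, B.abs_volForm hn (S.frame p) (S.isOpen_nhd p) (S.mem_nhd p)]
  exact mul_pos volConst_pos (abs_pos.2 ((S.frame p).det_matrix_ne_zero B (S.mem_nhd p) hx))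

/-- The determinant does not vanish, so its sign is constant near p and the absolute value may be
replaced by a constant multiple; in particular the density is smooth. -/
lemma exists_density_eq : ∃ c : ℝ, ∀ᶠ q in 𝓝 p, B.density x q
    = c * ((S.frame p).matrix B q (coordVec x q)).det := by
  have hU := S.isOpen_nhd p
  have hp := S.mem_nhd p
  have h0 := (S.frame p).det_matrix_ne_zero B hp hx
  have hc := (SmF.det fun k l => (S.frame p).smF_matrix B hU hp hx k l).contMDiffAt.continuousAt
  rcases lt_or_gt_of_ne h0 with h | h
  · refine ⟨-volConst n, ?_⟩
    filter_upwards [hc.eventually_lt continuousAt_const h, hU.mem_nhds hp] with q hq hqU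
    rw [density, B.abs_volForm hn (S.frame p) hU hqU, abs_of_neg hq]
    ring
  · refine ⟨volConst n, ?_⟩
    filter_upwards [continuousAt_const.eventually_lt hc h, hU.mem_nhds hp] with q hq hqU
    rw [density, B.abs_volForm hn (S.frame p) hU hqU, abs_of_pos hq]

lemma smF_density : SmF (4 * n + 3) (B.density x) p := by
  obtain ⟨c, hc⟩ := B.exists_density_eq hn hx
  exact ((SmF.const c).mul (SmF.det fun k l =>
    (S.frame p).smF_matrix B (S.isOpen_nhd p) (S.mem_nhd p) hx k l)).congr hc

/-- The divergence of a horizontal vector field in coordinates. -/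
theorem div_density (hY : Sm Y p) (hYH : ∀ᶠ q in 𝓝 p, Y q ∈ S.H q) :
    ∑ j : Fin (4 * n + 3), dirDeriv (fun q => B.density x q * dirDeriv (coordFun x j) q (Y q)) p (coordVec x p j)
      = B.density x p * ∑ a, B.gg p (B.cov Y p (S.e a p)) (S.e a p) := by
  have hU := S.isOpen_nhd p
  have hp := S.mem_nhd p
  obtain ⟨c, hc⟩ := B.exists_density_eq hn hx
  have hd := SmF.det fun k l => (S.frame p).smF_matrix B hU hp hx k l
  have hYj (j) := smF_dirDeriv (smF_coordFun hx j) hY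
  have h1 := (S.frame p).div_det_matrix B hU hp hx hn hY hYH
  have h2 : ∑ j : Fin (4 * n + 3), dirDeriv (B.density x) p (coordVec x p j) * dirDeriv (coordFun x j) p (Y p)
      = c * dirDeriv (fun q => ((S.frame p).matrix B q (coordVec x q)).det) p (Y p) := by
    rw [← dirDeriv_const_mul c hd, ← dirDeriv_congr hc]
    conv_rhs => rw [← sum_coordVec hx (Y p), dirDeriv_vsum]
    exact Finset.sum_congr rfl fun j _ => by rw [dirDeriv_vsmul, mul_comm]
  simp only [dirDeriv_mul (B.smF_density hn hx) (hYj _), Finset.sum_add_distrib, ← Finset.mul_sum]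
  rw [h2, hc.self_of_nhds]
  have h3 : ∑ a, B.gg p (B.cov Y p (S.e a p)) (S.e a p)
      = ∑ a, B.gg p (B.cov Y p ((S.frame p).e a p)) ((S.frame p).e a p) := rfl
  rw [h3]
  linear_combination c * h1

end Structure.Biquard

end Density

/-! ### Gluing the chart measures -/

section Gluing

variable {n : ℕ} {M : Type*} [TopologicalSpace M]
  [ChartedSpace (EuclideanSpace ℝ (Fin (4 * n + 3))) M] [IsManifold (𝓡 (4 * n + 3)) ∞ M]
  {x x' p : M}

open Structure.Biquard (coordVec)

lemma chart_symm_mem {y : EuclideanSpace ℝ (Fin (4 * n + 3))}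
    (hy : y ∈ (extChartAt (𝓡 (4 * n + 3)) x).target) : (extChartAt (𝓡 (4 * n + 3)) x).symm y
      ∈ (chartAt (EuclideanSpace ℝ (Fin (4 * n + 3))) x).source := by
  rw [← extChartAt_source (𝓡 (4 * n + 3))]
  exact (extChartAt (𝓡 (4 * n + 3)) x).map_target hy

lemma det_fderiv_transition {y : EuclideanSpace ℝ (Fin (4 * n + 3))}
    (hy : y ∈ (extChartAt (𝓡 (4 * n + 3)) x).target)
    (hy' : (extChartAt (𝓡 (4 * n + 3)) x).symm y
      ∈ (chartAt (EuclideanSpace ℝ (Fin (4 * n + 3))) x').source) :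
    DifferentiableAt ℝ (extChartAt (𝓡 (4 * n + 3)) x' ∘ (extChartAt (𝓡 (4 * n + 3)) x).symm) y ∧
    (fderiv ℝ (extChartAt (𝓡 (4 * n + 3)) x' ∘ (extChartAt (𝓡 (4 * n + 3)) x).symm) y).det
      = (Matrix.of fun i j : Fin (4 * n + 3) => dirDeriv (coordFun x' i)
        ((extChartAt (𝓡 (4 * n + 3)) x).symm y)
        (coordVec x ((extChartAt (𝓡 (4 * n + 3)) x).symm y) j)).det := by
  have h1 : MDifferentiableAt 𝓘(ℝ, EuclideanSpace ℝ (Fin (4 * n + 3))) (𝓡 (4 * n + 3))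
      (extChartAt (𝓡 (4 * n + 3)) x).symm y := by
    have := mdifferentiableWithinAt_extChartAt_symm (I := 𝓡 (4 * n + 3)) hy
    rwa [modelWithCornersSelf_coe, Set.range_id, mdifferentiableWithinAt_univ] at this
  have h2 : MDifferentiableAt (𝓡 (4 * n + 3)) 𝓘(ℝ, EuclideanSpace ℝ (Fin (4 * n + 3)))
    (extChartAt (𝓡 (4 * n + 3)) x') ((extChartAt (𝓡 (4 * n + 3)) x).symm y) :=
    mdifferentiableAt_extChartAt hy'
  have h3 := mdifferentiableAt_iff_differentiableAt.1 (h2.comp y h1)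
  refine ⟨h3, ?_⟩
  rw [ContinuousLinearMap.det,
    ← LinearMap.det_toMatrix (EuclideanSpace.basisFun (Fin (4 * n + 3)) ℝ).toBasis]
  congr 1
  ext i j
  rw [LinearMap.toMatrix_apply, Matrix.of_apply, ← fderiv_chart hy (smF_coordFun hy' i) j]
  have h4 := (EuclideanSpace.proj (𝕜 := ℝ) i).hasFDerivAt.comp y h3.hasFDerivAt
  have h5 := congrArg (fun L => L (EuclideanSpace.single j (1 : ℝ))) h4.fderiv
  refine Eq.trans ?_ h5.symm
  simp

variable [MeasurableSpace M] [BorelSpace M] in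
lemma aemeasurable_chart_symm : AEMeasurable (extChartAt (𝓡 (4 * n + 3)) x).symm
    ((volume : Measure (EuclideanSpace ℝ (Fin (4 * n + 3)))).restrict
      (extChartAt (𝓡 (4 * n + 3)) x).target) :=
  (continuousOn_extChartAt_symm x).aemeasurable (isOpen_extChartAt_target x).measurableSet

variable [MeasurableSpace M] [BorelSpace M] in
lemma measurableSet_chart {s : Set M} (hs : MeasurableSet s) : MeasurableSet
    ((extChartAt (𝓡 (4 * n + 3)) x).target ∩ (extChartAt (𝓡 (4 * n + 3)) x).symm ⁻¹' s) := by
  have h1 : Continuous fun y : (extChartAt (𝓡 (4 * n + 3)) x).target =>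
      (extChartAt (𝓡 (4 * n + 3)) x).symm y :=
    (continuousOn_extChartAt_symm x).comp_continuous continuous_subtype_val fun y => y.2
  have h2 := (isOpen_extChartAt_target (I := 𝓡 (4 * n + 3)) x).measurableSet.subtype_image
    (h1.measurable hs)
  convert h2 using 1
  ext y
  simp [and_comm]

namespace Structure.Biquard

variable [T2Space M] {S : Structure n M} (B : S.Biquard)

lemma continuousOn_density (hn : 1 ≤ n) : ContinuousOn
    (fun y => B.density x ((extChartAt (𝓡 (4 * n + 3)) x).symm y))
    (extChartAt (𝓡 (4 * n + 3)) x).target := fun y hy =>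
  ((B.smF_density hn (chart_symm_mem hy)).contMDiffAt.continuousAt.comp
    (continuousAt_extChartAt_symm'' hy)).continuousWithinAt

/-- The matrices of the two coordinate frames differ by the Jacobian matrix of the transition map,
which makes the densities compatible with the change of variables. -/
lemma density_eq (hn : 1 ≤ n) (hx : p ∈ (chartAt (EuclideanSpace ℝ (Fin (4 * n + 3))) x).source)
    (hx' : p ∈ (chartAt (EuclideanSpace ℝ (Fin (4 * n + 3))) x').source) :
    B.density x p = |(Matrix.of fun i j : Fin (4 * n + 3) =>
      dirDeriv (coordFun x' i) p (coordVec x p j)).det| * B.density x' p := by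
  have h1 : (S.frame p).matrix B p (coordVec x p) = (S.frame p).matrix B p (coordVec x' p)
      * ((Matrix.of fun i j : Fin (4 * n + 3) =>
        dirDeriv (coordFun x' i) p (coordVec x p j)).submatrix (frameIx n) (frameIx n)) := by
    ext k l
    rw [Matrix.mul_apply]
    have e : coordVec x p (frameIx n l) = _ := (sum_coordVec hx' (coordVec x p (frameIx n l))).symm
    change (S.frame p).coord B k p (coordVec x p (frameIx n l)) = _
    conv_lhs => rw [e, LocalFrame.coord_sum]
    refine (Fintype.sum_equiv (frameIx n) _ _ fun i => ?_).symm
    rw [LocalFrame.coord_smul, mul_comm]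
    rfl
  have hU := S.isOpen_nhd p
  have hp := S.mem_nhd p
  rw [density, density, B.abs_volForm hn (S.frame p) hU hp, B.abs_volForm hn (S.frame p) hU hp, h1,
    Matrix.det_mul, Matrix.det_submatrix_equiv_self, abs_mul]
  ring

variable [MeasurableSpace M] [BorelSpace M]

lemma chartVol_apply {s : Set M} (hs : MeasurableSet s) : B.chartVol x s
    = ∫⁻ y in (extChartAt (𝓡 (4 * n + 3)) x).target ∩ (extChartAt (𝓡 (4 * n + 3)) x).symm ⁻¹' s,
      ENNReal.ofReal (B.density x ((extChartAt (𝓡 (4 * n + 3)) x).symm y)) := by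
  have h1 := aemeasurable_chart_symm (n := n) (x := x)
  rw [chartVol, Measure.map_apply_of_aemeasurable
    (h1.mono_ac (withDensity_absolutelyContinuous _ _)) hs, withDensity_apply',
    Measure.restrict_restrict₀ (h1.nullMeasurable hs), Set.inter_comm]
  rfl

lemma chartVol_compl_source :
    B.chartVol x (chartAt (EuclideanSpace ℝ (Fin (4 * n + 3))) x).sourceᶜ = 0 := by
  rw [B.chartVol_apply (chartAt _ x).open_source.measurableSet.compl]
  have : (extChartAt (𝓡 (4 * n + 3)) x).target ∩ (extChartAt (𝓡 (4 * n + 3)) x).symm ⁻¹'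
      (chartAt (EuclideanSpace ℝ (Fin (4 * n + 3))) x).sourceᶜ = ∅ := by
    rw [Set.eq_empty_iff_forall_notMem]
    rintro y ⟨hy, hy'⟩
    exact hy' (chart_symm_mem hy)
  rw [this, Measure.restrict_empty, lintegral_zero_measure]

/-- The chart measures agree on overlaps. -/
lemma chartVol_eq_of_subset (hn : 1 ≤ n) {s : Set M} (hs : MeasurableSet s)
    (hsx : s ⊆ (chartAt (EuclideanSpace ℝ (Fin (4 * n + 3))) x).source)
    (hsx' : s ⊆ (chartAt (EuclideanSpace ℝ (Fin (4 * n + 3))) x').source) :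
    B.chartVol x s = B.chartVol x' s := by
  let τ := extChartAt (𝓡 (4 * n + 3)) x' ∘ (extChartAt (𝓡 (4 * n + 3)) x).symm
  have hD := measurableSet_chart (n := n) (x := x) hs
  set D := (extChartAt (𝓡 (4 * n + 3)) x).target ∩ (extChartAt (𝓡 (4 * n + 3)) x).symm ⁻¹' s
    with hDdef
  have himg : (extChartAt (𝓡 (4 * n + 3)) x').target ∩ (extChartAt (𝓡 (4 * n + 3)) x').symm ⁻¹' s
      = τ '' D := by
    ext z
    constructor
    · rintro ⟨hz, hz'⟩
      have h1 : (extChartAt (𝓡 (4 * n + 3)) x').symm z ∈ (extChartAt (𝓡 (4 * n + 3)) x).source := by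
        rw [extChartAt_source]; exact hsx hz'
      refine ⟨extChartAt (𝓡 (4 * n + 3)) x ((extChartAt (𝓡 (4 * n + 3)) x').symm z),
        ⟨(extChartAt (𝓡 (4 * n + 3)) x).map_source h1, ?_⟩, ?_⟩
      · rw [Set.mem_preimage, (extChartAt (𝓡 (4 * n + 3)) x).left_inv h1]; exact hz'
      · simp only [τ, Function.comp_apply]
        rw [(extChartAt (𝓡 (4 * n + 3)) x).left_inv h1,
          (extChartAt (𝓡 (4 * n + 3)) x').right_inv hz]
    · rintro ⟨y, ⟨hy, hy'⟩, rfl⟩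
      have h1 : (extChartAt (𝓡 (4 * n + 3)) x).symm y ∈ (extChartAt (𝓡 (4 * n + 3)) x').source := by
        rw [extChartAt_source]; exact hsx' hy'
      refine ⟨(extChartAt (𝓡 (4 * n + 3)) x').map_source h1, ?_⟩
      simp only [Set.mem_preimage, τ, Function.comp_apply]
      rw [(extChartAt (𝓡 (4 * n + 3)) x').left_inv h1]
      exact hy'
  have hinj : Set.InjOn τ D := by
    rintro y ⟨hy, hy'⟩ z ⟨hz, hz'⟩ h
    have h1 (y) (hy' : y ∈ (extChartAt (𝓡 (4 * n + 3)) x).symm ⁻¹' s) :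
        (extChartAt (𝓡 (4 * n + 3)) x).symm y ∈ (extChartAt (𝓡 (4 * n + 3)) x').source := by
      rw [extChartAt_source]; exact hsx' hy'
    have h2 := (extChartAt (𝓡 (4 * n + 3)) x').injOn (h1 y hy') (h1 z hz') h
    exact (extChartAt (𝓡 (4 * n + 3)) x).symm.injOn hy hz h2
  rw [B.chartVol_apply hs, B.chartVol_apply hs, himg,
    lintegral_image_eq_lintegral_abs_det_fderiv_mul volume hD (f' := fun y => fderiv ℝ τ y)
      (fun y hy => (det_fderiv_transition hy.1 (hsx' hy.2)).1.hasFDerivAt.hasFDerivWithinAt) hinj]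
  refine setLIntegral_congr_fun hD fun y hy => ?_
  have h1 := hsx hy.2
  have h2 := hsx' hy.2
  have h3 : (extChartAt (𝓡 (4 * n + 3)) x').symm (τ y) = (extChartAt (𝓡 (4 * n + 3)) x).symm y :=
    (extChartAt (𝓡 (4 * n + 3)) x').left_inv (by rw [extChartAt_source]; exact h2)
  rw [h3, (det_fderiv_transition hy.1 h2).2, ← ENNReal.ofReal_mul (abs_nonneg _),
    ← B.density_eq hn h1 h2]

/-- A supremum of measures is not computed set by set, so an upper bound is exhibited: every chart
measure is at most `chartVol x` plus the restriction of `vol` to the complement of the chart domain,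
and therefore so is `vol`. -/
lemma vol_restrict_source (hn : 1 ≤ n) (x : M) :
    B.vol.restrict (chartAt (EuclideanSpace ℝ (Fin (4 * n + 3))) x).source = B.chartVol x := by
  have hO := (chartAt (EuclideanSpace ℝ (Fin (4 * n + 3))) x).open_source.measurableSet
  set O := (chartAt (EuclideanSpace ℝ (Fin (4 * n + 3))) x).source with hOdef
  have h1 (x' : M) : B.chartVol x' ≤ B.chartVol x + B.vol.restrict Oᶜ := by
    refine Measure.le_iff.2 fun t ht => ?_
    have hO' := (chartAt (EuclideanSpace ℝ (Fin (4 * n + 3))) x').open_source.measurableSet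
    rw [← measure_inter_add_sdiff t hO, Measure.add_apply, Measure.restrict_apply ht]
    refine add_le_add ?_ ?_
    · have h2 := measure_inter_add_sdiff (μ := B.chartVol x') (t ∩ O) hO'
      have h3 : B.chartVol x' ((t ∩ O) \ (chartAt (EuclideanSpace ℝ (Fin (4 * n + 3))) x').source)
        = 0 := measure_mono_null (fun q hq => hq.2) B.chartVol_compl_source
      rw [h3, add_zero] at h2
      rw [← h2, ← B.chartVol_eq_of_subset hn ((ht.inter hO).inter hO')
        (fun q hq => hq.1.2) fun q hq => hq.2]
      exact measure_mono fun q hq => hq.1.1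
    · exact Measure.le_iff'.1 (le_iSup B.chartVol x') _
  have h2 : B.vol ≤ B.chartVol x + B.vol.restrict Oᶜ := iSup_le h1
  refine le_antisymm (Measure.le_iff.2 fun t ht => ?_) (Measure.le_iff.2 fun t ht => ?_)
  · rw [Measure.restrict_apply ht]
    refine (Measure.le_iff'.1 h2 _).trans ?_
    rw [Measure.add_apply, Measure.restrict_apply (ht.inter hO), Set.inter_assoc,
      Set.inter_compl_self, Set.inter_empty, measure_empty, add_zero]
    exact measure_mono Set.inter_subset_left
  · have h3 : B.chartVol x (t \ O) = 0 :=
      measure_mono_null (fun q hq => hq.2) B.chartVol_compl_source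
    rw [Measure.restrict_apply ht, ← measure_inter_add_sdiff t hO, h3, add_zero]
    exact Measure.le_iff'.1 (le_iSup B.chartVol x) _

/-- In the chart around a point of the open set the measure has a positive density with respect to
Lebesgue measure on a nonempty open set. -/
lemma isOpenPosMeasure_vol (hn : 1 ≤ n) : B.vol.IsOpenPosMeasure where
  open_pos U hU hne := by
    obtain ⟨x, hx⟩ := hne
    intro h0
    have h1 : B.chartVol x U = 0 :=
      le_antisymm ((Measure.le_iff'.1 (le_iSup B.chartVol x) U).trans h0.le) zero_le
    rw [B.chartVol_apply hU.measurableSet] at h1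
    have hO : IsOpen ((extChartAt (𝓡 (4 * n + 3)) x).target ∩
        (extChartAt (𝓡 (4 * n + 3)) x).symm ⁻¹' U) :=
      (continuousOn_extChartAt_symm x).isOpen_inter_preimage (isOpen_extChartAt_target x) hU
    have h2 := ContinuousOn.aemeasurable (μ := volume) ((B.continuousOn_density (x := x) hn).mono
      Set.inter_subset_left) hO.measurableSet
    rw [lintegral_eq_zero_iff' h2.ennreal_ofReal, Filter.EventuallyEq,
      ae_restrict_iff' hO.measurableSet] at h1
    have h3 : volume ((extChartAt (𝓡 (4 * n + 3)) x).target ∩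
        (extChartAt (𝓡 (4 * n + 3)) x).symm ⁻¹' U) = 0 := by
      refine measure_mono_null (fun y hy => ?_) (ae_iff.1 h1)
      rw [Set.mem_ofPred_eq]
      intro h
      have h4 := ENNReal.ofReal_eq_zero.1 (h hy)
      exact absurd (B.density_pos hn (chart_symm_mem hy.1)) (not_lt.2 h4)
    refine (hO.measure_pos volume ⟨extChartAt (𝓡 (4 * n + 3)) x x, mem_extChartAt_target x, ?_⟩).ne'
      h3
    rw [Set.mem_preimage, extChartAt_to_inv]
    exact hx

end Structure.Biquard

end Gluing

/-- Integration by parts against the constant function 1. -/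
lemma integral_fderiv_eq_zero {m : ℕ} {k : EuclideanSpace ℝ (Fin m) → ℝ} (hk : ContDiff ℝ 1 k)
    (hc : HasCompactSupport k) (v : EuclideanSpace ℝ (Fin m)) : ∫ y, fderiv ℝ k y v = 0 := by
  have h1 : Continuous fun y => fderiv ℝ k y v :=
    (hk.continuous_fderiv one_ne_zero).clm_apply continuous_const
  have h2 : HasCompactSupport fun y => fderiv ℝ k y v := hc.fderiv_apply (𝕜 := ℝ) v
  have h3 := integral_mul_fderiv_eq_neg_fderiv_mul_of_integrable (μ := volume)
    (f := fun _ : EuclideanSpace ℝ (Fin m) => (1 : ℝ)) (g := k) (v := v) (by simp)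
    (by simpa using h1.integrable_of_hasCompactSupport h2)
    (by simpa using hk.continuous.integrable_of_hasCompactSupport hc)
    (fun _ _ => differentiableAt_const _) (fun y _ => (hk.differentiable one_ne_zero) y)
  simpa using h3

/-! ### Functions with compact support in a chart domain -/

section Pullback

variable {n : ℕ} {M : Type*} [TopologicalSpace M]
  [ChartedSpace (EuclideanSpace ℝ (Fin (4 * n + 3))) M] [IsManifold (𝓡 (4 * n + 3)) ∞ M]
  {x p : M} {h : M → ℝ} {K : Set M} {y : EuclideanSpace ℝ (Fin (4 * n + 3))}

open Structure.Biquard (coordVec)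

/-- The expression of a function in the preferred chart around `x`, extended by zero. -/
def inChart (x : M) (h : M → ℝ) : EuclideanSpace ℝ (Fin (4 * n + 3)) → ℝ :=
  (extChartAt (𝓡 (4 * n + 3)) x).target.indicator (h ∘ (extChartAt (𝓡 (4 * n + 3)) x).symm)

lemma inChart_of_mem (hy : y ∈ (extChartAt (𝓡 (4 * n + 3)) x).target) :
    inChart x h y = h ((extChartAt (𝓡 (4 * n + 3)) x).symm y) := Set.indicator_of_mem hy _

lemma inChart_of_notMem (hy : y ∉ (extChartAt (𝓡 (4 * n + 3)) x).target) :
    inChart x h y = 0 := Set.indicator_of_notMem hy _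

lemma inChart_eventuallyEq (hy : y ∈ (extChartAt (𝓡 (4 * n + 3)) x).target) :
    inChart x h =ᶠ[𝓝 y] h ∘ (extChartAt (𝓡 (4 * n + 3)) x).symm :=
  ((isOpen_extChartAt_target x).eventually_mem hy).mono fun _ hz => inChart_of_mem hz

lemma inChart_sum {ι : Type*} (s : Finset ι) (h : ι → M → ℝ) :
    inChart (n := n) x (fun q => ∑ i ∈ s, h i q) = fun y => ∑ i ∈ s, inChart x (h i) y := by
  funext y
  by_cases hy : y ∈ (extChartAt (𝓡 (4 * n + 3)) x).target
  · simp only [inChart_of_mem hy]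
  · simp only [inChart_of_notMem hy, Finset.sum_const_zero]

variable (hK : IsCompact K) (hKx : K ⊆ (chartAt (EuclideanSpace ℝ (Fin (4 * n + 3))) x).source)
  (h0 : ∀ q ∉ K, h q = 0)
include hK hKx

omit [IsManifold (𝓡 (4 * n + 3)) ∞ M] in
lemma isCompact_chart_image : IsCompact (extChartAt (𝓡 (4 * n + 3)) x '' K) :=
  hK.image_of_continuousOn ((continuousOn_extChartAt x).mono (by rwa [extChartAt_source]))

include h0

omit hK in
lemma inChart_eq_zero (hy : y ∉ extChartAt (𝓡 (4 * n + 3)) x '' K) : inChart x h y = 0 := by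
  by_cases hy' : y ∈ (extChartAt (𝓡 (4 * n + 3)) x).target
  · rw [inChart_of_mem hy']
    exact h0 _ fun hq => hy ⟨_, hq, (extChartAt (𝓡 (4 * n + 3)) x).right_inv hy'⟩
  · exact inChart_of_notMem hy'

lemma inChart_eventually_eq_zero (hy : y ∉ extChartAt (𝓡 (4 * n + 3)) x '' K) :
    inChart x h =ᶠ[𝓝 y] fun _ => 0 :=
  ((isCompact_chart_image hK hKx).isClosed.isOpen_compl.eventually_mem hy).mono fun _ hz =>
    inChart_eq_zero hKx h0 hz

lemma hasCompactSupport_inChart : HasCompactSupport (inChart (n := n) x h) :=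
  HasCompactSupport.intro (isCompact_chart_image hK hKx) fun _ hy => inChart_eq_zero hKx h0 hy

omit hK h0 in
lemma mem_target_of_mem_image (hy : y ∈ extChartAt (𝓡 (4 * n + 3)) x '' K) :
    y ∈ (extChartAt (𝓡 (4 * n + 3)) x).target := by
  obtain ⟨q, hq, rfl⟩ := hy
  exact (extChartAt (𝓡 (4 * n + 3)) x).map_source (by rw [extChartAt_source]; exact hKx hq)

lemma continuous_inChart
    (hh : ∀ q ∈ (chartAt (EuclideanSpace ℝ (Fin (4 * n + 3))) x).source, ContinuousAt h q) :
    Continuous (inChart (n := n) x h) := by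
  rw [continuous_iff_continuousAt]
  intro y
  by_cases hy : y ∈ extChartAt (𝓡 (4 * n + 3)) x '' K
  · have hy' := mem_target_of_mem_image hKx hy
    exact ((hh _ (chart_symm_mem hy')).comp (continuousAt_extChartAt_symm'' hy')).congr
      (inChart_eventuallyEq hy').symm
  · exact continuousAt_const.congr (inChart_eventually_eq_zero hK hKx h0 hy).symm

/-- Extension by zero is harmless: the image of K is compact, hence closed, and every point lies
either in the open chart target or in the open complement of that image, where the function is zero.
-/
lemma contDiff_inChart
    (hh : ∀ q ∈ (chartAt (EuclideanSpace ℝ (Fin (4 * n + 3))) x).source, SmF (4 * n + 3) h q) :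
    ContDiff ℝ 1 (inChart (n := n) x h) := by
  rw [contDiff_iff_contDiffAt]
  intro y
  by_cases hy : y ∈ extChartAt (𝓡 (4 * n + 3)) x '' K
  · have hy' := mem_target_of_mem_image hKx hy
    have h1 : ContMDiffAt 𝓘(ℝ, EuclideanSpace ℝ (Fin (4 * n + 3))) (𝓡 (4 * n + 3)) ∞
        (extChartAt (𝓡 (4 * n + 3)) x).symm y :=
      (contMDiffOn_extChartAt_symm x).contMDiffAt (extChartAt_target_mem_nhds' hy')
    have h2 := contMDiffAt_iff_contDiffAt.1 ((hh _ (chart_symm_mem hy')).contMDiffAt.comp y h1)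
    exact (h2.of_le (by simp)).congr_of_eventuallyEq (inChart_eventuallyEq hy')
  · exact contDiffAt_const.congr_of_eventuallyEq (inChart_eventually_eq_zero hK hKx h0 hy)

lemma fderiv_inChart
    (hh : ∀ q ∈ (chartAt (EuclideanSpace ℝ (Fin (4 * n + 3))) x).source, SmF (4 * n + 3) h q)
    (j : Fin (4 * n + 3)) (y : EuclideanSpace ℝ (Fin (4 * n + 3))) :
    fderiv ℝ (inChart x h) y (EuclideanSpace.single j 1)
      = inChart x (fun q => dirDeriv h q (coordVec x q j)) y := by
  by_cases hy : y ∈ (extChartAt (𝓡 (4 * n + 3)) x).target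
  · rw [(inChart_eventuallyEq hy).fderiv_eq, fderiv_chart hy (hh _ (chart_symm_mem hy)),
      inChart_of_mem hy]
  · have hy' : y ∉ extChartAt (𝓡 (4 * n + 3)) x '' K := fun h => hy (mem_target_of_mem_image hKx h)
    rw [(inChart_eventually_eq_zero hK hKx h0 hy').fderiv_eq, inChart_of_notMem hy]
    simp

end Pullback

/-! ### The divergence theorem for horizontal fields -/

section Integration

variable {n : ℕ} {M : Type*} [TopologicalSpace M] [T2Space M]
  [ChartedSpace (EuclideanSpace ℝ (Fin (4 * n + 3))) M] [IsManifold (𝓡 (4 * n + 3)) ∞ M]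
  [MeasurableSpace M] [BorelSpace M] {S : Structure n M}
  {x p : M} {h : M → ℝ} {K : Set M} {Y : ∀ q : M, T (4 * n + 3) q}

open Structure.Biquard (coordVec)

namespace Structure.Biquard

variable (B : S.Biquard) (hn : 1 ≤ n) (hh : Continuous h) (hK : IsCompact K)
  (hKx : K ⊆ (chartAt (EuclideanSpace ℝ (Fin (4 * n + 3))) x).source) (h0 : ∀ q ∉ K, h q = 0)
include hn

lemma aemeasurable_density : AEMeasurable
    (fun y => ENNReal.ofReal (B.density x ((extChartAt (𝓡 (4 * n + 3)) x).symm y)))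
    ((volume : Measure (EuclideanSpace ℝ (Fin (4 * n + 3)))).restrict
      (extChartAt (𝓡 (4 * n + 3)) x).target) :=
  ((B.continuousOn_density hn).aemeasurable
    (isOpen_extChartAt_target x).measurableSet).ennreal_ofReal

include hh hKx h0

/-- Integration of a function supported in a chart domain. -/
lemma integral_vol_eq : ∫ q, h q ∂B.vol = ∫ y, inChart (n := n) x (fun q => B.density x q * h q) y := by
  have h1 := aemeasurable_chart_symm (n := n) (x := x)
  have h2 : ∀ q ∉ (chartAt (EuclideanSpace ℝ (Fin (4 * n + 3))) x).source, h q = 0 :=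
    fun q hq => h0 q fun h => hq (hKx h)
  rw [← setIntegral_eq_integral_of_forall_compl_eq_zero h2, B.vol_restrict_source hn, chartVol,
    integral_map (h1.mono_ac (withDensity_absolutelyContinuous _ _)) hh.aestronglyMeasurable]
  refine (integral_withDensity_eq_integral_toReal_smul₀ (B.aemeasurable_density hn)
    (.of_forall fun y => ENNReal.ofReal_lt_top) _).trans ?_
  rw [inChart, integral_indicator (isOpen_extChartAt_target x).measurableSet]
  refine setIntegral_congr_fun (isOpen_extChartAt_target x).measurableSet fun y hy => ?_
  simp only [Function.comp_apply, smul_eq_mul]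
  rw [ENNReal.toReal_ofReal (B.density_pos hn (chart_symm_mem hy)).le]

include hK

lemma integrable_of_subset_chart : Integrable h B.vol := by
  have h1 := aemeasurable_chart_symm (n := n) (x := x)
  have h2 : Function.support h ⊆ (chartAt (EuclideanSpace ℝ (Fin (4 * n + 3))) x).source :=
    fun q hq => hKx (by_contra fun h => hq (h0 q h))
  rw [← integrableOn_iff_integrable_of_support_subset h2, IntegrableOn, B.vol_restrict_source hn,
    chartVol, integrable_map_measure hh.aestronglyMeasurable
      (h1.mono_ac (withDensity_absolutelyContinuous _ _))]
  refine (integrable_withDensity_iff_integrable_smul₀' (B.aemeasurable_density hn)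
    (.of_forall fun y => ENNReal.ofReal_lt_top)).2 ?_
  have h3 : Integrable (inChart (n := n) x (fun q => B.density x q * h q)) := by
    have h0' : ∀ q ∉ K, B.density x q * h q = 0 := fun q hq => by rw [h0 q hq, mul_zero]
    exact (continuous_inChart hK hKx h0' fun q hq =>
      (B.smF_density hn hq).contMDiffAt.continuousAt.mul hh.continuousAt
      ).integrable_of_hasCompactSupport (hasCompactSupport_inChart hK hKx h0')
  refine (h3.restrict (s := (extChartAt (𝓡 (4 * n + 3)) x).target)).congr ?_
  refine (ae_restrict_iff' (isOpen_extChartAt_target x).measurableSet).2 (.of_forall fun y hy => ?_)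
  rw [inChart_of_mem hy]
  refine congrArg (· * _) ?_
  exact (ENNReal.toReal_ofReal (B.density_pos hn (chart_symm_mem hy)).le).symm

omit hh h0

/-- The divergence of a horizontal vector field supported in a chart domain integrates to zero. -/
lemma integral_div_of_subset_chart (hY : ∀ q, Sm Y q) (hYH : ∀ q, Y q ∈ S.H q)
    (h0 : ∀ q ∉ K, Y q = 0)
    (hc : Continuous fun q => ∑ a, B.gg q (B.cov Y q (S.e a q)) (S.e a q)) :
    ∫ q, ∑ a, B.gg q (B.cov Y q (S.e a q)) (S.e a q) ∂B.vol = 0 := by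
  have h1 : ∀ q ∉ K, ∑ a, B.gg q (B.cov Y q (S.e a q)) (S.e a q) = 0 := fun q hq => by
    have e : ∀ᶠ z in 𝓝 q, Y z = 0 :=
      (hK.isClosed.isOpen_compl.eventually_mem hq).mono fun z hz => h0 z hz
    refine Finset.sum_eq_zero fun a _ => ?_
    rw [cov_congr Sm.zero e, cov_zero, gg]
    simp
  rw [B.integral_vol_eq hn hc hKx h1]
  -- The j-th component of Y times the density. By `div_density` the integrand is Σ ∂_j k_j in the
  -- chart, and each summand integrates to zero.
  let k (j : Fin (4 * n + 3)) (q : M) : ℝ := B.density x q * dirDeriv (coordFun x j) q (Y q)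
  have hk (j) : ∀ q ∈ (chartAt (EuclideanSpace ℝ (Fin (4 * n + 3))) x).source,
      SmF (4 * n + 3) (k j) q := fun q hq =>
    (B.smF_density hn hq).mul (smF_dirDeriv (smF_coordFun hq j) (hY q))
  have hk0 (j) : ∀ q ∉ K, k j q = 0 := fun q hq => by
    simp only [k]
    rw [h0 q hq, dirDeriv_vzero, mul_zero]
  have h2 : inChart (n := n) x (fun q => B.density x q * ∑ a, B.gg q (B.cov Y q (S.e a q)) (S.e a q))
      = fun y => ∑ j : Fin (4 * n + 3), fderiv ℝ (inChart x (k j)) y (EuclideanSpace.single j 1) := by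
    have h3 : inChart (n := n) x (fun q => B.density x q * ∑ a, B.gg q (B.cov Y q (S.e a q)) (S.e a q))
      = inChart (n := n) x (fun q => ∑ j, dirDeriv (k j) q (coordVec x q j)) := by
      funext y
      by_cases hy : y ∈ (extChartAt (𝓡 (4 * n + 3)) x).target
      · rw [inChart_of_mem hy, inChart_of_mem hy]
        exact (B.div_density hn (chart_symm_mem hy) (hY _) (.of_forall hYH)).symm
      · rw [inChart_of_notMem hy, inChart_of_notMem hy]
    rw [h3, inChart_sum]
    funext y
    exact Finset.sum_congr rfl fun j _ => (fderiv_inChart hK hKx (hk0 j) (hk j) j y).symm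
  rw [h2, integral_finsetSum]
  · exact Finset.sum_eq_zero fun j _ => integral_fderiv_eq_zero
      (contDiff_inChart hK hKx (hk0 j) (hk j)) (hasCompactSupport_inChart hK hKx (hk0 j)) _
  · intro j _
    have hd := contDiff_inChart hK hKx (hk0 j) (hk j)
    exact ((hd.continuous_fderiv one_ne_zero).clm_apply
      continuous_const).integrable_of_hasCompactSupport
      ((hasCompactSupport_inChart hK hKx (hk0 j)).fderiv_apply (𝕜 := ℝ) _)

omit hK hKx

omit hn [MeasurableSpace M] [BorelSpace M] in
lemma smForm₂_cov (hY : ∀ q, Sm Y q) : SmForm₂ fun q v w => B.gg q (B.cov Y q v) w where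
  add_left p u v w := by rw [map_add, B.smForm₂_gg.add_left]
  smul_left p c v w := by rw [map_smul, B.smForm₂_gg.smul_left]
  add_right p u v w := B.smForm₂_gg.add_right _ _ _ _
  smul_right p c v w := B.smForm₂_gg.smul_right _ _ _ _
  smooth hX hZ := B.smForm₂_gg.smooth (Sm.nabla B.smooth_cov hX (hY _)) hZ

omit hn [MeasurableSpace M] [BorelSpace M] in
-- Near p the contraction is computed with the one smooth frame `S.frame p`, although the frame used
-- in the statement varies with the point without any continuity.
lemma smF_sum_e {β : ∀ p : M, T (4 * n + 3) p → T (4 * n + 3) p → ℝ} (hβ : SmForm₂ β) (p : M) :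
    SmF (4 * n + 3) (fun q => ∑ a, β q (S.e a q) (S.e a q)) p := by
  have hU := S.isOpen_nhd p
  have hp := S.mem_nhd p
  exact (SmF.sum fun a _ => hβ.smooth ((S.frame p).sm_e hU hp a) ((S.frame p).sm_e hU hp a)).congr
    ((hU.eventually_mem hp).mono fun q hq => (S.frame p).sum_e_eq hβ hq)

variable [CompactSpace M]

omit [MeasurableSpace M] [BorelSpace M] hn in
lemma exists_partition : ∃ (t : Finset M) (ρ : t → M → ℝ),
    (∀ i, ContMDiff (𝓡 (4 * n + 3)) 𝓘(ℝ, ℝ) ∞ (ρ i)) ∧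
    (∀ i, tsupport (ρ i) ⊆ (chartAt (EuclideanSpace ℝ (Fin (4 * n + 3))) i.1).source) ∧
    ∀ q, ∑ i, ρ i q = 1 := by
  obtain ⟨t, -, ht⟩ := isCompact_univ.elim_nhds_subcover
    (fun x : M => (chartAt (EuclideanSpace ℝ (Fin (4 * n + 3))) x).source)
    fun x _ => chart_source_mem_nhds _ x
  obtain ⟨ρ, hρ⟩ := SmoothPartitionOfUnity.exists_isSubordinate (𝓡 (4 * n + 3)) isClosed_univ
    (fun i : t => (chartAt (EuclideanSpace ℝ (Fin (4 * n + 3))) i.1).source)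
    (fun i => (chartAt _ i.1).open_source) (by simpa [Set.iUnion_subtype] using ht)
  refine ⟨t, fun i => ρ i, fun i => (ρ i).contMDiff, hρ, fun q => ?_⟩
  rw [← finsum_eq_sum_of_fintype]
  exact ρ.sum_eq_one (Set.mem_univ q)

/-- The constant 1 is a finite sum of continuous functions, each with compact support in a chart
domain, hence integrable. -/
lemma isFiniteMeasure_vol : IsFiniteMeasure B.vol := by
  obtain ⟨t, ρ, h1, h2, h3⟩ := exists_partition (n := n) (M := M)
  have h4 : Integrable (fun q => ∑ i, ρ i q) B.vol := integrable_finsetSum _ fun i _ =>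
    B.integrable_of_subset_chart hn (h1 i).continuous (isClosed_tsupport _).isCompact (h2 i)
      fun q hq => image_eq_zero_of_notMem_tsupport hq
  simp only [h3] at h4
  exact (integrable_const_iff_isFiniteMeasure one_ne_zero).1 h4

/-- The divergence theorem for horizontal vector fields. -/
theorem integral_div (hY : ∀ q, Sm Y q) (hYH : ∀ q, Y q ∈ S.H q) :
    ∫ q, ∑ a, B.gg q (B.cov Y q (S.e a q)) (S.e a q) ∂B.vol = 0 := by
  obtain ⟨t, ρ, h1, h2, h3⟩ := exists_partition (n := n) (M := M)
  have hρ (i q) : SmF (4 * n + 3) (ρ i) q := smF_of_contMDiff (h1 i)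
  have hZ (i q) : Sm (fun q => ρ i q • Y q) q := Sm.smul (hρ i q) (hY q)
  have hc (i) : Continuous fun q => ∑ a, B.gg q (B.cov (fun q => ρ i q • Y q) q (S.e a q)) (S.e a q) :=
    continuous_iff_continuousAt.2 fun p =>
      (smF_sum_e (B.smForm₂_cov (hZ i)) p).contMDiffAt.continuousAt
  have h0 (i) : ∀ q ∉ tsupport (ρ i), ρ i q = 0 := fun q hq => image_eq_zero_of_notMem_tsupport hq
  have hK (i) : IsCompact (tsupport (ρ i)) := (isClosed_tsupport _).isCompact
  have h4 (q) : ∑ a, B.gg q (B.cov Y q (S.e a q)) (S.e a q)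
      = ∑ i, ∑ a, B.gg q (B.cov (fun q => ρ i q • Y q) q (S.e a q)) (S.e a q) := by
    rw [Finset.sum_comm]
    refine Finset.sum_congr rfl fun a _ => ?_
    have e := cov_congr (cov := B.cov) (hY q)
      (.of_forall fun z : M => by rw [← Finset.sum_smul, h3, one_smul] :
        ∀ᶠ z in 𝓝 q, ∑ i, ρ i z • Y z = Y z) (S.e a q)
    rw [← e, cov_sum fun i _ => hZ i q]
    simp only [gg, map_sum, LinearMap.sum_apply]
  simp only [h4]
  rw [integral_finsetSum]
  · exact Finset.sum_eq_zero fun i _ => B.integral_div_of_subset_chart hn (hK i) (h2 i) (hZ i)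
      (fun q => (S.H q).smul_mem _ (hYH q)) (fun q hq => by rw [h0 i q hq, zero_smul]) (hc i)
  · have := B.isFiniteMeasure_vol hn
    exact fun i _ => (hc i).integrable_of_hasCompactSupport (HasCompactSupport.of_compactSpace _)

end Structure.Biquard

end Integration

/-! ### B_0 as an orthogonal projection of the Hessian -/

namespace Quat

variable {n : ℕ} {V : Type*} [AddCommGroup V] [Module ℝ V] (D : Quat n V)

lemma g_sum_smul (f : V →ₗ[ℝ] ℝ) (Y : V) : D.g (∑ a, f (D.e a) • D.e a) Y = f Y := by
  simp only [map_sum, map_smul, LinearMap.sum_apply, LinearMap.smul_apply, smul_eq_mul]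
  rw [← D.sum_apply f Y]
  exact Finset.sum_congr rfl fun a _ => mul_comm _ _

/-- The vector dual to a linear form depends on the metric only. -/
lemma sum_smul_eq {D D' : Quat n V} (hg : D.g = D'.g) (f : V →ₗ[ℝ] ℝ) :
    ∑ a, f (D.e a) • D.e a = ∑ a, f (D'.e a) • D'.e a := by
  refine sub_eq_zero.1 (D.eq_zero_of_g fun Y => ?_)
  rw [map_sub, LinearMap.sub_apply, D.g_sum_smul, hg, D'.g_sum_smul, sub_self]

/-- The part of an endomorphism which commutes with the complex structures. -/
lemma I_mul_proj (A : Module.End ℝ V) (t : Fin 3) :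
    D.I t * (A - ∑ s, D.I s * A * D.I s) = (A - ∑ s, D.I s * A * D.I s) * D.I t := by
  simp only [Fin.sum_univ_three, mul_sub, sub_mul, mul_add, add_mul, mul_assoc]
  fin_cases t <;>
  simp only [Fin.zero_eta, Fin.mk_one, Fin.reduceFinMk, D.I_sq_mul, D.I01_mul, D.I10_mul,
    D.I12_mul, D.I21_mul, D.I20_mul, D.I02_mul, D.I_sq, D.I_mul, D.I_mul', D.I12, D.I21, D.I20,
    D.I02, mul_neg, mul_one] <;> abel

lemma sum_sum_mul (A A' : Module.End ℝ V) :
    ∑ a, ∑ b, D.g (A (D.e a)) (D.e b) * D.g (A' (D.e a)) (D.e b) = D.tr (D.adj A * A') := by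
  rw [tr_apply]
  refine Finset.sum_congr rfl fun a _ => ?_
  rw [← D.g_e_sum, Module.End.mul_apply, D.g_adj, D.symm]

/-- The trace-free part of the projection to the commutant of the complex structures is an
orthogonal projection. -/
lemma sum_proj_mul (hn : 1 ≤ n) (h : V →ₗ[ℝ] V →ₗ[ℝ] ℝ) (b : V → V → ℝ)
    (hb : ∀ X Y, b X Y = (h X Y + ∑ s, h (D.I s X) (D.I s Y)
      - 1 / n * (∑ a, h (D.e a) (D.e a)) * D.g X Y) / 4) :
    ∑ a, ∑ c, b (D.e a) (D.e c) * h (D.e a) (D.e c) = ∑ a, ∑ c, b (D.e a) (D.e c) ^ 2 := by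
  let A : Module.End ℝ V :=
    { toFun := fun X => ∑ a, h X (D.e a) • D.e a
      map_add' := fun X Y => by simp [add_smul, Finset.sum_add_distrib]
      map_smul' := fun c X => by simp [mul_smul, Finset.smul_sum] }
  have hA (X Y) : h X Y = D.g (A X) Y := (D.g_sum_smul (h X) Y).symm
  have htr : ∑ a, h (D.e a) (D.e a) = D.tr A := Finset.sum_congr rfl fun a _ => hA _ _
  set G := (1 / 4 : ℝ) • ((A - ∑ s, D.I s * A * D.I s) - (1 / n * D.tr A) • 1) with hG
  have hn0 : (n : ℝ) ≠ 0 := by exact_mod_cast (by omega : n ≠ 0)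
  have hbG (X Y) : b X Y = D.g (G X) Y := by
    rw [hb, htr, hG]
    simp only [hA, LinearMap.smul_apply, LinearMap.sub_apply, LinearMap.sum_apply,
      Module.End.mul_apply, map_smul, map_sub, map_sum, Module.End.one_apply, smul_eq_mul]
    have : ∑ s, D.g (A (D.I s X)) (D.I s Y) = -∑ s, D.g (D.I s (A (D.I s X))) Y := by
      rw [← Finset.sum_neg_distrib]
      exact Finset.sum_congr rfl fun s _ => by rw [D.g_I, neg_neg]
    rw [this]
    ring
  have hGI (t) : D.I t * G = G * D.I t := by
    rw [hG, mul_smul_comm, smul_mul_assoc, mul_sub, sub_mul, D.I_mul_proj, mul_smul_comm,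
      smul_mul_assoc, mul_one, one_mul]
  have hGI' (t) : D.adj G * D.I t = D.I t * D.adj G := by
    have := congrArg D.adj (hGI t)
    rw [adj_mul, adj_mul, adj_I] at this
    simpa using this
  have hIAI (s) (E : Module.End ℝ V) (hE : E * D.I s = D.I s * E) :
      D.tr (E * (D.I s * A * D.I s)) = -D.tr (E * A) := by
    rw [← mul_assoc, D.tr_mul_comm _ (D.I s), ← mul_assoc, ← mul_assoc, ← hE, mul_assoc E, D.I_sq,
      mul_neg, mul_one, neg_mul, map_neg]
  have hIAI1 (s) : D.tr (D.I s * A * D.I s) = -D.tr A := by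
    simpa using hIAI s 1 (by rw [one_mul, mul_one])
  have htG : D.tr G = 0 := by
    rw [hG]
    simp only [map_smul, map_sub, map_sum, hIAI1, D.tr_one, smul_eq_mul, Finset.sum_const,
      Finset.card_univ, Fintype.card_fin]
    field_simp
    simp
    ring
  -- The endomorphism G of b commutes with Q, so each -I_s A I_s pairs with G exactly as A does; the
  -- four equal terms cancel the factor 1/4. The multiple of the identity drops out because G is
  -- trace-free.
  have key : D.tr (D.adj G * G) = D.tr (D.adj G * A) := by
    conv_lhs => rw [hG]
    rw [← hG, mul_smul_comm, mul_sub, mul_sub, mul_smul_comm, mul_one, Finset.mul_sum]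
    simp only [map_smul, map_sub, map_sum, hIAI _ _ (hGI' _), D.tr_adj, htG, smul_eq_mul,
      Finset.sum_const, Finset.card_univ, Fintype.card_fin]
    simp
    ring
  simp only [hbG, hA, sq]
  rw [D.sum_sum_mul, D.sum_sum_mul, key]

end Quat

/-! ### The divergence theorem for one-forms -/

section NonNegativity

variable {n : ℕ} {M : Type*} [TopologicalSpace M] [T2Space M]
  [ChartedSpace (EuclideanSpace ℝ (Fin (4 * n + 3))) M] [IsManifold (𝓡 (4 * n + 3)) ∞ M]
  {S : Structure n M} {α : ∀ p : M, T (4 * n + 3) p → ℝ} {p : M}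

/-- The horizontal vector field dual to a one-form. -/
def dual (S : Structure n M) (α : ∀ p : M, T (4 * n + 3) p → ℝ) (p : M) : S.H p :=
  ∑ a, α p (S.e a p) • S.e a p

/-- A one-form at a point, restricted to horizontal vectors. -/
def SmForm.horLin (hα : SmForm α) (S : Structure n M) (p : M) : S.H p →ₗ[ℝ] ℝ where
  toFun X := α p X
  map_add' X Y := hα.add p X Y
  map_smul' c X := hα.smul p c X

namespace Structure.Biquard

variable (B : S.Biquard)

lemma g_dual (hα : SmForm α) (X : S.H p) : S.g p (dual S α p) X = α p X :=
  ((S.frame p).quat (S.mem_nhd p)).g_sum_smul (hα.horLin S p) X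

lemma gg_dual (hα : SmForm α) (v : T (4 * n + 3) p) :
    B.gg p (dual S α p) v = α p (B.hor p v) := by
  rw [gg, B.hor_coe, g_dual hα]

lemma sm_dual (hα : SmForm α) (p : M) : Sm (fun q => (dual S α q : T (4 * n + 3) q)) p := by
  have hU := S.isOpen_nhd p
  have hp := S.mem_nhd p
  have he (a) := (S.frame p).sm_e hU hp a
  refine (Sm.sum (s := Finset.univ) fun a _ => Sm.smul (hα.smooth (he a)) (he a)).congr
    ((hU.eventually_mem hp).mono fun q hq => ?_)
  have h1 := Quat.sum_smul_eq (D := (S.frame q).quat (S.mem_nhd q)) (D' := (S.frame p).quat hq) rfl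
    (hα.horLin S q)
  have h2 := congrArg (fun X : S.H q => (X : T (4 * n + 3) q)) h1
  simp only [Submodule.coe_sum, Submodule.coe_smul] at h2
  refine Eq.trans ?_ h2
  simp only [dual, Submodule.coe_sum, Submodule.coe_smul]
  rfl

/-- The horizontal covariant derivatives of a one-form and of the dual vector field. -/
lemma gg_cov_dual (hα : SmForm α) (a b : Fin (4 * n)) :
    B.gg p (B.cov (fun q => (dual S α q : T (4 * n + 3) q)) p (S.e a p)) (S.e b p)
      = covOne B.cov α p (S.e a p) (S.e b p) := by
  have hU := S.isOpen_nhd p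
  have hp := S.mem_nhd p
  have he := (S.frame p).sm_e hU hp b
  have h1 := B.dirDeriv_gg (sm_dual (S := S) hα p) he (S.e a p)
  have h3 := B.cov_mem_of_eventually_mem he (.of_forall fun q => ((S.frame p).e b q).2) (S.e a p)
  simp only [B.gg_dual hα, B.hor_coe, B.hor_of_mem h3] at h1
  have h2 := covOne_eq (cov := B.cov) hα he (S.e a p)
  refine Eq.trans ?_ h2.symm
  rw [h1, add_sub_cancel_right]
  rfl

variable [MeasurableSpace M] [BorelSpace M] [CompactSpace M] (hn : 1 ≤ n)
include hn

/-- The divergence theorem for one-forms. -/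
theorem integral_covOne (hα : SmForm α) :
    ∫ q, ∑ a, covOne B.cov α q (S.e a q) (S.e a q) ∂B.vol = 0 := by
  have h := B.integral_div hn (fun q => sm_dual (S := S) hα q) fun q => (dual S α q).2
  simpa only [B.gg_cov_dual hα] using h

lemma integrable_of_smF {h : M → ℝ} (hh : ∀ p, SmF (4 * n + 3) h p) : Integrable h B.vol := by
  have := B.isFiniteMeasure_vol hn
  exact (continuous_iff_continuousAt.2 fun p =>
    (hh p).contMDiffAt.continuousAt).integrable_of_hasCompactSupport
      (HasCompactSupport.of_compactSpace _)

end Structure.Biquard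

end NonNegativity

/-! ### Integration of the P-form and the C-operator -/

section POperator

variable {n : ℕ} {M : Type*} [TopologicalSpace M] [T2Space M]
  [ChartedSpace (EuclideanSpace ℝ (Fin (4 * n + 3))) M] [IsManifold (𝓡 (4 * n + 3)) ∞ M]
  {S : Structure n M} {f : M → ℝ} {p : M}

namespace Structure.Biquard

variable (B : S.Biquard)

lemma P_hor (f : M → ℝ) (v : T (4 * n + 3) p) : B.P f p (B.hor p v) = B.P f p v := by
  unfold P
  simp only [B.hor_coe]

lemma B0_hor (f : M → ℝ) (v w : T (4 * n + 3) p) :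
    B.B0 f p (B.hor p v) (B.hor p w) = B.B0 f p v w := by
  unfold B0
  simp only [B.hor_coe]

variable (hn : 2 ≤ n) (hf : ∀ p, SmF (4 * n + 3) f p)
include hn hf

/-- The divergence formula solved for P_f, which is possible because n ≠ 1. Linearity and smoothness
of P_f are obtained from this expression, since the definition of P_f uses frames that vary with the
point. -/
lemma P_eq (v : T (4 * n + 3) p) : B.P f p v = 4 * n / (n - 1)
    * ∑ a, covTwo B.cov (B.B0 f) p (S.e a p) (S.e a p) (B.hor p v) := by
  have h1 := B.div_B0 (by omega) hf (B.hor p v)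
  have h2 : (2 : ℝ) ≤ n := by exact_mod_cast hn
  have h3 : (n : ℝ) - 1 ≠ 0 := by linarith
  have h4 : (n : ℝ) ≠ 0 := by linarith
  rw [B.P_hor] at h1
  field_simp at h1 ⊢
  linarith

lemma smForm_P : SmForm (B.P f) where
  add p v w := by
    have hβ := B.smForm₂_B0 hf (by omega)
    simp only [B.P_eq hn hf, map_add, Submodule.coe_add, covTwo_add_right hβ,
      Finset.sum_add_distrib]
    ring
  smul p c v := by
    have hβ := B.smForm₂_B0 hf (by omega)
    simp only [B.P_eq hn hf, map_smul, Submodule.coe_smul, covTwo_smul_right hβ, ← Finset.mul_sum]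
    ring
  smooth {p X} hX := by
    have hβ := B.smForm₂_B0 hf (by omega)
    have hU := S.isOpen_nhd p
    have hp := S.mem_nhd p
    have he (a) := (S.frame p).sm_e hU hp a
    refine ((SmF.const (4 * n / (n - 1) : ℝ)).mul (SmF.sum (s := Finset.univ) fun a _ =>
      smF_covTwo B.smooth_cov hβ (he a) (he a) (B.sm_hor hX))).congr
      ((hU.eventually_mem hp).mono fun q hq => ?_)
    rw [B.P_eq hn hf]
    congr 1
    exact Quat.sum_e_eq (D := (S.frame q).quat (S.mem_nhd q)) (D' := (S.frame p).quat hq) rfl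
      ((hβ.horTrilin B.cov S q).compr₂ (LinearMap.applyₗ (B.hor q (X q))))

lemma sm_grad (p : M) : Sm (fun q => (B.grad f q : T (4 * n + 3) q)) p :=
  sm_dual (S := S) (SmForm.dirDeriv hf) p

lemma smF_P_grad (p : M) : SmF (4 * n + 3) (fun q => B.P f q (B.grad f q)) p :=
  (B.smForm_P hn hf).smooth (B.sm_grad hn hf p)

lemma smF_C (p : M) : SmF (4 * n + 3) (B.C f) p :=
  smF_sum_e (SmForm.covOne B.smooth_cov (B.smForm_P hn hf)) p

lemma P_grad (p : M) : B.P f p (B.grad f p)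
    = ∑ a, dirDeriv f p (S.e a p : T (4 * n + 3) p) * B.P f p (S.e a p) := by
  have hP := B.smForm_P hn hf
  rw [grad, Submodule.coe_sum, hP.map_sum]
  exact Finset.sum_congr rfl fun a _ => by rw [Submodule.coe_smul, hP.smul]

lemma smForm_mul_P : SmForm fun q v => f q * B.P f q v where
  add p v w := by rw [(B.smForm_P hn hf).add, mul_add]
  smul p c v := by rw [(B.smForm_P hn hf).smul]; ring
  smooth hX := (hf _).mul ((B.smForm_P hn hf).smooth hX)

lemma sum_covOne_mul_P (p : M) :
    ∑ a, covOne B.cov (fun q v => f q * B.P f q v) p (S.e a p) (S.e a p)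
      = f p * B.C f p + B.P f p (B.grad f p) := by
  have hP := B.smForm_P hn hf
  rw [B.P_grad hn hf, C, Finset.mul_sum, ← Finset.sum_add_distrib]
  refine Finset.sum_congr rfl fun a _ => ?_
  unfold covOne
  rw [dirDeriv_mul (hf p) (hP.smooth (Sm.ext _)), ext_self]
  ring

lemma smForm_B0_grad : SmForm fun q v => B.B0 f q v (B.grad f q) where
  add p v w := (B.smForm₂_B0 hf (by omega)).add_left _ _ _ _
  smul p c v := (B.smForm₂_B0 hf (by omega)).smul_left _ _ _ _
  smooth hX := (B.smForm₂_B0 hf (by omega)).smooth hX (B.sm_grad hn hf _)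

/-- The product rule for B_0(·, ∇f): the first term is the divergence formula evaluated on ∇f, and
the second pairs B_0 with ∇(∇f), that is with the Hessian. The pairing equals |B_0|² by
`Quat.sum_proj_mul`. -/
lemma sum_covOne_B0_grad (p : M) :
    ∑ a, covOne B.cov (fun q v => B.B0 f q v (B.grad f q)) p (S.e a p) (S.e a p)
      = (n - 1) / (4 * n) * B.P f p (B.grad f p)
        + ∑ a, ∑ b, B.B0 f p (S.e a p) (S.e b p) ^ 2 := by
  have hβ := B.smForm₂_B0 hf (by omega)
  have hU := S.isOpen_nhd p
  have hp := S.mem_nhd p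
  have hG := B.sm_grad hn hf p
  have hdf : SmForm (m := 4 * n + 3) (dirDeriv f) := SmForm.dirDeriv hf
  have h1 (a) : covOne B.cov (fun q v => B.B0 f q v (B.grad f q)) p (S.e a p) (S.e a p)
      = covTwo B.cov (B.B0 f) p (S.e a p) (S.e a p) (B.grad f p)
        + B.B0 f p (S.e a p) (B.cov (fun q => (B.grad f q : T (4 * n + 3) q)) p (S.e a p)) := by
    have he := (S.frame p).sm_e hU hp a
    have e1 := covOne_eq (cov := B.cov) (B.smForm_B0_grad hn hf) he (S.e a p)
    have e2 := covTwo_eq (cov := B.cov) hβ he hG (S.e a p)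
    refine e1.trans ?_
    rw [← sub_eq_iff_eq_add]
    exact e2.symm
  have h2 (a) : B.B0 f p (S.e a p) (B.cov (fun q => (B.grad f q : T (4 * n + 3) q)) p (S.e a p))
      = ∑ b, B.B0 f p (S.e a p) (S.e b p) * hess B.cov f p (S.e a p) (S.e b p) := by
    have e1 := B.cov_mem_of_eventually_mem hG (.of_forall fun q => (B.grad f q).2) (S.e a p)
    have e2 := ((S.frame p).quat hp).expand ⟨_, e1⟩
    have e3 := congrArg (fun X : S.H p => B.B0 f p (S.e a p) X) e2
    simp only [Submodule.coe_sum, Submodule.coe_smul, ← SmForm₂.bilin_apply hβ, map_sum,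
      map_smul, smul_eq_mul] at e3
    rw [SmForm₂.bilin_apply] at e3
    refine e3.trans (Finset.sum_congr rfl fun b _ => ?_)
    have e4 : B.gg p (B.cov (fun q => (B.grad f q : T (4 * n + 3) q)) p (S.e a p)) (S.e b p)
      = hess B.cov f p (S.e a p) (S.e b p) := B.gg_cov_dual hdf a b
    rw [gg, B.hor_coe] at e4
    rw [← e4, mul_comm]
    congr 2
    exact congrArg (S.g p) (B.hor_coe ⟨_, e1⟩).symm
  simp only [h1, h2, Finset.sum_add_distrib]
  have h3 := ((S.frame p).quat hp).sum_proj_mul (by omega)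
    ((smForm₂_hess B.smooth_cov hf).horBilin S p) (fun X Y => B.B0 f p X Y) fun X Y => by
      rw [B.B0_eq hf (by omega) (S.frame p) hp]
      simp only [LocalFrame.J, B.hor_coe, gg]
      rfl
  have h4 : (2 : ℝ) ≤ n := by exact_mod_cast hn
  have h5 : (n : ℝ) - 1 ≠ 0 := by linarith
  rw [B.P_eq hn hf, B.hor_coe]
  refine congrArg₂ _ ?_ h3
  field_simp

/-- The preceding identity exhibits |B_0|² as a difference of smooth functions, so no separate
argument with local frames is needed. -/
lemma smF_sum_sq (p : M) :
    SmF (4 * n + 3) (fun q => ∑ a, ∑ b, B.B0 f q (S.e a q) (S.e b q) ^ 2) p := by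
  refine ((smF_sum_e (S := S) (SmForm.covOne B.smooth_cov (B.smForm_B0_grad hn hf)) p).sub
    ((SmF.const ((n - 1) / (4 * n) : ℝ)).mul (B.smF_P_grad hn hf p))).congr (.of_forall fun q => ?_)
  rw [B.sum_covOne_B0_grad hn hf, add_sub_cancel_left]

omit hn hf in
lemma B0_eq_zero_of_sum_sq (hf : ∀ p, SmF (4 * n + 3) f p) (hn : 1 ≤ n)
    (h : ∑ a, ∑ b, B.B0 f p (S.e a p) (S.e b p) ^ 2 = 0) (X Y : S.H p) : B.B0 f p X Y = 0 := by
  have hβ := B.smForm₂_B0 hf hn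
  have h1 (a b) : B.B0 f p (S.e a p) (S.e b p) = 0 := by
    have e1 := (Finset.sum_eq_zero_iff_of_nonneg fun a _ => Finset.sum_nonneg fun b _ =>
      sq_nonneg (B.B0 f p (S.e a p) (S.e b p))).1 h a (Finset.mem_univ a)
    exact pow_eq_zero_iff two_ne_zero |>.1 ((Finset.sum_eq_zero_iff_of_nonneg fun b _ =>
      sq_nonneg (B.B0 f p (S.e a p) (S.e b p))).1 e1 b (Finset.mem_univ b))
  have e (X : S.H p) : X = ∑ a, S.g p X (S.e a p) • S.e a p :=
    ((S.frame p).quat (S.mem_nhd p)).expand X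
  have key : hβ.horBilin S p X Y = 0 := by
    rw [e X, e Y]
    simp [SmForm₂.horBilin_apply, h1]
  exact key

omit hn in
lemma P_eq_zero_of_B0 (hn : 2 ≤ n) (h : ∀ (p : M) (X Y : S.H p), B.B0 f p X Y = 0)
    (v : T (4 * n + 3) p) : B.P f p v = 0 := by
  have h0 : B.B0 f = fun _ _ _ => 0 := by
    funext p v w
    rw [← B.B0_hor, h]
  rw [B.P_eq hn hf, h0]
  simp [covTwo, dirDeriv_const]

omit hn hf in
lemma C_eq_zero_of_P (h : ∀ (p : M) (v : T (4 * n + 3) p), B.P f p v = 0) (p : M) :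
    B.C f p = 0 := by
  have h0 : B.P f = fun _ _ => 0 := funext fun p => funext fun v => h p v
  rw [C, h0]
  simp [covOne, dirDeriv_const]

variable [MeasurableSpace M] [BorelSpace M] [CompactSpace M]

lemma integral_mul_C : ∫ p, f p * B.C f p ∂B.vol = -∫ p, B.P f p (B.grad f p) ∂B.vol := by
  have h := B.integral_covOne (by omega) (B.smForm_mul_P hn hf)
  simp only [B.sum_covOne_mul_P hn hf] at h
  rw [integral_add (B.integrable_of_smF (by omega) fun p => (hf p).mul (B.smF_C hn hf p))
    (B.integrable_of_smF (by omega) (B.smF_P_grad hn hf))] at h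
  linarith

/-- The divergence of B_0(·, ∇f) integrates to zero; solving for the integral of P_f(∇f) gives the
factor 4n/(n-1), which is positive for n ≥ 2. -/
lemma integral_P_grad : -∫ p, B.P f p (B.grad f p) ∂B.vol
    = 4 * n / (n - 1) * ∫ p, ∑ a, ∑ b, B.B0 f p (S.e a p) (S.e b p) ^ 2 ∂B.vol := by
  have h := B.integral_covOne (by omega) (B.smForm_B0_grad hn hf)
  simp only [B.sum_covOne_B0_grad hn hf] at h
  rw [integral_add ((B.integrable_of_smF (by omega) (B.smF_P_grad hn hf)).const_mul _)
    (B.integrable_of_smF (by omega) (B.smF_sum_sq hn hf)), integral_const_mul] at h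
  have h4 : (2 : ℝ) ≤ n := by exact_mod_cast hn
  have h5 : (n : ℝ) - 1 ≠ 0 := by linarith
  field_simp at h ⊢
  linarith

omit hf in
theorem cOperatorNonneg : B.COperatorNonneg := by
  intro f hf _
  have hf' (p) : SmF (4 * n + 3) f p := smF_of_contMDiff hf
  refine ⟨B.integrable_of_smF (by omega) fun p => (hf' p).mul (B.smF_C hn hf' p),
    B.integrable_of_smF (by omega) (B.smF_P_grad hn hf'), B.integral_mul_C hn hf', ?_⟩
  rw [B.integral_mul_C hn hf', B.integral_P_grad hn hf']
  have h4 : (2 : ℝ) ≤ n := by exact_mod_cast hn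
  exact mul_nonneg (div_nonneg (by positivity) (by linarith)) (integral_nonneg fun p =>
    Finset.sum_nonneg fun a _ => Finset.sum_nonneg fun b _ => sq_nonneg _)

/-- The integral of the continuous non-negative function |B_0|² vanishes, and the measure charges
every nonempty open set, so the function vanishes everywhere and not only almost everywhere. -/
lemma B0_eq_zero_of_C (h : ∀ p, B.C f p = 0) (p : M) (X Y : S.H p) : B.B0 f p X Y = 0 := by
  have h1 := B.integral_mul_C hn hf
  rw [B.integral_P_grad hn hf] at h1
  simp only [h, mul_zero, integral_zero] at h1
  have h4 : (2 : ℝ) ≤ n := by exact_mod_cast hn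
  have h5 : (4 * n / (n - 1) : ℝ) ≠ 0 := div_ne_zero (by positivity) (by linarith)
  have h6 := (mul_eq_zero.1 h1.symm).resolve_left h5
  have := B.isOpenPosMeasure_vol (by omega)
  have hc : Continuous fun p => ∑ a, ∑ b, B.B0 f p (S.e a p) (S.e b p) ^ 2 :=
    continuous_iff_continuousAt.2 fun p => (B.smF_sum_sq hn hf p).contMDiffAt.continuousAt
  have h7 := (integral_eq_zero_iff_of_nonneg (fun p => Finset.sum_nonneg fun a _ =>
    Finset.sum_nonneg fun b _ => sq_nonneg (B.B0 f p (S.e a p) (S.e b p)))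
    (B.integrable_of_smF (by omega) (B.smF_sum_sq hn hf))).1 h6
  have h8 := (Continuous.ae_eq_iff_eq B.vol hc continuous_const).1 h7
  exact B.B0_eq_zero_of_sum_sq hf (by omega) (congrFun h8 p) X Y

end Structure.Biquard

end POperator
end QC
end
theorem theorem3p2 {n : ℕ} (hn : 1 ≤ n) {M : Type*} [TopologicalSpace M] [T2Space M]
    [ChartedSpace (EuclideanSpace ℝ (Fin (4 * n + 3))) M] [IsManifold (𝓡 (4 * n + 3)) ∞ M]
    [MeasurableSpace M] [BorelSpace M] (S : QC.Structure n M) (B : S.Biquard) :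
    (∀ f : M → ℝ, ContMDiff (𝓡 (4 * n + 3)) 𝓘(ℝ, ℝ) ∞ f → ∀ (p : M) (X : S.H p),
      4 * ∑ a, QC.covTwo B.cov (B.B0 f) p (S.e a p) (S.e a p) X
        = ((n : ℝ) - 1) / n * B.P f p X) ∧
    (CompactSpace M → 7 < 4 * n + 3 →
      B.COperatorNonneg ∧
      ∀ f : M → ℝ, ContMDiff (𝓡 (4 * n + 3)) 𝓘(ℝ, ℝ) ∞ f →
        ((∀ p, B.C f p = 0) ↔ ∀ (p : M) (X Y : S.H p), B.B0 f p X Y = 0) ∧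
        ((∀ p, B.C f p = 0) → ∀ (p : M) (X : S.H p), B.P f p X = 0)) := by
  refine ⟨fun f hf p X => B.div_B0 hn (fun p => QC.smF_of_contMDiff hf) X, fun hM h7 => ?_⟩
  -- Dimension greater than seven excludes n = 1, the only case in which the divergence formula
  -- carries no information on P_f.
  have hn2 : 2 ≤ n := by omega
  refine ⟨B.cOperatorNonneg hn2, fun f hf => ?_⟩
  have hf' (p) : QC.SmF (4 * n + 3) f p := QC.smF_of_contMDiff hf
  have h1 : (∀ p, B.C f p = 0) → ∀ (p : M) (X Y : S.H p), B.B0 f p X Y = 0 :=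
    B.B0_eq_zero_of_C hn2 hf'
  have h2 (h : ∀ (p : M) (X Y : S.H p), B.B0 f p X Y = 0) (p : M) (v : QC.T (4 * n + 3) p) :
    B.P f p v = 0 := B.P_eq_zero_of_B0 hf' hn2 h v
  exact ⟨⟨h1, fun h => B.C_eq_zero_of_P (h2 h)⟩, fun h p X => h2 (h1 h) p X⟩
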